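/- Notation. Write $\mathbb C((z))$ for formal Laurent series, $\operatorname{Res}$ for the residue of a differential at $z=0$, and $'=d/dz$. All matrices have entries in $\mathbb C((z))$, with rows and columns numbered from $0$. Matrices of complex size. Let $\mathfrak{gl}$ be the algebra of matrices $(a_{ij})_{i,j\ge 0}$ with entries in $\mathbb C((z))[t]$ such that $a_{ij}=0$ for $i>j+N$ (for some $N$) and such that, apart from finitely many rows, $a_{i,i+n}$ is, for each fixed $n\in\mathbb Z$, a polynomial in $i$ with coefficients in $\mathbb C((z))[t]$, and $a_{ij}|_{t=\mu}=0$ for all positive integers $\mu$ with $i<\mu\le j$. For $\lambda\in\mathbb C$ let $\overline{\mathfrak{gl}}_\lambda(z)$ be the set of the specializations of its elements at $t=\lambda$. For $A\in\overline{\mathfrak{gl}}_\lambda(z)$ the sum $\sum_{i<N}a_{ii}$ is, for large $N$, a polynomial $P(N)$; put $\operatorname{Tr}A=P(\lambda)$. Let $\widehat{\mathfrak{gl}}_\lambda=\overline{\mathfrak{gl}}_\lambda(z)\oplus\mathbb C$ be the central extension by the cocycle $\operatorname{Res}\operatorname{Tr}(X\,dY)$. Its dual is taken to be $\{(A,k):A\in\overline{\mathfrak{gl}}_\lambda(z),\,k\in\mathbb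 C\}$, where $\langle (A,k),(X,c)\rangle=\operatorname{Res}\operatorname{Tr}(AX)z^{-1}dz+kc$; it carries the Kirillov–Kostant bracket $\{F,G\}(\xi)=\langle\xi,[d_\xi F,d_\xi G]\rangle$ of functions whose differentials lie in $\widehat{\mathfrak{gl}}_\lambda$. Reduction. Let $\mathfrak n_\lambda(z)\subset\overline{\mathfrak{gl}}_\lambda(z)$ be the strictly upper triangular matrices, $N_\lambda(z)=1+\mathfrak n_\lambda(z)$, $f$ the matrix with entries $1$ just below the diagonal and $0$ elsewhere, and $p_\lambda$ the restriction to $\mathfrak n_\lambda(z)$ of functionals of level $k=1$. The group $N_\lambda(z)$ acts on $p_\lambda^{-1}(f)$ by the coadjoint action $A\mapsto XAX^{-1}+zX'X^{-1}$. Functions on $p_\lambda^{-1}(f)/N_\lambda(z)$ are the $N_\lambda(z)$-invariant functions on $p_\lambda^{-1}(f)$ that depend on finitely many diagonals and that, on each family of matrices for which, on these diagonals, the number of exceptional rows, the degrees in $i$ of the entries $a_{i,i+n}$ and the orders of the poles are bounded, are polynomials in finitely many Laurent coefficients of entries. The reduced bracket of two such functions is the restriction to $p_\lambda^{-1}(f)$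 of the Kirillov–Kostant bracket of arbitrary continuations to $(\widehat{\mathfrak{gl}}_\lambda)^*$. The classical reduction of $\widehat{\mathfrak{gl}}_n$, $n\ge1$, is defined in the same way with $n\times n$ matrices over $\mathbb C((z))$ and the usual trace. Pseudodifferential symbols. Let $\Psi DS_\lambda=\{L=D^\lambda+\sum_{i\ge1}u_iD^{\lambda-i}:u_i\in\mathbb C((z))\}$, $D=d/dz$, with $D^\mu\circ u=\sum_{l\ge0}\binom{\mu}{l}u^{(l)}D^{\mu-l}$. Functions on $\Psi DS_\lambda$ are the regular functions of $(u_i)\in\prod_{i\ge1}\mathbb C((z))$, i.e. those that depend on finitely many $u_i$ and that, on series with poles of bounded order, are polynomials in finitely many Laurent coefficients. Their differentials at $L$ are represented by $X=D^{-\lambda}\circ Q$, $Q$ a differential operator, through $\delta L\mapsto\operatorname{Tr}(\delta L\circ X)$, where $\operatorname{Tr}$ is the residue of the coefficient of $D^{-1}$. The quadratic Gelfand–Dickey bracket at $L$ of functions with differentials $X,Y$ is $\operatorname{Tr}\big(((LX)_+L-L(XL)_+)\,Y\big)$, where $+$ denotes the differential part. Theorem. For every $\lambda\in\mathbb C$ the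 reduced bracket on $p_\lambda^{-1}(f)/N_\lambda(z)$ and the quadratic Gelfand–Dickey bracket on $\Psi DS_\lambda$ are well defined Poisson structures, and $p_\lambda^{-1}(f)/N_\lambda(z)$ and $\Psi DS_\lambda$ are isomorphic as Poisson manifolds (there is a bijection between them that induces an isomorphism of the Poisson algebras of functions). Moreover, these reductions form a one-parameter deformation of the classical ones in the following sense. Each orbit in $p_\lambda^{-1}(f)$ contains exactly one Frobenius matrix (first row $b_1,b_2,\dots$, ones just below the diagonal, zeros elsewhere), every sequence $b$ occurs, and this identifies $p_\lambda^{-1}(f)/N_\lambda(z)$, together with its algebra of functions, with $\prod_{i\ge1}\mathbb C((z))$ and its regular functions, for all $\lambda$ simultaneously. For fixed regular functions $F,G$ on $\prod_{i\ge1}\mathbb C((z))$ and a fixed point $b$, the value $\{F,G\}_\lambda(b)$ of the reduced bracket is a polynomial in $\lambda$. For every integer $n\ge1$ the classical reduced bracket of $\widehat{\mathfrak{gl}}_n$ is a well defined Poisson structure, each orbit contains exactly one $n\times n$ Frobenius matrix, and the map $(b_1,\dots,b_n)\mapsto(b_1,\dots,b_n,0,0,\dots)$ embeds the classical reduced space into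 $p_n^{-1}(f)/N_n(z)$ as a Poisson submanifold: the map is injective, restriction of functions along it is onto the functions of the classical reduced space, and it respects the brackets. -/

import Mathlib

namespace DSReduction

noncomputable section

/-! ### The coefficient field `ℂ((z))` -/

/-- The field `ℂ((z))` of formal Laurent series. -/
abbrev K := LaurentSeries ℂ

/-- The monomial `z ^ n`. -/
def zpow (n : ℤ) : K := HahnSeries.single n 1

/-- A complex number as a constant Laurent series. -/
def cst (c : ℂ) : K := HahnSeries.C c

/-- The derivation `d/dz` of `ℂ((z))`. -/
def dz : K →ₗ[ℂ] K := LaurentSeries.derivative ℂ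

/-- The residue at `z = 0` of `a(z) dz`. -/
def res (a : K) : ℂ := a.coeff (-1)

/-- The pole of `a` at `z = 0` has order at most `m`. -/
def PoleLE (m : ℕ) (a : K) : Prop := ∀ l : ℤ, l < -(m : ℤ) → a.coeff l = 0

/-! ### Poisson manifolds, given by their Poisson algebras of functions -/

/-- A Poisson structure on `M`: an algebra of functions on `M`, with a Lie bracket on it that
satisfies the Leibniz identity. -/
structure PoissonStructure (M : Type) where
  functions : Subalgebra ℂ (M → ℂ)
  bracket : functions →ₗ[ℂ] functions →ₗ[ℂ] functions
  bracket_self : ∀ f, bracket f f = 0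
  jacobi : ∀ f g h, bracket f (bracket g h) + bracket g (bracket h f)
    + bracket h (bracket f g) = 0
  leibniz : ∀ f g h, bracket f (g * h) = bracket f g * h + g * bracket f h

/-- An isomorphism of Poisson manifolds: a bijection of the points that induces a bijection
of the algebras of functions and respects the brackets. -/
structure PoissonIso {M M' : Type} (P : PoissonStructure M) (P' : PoissonStructure M') where
  toEquiv : M ≃ M'
  mem_iff : ∀ F : M' → ℂ, F ∘ toEquiv ∈ P.functions ↔ F ∈ P'.functions
  map_bracket : ∀ (F G : P'.functions) (F' G' : P.functions),
    (F' : M → ℂ) = (F : M' → ℂ) ∘ toEquiv → (G' : M → ℂ) = (G : M' → ℂ) ∘ toEquiv →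
      (P.bracket F' G' : M → ℂ) = (P'.bracket F G : M' → ℂ) ∘ toEquiv

/-- `ι : M → M'` is the embedding of a (closed) Poisson submanifold: it is injective, the
restriction of functions along `ι` is onto, and it is a morphism of Poisson algebras. -/
structure IsPoissonEmbedding {M M' : Type} (P : PoissonStructure M) (P' : PoissonStructure M')
    (ι : M → M') : Prop where
  injective : Function.Injective ι
  pullback_mem : ∀ F ∈ P'.functions, F ∘ ι ∈ P.functions
  pullback_surjective : ∀ F ∈ P.functions, ∃ F' ∈ P'.functions, F' ∘ ι = F
  map_bracket : ∀ (F G : P'.functions) (F' G' : P.functions),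
    (F' : M → ℂ) = (F : M' → ℂ) ∘ ι → (G' : M → ℂ) = (G : M' → ℂ) ∘ ι →
      (P.bracket F' G' : M → ℂ) = (P'.bracket F G : M' → ℂ) ∘ ι

/-! ### Matrices over `ℂ((z))` -/

/-- The product of matrices; in all the products below the sums are finite. -/
def mmul {I : Type} (A B : Matrix I I K) : Matrix I I K := fun i k => ∑ᶠ j, A i j * B j k

/-- The entrywise derivative `d/dz`. -/
def mdz {I : Type} (A : Matrix I I K) : Matrix I I K := fun i j => dz (A i j)

/-- The entrywise Euler derivative `z d/dz`. -/
def mzdz {I : Type} (A : Matrix I I K) : Matrix I I K := fun i j => zpow 1 * dz (A i j)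

/-- The coadjoint action of `X ∈ N(z)`, with inverse `Xinv`, on `(A, k)`: the gauge action on
the operator `- k z d/dz + A`. -/
def coadjoint {I : Type} (X Xinv : Matrix I I K) (ξ : Matrix I I K × ℂ) : Matrix I I K × ℂ :=
  (mmul (mmul X ξ.1) Xinv + ξ.2 • mmul (mzdz X) Xinv, ξ.2)

/-- The data of a loop algebra of matrices: the numbering `idx` of rows and columns (starting
from `0`), the set `alg` of matrices over `ℂ((z))` that form the loop algebra, and the trace.
For matrices of infinite size, `tame k` is a collection of subsets of the algebra which single
out the matrices whose first `k` upper diagonals form a family with finitely many parameters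
in `ℂ((z))`.

It is used for two models only, `barGl lam` and `glMat n` below. -/
structure LoopModel (I : Type) where
  idx : I → ℕ
  alg : Set (Matrix I I K)
  tr : Matrix I I K → K
  tame : ℕ → Set (Set (Matrix I I K))

namespace LoopModel

variable {I : Type} (g : LoopModel I)

/-- The loop algebra of strictly upper triangular matrices. -/
def nil : Set (Matrix I I K) := {X | X ∈ g.alg ∧ ∀ i j, g.idx j ≤ g.idx i → X i j = 0}

/-- The identity matrix. -/
def one : Matrix I I K := fun i j => if g.idx i = g.idx j then 1 else 0

/-- The nilpotent loop group `N(z) = 1 + n(z)`. -/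
def unip : Set (Matrix I I K) := {X | X - g.one ∈ g.nil}

/-- The matrix with entries `1` just below the diagonal and `0` elsewhere. -/
def lowerShift : Matrix I I K := fun i j => if g.idx i = g.idx j + 1 then 1 else 0

/-- The Frobenius matrix with first row `b`. -/
def frobenius (b : I → K) : Matrix I I K := fun i j =>
  if g.idx i = 0 then b j else if g.idx i = g.idx j + 1 then 1 else 0

/-- The invariant inner product `Res Tr (A(z) X(z)) z⁻¹ dz` of the loop algebra. It identifies
the dual of the loop algebra with the loop algebra. -/
def inner (A X : Matrix I I K) : ℂ := res (zpow (-1) * g.tr (mmul A X))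

/-- The cocycle `Res Tr (X(z) dY(z))`. -/
def cocycle (X Y : Matrix I I K) : ℂ := res (g.tr (mmul X (mdz Y)))

/-- The Lie bracket of the affine algebra, the central extension of the loop algebra by the
cocycle. Its elements are the pairs `(X, c)`, `X ∈ g.alg`, `c ∈ ℂ`. -/
def affBracket (x y : Matrix I I K × ℂ) : Matrix I I K × ℂ :=
  (mmul x.1 y.1 - mmul y.1 x.1, g.cocycle x.1 y.1)

/-- The pairing between the dual `{(A, k)}` of the affine algebra and the affine algebra
`{(X, c)}`; `k` is the value of the functional `(A, k)` on the central element. -/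
def affPairing (ξ x : Matrix I I K × ℂ) : ℂ := g.inner ξ.1 x.1 + ξ.2 * x.2

/-- `x`, an element of the affine algebra, is the differential at `ξ` of the function `F` on
the dual of the affine algebra. -/
def IsDifferentialAt (F : Matrix I I K × ℂ → ℂ) (ξ x : Matrix I I K × ℂ) : Prop :=
  x.1 ∈ g.alg ∧ ∀ η : Matrix I I K × ℂ, η.1 ∈ g.alg →
    HasDerivAt (fun s : ℂ => F (ξ + s • η)) (g.affPairing η x) 0

/-- `F` is a differentiable function on the dual of the affine algebra: at each point it has a
differential that belongs to the affine algebra. -/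
def IsDifferentiable (F : Matrix I I K × ℂ → ℂ) : Prop :=
  ∀ ξ : Matrix I I K × ℂ, ξ.1 ∈ g.alg → ∃ x, g.IsDifferentialAt F ξ x

/-- The value at `ξ` of the Kirillov--Kostant bracket of two functions whose differentials at
`ξ` are `x` and `y`. -/
def kirillovKostant (ξ x y : Matrix I I K × ℂ) : ℂ := g.affPairing ξ (g.affBracket x y)

/-- The momentum map: the restriction of functionals to the nilpotent loop algebra. -/
def momentum (ξ : Matrix I I K × ℂ) : g.nil → ℂ := fun Y => g.affPairing ξ ((Y : Matrix I I K), 0)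

/-- The set `p⁻¹(f)`, where `p` is the momentum map on the hyperplane of level `k = 1` and `f`
is the functional on the nilpotent loop algebra given by the matrix `lowerShift`. -/
def fiber : Set (Matrix I I K) :=
  {A | A ∈ g.alg ∧ g.momentum (A, 1) = fun Y : g.nil => g.inner g.lowerShift Y}

/-- Two elements of `p⁻¹(f)` lie in the same orbit of the nilpotent loop group. -/
def SameOrbit (A B : g.fiber) : Prop :=
  ∃ X ∈ g.unip, ∃ Xinv ∈ g.unip, mmul X Xinv = g.one ∧ mmul Xinv X = g.one ∧
    coadjoint X Xinv ((A : Matrix I I K), 1) = ((B : Matrix I I K), 1)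

/-- The reduced space `p⁻¹(f) / N(z)`. -/
def Reduced : Type := Quot g.SameOrbit

/-- The projection `p⁻¹(f) → p⁻¹(f) / N(z)`. -/
def proj (A : g.fiber) : g.Reduced := Quot.mk _ A

/-- The positions of the first `k` upper diagonals, the main diagonal being the first. -/
def Band (k : ℕ) : Set (I × I) :=
  {p | g.idx p.1 ≤ g.idx p.2 ∧ g.idx p.2 < g.idx p.1 + k}

/-- Regular functions on `p⁻¹(f)`: those that depend on finitely many diagonals and that, on
each tame family of matrices with poles of bounded order, are polynomials in finitely many
Laurent coefficients of the matrix entries. -/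
def IsRegularOnFiber (F : g.fiber → ℂ) : Prop :=
  ∃ k : ℕ, ∀ S ∈ g.tame k, ∀ m : ℕ, ∃ P : MvPolynomial (g.Band k × ℤ) ℂ,
    ∀ A : g.fiber, (A : Matrix I I K) ∈ S →
      (∀ p ∈ g.Band k, PoleLE m ((A : Matrix I I K) p.1 p.2)) →
      F A = MvPolynomial.eval
        (fun v : g.Band k × ℤ => ((A : Matrix I I K) v.1.1.1 v.1.1.2).coeff v.2) P

/-- `Ft` is a continuation to the dual of the affine algebra of the pull-back to `p⁻¹(f)`
of the function `F` on the reduced space. -/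
def IsContinuation (F : g.Reduced → ℂ) (Ft : Matrix I I K × ℂ → ℂ) : Prop :=
  g.IsDifferentiable Ft ∧ ∀ A : g.fiber, Ft ((A : Matrix I I K), 1) = F (g.proj A)

/-- `P` is the Poisson structure on `p⁻¹(f) / N(z)` obtained by Hamiltonian reduction. The
functions are the regular `N(z)`-invariant functions on `p⁻¹(f)`, and the bracket at `π(A)` is
the Kirillov--Kostant bracket at `(A, 1)` of arbitrary continuations. -/
structure IsHamiltonianReduction (P : PoissonStructure g.Reduced) : Prop where
  mem_iff : ∀ F : g.Reduced → ℂ,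
    F ∈ P.functions ↔ g.IsRegularOnFiber (fun A => F (g.proj A))
  exists_continuation : ∀ F ∈ P.functions, ∃ Ft, g.IsContinuation F Ft
  bracket_eq : ∀ (F G : P.functions) (Ft Gt : Matrix I I K × ℂ → ℂ),
    g.IsContinuation F Ft → g.IsContinuation G Gt →
    ∀ (A : g.fiber) (x y : Matrix I I K × ℂ),
      g.IsDifferentialAt Ft ((A : Matrix I I K), 1) x →
      g.IsDifferentialAt Gt ((A : Matrix I I K), 1) y →
      (P.bracket F G : g.Reduced → ℂ) (g.proj A)
        = g.kirillovKostant ((A : Matrix I I K), 1) x y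

/-- The orbit `x` contains the Frobenius matrix with first row `b`. -/
def HasFrobeniusForm (x : g.Reduced) (b : I → K) : Prop :=
  ∃ h : g.frobenius b ∈ g.fiber, x = g.proj ⟨g.frobenius b, h⟩

end LoopModel

/-! ### The classical loop algebra -/

/-- The loop algebra `gl_n(z)` of `n × n` matrices. -/
def glMat (n : ℕ) : LoopModel (Fin n) where
  idx := fun i => i
  alg := Set.univ
  tr := Matrix.trace
  tame := fun _ => {Set.univ}

/-! ### Matrices of complex size -/

/-- The algebra `gl` over the polynomials in a formal variable `t` (the variable of
`Polynomial K`): matrices with finitely many nonzero lower diagonals for which, with finitely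
many exceptional rows,
* the entries `a_{i,i+n}` on a fixed diagonal are polynomials in `i` (and `t`), and
* `a_{ij}` vanishes at `t = μ` for all positive integers `μ` with `i < μ ≤ j`. -/
def IsGlFamily (A : ℕ → ℕ → Polynomial K) : Prop :=
  (∃ N : ℕ, ∀ i j, j + N < i → A i j = 0) ∧
  ∃ R : ℕ,
    (∃ Q : ℤ → Polynomial (Polynomial K), ∀ i j : ℕ, R ≤ i →
      A i j = (Q ((j : ℤ) - (i : ℤ))).eval (i : Polynomial K)) ∧
    (∀ i j μ : ℕ, R ≤ i → i < μ → μ ≤ j → (A i j).eval (μ : K) = 0)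

/-- The trace of a matrix of complex size `lam`: for all large `N` the sum of the first `N`
diagonal entries is a polynomial in `N`, and the trace is the value of this polynomial
at `N = lam`. -/
def complexTrace (lam : ℂ) (A : Matrix ℕ ℕ K) : K :=
  open Classical in
  if h : ∃ P : Polynomial K, ∃ N₀ : ℕ, ∀ N ≥ N₀, ∑ i ∈ Finset.range N, A i i = P.eval (N : K)
  then h.choose.eval (cst lam) else 0

/-- The loop algebra of the extended algebra of matrices of complex size `lam`, the
specialization at `t = lam` of the algebra `gl`. A tame family is given by a bound on the
number of exceptional rows and on the degrees in `i` of the entries `a_{i,i+n}`. -/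
def barGl (lam : ℂ) : LoopModel ℕ where
  idx := fun i => i
  alg := {A | ∃ At, IsGlFamily At ∧ ∀ i j, A i j = (At i j).eval (cst lam)}
  tr := complexTrace lam
  tame := fun k => {S | ∃ R d : ℕ, S = {A | ∀ n < k, ∃ q : Polynomial K, q.natDegree ≤ d ∧
    ∀ i ≥ R, A i (i + n) = q.eval (i : K)}}

/-! ### Regular functions of sequences of Laurent series -/

/-- Regular functions on `∏_{i ≥ 1} ℂ((z))`: those that depend on finitely many of the series
and that, on series with poles of bounded order, are polynomials in finitely many Laurent
coefficients. -/
def IsRegularSeq (F : (ℕ → K) → ℂ) : Prop :=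
  ∃ k : ℕ, ∀ m : ℕ, ∃ P : MvPolynomial (Fin k × ℤ) ℂ,
    ∀ u : ℕ → K, (∀ i < k, PoleLE m (u i)) →
      F u = MvPolynomial.eval (fun v : Fin k × ℤ => (u v.1).coeff v.2) P

/-! ### Pseudodifferential symbols -/

/-- The binomial coefficient `a (a - 1) ⋯ (a - l + 1) / l!`. -/
def binom (a : ℂ) (l : ℕ) : ℂ := (∏ r ∈ Finset.range l, (a - r)) / (l.factorial : ℂ)

/-- The product of the symbols `∑ a_i D^(μ+i)` and `∑ b_j D^(ν+j)`, with `D = d/dz`, as a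
symbol `∑ c_n D^(μ+ν+n)`. The sequences vanish for large positive indices, so that the sums
are finite. -/
def symMul (μ : ℂ) (a b : ℤ → K) : ℤ → K := fun n =>
  ∑ᶠ p : ℤ × ℕ, binom (μ + p.1) p.2 • (a p.1 * dz^[p.2] (b (n - p.1 + p.2)))

/-- The differential part of a symbol of integral order. -/
def symPlus (a : ℤ → K) : ℤ → K := fun n => if 0 ≤ n then a n else 0

/-- The trace of a symbol of integral order: the residue of the coefficient of `D⁻¹`. -/
def symTrace (a : ℤ → K) : ℂ := res (a (-1))

/-- `coeff i` is the coefficient of `D^(lam-i-1)` in the symbol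
`D^lam + ∑_{i ≥ 0} coeff i D^(lam-i-1)`. -/
@[ext]
structure PsiDS (lam : ℂ) where
  coeff : ℕ → K

/-- The part `∑_{i ≥ 0} u_i D^(lam-i-1)`, with respect to `D^lam`. -/
def lowerSym (u : ℕ → K) : ℤ → K := fun n => if n < 0 then u (-n - 1).toNat else 0

/-- The symbol `D^lam + ∑_{i ≥ 0} u_i D^(lam-i-1)`, with respect to `D^lam`. -/
def PsiDS.sym {lam : ℂ} (L : PsiDS lam) : ℤ → K := fun n =>
  if n = 0 then 1 else lowerSym L.coeff n

/-- The symbol of a differential operator `∑_{j ≥ 0} q_j D^j`. -/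
def doSym (q : ℕ →₀ K) : ℤ → K := fun n => if 0 ≤ n then q n.toNat else 0

/-- The covector `X = D^(-lam) ∘ q`, `q` a differential operator, with respect to `D^(-lam)`. -/
def covSym (lam : ℂ) (q : ℕ →₀ K) : ℤ → K :=
  symMul (-lam) (fun n => if n = 0 then 1 else 0) (doSym q)

/-- `X = D^(-lam) ∘ q` is the differential at `L` of the function `F`: the derivative in the
direction `δL` is `Tr (δL ∘ X)`. -/
def PsiDS.IsDifferentialAt {lam : ℂ} (F : PsiDS lam → ℂ) (L : PsiDS lam) (q : ℕ →₀ K) : Prop :=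
  ∀ δ : ℕ → K, HasDerivAt (fun s : ℂ => F ⟨L.coeff + s • δ⟩)
    (symTrace (symMul lam (lowerSym δ) (covSym lam q))) 0

/-- The Hamiltonian map `V_X(L) = (L X)_+ L - L (X L)_+`, with respect to `D^lam`. -/
def PsiDS.hamiltonian {lam : ℂ} (L : PsiDS lam) (q : ℕ →₀ K) : ℤ → K :=
  symMul 0 (symPlus (symMul lam L.sym (covSym lam q))) L.sym
    - symMul lam L.sym (symPlus (symMul (-lam) (covSym lam q) L.sym))

/-- `P` is the quadratic Gelfand--Dickey structure on the symbols of order `lam`: the bracket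
at `L` of functions with differentials `X` and `Y` is `Tr (V_X(L) ∘ Y)`. -/
structure IsGelfandDickey (lam : ℂ) (P : PoissonStructure (PsiDS lam)) : Prop where
  mem_iff : ∀ F : PsiDS lam → ℂ, F ∈ P.functions ↔ IsRegularSeq (fun u => F ⟨u⟩)
  exists_differential : ∀ F ∈ P.functions, ∀ L, ∃ q, PsiDS.IsDifferentialAt F L q
  bracket_eq : ∀ (F G : P.functions) (L : PsiDS lam) (q r : ℕ →₀ K),
    PsiDS.IsDifferentialAt (F : PsiDS lam → ℂ) L q →
    PsiDS.IsDifferentialAt (G : PsiDS lam → ℂ) L r →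
    (P.bracket F G : PsiDS lam → ℂ) L
      = symTrace (symMul lam (L.hamiltonian q) (covSym lam r))

/-- Continuation by zeros of a finite sequence. -/
def extendZero {n : ℕ} (b : Fin n → K) : ℕ → K := fun j => if h : j < n then b ⟨j, h⟩ else 0

end

end DSReduction

/-! The momentum fiber consists of the Hessenberg matrices of size lam: ones just below the
diagonal, zeros under them, anything else above. In `IsPolyMat` the formal size is eliminated: the
entries of the n-th diagonal are eventually the values at the row number of one polynomial, and this
polynomial vanishes at lam - r for 1 ≤ r ≤ n. These zeros do three things. They are preserved by
products, they make the trace cyclic (`HasTrace.mul_comm`), because they annihilate the boundary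
terms, and they fix the constants of summation in difference equations. The last point gives the
normal form: a unitriangular gauge transformation to a Frobenius matrix solves, diagonal by
diagonal, a first order difference equation in the row number. A polynomial solution exists by
summation, and the zero at lam - 1 makes it unique (`exists_isGauge`, `IsGauge.unique`). Hence the
Frobenius matrices are a slice of the action.

On a slice the reduced bracket is computed as follows. For a covector q at b there is a matrix x
with first column q whose coadjoint vector field [x, F] + θx at the Frobenius matrix F is
concentrated in the first row, where it equals some w. Invariance of the trace form shows that x
represents the differential of an invariant function along the fiber, so the Kirillov–Kostant
bracket is minus the pairing of w with the second covector (`SliceData.isFiberDiff`,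
`SliceData.tau_vec_isFiberDiff`). The matrix is explicit. With L = D^lam - ∑ b_j D^(lam-1-j), Q = ∑
D^i q_i and S = (D^(-lam) Q L)_+, its i-th row consists of the coefficients of D^(-i-1) D^lam S -
(D^(-i-1) Q)_+ L, where the L of the second term, and likewise that of the outer products below, is
written relative to D^lam. Its entries are polynomial in i because D^(lam-1-i) S has binomial
coefficients in lam - 1 - i, and its first row field is w = L S - (L Q)_+ L, which is minus the
quadratic Gelfand–Dickey vector field (`isHam_hamMat`, `hamiltonian_eq`).

One discrepancy remains: the reduction contains z d/dz, the symbols contain d/dz. Conjugation by the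
diagonal matrix with entries z^i exchanges the two derivations at the cost of diagonal entries -i.
Therefore the slices `barSlice lam c` carry a constant c. The value c = 0 gives Frobenius matrices
and c = 1 gives the symbols; both are slices of the same orbits, so both compute the same Poisson
structure.

Existence results are proved over an arbitrary differential ℂ-algebra. Applied to Laurent series
over a polynomial ring of parameters, they yield families: over ℂ[X] curves and their velocities,
or, with X in the role of lam, the polynomial dependence of the bracket on lam; over a ring of
indeterminate Laurent coefficients the regularity of the bracket and of the normal form. The Jacobi
identity is obtained by differentiating the equation of the Hamiltonian matrix along a Hamiltonian
direction: terms with second derivatives cancel by symmetry, the others by a cyclic trace identity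
(`seqBracket_seqBracket`, `seqBracket_jacobi`).

For lam = n and b_j = 0 for j ≥ n the gauge transformations and Hamiltonian matrices have zero upper
right block, since the diagonals there are constant along the rows and vanish at lam - 1. Passing to
the n × n block is then multiplicative, Hamiltonian vector fields are tangent to the subspace, and
the classical structure is obtained by restriction. -/

namespace DSReduction

noncomputable section

open Polynomial

set_option linter.unusedSectionVars false

/-! ### Laurent series with coefficients in an algebra of parameters -/

section Laurent

variable {A B : Type} [CommRing A] [Algebra ℂ A] [CommRing B] [Algebra ℂ B]

instance laurentAlgebra : Algebra ℂ (LaurentSeries A) := HahnSeries.instAlgebra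

instance laurentSeriesModule : Module ℂ (LaurentSeries A) := HahnSeries.instModule

/-- The Euler derivative `z d/dz` of Laurent series. -/
def eulerFun (x : LaurentSeries A) : LaurentSeries A where
  coeff n := (n : A) * x.coeff n
  isPWO_support' := x.isPWO_support.mono fun n hn h => hn (by simp [h])

theorem eulerFun_coeff (x : LaurentSeries A) (n : ℤ) :
    (eulerFun x).coeff n = (n : A) * x.coeff n := rfl

theorem eulerFun_mul (x y : LaurentSeries A) :
    eulerFun (x * y) = x * eulerFun y + y * eulerFun x := by
  ext n
  have h1 : (eulerFun x).support ⊆ x.support := fun m hm h => hm (by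
    simp [eulerFun_coeff, h])
  have h2 : (eulerFun y).support ⊆ y.support := fun m hm h => hm (by
    simp [eulerFun_coeff, h])
  rw [mul_comm y, HahnSeries.coeff_add, eulerFun_coeff, HahnSeries.coeff_mul,
    HahnSeries.coeff_mul_left' x.isPWO_support h1, HahnSeries.coeff_mul_right' y.isPWO_support h2,
    Finset.mul_sum, ← Finset.sum_add_distrib]
  refine Finset.sum_congr rfl fun p hp => ?_
  have : p.1 + p.2 = n := (Finset.mem_antidiagonal.1 hp).2.2
  rw [eulerFun_coeff, eulerFun_coeff, ← this]
  push_cast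
  ring

variable (A) in
/-- The derivation `z d/dz` of Laurent series. -/
def theta : Derivation ℂ (LaurentSeries A) (LaurentSeries A) :=
  Derivation.mk' (R := ℂ)
    { toFun := eulerFun
      map_add' := fun x y => by ext n; simp [eulerFun_coeff, mul_add]
      map_smul' := fun c x => by ext n; simp [eulerFun_coeff] }
    (fun x y => by simpa using eulerFun_mul x y)

theorem theta_coeff (x : LaurentSeries A) (n : ℤ) :
    (theta A x).coeff n = (n : A) * x.coeff n := rfl

/-- The map of Laurent series induced by a homomorphism of coefficients. -/
def mapL (f : A →ₐ[ℂ] B) : LaurentSeries A →ₐ[ℂ] LaurentSeries B where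
  toFun x := x.map f
  map_one' := by
    ext n
    rw [HahnSeries.map_coeff, HahnSeries.coeff_one, HahnSeries.coeff_one]
    split_ifs <;> simp
  map_mul' x y := HahnSeries.map_mul ((f : A →+* B) : A →ₙ+* B)
  map_zero' := by ext; simp
  map_add' x y := by ext; simp
  commutes' c := by
    ext n
    rw [HahnSeries.algebraMap_apply, HahnSeries.algebraMap_apply, HahnSeries.map_coeff,
      HahnSeries.C_apply, HahnSeries.C_apply, HahnSeries.coeff_single, HahnSeries.coeff_single]
    split_ifs <;> simp

@[simp] theorem mapL_coeff (f : A →ₐ[ℂ] B) (x : LaurentSeries A) (n : ℤ) :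
    (mapL f x).coeff n = f (x.coeff n) := rfl

theorem mapL_theta (f : A →ₐ[ℂ] B) (x : LaurentSeries A) :
    mapL f (theta A x) = theta B (mapL f x) := by
  ext n; simp [theta_coeff]

instance charZero_laurent [Nontrivial A] : CharZero (LaurentSeries A) :=
  charZero_of_injective_algebraMap (algebraMap ℂ (LaurentSeries A)).injective

/-- Constants in the direction of the coefficients. -/
def constL (A : Type) [CommRing A] [Algebra ℂ A] : K →ₐ[ℂ] LaurentSeries A :=
  mapL (Algebra.ofId ℂ A)

@[simp] theorem mapL_constL (f : A →ₐ[ℂ] ℂ) (x : K) : mapL f (constL A x) = x := by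
  ext n
  simp [constL, Algebra.ofId_apply]

theorem cst_eq (c : ℂ) : cst c = algebraMap ℂ K c := rfl

theorem theta_cst (c : ℂ) : theta ℂ (cst c) = 0 := (theta ℂ).map_algebraMap c

/-- Evaluation of a one-parameter family of Laurent series. -/
def evL (s : ℂ) : LaurentSeries ℂ[X] →ₐ[ℂ] K := mapL (aeval s)

/-- The derivative at `0` of a one-parameter family of Laurent series. -/
def d0L : LaurentSeries ℂ[X] →ₗ[ℂ] K where
  toFun x :=
    { coeff := fun n => (x.coeff n).coeff 1
      isPWO_support' := x.isPWO_support.mono fun n hn h => hn (by simp [h]) }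
  map_add' x y := by ext n; simp
  map_smul' c x := by ext n; simp

/-- The parameter of a one-parameter family. -/
def parL : LaurentSeries ℂ[X] := HahnSeries.C X

theorem d0L_coeff (x : LaurentSeries ℂ[X]) (n : ℤ) :
    (d0L x).coeff n = (x.coeff n).coeff 1 := rfl

theorem evL_coeff (s : ℂ) (x : LaurentSeries ℂ[X]) (n : ℤ) :
    (evL s x).coeff n = (x.coeff n).eval s := by simp [evL, aeval_def, eval₂_eq_eval_map]

theorem evL_zero_coeff (x : LaurentSeries ℂ[X]) (n : ℤ) :
    (evL 0 x).coeff n = (x.coeff n).coeff 0 := by rw [evL_coeff, coeff_zero_eq_eval_zero]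

theorem d0L_mul (x y : LaurentSeries ℂ[X]) :
    d0L (x * y) = d0L x * evL 0 y + evL 0 x * d0L y := by
  ext n
  have h1 : (d0L x).support ⊆ x.support := fun m hm h => hm (by simp [d0L_coeff, h])
  have h2 : (d0L y).support ⊆ y.support := fun m hm h => hm (by simp [d0L_coeff, h])
  have h3 : (evL 0 x).support ⊆ x.support := fun m hm h => hm (by simp [evL_coeff, h])
  have h4 : (evL 0 y).support ⊆ y.support := fun m hm h => hm (by simp [evL_coeff, h])
  -- The products on the two sides are convolutions over different supports. All of them are written
  -- over the antidiagonal of the supports of `x` and `y`, where the claim is the formula for the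
  -- linear coefficient of a product of polynomials.
  have key : ∀ u v : K, u.support ⊆ x.support → v.support ⊆ y.support →
      (u * v).coeff n = ∑ p ∈ Finset.antidiagonal x.isPWO_support y.isPWO_support n,
        u.coeff p.1 * v.coeff p.2 := by
    intro u v hu hv
    rw [HahnSeries.coeff_mul]
    refine Finset.sum_subset (Finset.antidiagonal_mono_left hu |>.trans
      (Finset.antidiagonal_mono_right hv)) ?_
    intro p hp hp'
    by_contra hne
    refine hp' (Finset.mem_antidiagonal.2 ⟨?_, ?_, (Finset.mem_antidiagonal.1 hp).2.2⟩)
    · exact fun h => hne (by rw [h, zero_mul])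
    · exact fun h => hne (by rw [h, mul_zero])
  rw [HahnSeries.coeff_add, key _ _ h1 h4, key _ _ h3 h2, d0L_coeff, HahnSeries.coeff_mul,
    finsetSum_coeff, ← Finset.sum_add_distrib]
  refine Finset.sum_congr rfl fun p _ => ?_
  rw [d0L_coeff, d0L_coeff, evL_zero_coeff, evL_zero_coeff, mul_coeff_one]
  ring

theorem d0L_theta (x : LaurentSeries ℂ[X]) : d0L (theta _ x) = theta ℂ (d0L x) := by
  ext n
  simp only [d0L_coeff, theta_coeff]
  rw [← map_intCast (C : ℂ →+* ℂ[X]), coeff_C_mul]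

theorem evL_theta (s : ℂ) (x : LaurentSeries ℂ[X]) : evL s (theta _ x) = theta ℂ (evL s x) :=
  mapL_theta _ x

@[simp] theorem evL_constL (s : ℂ) (x : K) : evL s (constL _ x) = x := mapL_constL _ x

@[simp] theorem d0L_constL (x : K) : d0L (constL _ x) = 0 := by
  ext n
  simp [d0L_coeff, constL, Algebra.ofId_apply]

@[simp] theorem evL_parL (s : ℂ) : evL s parL = cst s := by
  ext n
  rw [evL_coeff, parL, cst, HahnSeries.C_apply, HahnSeries.C_apply, HahnSeries.coeff_single,
    HahnSeries.coeff_single]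
  split_ifs <;> simp

@[simp] theorem d0L_parL : d0L parL = 1 := by
  ext n
  rw [d0L_coeff, parL, HahnSeries.C_apply, HahnSeries.coeff_single, HahnSeries.coeff_one]
  split_ifs <;> simp

theorem theta_parL : theta ℂ[X] parL = 0 := by
  ext n
  rw [theta_coeff, parL, HahnSeries.C_apply, HahnSeries.coeff_single]
  split_ifs with h <;> simp [h]

theorem zpow_mul_coeff (n m : ℤ) (x : K) : (zpow n * x).coeff m = x.coeff (m - n) := by
  have := HahnSeries.coeff_single_mul_add (r := (1 : ℂ)) (x := x) (a := m - n) (b := n)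
  simpa [zpow] using this

theorem zpow_add (n m : ℤ) : zpow n * zpow m = zpow (n + m) := by
  simp [zpow, HahnSeries.single_mul_single]

@[simp] theorem zpow_zero : zpow 0 = 1 := rfl

theorem dz_coeff (x : K) (n : ℤ) : (dz x).coeff n = (n + 1) * x.coeff (n + 1) := by
  simp [dz, LaurentSeries.derivative_apply, LaurentSeries.hasseDeriv_coeff, zsmul_eq_mul]

theorem theta_eq (x : K) : theta ℂ x = zpow 1 * dz x := by
  ext n
  rw [zpow_mul_coeff, dz_coeff, theta_coeff]
  simp

theorem dz_eq (x : K) : dz x = zpow (-1) * theta ℂ x := by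
  rw [theta_eq, ← mul_assoc, zpow_add]
  simp

/-- The derivation `d/dz` of `ℂ((z))`. -/
def dzD : Derivation ℂ K K := (zpow (-1) : LaurentSeries ℂ) • theta ℂ

theorem dzD_apply (x : K) : dzD x = dz x := by
  rw [dz_eq]; rfl

theorem theta_zpow (n : ℤ) : theta ℂ (zpow n) = (n : K) * zpow n := by
  ext m
  rw [theta_coeff, ← map_intCast (HahnSeries.C : ℂ →+* K), HahnSeries.C_apply,
    HahnSeries.coeff_single_zero_mul, zpow]
  by_cases h : m = n
  · simp [h]
  · simp [HahnSeries.coeff_single_of_ne h]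

theorem res_zpow_mul (x : K) : res (zpow (-1) * x) = x.coeff 0 := by
  rw [res, zpow_mul_coeff]; simp

theorem smul_eq_cst_mul (c : ℂ) (x : K) : c • x = cst c * x := Algebra.smul_def c x

end Laurent

/-! ### Binomial coefficients with upper argument in a ℂ-algebra -/

section Binomial

variable {R : Type} [CommRing R] [Algebra ℂ R]

/-- The binomial coefficient `a (a - 1) ⋯ (a - l + 1) / l!`. -/
def gbinom (a : R) (l : ℕ) : R :=
  algebraMap ℂ R (l.factorial : ℂ)⁻¹ * ∏ r ∈ Finset.range l, (a - r)

@[simp] theorem gbinom_zero (a : R) : gbinom a 0 = 1 := by simp [gbinom]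

theorem algebraMap_inv_mul_natCast {n : ℕ} (hn : n ≠ 0) :
    algebraMap ℂ R (n : ℂ)⁻¹ * (n : R) = 1 := by
  rw [← map_natCast (algebraMap ℂ R), ← map_mul, inv_mul_cancel₀ (by exact_mod_cast hn), map_one]

/-- The recursion in the lower index. Together with `natCast_succ_mul_cancel` it allows induction
without division in the ring. -/
theorem succ_mul_gbinom (a : R) (l : ℕ) :
    ((l : R) + 1) * gbinom a (l + 1) = (a - l) * gbinom a l := by
  have h : algebraMap ℂ R ((l + 1).factorial : ℂ)⁻¹ * ((l : R) + 1)
      = algebraMap ℂ R (l.factorial : ℂ)⁻¹ := by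
    have : ((l : R) + 1) = algebraMap ℂ R ((l : ℂ) + 1) := by simp
    rw [this, ← map_mul]
    congr 1
    have h1 : ((l : ℂ) + 1) ≠ 0 := by exact_mod_cast Nat.succ_ne_zero l
    have h2 : (l.factorial : ℂ) ≠ 0 := by exact_mod_cast l.factorial_ne_zero
    rw [Nat.factorial_succ]
    push_cast
    field_simp
  rw [gbinom, gbinom, Finset.prod_range_succ, ← h]
  ring

theorem natCast_succ_mul_cancel {l : ℕ} {x y : R} (h : ((l : R) + 1) * x = ((l : R) + 1) * y) :
    x = y := by
  have h1 := algebraMap_inv_mul_natCast (R := R) (Nat.succ_ne_zero l)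
  push_cast at h1
  have h2 := congrArg (algebraMap ℂ R ((l : ℂ) + 1)⁻¹ * ·) h
  simp only [← mul_assoc] at h2
  rwa [h1, one_mul, one_mul] at h2

theorem gbinom_one (a : R) : gbinom a 1 = a := by simp [gbinom]

theorem gbinom_natCast_of_lt {m l : ℕ} (h : m < l) : gbinom (m : R) l = 0 := by
  rw [gbinom, Finset.prod_eq_zero (Finset.mem_range.2 h) (by simp), mul_zero]

/-- The Chu--Vandermonde identity. -/
theorem gbinom_add (a b : R) (m : ℕ) :
    gbinom (a + b) m = ∑ p ∈ Finset.HasAntidiagonal.antidiagonal m, gbinom a p.1 * gbinom b p.2 := by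
  induction m with
  | zero => simp
  | succ m ih =>
    apply natCast_succ_mul_cancel (l := m)
    rw [succ_mul_gbinom, ih, Finset.mul_sum, Finset.mul_sum]
    have e : ∀ p ∈ Finset.HasAntidiagonal.antidiagonal (m + 1),
        ((m : R) + 1) * (gbinom a p.1 * gbinom b p.2)
          = (p.1 : R) * gbinom a p.1 * gbinom b p.2 + gbinom a p.1 * ((p.2 : R) * gbinom b p.2) := by
      intro p hp
      have : ((p.1 + p.2 : ℕ) : R) = ((m + 1 : ℕ) : R) := by rw [Finset.HasAntidiagonal.mem_antidiagonal.1 hp]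
      push_cast at this
      rw [← this]; ring
    rw [Finset.sum_congr rfl e, Finset.sum_add_distrib, Finset.Nat.sum_antidiagonal_succ,
      Finset.Nat.sum_antidiagonal_succ' (n := m)]
    simp only [Nat.cast_zero, zero_mul, mul_zero, zero_add]
    rw [← Finset.sum_add_distrib]
    refine Finset.sum_congr rfl fun p hp => ?_
    have : ((p.1 + p.2 : ℕ) : R) = (m : R) := by rw [Finset.HasAntidiagonal.mem_antidiagonal.1 hp]
    push_cast at this ⊢
    rw [succ_mul_gbinom, succ_mul_gbinom, ← this]
    ring

/-- Both sides are the product of a - r over r < l + s divided by l! s!. In the associativity of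
symbols it matches the binomials of the order with those of the Leibniz rule. -/
theorem gbinom_mul_choose (a : R) (l s : ℕ) :
    gbinom a (l + s) * ((l + s).choose l : R) = gbinom a l * gbinom (a - l) s := by
  have h1 : (∏ r ∈ Finset.range (l + s), (a - (r : R)))
      = (∏ r ∈ Finset.range l, (a - (r : R))) * ∏ r ∈ Finset.range s, (a - l - (r : R)) := by
    rw [Finset.prod_range_add]
    congr 1
    refine Finset.prod_congr rfl fun r _ => ?_
    push_cast; ring
  have h2 : algebraMap ℂ R ((l + s).factorial : ℂ)⁻¹ * ((l + s).choose l : R)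
      = algebraMap ℂ R (l.factorial : ℂ)⁻¹ * algebraMap ℂ R (s.factorial : ℂ)⁻¹ := by
    rw [← map_natCast (algebraMap ℂ R), ← map_mul, ← map_mul]
    congr 1
    have h := Nat.choose_mul_factorial_mul_factorial (Nat.le_add_right l s)
    rw [Nat.add_sub_cancel_left] at h
    have h' : ((l + s).choose l : ℂ) * l.factorial * s.factorial = (l + s).factorial := by
      exact_mod_cast h
    have n1 : (l.factorial : ℂ) ≠ 0 := by exact_mod_cast l.factorial_ne_zero
    have n2 : (s.factorial : ℂ) ≠ 0 := by exact_mod_cast s.factorial_ne_zero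
    have n3 : ((l + s).factorial : ℂ) ≠ 0 := by exact_mod_cast (l + s).factorial_ne_zero
    field_simp
    linear_combination h'
  rw [gbinom, gbinom, gbinom, h1]
  linear_combination ((∏ r ∈ Finset.range l, (a - (r : R)))
    * ∏ r ∈ Finset.range s, (a - l - (r : R))) * h2

theorem gbinom_algebraMap (c : ℂ) (l : ℕ) :
    gbinom (algebraMap ℂ R c) l = algebraMap ℂ R (binom c l) := by
  rw [gbinom, binom, div_eq_inv_mul, map_mul, map_prod]
  simp

end Binomial

/-! ### Iterated derivations -/

section Deriv

variable {R : Type} [CommRing R] [Algebra ℂ R] (d : Derivation ℂ R R)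

theorem deriv_iterate_zero (n : ℕ) : d^[n] 0 = 0 :=
  Function.iterate_fixed (map_zero d) n

theorem deriv_iterate_add (n : ℕ) (a b : R) : d^[n] (a + b) = d^[n] a + d^[n] b := by
  induction n generalizing a b with
  | zero => rfl
  | succ n ih => rw [Function.iterate_succ_apply, map_add, ih]; rfl

theorem deriv_iterate_sum {ι : Type} (n : ℕ) (s : Finset ι) (f : ι → R) :
    d^[n] (∑ i ∈ s, f i) = ∑ i ∈ s, d^[n] (f i) := by
  classical
  induction s using Finset.induction_on with
  | empty => simp
  | insert a s ha ih => rw [Finset.sum_insert ha, Finset.sum_insert ha, deriv_iterate_add, ih]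

theorem deriv_iterate_const_mul {c : R} (hc : d c = 0) (n : ℕ) (a : R) :
    d^[n] (c * a) = c * d^[n] a := by
  induction n generalizing a with
  | zero => rfl
  | succ n ih =>
    rw [Function.iterate_succ_apply, d.leibniz, hc, smul_zero, add_zero, smul_eq_mul, ih]; rfl

theorem deriv_natCast (n : ℕ) : d (n : R) = 0 := d.map_natCast n

theorem deriv_intCast (n : ℤ) : d (n : R) = 0 := by
  simp

theorem deriv_iterate_mul (n : ℕ) (a b : R) :
    d^[n] (a * b) = ∑ p ∈ Finset.HasAntidiagonal.antidiagonal n, (n.choose p.1 : R) * (d^[p.1] a * d^[p.2] b) := by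
  induction n with
  | zero => simp
  | succ n ih =>
    rw [Function.iterate_succ_apply', ih, map_sum]
    have e : ∀ p ∈ Finset.HasAntidiagonal.antidiagonal n, d ((n.choose p.1 : R) * (d^[p.1] a * d^[p.2] b))
        = (n.choose p.1 : R) * (d^[p.1] a * d^[p.2 + 1] b)
          + (n.choose p.2 : R) * (d^[p.1 + 1] a * d^[p.2] b) := by
      intro p hp
      have : (n.choose p.1) = n.choose p.2 := by
        have := Finset.HasAntidiagonal.mem_antidiagonal.1 hp
        rw [← Nat.choose_symm (show p.1 ≤ n by omega), show n - p.1 = p.2 by omega]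
      rw [d.leibniz, deriv_natCast, smul_zero, add_zero, d.leibniz, Function.iterate_succ_apply',
        Function.iterate_succ_apply']
      simp only [smul_eq_mul]
      rw [mul_add, mul_comm (d^[p.2] b), ← this]
    rw [Finset.sum_congr rfl e, Finset.sum_add_distrib]
    exact (Finset.sum_antidiagonal_choose_succ_mul (R := R) (fun i j => d^[i] a * d^[j] b) n).symm

theorem deriv_gbinom {a : R} (ha : d a = 0) (l : ℕ) : d (gbinom a l) = 0 := by
  rw [gbinom, d.leibniz, d.map_algebraMap, smul_zero, add_zero]
  have : d (∏ r ∈ Finset.range l, (a - (r : R))) = 0 := by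
    induction l with
    | zero => simp
    | succ l ih =>
      rw [Finset.prod_range_succ, d.leibniz, ih, map_sub, ha, deriv_natCast]; simp
  rw [this, smul_zero]

end Deriv

/-! ### Products of pseudodifferential symbols of arbitrary order -/

section Symbols

variable {R : Type} [CommRing R] [Algebra ℂ R] (d : Derivation ℂ R R)

/-- The product of the symbols `∑ a_i D^(μ+i)` and `∑ b_j D^(ν+j)` over a differential ring, as a
symbol `∑ c_n D^(μ+ν+n)`. -/
def gsymMul (μ : R) (a b : ℤ → R) : ℤ → R := fun n =>
  ∑ᶠ p : ℤ × ℕ, gbinom (μ + p.1) p.2 * (a p.1 * d^[p.2] (b (n - p.1 + p.2)))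

/-- The symbol `a` has order at most `N`. -/
def OrdLE (N : ℤ) (a : ℤ → R) : Prop := ∀ n, N < n → a n = 0

variable {d}

theorem OrdLE.mono {N M : ℤ} {a : ℤ → R} (h : OrdLE N a) (hM : N ≤ M) : OrdLE M a :=
  fun n hn => h n (by omega)

theorem OrdLE.add {N : ℤ} {a b : ℤ → R} (ha : OrdLE N a) (hb : OrdLE N b) : OrdLE N (a + b) :=
  fun n hn => by simp [ha n hn, hb n hn]

theorem OrdLE.sub {N : ℤ} {a b : ℤ → R} (ha : OrdLE N a) (hb : OrdLE N b) : OrdLE N (a - b) :=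
  fun n hn => by simp [ha n hn, hb n hn]

/-- The product of symbols as a finite sum. -/
theorem gsymMul_eq_sum {μ : R} {a b : ℤ → R} {N M n : ℤ} (ha : OrdLE N a) (hb : OrdLE M b)
    {s : Finset ℤ} {t : Finset ℕ} (hs : ∀ p, n - M ≤ p → p ≤ N → p ∈ s)
    (ht : ∀ l : ℕ, (l : ℤ) ≤ M - n + N → l ∈ t) :
    gsymMul d μ a b n
      = ∑ p ∈ s, ∑ l ∈ t, gbinom (μ + p) l * (a p * d^[l] (b (n - p + l))) := by
  rw [← Finset.sum_product', gsymMul]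
  refine finsum_eq_sum_of_support_subset _ ?_
  intro p hp
  rw [Function.mem_support] at hp
  have h1 : p.1 ≤ N := by
    by_contra h
    exact hp (by rw [ha p.1 (by omega), zero_mul, mul_zero])
  have h2 : n - p.1 + p.2 ≤ M := by
    by_contra h
    exact hp (by rw [hb _ (by omega), deriv_iterate_zero, mul_zero, mul_zero])
  simp only [Finset.coe_product, Set.mem_prod, Finset.mem_coe]
  exact ⟨hs _ (by omega) h1, ht _ (by omega)⟩

theorem OrdLE.gsymMul {μ : R} {a b : ℤ → R} {N M : ℤ} (ha : OrdLE N a) (hb : OrdLE M b) :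
    OrdLE (N + M) (gsymMul d μ a b) := by
  intro n hn
  rw [DSReduction.gsymMul, finsum_eq_zero_of_forall_eq_zero]
  intro p
  by_cases h : N < p.1
  · rw [ha _ h, zero_mul, mul_zero]
  · rw [hb _ (by omega), deriv_iterate_zero, mul_zero, mul_zero]

theorem gsymMul_add_left {μ : R} {a a' b : ℤ → R} {N₁ N₂ M : ℤ} (ha : OrdLE N₁ a)
    (ha' : OrdLE N₂ a') (hb : OrdLE M b) :
    gsymMul d μ (a + a') b = gsymMul d μ a b + gsymMul d μ a' b := by
  funext n
  obtain ⟨N, hN, hN'⟩ : ∃ N, N₁ ≤ N ∧ N₂ ≤ N := ⟨_, le_max_left _ _, le_max_right _ _⟩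
  replace ha := ha.mono hN
  replace ha' := ha'.mono hN'
  have hs : ∀ p, n - M ≤ p → p ≤ N → p ∈ Finset.Icc (n - M) N :=
    fun p h h' => Finset.mem_Icc.2 ⟨h, h'⟩
  have ht : ∀ l : ℕ, (l : ℤ) ≤ M - n + N → l ∈ Finset.range ((M - n + N).toNat + 1) :=
    fun l h => Finset.mem_range.2 (by omega)
  rw [Pi.add_apply, gsymMul_eq_sum ha hb hs ht, gsymMul_eq_sum ha' hb hs ht,
    gsymMul_eq_sum (ha.add ha') hb hs ht, ← Finset.sum_add_distrib]
  refine Finset.sum_congr rfl fun p _ => ?_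
  rw [← Finset.sum_add_distrib]
  refine Finset.sum_congr rfl fun l _ => ?_
  rw [Pi.add_apply]; ring

theorem gsymMul_sub_left {μ : R} {a a' b : ℤ → R} {N₁ N₂ M : ℤ} (ha : OrdLE N₁ a)
    (ha' : OrdLE N₂ a') (hb : OrdLE M b) :
    gsymMul d μ (a - a') b = gsymMul d μ a b - gsymMul d μ a' b := by
  obtain ⟨N, hN, hN'⟩ : ∃ N, N₁ ≤ N ∧ N₂ ≤ N := ⟨_, le_max_left _ _, le_max_right _ _⟩
  rw [eq_sub_iff_add_eq, ← gsymMul_add_left ((ha.mono hN).sub (ha'.mono hN')) ha' hb,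
    sub_add_cancel]

theorem gsymMul_add_right {μ : R} {a b b' : ℤ → R} {N M₁ M₂ : ℤ} (ha : OrdLE N a)
    (hb : OrdLE M₁ b) (hb' : OrdLE M₂ b') :
    gsymMul d μ a (b + b') = gsymMul d μ a b + gsymMul d μ a b' := by
  funext n
  obtain ⟨M, hM, hM'⟩ : ∃ M, M₁ ≤ M ∧ M₂ ≤ M := ⟨_, le_max_left _ _, le_max_right _ _⟩
  replace hb := hb.mono hM
  replace hb' := hb'.mono hM'
  have hs : ∀ p, n - M ≤ p → p ≤ N → p ∈ Finset.Icc (n - M) N :=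
    fun p h h' => Finset.mem_Icc.2 ⟨h, h'⟩
  have ht : ∀ l : ℕ, (l : ℤ) ≤ M - n + N → l ∈ Finset.range ((M - n + N).toNat + 1) :=
    fun l h => Finset.mem_range.2 (by omega)
  rw [Pi.add_apply, gsymMul_eq_sum ha hb hs ht, gsymMul_eq_sum ha hb' hs ht,
    gsymMul_eq_sum ha (hb.add hb') hs ht, ← Finset.sum_add_distrib]
  refine Finset.sum_congr rfl fun p _ => ?_
  rw [← Finset.sum_add_distrib]
  refine Finset.sum_congr rfl fun l _ => ?_
  rw [Pi.add_apply, deriv_iterate_add]; ring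

theorem gsymMul_sub_right {μ : R} {a b b' : ℤ → R} {N M₁ M₂ : ℤ} (ha : OrdLE N a)
    (hb : OrdLE M₁ b) (hb' : OrdLE M₂ b') :
    gsymMul d μ a (b - b') = gsymMul d μ a b - gsymMul d μ a b' := by
  obtain ⟨M, hM, hM'⟩ : ∃ M, M₁ ≤ M ∧ M₂ ≤ M := ⟨_, le_max_left _ _, le_max_right _ _⟩
  rw [eq_sub_iff_add_eq, ← gsymMul_add_right ha ((hb.mono hM).sub (hb'.mono hM')) hb',
    sub_add_cancel]

end Symbols

/-! ### Associativity of the product of symbols -/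

section Assoc

variable {R : Type} [CommRing R] [Algebra ℂ R] {d : Derivation ℂ R R}

/-- `f e` for `e ≥ 0` and `0` otherwise. -/
def ifNonneg (e : ℤ) (f : ℕ → R) : R := if 0 ≤ e then f e.toNat else 0

/-- Summing over the exponents p, q of the two factors, instead of p and the number l = p + q - n of
differentiations, makes iterated products comparable: a triple product becomes a sum over three
exponents and one intermediate exponent. -/
theorem gsymMul_eq_pairs {μ : R} {a b : ℤ → R} {N M n : ℤ} (ha : OrdLE N a) (hb : OrdLE M b)
    {s t : Finset ℤ} (hs : ∀ p, n - M ≤ p → p ≤ N → p ∈ s)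
    (ht : ∀ q, n - N ≤ q → q ≤ M → q ∈ t) :
    gsymMul d μ a b n
      = ∑ p ∈ s, ∑ q ∈ t, ifNonneg (p + q - n) fun l => gbinom (μ + p) l * (a p * d^[l] (b q)) := by
  rw [gsymMul_eq_sum ha hb hs (t := Finset.range ((M - n + N).toNat + 1))
    (fun l h => Finset.mem_range.2 (by omega))]
  refine Finset.sum_congr rfl fun p _ => ?_
  by_cases hp : N < p
  · rw [Finset.sum_eq_zero, Finset.sum_eq_zero]
    · intro q _
      rw [ifNonneg]
      split_ifs
      · rw [ha p hp, zero_mul, mul_zero]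
      · rfl
    · intro l _
      rw [ha p hp, zero_mul, mul_zero]
  refine Finset.sum_bij_ne_zero (fun l _ _ => n - p + l) ?_ ?_ ?_ ?_
  · intro l _ hne
    have h : n - p + l ≤ M := by
      by_contra h
      exact hne (by rw [hb _ (by omega), deriv_iterate_zero, mul_zero, mul_zero])
    exact ht _ (by omega) h
  · intro l _ _ l' _ _ h
    have : (l : ℤ) = l' := by linarith
    exact_mod_cast this
  · intro q _ hne
    have h0 : 0 ≤ p + q - n := by
      by_contra h
      exact hne (by rw [ifNonneg, if_neg h])
    rw [ifNonneg, if_pos h0] at hne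
    have h : q ≤ M := by
      by_contra h
      exact hne (by rw [hb _ (by omega), deriv_iterate_zero, mul_zero, mul_zero])
    have e : n - p + (((p + q - n).toNat : ℕ) : ℤ) = q := by omega
    refine ⟨(p + q - n).toNat, Finset.mem_range.2 (by omega), ?_, e⟩
    rw [e]; exact hne
  · intro l _ _
    have e : p + (n - p + l) - n = (l : ℤ) := by ring
    rw [ifNonneg, if_pos (by omega), e, Int.toNat_natCast]

/-- Associativity for three monomials with a fixed total number e of differentiations. On the left
the binomial is expanded by Chu–Vandermonde, on the right the derivative of a product by the Leibniz
rule; both become the same sum over the decompositions of e into three parts. That β is a constant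
is needed to move its binomials through the derivation. -/
theorem gsymMul_assoc_aux {α β : R} (hβ : d β = 0) (a b c : R) (e : ℕ) :
    ∑ x ∈ Finset.HasAntidiagonal.antidiagonal e,
        gbinom (α + β - x.1) x.2 * (gbinom α x.1 * (a * d^[x.1] b) * d^[x.2] c)
      = ∑ x ∈ Finset.HasAntidiagonal.antidiagonal e,
        gbinom α x.1 * (a * d^[x.1] (gbinom β x.2 * (b * d^[x.2] c))) := by
  have h1 : ∀ x ∈ Finset.HasAntidiagonal.antidiagonal e,
      gbinom (α + β - x.1) x.2 * (gbinom α x.1 * (a * d^[x.1] b) * d^[x.2] c)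
        = ∑ y ∈ Finset.HasAntidiagonal.antidiagonal x.2,
          gbinom α (x.1 + y.1) * ((x.1 + y.1).choose x.1 : R) * gbinom β y.2 * a * d^[x.1] b
            * d^[y.1 + y.2] c := by
    intro x _
    rw [show α + β - (x.1 : R) = (α - x.1) + β by ring, gbinom_add, Finset.sum_mul]
    refine Finset.sum_congr rfl fun y hy => ?_
    rw [gbinom_mul_choose, Finset.HasAntidiagonal.mem_antidiagonal.1 hy]
    ring
  have h2 : ∀ x ∈ Finset.HasAntidiagonal.antidiagonal e,
      gbinom α x.1 * (a * d^[x.1] (gbinom β x.2 * (b * d^[x.2] c)))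
        = ∑ y ∈ Finset.HasAntidiagonal.antidiagonal x.1,
          gbinom α (y.1 + y.2) * ((y.1 + y.2).choose y.1 : R) * gbinom β x.2 * a * d^[y.1] b
            * d^[y.2 + x.2] c := by
    intro x _
    rw [deriv_iterate_const_mul d (deriv_gbinom d hβ _), deriv_iterate_mul, Finset.mul_sum,
      Finset.mul_sum, Finset.mul_sum]
    refine Finset.sum_congr rfl fun y hy => ?_
    rw [Finset.HasAntidiagonal.mem_antidiagonal.1 hy, Function.iterate_add_apply]
    ring
  rw [Finset.sum_congr rfl h1, Finset.sum_congr rfl h2, Finset.sum_sigma', Finset.sum_sigma']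
  refine Finset.sum_nbij' (fun x => ⟨(x.1.1 + x.2.1, x.2.2), (x.1.1, x.2.1)⟩)
    (fun x => ⟨(x.2.1, x.2.2 + x.1.2), (x.2.2, x.1.2)⟩) ?_ ?_ ?_ ?_ ?_
  · rintro ⟨⟨i, j⟩, ⟨k, l⟩⟩ h
    simp only [Finset.mem_sigma, Finset.HasAntidiagonal.mem_antidiagonal] at h ⊢
    obtain ⟨h1, h2⟩ := h
    exact ⟨by omega, trivial⟩
  · rintro ⟨⟨i, j⟩, ⟨k, l⟩⟩ h
    simp only [Finset.mem_sigma, Finset.HasAntidiagonal.mem_antidiagonal] at h ⊢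
    obtain ⟨h1, h2⟩ := h
    exact ⟨by omega, trivial⟩
  · rintro ⟨⟨i, j⟩, ⟨k, l⟩⟩ h
    simp only [Finset.mem_sigma, Finset.HasAntidiagonal.mem_antidiagonal] at h
    simp [h.2]
  · rintro ⟨⟨i, j⟩, ⟨k, l⟩⟩ h
    simp only [Finset.mem_sigma, Finset.HasAntidiagonal.mem_antidiagonal] at h
    simp [h.2]
  · rintro ⟨⟨i, j⟩, ⟨k, l⟩⟩ _
    rfl

/-- An intermediate exponent r contributes only if l = u - r and m = r - (u - e) are both
nonnegative, so it parametrizes the decompositions l + m = e. -/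
theorem sum_ifNonneg_shift {s : Finset ℤ} {u e : ℤ} (f : ℕ → ℕ → R)
    (hs : ∀ r, u - e ≤ r → r ≤ u → r ∈ s) :
    ∑ r ∈ s, ifNonneg (u - r) (fun l => ifNonneg (r - (u - e)) fun m => f l m)
      = ifNonneg e fun e => ∑ x ∈ Finset.HasAntidiagonal.antidiagonal e, f x.1 x.2 := by
  by_cases he : 0 ≤ e
  · rw [ifNonneg, if_pos he]
    refine (Finset.sum_bij_ne_zero (fun x _ _ => u - x.1) ?_ ?_ ?_ ?_).symm
    · rintro ⟨i, j⟩ h _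
      have := Finset.HasAntidiagonal.mem_antidiagonal.1 h
      simp only at this ⊢
      exact hs _ (by omega) (by omega)
    · rintro ⟨i, j⟩ h _ ⟨i', j'⟩ h' _ hh
      have := Finset.HasAntidiagonal.mem_antidiagonal.1 h
      have := Finset.HasAntidiagonal.mem_antidiagonal.1 h'
      simp only at *
      ext <;> simp only <;> omega
    · intro r _ hne
      have h1 : 0 ≤ u - r := by
        by_contra h
        exact hne (by rw [ifNonneg, if_neg h])
      rw [ifNonneg, if_pos h1] at hne
      have h2 : 0 ≤ r - (u - e) := by
        by_contra h
        exact hne (by rw [ifNonneg, if_neg h])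
      rw [ifNonneg, if_pos h2] at hne
      refine ⟨((u - r).toNat, (r - (u - e)).toNat), ?_, hne, ?_⟩
      · rw [Finset.HasAntidiagonal.mem_antidiagonal]; simp only; omega
      · simp only; omega
    · rintro ⟨i, j⟩ h _
      have := Finset.HasAntidiagonal.mem_antidiagonal.1 h
      simp only at this ⊢
      rw [ifNonneg, if_pos (by omega), ifNonneg, if_pos (by omega)]
      congr 1 <;> omega
  · rw [ifNonneg, if_neg he]
    refine Finset.sum_eq_zero fun r _ => ?_
    rw [ifNonneg]
    split_ifs
    · rw [ifNonneg, if_neg (by omega)]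
    · rfl

theorem mul_ifNonneg (c : R) (e : ℤ) (f : ℕ → R) :
    c * ifNonneg e f = ifNonneg e fun l => c * f l := by
  rw [ifNonneg, ifNonneg]; split_ifs <;> simp

theorem ifNonneg_mul (c : R) (e : ℤ) (f : ℕ → R) :
    ifNonneg e f * c = ifNonneg e fun l => f l * c := by
  rw [ifNonneg, ifNonneg]; split_ifs <;> simp

theorem ifNonneg_sum {ι : Type} (s : Finset ι) (e : ℤ) (f : ι → ℕ → R) :
    (ifNonneg e fun l => ∑ i ∈ s, f i l) = ∑ i ∈ s, ifNonneg e (f i) := by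
  simp only [ifNonneg]; split_ifs <;> simp

theorem ifNonneg_comm (e e' : ℤ) (f : ℕ → ℕ → R) :
    (ifNonneg e fun l => ifNonneg e' fun m => f l m)
      = ifNonneg e' fun m => ifNonneg e fun l => f l m := by
  simp only [ifNonneg]; split_ifs <;> simp

theorem deriv_iterate_ifNonneg (n : ℕ) (e : ℤ) (f : ℕ → R) :
    d^[n] (ifNonneg e f) = ifNonneg e fun l => d^[n] (f l) := by
  rw [ifNonneg, ifNonneg]; split_ifs <;> simp

theorem ifNonneg_congr {e e' : ℤ} (he : e = e') {f g : ℕ → R}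
    (h : ∀ l : ℕ, e = l → f l = g l) : ifNonneg e f = ifNonneg e' g := by
  subst he
  rw [ifNonneg, ifNonneg]
  split_ifs with h0
  · exact h _ (by omega)
  · rfl

/-- Associativity of the product of symbols. -/
theorem gsymMul_assoc {μ ν : R} (hν : d ν = 0) {a b c : ℤ → R} {Na Nb Nc : ℤ}
    (ha : OrdLE Na a) (hb : OrdLE Nb b) (hc : OrdLE Nc c) :
    gsymMul d (μ + ν) (gsymMul d μ a b) c = gsymMul d μ a (gsymMul d ν b c) := by
  funext n
  -- The exponents of the three factors that can contribute to the coefficient n lie in `P`, `Q`,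
  -- `S`. With these fixed, only the exponent of the intermediate product is summed, and its sum is
  -- the monomial identity `gsymMul_assoc_aux`.
  set P := Finset.Icc (n - Nc - Nb) Na
  set Q := Finset.Icc (n - Nc - Na) Nb
  set S := Finset.Icc (n - Na - Nb) Nc
  rw [gsymMul_eq_pairs (ha.gsymMul hb) hc (s := Finset.Icc (n - Nc) (Na + Nb)) (t := S)
      (fun p h h' => Finset.mem_Icc.2 ⟨h, h'⟩) (fun p h h' => Finset.mem_Icc.2 ⟨by omega, h'⟩),
    gsymMul_eq_pairs ha (hb.gsymMul hc) (s := P) (t := Finset.Icc (n - Na) (Nb + Nc))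
      (fun p h h' => Finset.mem_Icc.2 ⟨by omega, h'⟩) (fun p h h' => Finset.mem_Icc.2 ⟨by omega, h'⟩)]
  have hL : ∀ r ∈ Finset.Icc (n - Nc) (Na + Nb), gsymMul d μ a b r
      = ∑ p ∈ P, ∑ q ∈ Q, ifNonneg (p + q - r) fun l => gbinom (μ + p) l * (a p * d^[l] (b q)) := by
    intro r hr
    have := Finset.mem_Icc.1 hr
    exact gsymMul_eq_pairs ha hb (fun p h h' => Finset.mem_Icc.2 ⟨by omega, h'⟩)
      (fun p h h' => Finset.mem_Icc.2 ⟨by omega, h'⟩)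
  have hR : ∀ t ∈ Finset.Icc (n - Na) (Nb + Nc), gsymMul d ν b c t
      = ∑ q ∈ Q, ∑ k ∈ S, ifNonneg (q + k - t) fun l => gbinom (ν + q) l * (b q * d^[l] (c k)) := by
    intro r hr
    have := Finset.mem_Icc.1 hr
    exact gsymMul_eq_pairs hb hc (fun p h h' => Finset.mem_Icc.2 ⟨by omega, h'⟩)
      (fun p h h' => Finset.mem_Icc.2 ⟨by omega, h'⟩)
  have eL : ∑ r ∈ Finset.Icc (n - Nc) (Na + Nb), ∑ k ∈ S, (ifNonneg (r + k - n) fun m =>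
        gbinom (μ + ν + r) m * (gsymMul d μ a b r * d^[m] (c k)))
      = ∑ p ∈ P, ∑ q ∈ Q, ∑ k ∈ S, ∑ r ∈ Finset.Icc (n - Nc) (Na + Nb),
        ifNonneg (p + q - r) fun l => ifNonneg (r - (p + q - (p + q + k - n))) fun m =>
          gbinom (μ + p + (ν + q) - l) m * (gbinom (μ + p) l * (a p * d^[l] (b q)) * d^[m] (c k)) := by
    have step : ∀ r ∈ Finset.Icc (n - Nc) (Na + Nb), ∑ k ∈ S, (ifNonneg (r + k - n) fun m =>
        gbinom (μ + ν + r) m * (gsymMul d μ a b r * d^[m] (c k)))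
        = ∑ p ∈ P, ∑ q ∈ Q, ∑ k ∈ S, ifNonneg (p + q - r) fun l =>
          ifNonneg (r - (p + q - (p + q + k - n))) fun m =>
          gbinom (μ + p + (ν + q) - l) m
            * (gbinom (μ + p) l * (a p * d^[l] (b q)) * d^[m] (c k)) := by
      intro r hr
      simp only [hL r hr, Finset.sum_mul, Finset.mul_sum, ifNonneg_sum, ifNonneg_mul, mul_ifNonneg]
      rw [Finset.sum_comm]
      refine Finset.sum_congr rfl fun p _ => ?_
      rw [Finset.sum_comm]
      refine Finset.sum_congr rfl fun q _ => Finset.sum_congr rfl fun k _ => ?_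
      rw [ifNonneg_comm]
      refine ifNonneg_congr rfl fun l hl => ifNonneg_congr (by ring) fun m _ => ?_
      have : (r : R) = p + q - l := by
        have : r = p + q - l := by omega
        rw [this]; push_cast; ring
      rw [this]
      congr 2
      ring
    rw [Finset.sum_congr rfl step, Finset.sum_comm]
    refine Finset.sum_congr rfl fun p _ => ?_
    rw [Finset.sum_comm]
    refine Finset.sum_congr rfl fun q _ => ?_
    rw [Finset.sum_comm]
  have eR : ∑ p ∈ P, ∑ t ∈ Finset.Icc (n - Na) (Nb + Nc), (ifNonneg (p + t - n) fun l =>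
        gbinom (μ + p) l * (a p * d^[l] (gsymMul d ν b c t)))
      = ∑ p ∈ P, ∑ q ∈ Q, ∑ k ∈ S, ∑ t ∈ Finset.Icc (n - Na) (Nb + Nc),
        ifNonneg (q + k - t) fun m => ifNonneg (t - (q + k - (p + q + k - n))) fun l =>
          gbinom (μ + p) l * (a p * d^[l] (gbinom (ν + q) m * (b q * d^[m] (c k)))) := by
    refine Finset.sum_congr rfl fun p _ => ?_
    have step : ∀ t ∈ Finset.Icc (n - Na) (Nb + Nc), (ifNonneg (p + t - n) fun l =>
        gbinom (μ + p) l * (a p * d^[l] (gsymMul d ν b c t)))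
        = ∑ q ∈ Q, ∑ k ∈ S, ifNonneg (q + k - t) fun m =>
          ifNonneg (t - (q + k - (p + q + k - n))) fun l =>
          gbinom (μ + p) l * (a p * d^[l] (gbinom (ν + q) m * (b q * d^[m] (c k)))) := by
      intro t ht
      simp only [hR t ht, deriv_iterate_sum, Finset.mul_sum, ifNonneg_sum, mul_ifNonneg,
        deriv_iterate_ifNonneg]
      refine Finset.sum_congr rfl fun q _ => Finset.sum_congr rfl fun k _ => ?_
      rw [ifNonneg_comm]
      exact ifNonneg_congr rfl fun l hl => ifNonneg_congr (by ring) fun m _ => rfl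
    rw [Finset.sum_congr rfl step, Finset.sum_comm]
    refine Finset.sum_congr rfl fun q _ => ?_
    rw [Finset.sum_comm]
  rw [eL, eR]
  refine Finset.sum_congr rfl fun p hp => Finset.sum_congr rfl fun q hq =>
    Finset.sum_congr rfl fun k hk => ?_
  have hp := Finset.mem_Icc.1 hp
  have hq := Finset.mem_Icc.1 hq
  have hk := Finset.mem_Icc.1 hk
  rw [sum_ifNonneg_shift _ (fun r h h' => Finset.mem_Icc.2 ⟨by omega, by omega⟩),
    sum_ifNonneg_shift (fun m l => gbinom (μ + p) l
      * (a p * d^[l] (gbinom (ν + q) m * (b q * d^[m] (c k)))))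
      (fun r h h' => Finset.mem_Icc.2 ⟨by omega, by omega⟩)]
  refine ifNonneg_congr rfl fun e _ => ?_
  rw [gsymMul_assoc_aux (by rw [map_add, hν, deriv_intCast, add_zero]),
    ← Finset.Nat.sum_antidiagonal_swap]
  rfl

end Assoc

/-! ### Monomial symbols and differential parts -/

section SymbolBasics

variable {R : Type} [CommRing R] [Algebra ℂ R] {d : Derivation ℂ R R}

/-- The symbol `c D^k`. -/
def monoSym (k : ℤ) (c : R) : ℤ → R := fun n => if n = k then c else 0

/-- The differential part of a symbol. -/
def gplus (a : ℤ → R) : ℤ → R := fun n => if 0 ≤ n then a n else 0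

theorem ordLE_monoSym (k : ℤ) (c : R) : OrdLE k (monoSym k c) := fun n hn => if_neg (by omega)

theorem OrdLE.gplus {N : ℤ} {a : ℤ → R} (h : OrdLE N a) : OrdLE N (gplus a) := fun n hn => by
  rw [DSReduction.gplus, h n hn, ite_self]

theorem gplus_eq_zero {N : ℤ} {a : ℤ → R} (h : OrdLE N a) (hN : N < 0) : gplus a = 0 := by
  funext n
  rw [gplus]
  split_ifs
  · exact h n (by omega)
  · rfl

theorem gsymMul_monoSym_left {μ : R} {k : ℤ} {c : R} {b : ℤ → R} {M n : ℤ} (hb : OrdLE M b)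
    {B : ℕ} (hB : M - n + k < B) : gsymMul d μ (monoSym k c) b n
      = ∑ l ∈ Finset.range B, gbinom (μ + k) l * (c * d^[l] (b (n - k + l))) := by
  rw [gsymMul_eq_sum (ordLE_monoSym k c) hb (s := insert k (Finset.Icc (n - M) k))
    (t := Finset.range B) (fun p h h' => Finset.mem_insert_of_mem (Finset.mem_Icc.2 ⟨h, h'⟩))
    (fun l h => Finset.mem_range.2 (by omega))]
  rw [Finset.sum_eq_single k]
  · simp [monoSym]
  · intro p _ hp
    simp [monoSym, hp]
  · intro h
    exact absurd (Finset.mem_insert_self _ _) h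

/-- The product as the sum over the monomials of the first factor. -/
theorem gsymMul_eq_sum_mono {a b : ℤ → R} {N M n : ℤ} (ha : OrdLE N a) (hb : OrdLE M b)
    {s : Finset ℤ} (hs : ∀ p, n - M ≤ p → p ≤ N → p ∈ s) :
    gsymMul d 0 a b n = ∑ p ∈ s, a p * gsymMul d 0 (monoSym p 1) b n := by
  obtain ⟨B, hB⟩ : ∃ B : ℕ, M - n + N < B := ⟨(M - n + N).toNat + 1, by omega⟩
  rw [gsymMul_eq_sum ha hb hs (t := Finset.range B) (fun l h => Finset.mem_range.2 (by omega))]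
  refine Finset.sum_congr rfl fun p _ => ?_
  by_cases hp : p ≤ N
  · rw [gsymMul_monoSym_left hb (B := B) (by omega), Finset.mul_sum]
    refine Finset.sum_congr rfl fun l _ => ?_
    ring
  · rw [ha p (by omega)]
    simp

theorem gsymMul_one_left {a : ℤ → R} {N : ℤ} (ha : OrdLE N a) :
    gsymMul d 0 (monoSym 0 1) a = a := by
  funext n
  obtain ⟨B, hB⟩ : ∃ B : ℕ, N - n + 0 < B + 1 := ⟨(N - n).toNat, by omega⟩
  rw [gsymMul_monoSym_left ha (B := B + 1) (by push_cast; omega), Finset.sum_range_succ',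
    Finset.sum_eq_zero]
  · simp
  · intro l _
    have : gbinom ((0 : R) + (0 : ℤ)) (l + 1) = 0 := by
      simpa using gbinom_natCast_of_lt (R := R) (Nat.succ_pos l)
    rw [this, zero_mul]

theorem gsymMul_monoSym_right {μ : R} {a : ℤ → R} {N : ℤ} (ha : OrdLE N a) (k : ℤ) :
    gsymMul d μ a (monoSym k 1) = fun n => a (n - k) := by
  funext n
  obtain ⟨B, hB⟩ : ∃ B : ℕ, k - n + N ≤ B := ⟨(k - n + N).toNat, by omega⟩
  rw [gsymMul_eq_sum ha (ordLE_monoSym k 1) (s := insert (n - k) (Finset.Icc (n - k) N))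
    (t := Finset.range (B + 1)) (fun p h h' => Finset.mem_insert_of_mem (Finset.mem_Icc.2 ⟨h, h'⟩))
    (fun l h => Finset.mem_range.2 (by omega))]
  have hl : ∀ (l : ℕ) (m : ℤ), d^[l + 1] (monoSym k (1 : R) m) = 0 := by
    intro l m
    rw [Function.iterate_succ_apply, monoSym]
    split_ifs <;> simp
  rw [Finset.sum_eq_single (n - k)]
  · rw [Finset.sum_range_succ', Finset.sum_eq_zero]
    · simp [monoSym]
    · intro l _
      rw [hl, mul_zero, mul_zero]
  · intro p _ hp
    rw [Finset.sum_range_succ', Finset.sum_eq_zero]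
    · have : n - p ≠ k := by omega
      simp [monoSym, this]
    · intro l _
      rw [hl, mul_zero, mul_zero]
  · intro h
    exact absurd (Finset.mem_insert_self _ _) h

theorem gsymMul_monoSym_monoSym (μ : R) (j k : ℤ) :
    gsymMul d μ (monoSym j 1) (monoSym k 1) = monoSym (j + k) 1 := by
  rw [gsymMul_monoSym_right (ordLE_monoSym j 1)]
  funext n
  simp only [monoSym]
  congr 1
  exact propext ⟨fun h => by omega, fun h => by omega⟩

theorem gsymMul_D_left {a : ℤ → R} {N : ℤ} (ha : OrdLE N a) (n : ℤ) :
    gsymMul d 0 (monoSym 1 1) a n = a (n - 1) + d (a n) := by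
  obtain ⟨B, hB⟩ : ∃ B : ℕ, N - n + 1 < B + 2 := ⟨(N - n).toNat, by omega⟩
  rw [gsymMul_monoSym_left ha (B := B + 2) (by push_cast; omega), Finset.sum_range_succ',
    Finset.sum_range_succ', Finset.sum_eq_zero]
  · simp [gbinom_one, add_comm]
  · intro l _
    have : gbinom ((0 : R) + (1 : ℤ)) (l + 1 + 1) = 0 := by
      simpa using gbinom_natCast_of_lt (R := R) (show 1 < l + 1 + 1 by omega)
    rw [this, zero_mul]

theorem gsymMul_smul_left {a b : ℤ → R} {N M : ℤ} (ha : OrdLE N a) (hb : OrdLE M b) (c : R)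
    (n : ℤ) : gsymMul d 0 (fun m => c * a m) b n = c * gsymMul d 0 a b n := by
  have hs : ∀ p, n - M ≤ p → p ≤ N → p ∈ Finset.Icc (n - M) N :=
    fun p h h' => Finset.mem_Icc.2 ⟨h, h'⟩
  rw [gsymMul_eq_sum_mono ha hb hs,
    gsymMul_eq_sum_mono (N := N) (fun m hm => by rw [ha m hm, mul_zero]) hb hs, Finset.mul_sum]
  refine Finset.sum_congr rfl fun p _ => by ring

theorem gsymMul_monoSym_coeff {b : ℤ → R} {M : ℤ} (hb : OrdLE M b) (c : R) (n : ℤ) :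
    gsymMul d 0 (monoSym 0 c) b n = c * b n := by
  have := gsymMul_smul_left (d := d) (ordLE_monoSym (R := R) 0 1) hb c n
  rw [gsymMul_one_left hb] at this
  rw [← this]
  congr 1
  funext m
  simp [monoSym]

theorem gsymMul_mono_mono {a : ℤ → R} {N : ℤ} (ha : OrdLE N a) (j k : ℤ) :
    gsymMul d 0 (monoSym j 1) (gsymMul d 0 (monoSym k 1) a) = gsymMul d 0 (monoSym (j + k) 1) a := by
  have := gsymMul_assoc (d := d) (μ := 0) (ν := 0) (map_zero d) (ordLE_monoSym (R := R) j 1)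
    (ordLE_monoSym k 1) ha
  rw [← this, gsymMul_monoSym_monoSym, add_zero]

/-- The product of differential operators is a differential operator. -/
theorem gsymMul_apply_eq_zero {a b : ℤ → R} (ha' : ∀ n < 0, a n = 0) {K n : ℤ} (hb' : ∀ n < K, b n = 0) (hn : n < K) :
    gsymMul d 0 a b n = 0 := by
  rw [gsymMul, finsum_eq_zero_of_forall_eq_zero]
  rintro ⟨p, l⟩
  simp only
  by_cases hp : p < 0
  · rw [ha' p hp]; simp
  by_cases hl : n - p + l < K
  · rw [hb' _ hl, deriv_iterate_zero]; simp
  -- Here p ≥ 0 and n - p + l ≥ K > n, so l > p: the operator D^p never differentiates more than p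
  -- times.
  have : gbinom ((0 : R) + (p : ℤ)) l = 0 := by
    have h : ((p.toNat : ℕ) : ℤ) = p := by omega
    rw [zero_add, ← h, Int.cast_natCast]
    exact gbinom_natCast_of_lt (by omega)
  rw [this, zero_mul]

end SymbolBasics

/-! ### Hamiltonian matrices built from symbols -/

section Ham

variable {R : Type} [CommRing R] [Algebra ℂ R]

/-- Matrices over `R` of size `lam`: the values of `Q n` at the row numbers are the entries of the
`n`-th diagonal, apart from finitely many rows. -/
def IsPolyMat (lam : R) (A : ℕ → ℕ → R) : Prop :=
  ∃ (N R₀ : ℕ) (Q : ℤ → R[X]), (∀ i j, j + N < i → A i j = 0) ∧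
    (∀ i j : ℕ, R₀ ≤ i → A i j = (Q ((j : ℤ) - i)).eval (i : R)) ∧
    ∀ n r : ℤ, 1 ≤ r → r ≤ n → (Q n).eval (lam - r) = 0

/-- `x` is a matrix of size `lam` with first column `q` such that `[x, F] + d x`, `F` the Frobenius
matrix with first row `b`, has `w` as its first row and zeros elsewhere. -/
structure IsHam (d : Derivation ℂ R R) (lam : R) (b q : ℕ → R) (x : ℕ → ℕ → R) (w : ℕ → R) :
    Prop where
  polyMat : IsPolyMat lam x
  col : ∀ i, x i 0 = q i
  step : ∀ i j, x i j = x (i + 1) (j + 1) + d (x (i + 1) j) + q (i + 1) * b j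
  row : ∀ j, w j = x 0 (j + 1) + d (x 0 j) + q 0 * b j - ∑ᶠ k, b k * x k j

variable (d : Derivation ℂ R R) (lam : R) (b : ℕ → R) (Q : ℤ → R)

/-- The symbol `D^lam - ∑ b_j D^(lam-1-j)` with respect to `D^lam`. -/
def frobSym : ℤ → R := fun n => if n = 0 then 1 else if n < 0 then -b (-n - 1).toNat else 0

/-- The differential part of `D^(-lam) Q L`. -/
def hamPlus : ℤ → R :=
  gplus (gsymMul d (-lam) (gsymMul d (-lam) (monoSym 0 1) Q) (frobSym b))

/-- The symbol `D^e D^lam S - (D^e Q)_+ L` with `S` the differential part of `D^(-lam) Q L`. -/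
def hamRow (e : ℤ) : ℤ → R :=
  gsymMul d 0 (monoSym e 1) (gsymMul d lam (monoSym 0 1) (hamPlus d lam b Q))
    - gsymMul d 0 (gplus (gsymMul d 0 (monoSym e 1) Q)) (frobSym b)

/-- The matrix whose rows are the coefficients of the symbols `hamRow`. -/
def hamMat (i j : ℕ) : R := hamRow d lam b Q (-(i : ℤ) - 1) (-1 - j)

/-- The symbol `L S - (L Q)_+ L`. -/
def hamSym : ℤ → R :=
  gsymMul d 0 (frobSym b) (gsymMul d lam (monoSym 0 1) (hamPlus d lam b Q))
    - gsymMul d 0 (gplus (gsymMul d 0 (frobSym b) Q)) (frobSym b)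

/-- The right coefficients of a differential operator `∑ D^i q_i`. -/
def rightCoeff (i : ℕ) : R := gsymMul d 0 (monoSym (-(i : ℤ) - 1) 1) Q (-1)

variable {d lam b Q}

theorem ordLE_frobSym : OrdLE 0 (frobSym b) := fun n hn => by
  rw [frobSym, if_neg (by omega), if_neg (by omega)]

theorem frobSym_neg (j : ℕ) : frobSym b (-1 - j) = -b j := by
  rw [frobSym, if_neg (by omega), if_pos (by omega)]
  congr 2
  omega

theorem gsymMul_neg_cancel (hlam : d lam = 0) {M : ℤ} (hQ : OrdLE M Q) :
    gsymMul d lam (monoSym 0 1) (gsymMul d (-lam) (monoSym 0 1) Q) = Q := by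
  have h := gsymMul_assoc (d := d) (μ := lam) (ν := -lam) (by rw [map_neg, hlam, neg_zero])
    (ordLE_monoSym (R := R) 0 1) (ordLE_monoSym 0 1) hQ
  rw [← h, add_neg_cancel, gsymMul_monoSym_monoSym, add_zero, gsymMul_one_left hQ]

variable {M : ℤ} (hlam : d lam = 0) (hQ : OrdLE M Q)
include hQ

theorem ordLE_hamPlus : OrdLE M (hamPlus d lam b Q) := by
  have := (((ordLE_monoSym (R := R) 0 1).gsymMul hQ (d := d) (μ := -lam)).gsymMul
    (ordLE_frobSym (b := b)) (d := d) (μ := -lam)).gplus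
  rw [zero_add, add_zero] at this
  exact this

theorem ordLE_lam_hamPlus :
    OrdLE M (gsymMul d lam (monoSym 0 1) (hamPlus d lam b Q)) := by
  simpa using (ordLE_monoSym (R := R) 0 1).gsymMul (ordLE_hamPlus hQ) (d := d) (μ := lam)

omit hQ in
theorem hamPlus_neg {n : ℤ} (hn : n < 0) : hamPlus d lam b Q n = 0 := if_neg (by omega)

-- Substituting S = D^(-lam) Q L - (D^(-lam) Q L)_- turns the row into (D^e Q)_- L - D^e V, where V
-- = D^lam (D^(-lam) Q L)_-. Both terms have order at most -1 relative to D^lam when e ≤ 0.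
include hlam in
theorem ordLE_hamRow {e : ℤ} (he : e ≤ 0) : OrdLE (-1) (hamRow d lam b Q e) := by
  set L := frobSym b
  have hL : OrdLE 0 L := ordLE_frobSym
  have h1 : OrdLE (0 : ℤ) (monoSym 0 (1 : R)) := ordLE_monoSym 0 1
  have he1 : OrdLE e (monoSym e (1 : R)) := ordLE_monoSym e 1
  set C := gsymMul d (-lam) (monoSym 0 1) Q with hC
  have hCo : OrdLE M C := by simpa using h1.gsymMul hQ (d := d) (μ := -lam)
  set Y := gsymMul d (-lam) C L with hY
  have hYo : OrdLE M Y := by simpa using hCo.gsymMul hL (d := d) (μ := -lam)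
  have hQL : gsymMul d lam (monoSym 0 1) Y = gsymMul d 0 Q L := by
    rw [hY, ← gsymMul_assoc (by rw [map_neg, hlam, neg_zero]) h1 hCo hL, hC,
      gsymMul_neg_cancel hlam hQ, add_neg_cancel]
  have hminus : OrdLE (-1) (Y - hamPlus d lam b Q) := fun n hn => by
    rw [Pi.sub_apply, hamPlus, gplus, if_pos (by omega), sub_self]
  have hZ : gsymMul d lam (monoSym 0 1) (hamPlus d lam b Q)
      = gsymMul d 0 Q L - gsymMul d lam (monoSym 0 1) (Y - hamPlus d lam b Q) := by
    rw [gsymMul_sub_right h1 hYo (ordLE_hamPlus hQ), hQL, sub_sub_cancel]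
  have hQLo : OrdLE M (gsymMul d 0 Q L) := by simpa using hQ.gsymMul hL (d := d) (μ := 0)
  set V := gsymMul d lam (monoSym 0 1) (Y - hamPlus d lam b Q)
  have hV : OrdLE (-1) V := by simpa using h1.gsymMul hminus (d := d) (μ := lam)
  set E := gsymMul d 0 (monoSym e 1) Q with hE
  have hEo : OrdLE (e + M) E := he1.gsymMul hQ
  have hEm : OrdLE (-1) (E - gplus E) := fun n hn => by
    rw [Pi.sub_apply, gplus, if_pos (by omega), sub_self]
  have key : hamRow d lam b Q e
      = gsymMul d 0 (E - gplus E) L - gsymMul d 0 (monoSym e 1) V := by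
    rw [hamRow, hZ, gsymMul_sub_right he1 hQLo hV, gsymMul_sub_left hEo hEo.gplus hL]
    have := gsymMul_assoc (d := d) (μ := 0) (ν := 0) (map_zero d) he1 hQ hL
    rw [add_zero] at this
    rw [← this]
    abel
  rw [key]
  refine OrdLE.sub (by simpa using hEm.gsymMul hL (d := d) (μ := 0)) ?_
  exact (he1.gsymMul hV (d := d) (μ := 0)).mono (by omega)

/-- The operators (D^(e+1) Q)_+ and D (D^e Q)_+ differ by the coefficient of D^(-1) in D^e Q, a
function. So consecutive rows are related by left multiplication by D and a multiple of L. -/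
theorem hamRow_succ (e n : ℤ) : hamRow d lam b Q (e + 1) n
    = hamRow d lam b Q e (n - 1) + d (hamRow d lam b Q e n)
      - gsymMul d 0 (monoSym e 1) Q (-1) * frobSym b n := by
  have hL : OrdLE 0 (frobSym b) := ordLE_frobSym
  have h1 : OrdLE (1 : ℤ) (monoSym 1 (1 : R)) := ordLE_monoSym 1 1
  have he1 : OrdLE e (monoSym e (1 : R)) := ordLE_monoSym e 1
  have hT := ordLE_lam_hamPlus (d := d) (lam := lam) (b := b) hQ
  set T := gsymMul d lam (monoSym 0 1) (hamPlus d lam b Q)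
  set E := gsymMul d 0 (monoSym e 1) Q with hE
  have hEo : OrdLE (e + M) E := he1.gsymMul hQ
  have hEE : gsymMul d 0 (monoSym (e + 1) 1) Q = gsymMul d 0 (monoSym 1 1) E := by
    rw [hE, gsymMul_mono_mono hQ, add_comm]
  have hpl : gplus (gsymMul d 0 (monoSym 1 1) E)
      = gsymMul d 0 (monoSym 1 1) (gplus E) + monoSym 0 (E (-1)) := by
    funext m
    rw [Pi.add_apply, gplus, gsymMul_D_left hEo, gsymMul_D_left hEo.gplus, gplus, gplus, monoSym]
    rcases lt_trichotomy m 0 with h | h | h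
    · rw [if_neg (by omega), if_neg (by omega), if_neg (by omega), if_neg (by omega)]; simp
    · subst h; simp [add_comm]
    · rw [if_pos (by omega), if_pos (by omega), if_pos (by omega), if_neg (by omega), add_zero]
  have key : hamRow d lam b Q (e + 1) = gsymMul d 0 (monoSym 1 1) (hamRow d lam b Q e)
      - gsymMul d 0 (monoSym 0 (E (-1))) (frobSym b) := by
    have e1 := h1.gsymMul hEo.gplus (d := d) (μ := 0)
    rw [hamRow, hEE, hpl, hamRow, gsymMul_sub_right h1 (he1.gsymMul hT) (hEo.gplus.gsymMul hL),
      gsymMul_mono_mono hT, add_comm 1 e, gsymMul_add_left e1 (ordLE_monoSym 0 _) hL]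
    · have := gsymMul_assoc (d := d) (μ := 0) (ν := 0) (map_zero d) h1 hEo.gplus hL
      rw [add_zero] at this
      rw [← this]
      abel
  have hro : OrdLE (max (e + M) (e + M + 0)) (hamRow d lam b Q e) :=
    ((he1.gsymMul hT).mono (le_max_left _ _)).sub ((hEo.gplus.gsymMul hL).mono (le_max_right _ _))
  rw [key, Pi.sub_apply, gsymMul_D_left hro, gsymMul_monoSym_coeff hL]

end Ham

theorem finsum_eq_sum_range {R : Type} [CommRing R] {f : ℕ → R} {k : ℕ} (h : ∀ i, k ≤ i → f i = 0) :
    ∑ᶠ i, f i = ∑ i ∈ Finset.range k, f i :=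
  finsum_eq_sum_of_support_subset _ fun i hi => by
    by_contra hik
    exact hi (h i (by simpa using hik))

section Ham

/-- The polynomial with values `binom(lam - 1 - i, l)`. -/
def binomPoly {R : Type} [CommRing R] [Algebra ℂ R] (lam : R) (l : ℕ) : R[X] :=
  C (algebraMap ℂ R (l.factorial : ℂ)⁻¹) * ∏ r ∈ Finset.range l, (C (lam - 1) - X - C (r : R))

theorem eval_binomPoly {R : Type} [CommRing R] [Algebra ℂ R] (lam a : R) (l : ℕ) :
    (binomPoly lam l).eval a = gbinom (lam - 1 - a) l := by
  rw [binomPoly, gbinom, eval_mul, eval_C, eval_prod]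
  simp

variable {R : Type} [CommRing R] [Algebra ℂ R] {d : Derivation ℂ R R} {lam : R} {b : ℕ → R}
  {Q : ℤ → R} {M : ℤ} (hlam : d lam = 0) (hQ : OrdLE M Q)

theorem frobSym_zero : frobSym b 0 = 1 := if_pos rfl

include hlam hQ

/-- In `hamRow_succ` at the coefficient 0 both rows vanish, having order at most -1, while L has
coefficient 1. What remains expresses the first entry of the row through the right coefficient of Q.
-/
theorem hamMat_col (i : ℕ) : hamMat d lam b Q i 0 = rightCoeff d Q i := by
  have h := hamRow_succ (d := d) (lam := lam) (b := b) hQ (-(i : ℤ) - 1) 0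
  rw [ordLE_hamRow hlam hQ (e := -(i : ℤ) - 1 + 1) (by omega) 0 (by omega),
    ordLE_hamRow hlam hQ (e := -(i : ℤ) - 1) (by omega) 0 (by omega), frobSym_zero,
    map_zero] at h
  rw [hamMat, rightCoeff]
  have e : (-1 - ((0 : ℕ) : ℤ)) = 0 - 1 := by simp
  rw [e]
  linear_combination -h

omit hlam in
theorem hamRow_succ_coeff (i j : ℕ) : hamRow d lam b Q (-(i : ℤ)) (-1 - j)
    = hamMat d lam b Q i (j + 1) + d (hamMat d lam b Q i j) + rightCoeff d Q i * b j := by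
  have h := hamRow_succ (d := d) (lam := lam) (b := b) hQ (-(i : ℤ) - 1) (-1 - j)
  rw [frobSym_neg, sub_add_cancel] at h
  rw [h, hamMat, hamMat, rightCoeff]
  have e : (-1 - ((j + 1 : ℕ) : ℤ)) = -1 - j - 1 := by push_cast; ring
  rw [e]
  ring

omit hlam in
theorem hamMat_step (i j : ℕ) : hamMat d lam b Q i j
    = hamMat d lam b Q (i + 1) (j + 1) + d (hamMat d lam b Q (i + 1) j)
      + rightCoeff d Q (i + 1) * b j := by
  rw [← hamRow_succ_coeff hQ, hamMat]
  congr 1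
  push_cast; ring

-- For e + M < 0 the operator (D^e Q)_+ is zero and only D^e D^lam S is left, of order at most e +
-- M. This bounds the number of nonzero lower diagonals.
omit hlam in
theorem ordLE_hamRow_neg {e : ℤ} (he : e + M < 0) : OrdLE (e + M) (hamRow d lam b Q e) := by
  have h : gplus (gsymMul d 0 (monoSym e 1) Q) = 0 :=
    gplus_eq_zero ((ordLE_monoSym e 1).gsymMul hQ) he
  intro n hn
  rw [hamRow, h, Pi.sub_apply,
    (ordLE_monoSym e 1).gsymMul (ordLE_lam_hamPlus hQ) (μ := 0) (d := d) n hn, gsymMul,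
    finsum_eq_zero_of_forall_eq_zero]
  · simp
  · intro p; simp

omit hlam in
theorem hamMat_lower {i j : ℕ} (h : j + M.toNat < i) : hamMat d lam b Q i j = 0 :=
  ordLE_hamRow_neg hQ (e := -(i : ℤ) - 1) (by omega) _ (by omega)

omit hlam hQ in
theorem gsymMul_frobSym {Y : ℤ → R} {M : ℤ} (hY : OrdLE M Y) {n : ℤ} {k : ℕ} (hk : M - n ≤ k) :
    gsymMul d 0 (frobSym b) Y n
      = Y n - ∑ i ∈ Finset.range k, b i * gsymMul d 0 (monoSym (-(i : ℤ) - 1) 1) Y n := by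
  classical
  have hinj : Set.InjOn (fun i : ℕ => -(i : ℤ) - 1) (Finset.range k : Set ℕ) :=
    fun i _ j _ h => by simpa using h
  rw [gsymMul_eq_sum_mono ordLE_frobSym hY
    (s := insert 0 ((Finset.range k).image fun i : ℕ => -(i : ℤ) - 1)), Finset.sum_insert,
    Finset.sum_image hinj, frobSym_zero, gsymMul_one_left hY, one_mul, sub_eq_add_neg,
    ← Finset.sum_neg_distrib]
  · congr 1
    refine Finset.sum_congr rfl fun i _ => ?_
    rw [show -(i : ℤ) - 1 = -1 - i by ring, frobSym_neg]
    ring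
  · simp only [Finset.mem_image, not_exists, not_and]
    intro i _; omega
  · intro p h h'
    simp only [Finset.mem_insert, Finset.mem_image, Finset.mem_range]
    rcases eq_or_lt_of_le h' with h0 | h0
    · exact Or.inl h0
    · exact Or.inr ⟨(-p - 1).toNat, by omega, by omega⟩

-- The row symbol is linear in its left factor D^e over the coefficients, also after the
-- differential part is taken. Expanding L = 1 - ∑ b_i D^(-i-1) relative to D^lam gives the
-- combination of rows.
omit hlam in
theorem hamSym_eq {n : ℤ} {k : ℕ} (hk : M - n ≤ k) (hkM : M ≤ k) : hamSym d lam b Q n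
    = hamRow d lam b Q 0 n
      - ∑ i ∈ Finset.range k, b i * hamRow d lam b Q (-(i : ℤ) - 1) n := by
  have hT := ordLE_lam_hamPlus (d := d) (lam := lam) (b := b) hQ
  have hL : OrdLE 0 (frobSym b) := ordLE_frobSym
  have hs : ∀ p, n - 0 ≤ p → p ≤ M → p ∈ Finset.Icc n M :=
    fun p h h' => Finset.mem_Icc.2 ⟨by omega, h'⟩
  have hLQ : OrdLE M (gsymMul d 0 (frobSym b) Q) := by simpa using hL.gsymMul hQ (d := d) (μ := 0)
  have hY : ∀ i : ℕ, OrdLE M (gsymMul d 0 (monoSym (-(i : ℤ) - 1) 1) Q) := fun i =>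
    ((ordLE_monoSym _ _).gsymMul hQ).mono (by omega)
  have hpl : ∀ p, gplus (gsymMul d 0 (frobSym b) Q) p = gplus Q p
      - ∑ i ∈ Finset.range k, b i * gplus (gsymMul d 0 (monoSym (-(i : ℤ) - 1) 1) Q) p := by
    intro p
    simp only [gplus]
    split_ifs with hp
    · exact gsymMul_frobSym hQ (by omega)
    · simp
  rw [hamSym, hamRow, gsymMul_one_left hT, gsymMul_one_left hQ, Pi.sub_apply, Pi.sub_apply,
    gsymMul_frobSym hT hk, gsymMul_eq_sum_mono hLQ.gplus hL hs,
    gsymMul_eq_sum_mono hQ.gplus hL hs]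
  simp only [hpl, hamRow, Pi.sub_apply, sub_mul, Finset.sum_sub_distrib, mul_sub, Finset.sum_mul]
  have e : ∀ i ∈ Finset.range k, b i * gsymMul d 0
      (gplus (gsymMul d 0 (monoSym (-(i : ℤ) - 1) 1) Q)) (frobSym b) n
      = ∑ p ∈ Finset.Icc n M, b i * gplus (gsymMul d 0 (monoSym (-(i : ℤ) - 1) 1) Q) p
        * gsymMul d 0 (monoSym p 1) (frobSym b) n := by
    intro i _
    rw [gsymMul_eq_sum_mono (hY i).gplus hL hs, Finset.mul_sum]
    exact Finset.sum_congr rfl fun p _ => by ring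
  rw [Finset.sum_congr rfl e, Finset.sum_comm]
  ring

omit hlam in
theorem hamSym_row (j : ℕ) : hamSym d lam b Q (-1 - j)
    = hamMat d lam b Q 0 (j + 1) + d (hamMat d lam b Q 0 j) + rightCoeff d Q 0 * b j
      - ∑ᶠ k, b k * hamMat d lam b Q k j := by
  rw [hamSym_eq hQ (k := M.toNat + j + 1) (by omega) (by omega),
    finsum_eq_sum_range (k := M.toNat + j + 1)
      (fun i hi => by rw [hamMat_lower hQ (by omega), mul_zero]), ← hamRow_succ_coeff hQ]
  simp [hamMat]

/-- From row M on the term (D^(-i-1) Q)_+ is absent, and the row is D^(lam-1-i) S. Its coefficients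
are binomials in lam - 1 - i times derivatives of the coefficients of S. -/
theorem hamMat_eq_sum {i j : ℕ} (hi : M ≤ i) : hamMat d lam b Q i j
    = ∑ m ∈ Finset.range (M.toNat + 1), ifNonneg (m + ((j : ℤ) - i)) fun l =>
        gbinom (lam - 1 - i) l * d^[l] (hamPlus d lam b Q m) := by
  classical
  have hS := ordLE_hamPlus (d := d) (lam := lam) (b := b) hQ
  have h : gplus (gsymMul d 0 (monoSym (-(i : ℤ) - 1) 1) Q) = 0 :=
    gplus_eq_zero ((ordLE_monoSym _ 1).gsymMul hQ) (by omega)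
  have h2 : gsymMul d 0 (0 : ℤ → R) (frobSym b) = 0 := by
    funext n
    rw [gsymMul, finsum_eq_zero_of_forall_eq_zero]
    · simp
    · intro p; simp
  have h3 := gsymMul_assoc (d := d) (μ := 0) hlam (ordLE_monoSym (R := R) (-(i : ℤ) - 1) 1)
    (ordLE_monoSym 0 1) hS
  have hm : (M.toNat : ℤ) = M ∨ M < 0 := by omega
  rw [hamMat, hamRow, h, h2, sub_zero, ← h3, gsymMul_monoSym_monoSym, zero_add, add_zero,
    gsymMul_eq_pairs (ordLE_monoSym _ 1) (hS.mono (Int.self_le_toNat M))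
      (s := insert (-(i : ℤ) - 1) (Finset.Icc (-1 - j - M.toNat) (-(i : ℤ) - 1)))
      (t := Finset.Icc (min (i - j) 0) M.toNat)
      (fun p h h' => Finset.mem_insert_of_mem (Finset.mem_Icc.2 ⟨h, h'⟩))
      (fun p h h' => Finset.mem_Icc.2 ⟨by omega, h'⟩), Finset.sum_eq_single (-(i : ℤ) - 1)]
  · have hinj : Set.InjOn (fun i : ℕ => (i : ℤ)) (Finset.range (M.toNat + 1) : Set ℕ) :=
      fun i _ j _ h => by simpa using h
    rw [← Finset.sum_subset (s₁ := (Finset.range (M.toNat + 1)).image fun i : ℕ => (i : ℤ)),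
      Finset.sum_image hinj]
    · refine Finset.sum_congr rfl fun m _ => ifNonneg_congr (by ring) fun l _ => ?_
      rw [monoSym, if_pos rfl, one_mul]
      congr 2
      push_cast; ring
    · intro q hq
      obtain ⟨m, hm, rfl⟩ := Finset.mem_image.1 hq
      have := Finset.mem_range.1 hm
      exact Finset.mem_Icc.2 ⟨by omega, by omega⟩
    · intro q hq hq'
      have := Finset.mem_Icc.1 hq
      have hneg : q < 0 := by
        by_contra hc
        exact hq' (Finset.mem_image.2 ⟨q.toNat, Finset.mem_range.2 (by omega), by omega⟩)
      rw [ifNonneg]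
      split_ifs
      · rw [hamPlus_neg hneg, deriv_iterate_zero, mul_zero, mul_zero]
      · rfl
  · intro p _ hp
    refine Finset.sum_eq_zero fun q _ => ?_
    rw [ifNonneg]
    split_ifs
    · rw [monoSym, if_neg hp, zero_mul, mul_zero]
    · rfl
  · intro h
    exact absurd (Finset.mem_insert_self _ _) h

/-- On the n-th diagonal every term contains a binomial of lam - 1 - i with lower index m + n, where
m ≥ 0 because S is a differential operator. At i = lam - r this is the binomial of r - 1, a natural
number less than n, hence zero. -/
theorem isPolyMat_hamMat : IsPolyMat lam (hamMat d lam b Q) := by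
  refine ⟨M.toNat, M.toNat, fun n => ∑ m ∈ Finset.range (M.toNat + 1),
    if 0 ≤ (m + n : ℤ) then binomPoly lam (m + n : ℤ).toNat
      * C (d^[(m + n : ℤ).toNat] (hamPlus d lam b Q m)) else 0,
    fun i j h => hamMat_lower hQ h, ?_, ?_⟩
  · intro i j hi
    rw [hamMat_eq_sum hlam hQ (by omega), eval_finsetSum]
    refine Finset.sum_congr rfl fun m _ => ?_
    rw [ifNonneg]
    split_ifs
    · rw [eval_mul, eval_C, eval_binomPoly]
    · simp
  · intro n r hr hrn
    rw [eval_finsetSum]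
    refine Finset.sum_eq_zero fun m _ => ?_
    split_ifs
    · have e : lam - 1 - (lam - (r : R)) = ((r - 1).toNat : R) := by
        have : ((r - 1).toNat : ℤ) = r - 1 := by omega
        rw [← Int.cast_natCast, this]; push_cast; ring
      rw [eval_mul, eval_binomPoly, e, gbinom_natCast_of_lt (by omega), zero_mul]
    · simp

theorem isHam_hamMat : IsHam d lam b (rightCoeff d Q) (hamMat d lam b Q)
    (fun j => hamSym d lam b Q (-1 - j)) where
  polyMat := isPolyMat_hamMat hlam hQ
  col := hamMat_col hlam hQ
  step := hamMat_step hQ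
  row := hamSym_row hQ

/-- At an integral point, for a differential operator `L`, the first `n` rows of the matrix are
differential operators. -/
theorem hamMat_eq_zero {n : ℕ} (hn : lam = n) (hb : ∀ j, n ≤ j → b j = 0) {i j : ℕ} (hi : i < n)
    (hj : n ≤ j) : hamMat d lam b Q i j = 0 := by
  have hS := ordLE_hamPlus (d := d) (lam := lam) (b := b) hQ
  have hE := (ordLE_monoSym (-(i : ℤ) - 1) (1 : R)).gsymMul hQ (d := d) (μ := 0)
  have h3 := gsymMul_assoc (d := d) (μ := 0) hlam (ordLE_monoSym (R := R) (-(i : ℤ) - 1) 1)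
    (ordLE_monoSym 0 1) hS
  have h1 : gsymMul d 0 (gplus (gsymMul d 0 (monoSym (-(i : ℤ) - 1) 1) Q)) (frobSym b) (-1 - j)
      = 0 := by
    refine gsymMul_apply_eq_zero (K := -n) (fun m hm => if_neg (by omega)) (fun m hm => ?_)
      (by omega)
    have := frobSym_neg (b := b) (-m - 1).toNat
    rw [show -1 - (((-m - 1).toNat : ℕ) : ℤ) = m by omega] at this
    rw [this, hb _ (by omega), neg_zero]
  rw [hamMat, hamRow, Pi.sub_apply, h1, sub_zero, ← h3, gsymMul_monoSym_monoSym, zero_add,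
    add_zero]
  obtain ⟨B, hB⟩ : ∃ B : ℕ, M - (-1 - j) + (-(i : ℤ) - 1) < B :=
    ⟨(M - (-1 - j) + (-(i : ℤ) - 1)).toNat + 1, by omega⟩
  rw [gsymMul_monoSym_left hS hB]
  refine Finset.sum_eq_zero fun l _ => ?_
  by_cases hl : -1 - (j : ℤ) - (-(i : ℤ) - 1) + l < 0
  · rw [hamPlus_neg hl, deriv_iterate_zero, mul_zero, mul_zero]
  -- The order lam - 1 - i is the natural number n - 1 - i, whereas the surviving terms have l ≥ j -
  -- i > n - 1 - i differentiations.
  · have e : lam + ((-(i : ℤ) - 1 : ℤ) : R) = ((n - 1 - i : ℕ) : R) := by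
      have : ((n - 1 - i : ℕ) : ℤ) = (n : ℤ) + (-(i : ℤ) - 1) := by omega
      rw [hn, ← Int.cast_natCast (n - 1 - i), this]; push_cast; ring
    rw [e, gbinom_natCast_of_lt (by omega), zero_mul]

end Ham

/-! ### Differential operators with prescribed right coefficients -/

section RightCoeff

variable {R : Type} [CommRing R] [Algebra ℂ R] {d : Derivation ℂ R R}

variable (d) in
/-- The differential operator `∑_{i < k} D^i q_i`. -/
def ofRightCoeff (q : ℕ → R) : ℕ → ℤ → R
  | 0 => 0
  | k + 1 => ofRightCoeff q k + gsymMul d 0 (monoSym k 1) (monoSym 0 (q k))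

theorem ordLE_ofRightCoeff (q : ℕ → R) (k : ℕ) : OrdLE k (ofRightCoeff d q k) := by
  induction k with
  | zero => exact fun _ _ => rfl
  | succ k ih =>
    refine (ih.mono (by push_cast; omega)).add ?_
    exact ((ordLE_monoSym (k : ℤ) (1 : R)).gsymMul (ordLE_monoSym 0 (q k))).mono
      (by push_cast; omega)

theorem gsymMul_mono_neg {e : ℤ} (he : 0 ≤ e) (c : R) {n : ℤ} (hn : n < 0) :
    gsymMul d 0 (monoSym e 1) (monoSym 0 c) n = 0 :=
  gsymMul_apply_eq_zero (fun m hm => if_neg (by omega)) (K := 0)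
    (fun m hm => if_neg (by omega)) hn

theorem ofRightCoeff_neg (q : ℕ → R) (k : ℕ) {n : ℤ} (hn : n < 0) : ofRightCoeff d q k n = 0 := by
  induction k with
  | zero => rfl
  | succ k ih => rw [ofRightCoeff, Pi.add_apply, ih, gsymMul_mono_neg (by omega) _ hn, add_zero]

theorem gsymMul_zero_right (a : ℤ → R) (μ : R) : gsymMul d μ a 0 = 0 := by
  funext n
  rw [gsymMul, finsum_eq_zero_of_forall_eq_zero]
  · simp
  · intro p; simp

/-- The symbol D^(-i-1) D^k q_k = D^(k-i-1) q_k is a differential operator for k > i, has order less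
than -1 for k < i, and has q_i as its coefficient of D^(-1) for k = i. -/
theorem rightCoeff_ofRightCoeff (q : ℕ → R) (k i : ℕ) :
    rightCoeff d (ofRightCoeff d q k) i = if i < k then q i else 0 := by
  induction k with
  | zero => simp [rightCoeff, ofRightCoeff, gsymMul_zero_right]
  | succ k ih =>
    have h0 := ordLE_monoSym (R := R) 0 (q k)
    rw [rightCoeff, ofRightCoeff, gsymMul_add_right (ordLE_monoSym _ 1) (ordLE_ofRightCoeff q k)
      ((ordLE_monoSym (k : ℤ) (1 : R)).gsymMul h0), Pi.add_apply, gsymMul_mono_mono h0]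
    rw [rightCoeff] at ih
    rw [ih]
    rcases lt_trichotomy i k with h | h | h
    · rw [if_pos h, if_pos (by omega), gsymMul_mono_neg (by omega) _ (by omega), add_zero]
    · subst h
      rw [if_neg (by omega), if_pos (by omega), zero_add, gsymMul_monoSym_left h0 (B := 1)
        (by push_cast; omega)]
      have : (-1 : ℤ) - (-i - 1 + i) = 0 := by ring
      simp [monoSym, this]
    · rw [if_neg (by omega), if_neg (by omega), zero_add]
      exact (ordLE_monoSym _ _).gsymMul h0 _ (by omega)

/-- A finite sequence q consists of the right coefficients of a differential operator, and the
matrix of that operator solves the equations. That `R` is an arbitrary differential algebra is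
essential: it may contain parameters, and lam may be one of them. -/
theorem exists_isHam {lam : R} (hlam : d lam = 0) (b : ℕ → R) {q : ℕ → R} {k : ℕ}
    (hq : ∀ i, k ≤ i → q i = 0) : ∃ x w, IsHam d lam b q x w := by
  have h := isHam_hamMat (b := b) hlam (ordLE_ofRightCoeff (d := d) q k)
  have e : rightCoeff d (ofRightCoeff d q k) = q := by
    funext i
    rw [rightCoeff_ofRightCoeff]
    split_ifs with hi
    · rfl
    · exact (hq i (by omega)).symm
  rw [e] at h
  exact ⟨_, _, h⟩

theorem exists_isHam_natCast {n : ℕ} (hn : 1 ≤ n) {b : ℕ → R} (hb : ∀ j, n ≤ j → b j = 0) {q : ℕ → R} {k : ℕ}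
    (hq : ∀ i, k ≤ i → q i = 0) : ∃ x w, IsHam d (n : R) b q x w ∧
      (∀ i j, i < n → n ≤ j → x i j = 0) ∧ ∀ j, n ≤ j → w j = 0 := by
  have h := isHam_hamMat (b := b) (deriv_natCast d n) (ordLE_ofRightCoeff (d := d) q k)
  have hx : ∀ i j, i < n → n ≤ j → hamMat d (n : R) b (ofRightCoeff d q k) i j = 0 := fun i j =>
    hamMat_eq_zero (deriv_natCast d n) (ordLE_ofRightCoeff (d := d) q k) rfl hb
  have e : rightCoeff d (ofRightCoeff d q k) = q := by
    funext i
    rw [rightCoeff_ofRightCoeff]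
    split_ifs with hi
    · rfl
    · exact (hq i (by omega)).symm
  rw [e] at h
  refine ⟨_, _, h, hx, fun j hj => ?_⟩
  rw [h.row, finsum_eq_zero_of_forall_eq_zero]
  · rw [hx 0 _ hn (by omega), hx 0 _ hn hj, hb j hj, map_zero]; simp
  · intro i
    rcases lt_or_ge i n with hi | hi
    · rw [hx i j hi hj, mul_zero]
    · rw [hb i hi, zero_mul]

end RightCoeff

/-- Recursive choice of a sequence. -/
theorem exists_strong_seq {α : Type} [Nonempty α] (P : ℕ → (ℕ → α) → Prop)
    (hloc : ∀ n f g, (∀ m ≤ n, f m = g m) → P n f → P n g)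
    (h : ∀ n f, (∀ m < n, P m f) → ∃ a, P n (Function.update f n a)) : ∃ f, ∀ n, P n f := by
  classical
  inhabit α
  choose! s hs using h
  have hstep : ∀ n, ∃ f : ℕ → α, ∀ m < n, P m f := by
    intro n
    induction n with
    | zero => exact ⟨fun _ => default, fun m hm => absurd hm (by omega)⟩
    | succ n ih =>
      obtain ⟨f, hf⟩ := ih
      refine ⟨Function.update f n (s n f), fun m hm => ?_⟩
      rcases Nat.lt_succ_iff_lt_or_eq.1 hm with h | h
      · refine hloc m f _ (fun k hk => ?_) (hf m h)
        rw [Function.update_of_ne (by omega)]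
      · subst h
        exact hs m f hf
  -- `G n` is no longer changed at positions below n, so the limit sequence is read off as n ↦ `G (n
  -- + 1) n`.
  let G : ℕ → ℕ → α := fun n => Nat.rec (fun _ => default) (fun n f => Function.update f n (s n f)) n
  have hG : ∀ n, G (n + 1) = Function.update (G n) n (s n (G n)) := fun n => rfl
  have hagree : ∀ n k m, m < n → G (n + k) m = G n m := by
    intro n k m hm
    induction k with
    | zero => rfl
    | succ k ih => rw [← Nat.add_assoc, hG, Function.update_of_ne (by omega), ih]
  have hGP : ∀ n, ∀ m < n, P m (G n) := by
    intro n
    induction n with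
    | zero => exact fun m hm => absurd hm (by omega)
    | succ n ih =>
      intro m hm
      rcases Nat.lt_succ_iff_lt_or_eq.1 hm with h | h
      · exact hloc m (G n) _ (fun k hk => (hagree n 1 k (by omega)).symm) (ih m h)
      · subst h
        rw [hG]
        exact hs m _ ih
  refine ⟨fun n => G (n + 1) n, fun n => hloc n (G (n + 1)) _ (fun m hm => ?_)
    (hGP (n + 1) n (by omega))⟩
  obtain ⟨k, rfl⟩ := Nat.exists_eq_add_of_le hm
  have := hagree (m + 1) k m (by omega)
  rw [← this, show m + 1 + k = m + k + 1 by omega]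

/-! ### Evaluation of polynomials at constants -/

section Eval

variable {R : Type} [CommRing R]

/-- An additive map that commutes with the multiplication by constants commutes with the
evaluation of polynomials at constants. -/
theorem exists_eval_eq_map {S : Type} [CommRing S] (φ : R →+ S) (p : R[X]) :
    ∃ p' : S[X], ∀ a a', (∀ x, φ (x * a) = φ x * a') → p'.eval a' = φ (p.eval a) := by
  induction p using Polynomial.induction_on' with
  | add p q hp hq =>
    obtain ⟨p', hp⟩ := hp
    obtain ⟨q', hq⟩ := hq
    exact ⟨p' + q', fun a a' h => by rw [eval_add, eval_add, map_add, hp a a' h, hq a a' h]⟩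
  | monomial n c =>
    refine ⟨monomial n (φ c), fun a a' h => ?_⟩
    rw [eval_monomial, eval_monomial]
    induction n with
    | zero => simp
    | succ n ih => rw [pow_succ, pow_succ, ← mul_assoc, ← mul_assoc, ih, h]

theorem eq_of_eval_eventually [IsDomain R] [CharZero R] {p q : R[X]} {N : ℕ}
    (h : ∀ i : ℕ, N ≤ i → p.eval (i : R) = q.eval (i : R)) : p = q := by
  refine Polynomial.eq_of_infinite_eval_eq p q ?_
  refine Set.Infinite.mono (s := (fun i : ℕ => (i : R)) '' Set.Ici N) ?_
    ((Set.Ici_infinite N).image (fun i _ j _ h => Nat.cast_injective h))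
  rintro _ ⟨i, hi, rfl⟩
  exact h i hi

end Eval

/-! ### Polynomial solutions of difference equations -/

section Difference

variable {R : Type} [CommRing R] [Algebra ℂ R]

/-- The Bernoulli polynomial satisfies B(1 + x) - B(x) = (n + 1) x^n in degree n + 1. The solution
is found over ℚ and carried to `R`. -/
theorem exists_antidifference_pow (n : ℕ) :
    ∃ u : R[X], u - u.comp (X - 1) = X ^ n := by
  have hq : ∃ u : ℚ[X], u - u.comp (X - 1) = X ^ n := by
    refine ⟨C ((n : ℚ) + 1)⁻¹ * (Polynomial.bernoulli (n + 1)).comp (1 + X), ?_⟩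
    refine Polynomial.funext fun x => ?_
    have h := Polynomial.bernoulli_eval_one_add (n + 1) x
    have h0 : ((n : ℚ) + 1) ≠ 0 := by positivity
    simp only [eval_sub, eval_mul, eval_C, eval_comp, eval_add, eval_one, eval_X, eval_pow]
    rw [show (1 : ℚ) + (x - 1) = x by ring, h]
    push_cast
    field_simp
    ring
  obtain ⟨u, hu⟩ := hq
  refine ⟨u.map ((algebraMap ℂ R).comp (algebraMap ℚ ℂ)), ?_⟩
  have := congrArg (Polynomial.map ((algebraMap ℂ R).comp (algebraMap ℚ ℂ))) hu
  simpa [Polynomial.map_comp] using this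

theorem exists_antidifference (v : R[X]) : ∃ u : R[X], u - u.comp (X - 1) = v := by
  induction v using Polynomial.induction_on' with
  | add p q hp hq =>
    obtain ⟨u, hu⟩ := hp
    obtain ⟨u', hu'⟩ := hq
    exact ⟨u + u', by rw [add_comp, ← hu, ← hu']; ring⟩
  | monomial n a =>
    obtain ⟨u, hu⟩ := exists_antidifference_pow (R := R) n
    exact ⟨C a * u, by rw [mul_comp, C_comp, ← mul_sub, hu, C_mul_X_pow_eq_monomial]⟩

/-- Solution of a difference equation by a sequence that is given by a polynomial with prescribed
zeros for large arguments. -/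
theorem exists_difference_eq (lam : R) (n R₀ : ℕ) (v : ℕ → R) (V : R[X])
    (hv : ∀ i, R₀ < i → v i = V.eval (i : R))
    (hV : ∀ r : ℤ, 1 ≤ r → r ≤ n → V.eval (lam - r) = 0) :
    ∃ (u : ℕ → R) (U : R[X]), (∀ i, u (i + 1) - u i = v (i + 1)) ∧
      (∀ i, R₀ ≤ i → u i = U.eval (i : R)) ∧
      ∀ r : ℤ, 1 ≤ r → r ≤ n + 1 → U.eval (lam - r) = 0 := by
  obtain ⟨U₀, hU₀⟩ := exists_antidifference V
  -- The constant of summation is fixed by the zero at lam - 1. The zeros of V at lam - r, r ≤ n,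
  -- then propagate it to lam - 2, …, lam - n - 1, so the solution has one zero more than the right
  -- side.
  set U := U₀ - C (U₀.eval (lam - 1)) with hU
  have hdiff : ∀ x, U.eval x - U.eval (x - 1) = V.eval x := by
    intro x
    have := congrArg (eval x) hU₀
    simp only [eval_sub, eval_comp, eval_X, eval_one] at this
    rw [← this, hU]
    simp
  -- The initial value is chosen so that the sequence meets U at R₀; in the exceptional rows it just
  -- follows `v`.
  refine ⟨fun i => U.eval (R₀ : R) - ∑ k ∈ Finset.range R₀, v (k + 1)
    + ∑ k ∈ Finset.range i, v (k + 1), U, fun i => ?_, fun i hi => ?_, fun r hr hrn => ?_⟩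
  · beta_reduce
    rw [Finset.sum_range_succ]; ring
  · beta_reduce
    induction i, hi using Nat.le_induction with
    | base => ring
    | succ i hi ih =>
      have := hdiff ((i + 1 : ℕ) : R)
      rw [← hv (i + 1) (by omega)] at this
      rw [Finset.sum_range_succ, ← add_assoc, ih, ← this]
      push_cast
      rw [add_sub_cancel_right]
      ring
  · obtain ⟨k, rfl⟩ : ∃ k : ℕ, r = k + 1 := ⟨(r - 1).toNat, by omega⟩
    induction k with
    | zero => simp [hU]
    | succ k ih =>
      have h1 := ih (by omega) (by push_cast at hrn ⊢; omega)
      have h2 := hdiff (lam - ((k + 1 : ℤ) : R))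
      rw [hV _ (by omega) (by push_cast at hrn ⊢; omega), h1] at h2
      rw [← neg_eq_zero, ← h2]
      push_cast
      rw [zero_sub]
      congr 2
      ring

variable [IsDomain R] [CharZero R]

/-- A constant sequence comes from a constant polynomial, and a single zero of it anywhere, even at
a non-integral point, kills it. With a = lam - 1 this is the source of all uniqueness statements. -/
theorem eq_zero_of_difference_eq_zero {u : ℕ → R} {U : R[X]} {i₀ R₀ : ℕ} {a : R}
    (h : ∀ i, i₀ ≤ i → u (i + 1) = u i) (hU : ∀ i, R₀ ≤ i → u i = U.eval (i : R))
    (ha : U.eval a = 0) : ∀ i, i₀ ≤ i → u i = 0 := by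
  have hc : ∀ i, i₀ ≤ i → u i = u i₀ := by
    intro i hi
    induction i, hi using Nat.le_induction with
    | base => rfl
    | succ i hi ih => rw [h i hi, ih]
  have hUC : U = C (u i₀) := by
    refine eq_of_eval_eventually (N := max i₀ R₀) fun i hi => ?_
    rw [← hU i (le_of_max_le_right hi), hc i (le_of_max_le_left hi), eval_C]
  rw [hUC, eval_C] at ha
  intro i hi
  rw [hc i hi, ha]

end Difference

/-! ### Gauge transformations to the normal form -/

section Gauge

variable {R : Type} [CommRing R] [Algebra ℂ R]

/-- Applying d to the coefficients commutes with evaluation only at constants. It is used at row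
numbers and at lam - r, which are constants. -/
theorem exists_eval_eq_deriv (d : Derivation ℂ R R) (p : R[X]) :
    ∃ p' : R[X], ∀ a, d a = 0 → p'.eval a = d (p.eval a) := by
  obtain ⟨p', h⟩ := exists_eval_eq_map (d : R →+ R) p
  refine ⟨p', fun a ha => h a a fun x => ?_⟩
  have := d.leibniz x a
  rw [ha, smul_zero, zero_add, smul_eq_mul, mul_comm a] at this
  exact this

/-- The matrices with ones just below the diagonal and zeros below them. -/
def IsHess {R : Type} [CommRing R] (A : ℕ → ℕ → R) : Prop :=
  (∀ i, A (i + 1) i = 1) ∧ ∀ i j, j + 1 < i → A i j = 0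

/-- The upper unitriangular matrix `X` transforms `A` into the sum of the Frobenius matrix with
first row `b` and of the diagonal matrix with entries `-c i`. -/
structure IsGauge (d : Derivation ℂ R R) (lam c : R) (A X : ℕ → ℕ → R) (b : ℕ → R) : Prop where
  polyMat : IsPolyMat lam X
  diag : ∀ i, X i i = 1
  lower : ∀ i j, j < i → X i j = 0
  step : ∀ i j, X i j = (∑ k ∈ Finset.range (j + 2), X (i + 1) k * A k j) + d (X (i + 1) j)
    + c * ((i : R) + 1) * X (i + 1) j
  row : ∀ j, (∑ k ∈ Finset.range (j + 2), X 0 k * A k j) + d (X 0 j)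
    = ∑ k ∈ Finset.range (j + 1), b k * X k j

/-- The equations of a gauge transformation in terms of the diagonals `ξ n` of the matrix. -/
theorem sum_diag_eq {A X : ℕ → ℕ → R} (hA : IsHess A) (hX : ∀ i j, j < i → X i j = 0) (i n : ℕ) :
    ∑ k ∈ Finset.range (i + n + 2), X (i + 1) k * A k (i + n)
      = X (i + 1) (i + 1 + n)
        + ∑ m ∈ Finset.range n, X (i + 1) (i + 1 + m) * A (i + 1 + m) (i + n) := by
  rw [show i + n + 2 = (i + 1) + (n + 1) by ring, Finset.sum_range_add,
    Finset.sum_eq_zero, zero_add, Finset.sum_range_succ, add_comm]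
  · congr 1
    rw [show i + 1 + n = i + n + 1 by ring, hA.1, mul_one]
  · intro k hk
    rw [hX _ _ (by simpa using hk), zero_mul]

/-- On the n-th diagonal the equations prescribe the difference of consecutive entries of X in terms
of the previous diagonals. This right side is polynomial in the row with n - 1 zeros inherited from
X and A; summation adds the n-th zero. The first row equations then determine b. -/
theorem exists_isGauge (d : Derivation ℂ R R) {lam : R} (hlam : d lam = 0) (c : R)
    {A : ℕ → ℕ → R} (hA : IsHess A) (hAp : IsPolyMat lam A) :
    ∃ X b, IsGauge d lam c A X b := by
  obtain ⟨-, R₀, Q, -, hQ, hQr⟩ := hAp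
  let P : ℕ → (ℕ → ℕ → R) → Prop := fun n ξ =>
    (n = 0 → ∀ i, ξ 0 i = 1) ∧
    (∀ i, ξ n i = ξ n (i + 1) + ∑ m ∈ Finset.range n, ξ m (i + 1) * A (i + 1 + m) (i + n)
      + if n = 0 then 0 else d (ξ (n - 1) (i + 1)) + c * ((i : R) + 1) * ξ (n - 1) (i + 1)) ∧
    ∃ Ξ : R[X], (∀ i, R₀ ≤ i → ξ n i = Ξ.eval (i : R)) ∧
      ∀ r : ℤ, 1 ≤ r → r ≤ n → Ξ.eval (lam - r) = 0
  obtain ⟨ξ, hξ⟩ : ∃ ξ : ℕ → ℕ → R, ∀ n, P n ξ := by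
    refine exists_strong_seq P ?_ ?_
    · rintro n f g hfg ⟨h1, h2, Ξ, h3, h4⟩
      refine ⟨fun hn i => ?_, fun i => ?_, Ξ, fun i hi => ?_, h4⟩
      · rw [← hfg 0 (by omega), h1 hn]
      · rw [← hfg n le_rfl, h2 i, ← hfg (n - 1) (by omega)]
        congr 2
        refine Finset.sum_congr rfl fun m hm => ?_
        rw [hfg m (by simp at hm; omega)]
      · rw [← hfg n le_rfl, h3 i hi]
    · intro n f hf
      rcases n with _ | n
      · refine ⟨fun _ => 1, fun _ i => by simp, fun i => by simp, 1, fun i _ => by simp, ?_⟩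
        intro r h1 h2
        push_cast at h2
        omega
      · have hΞ : ∀ m, ∃ Ξ : R[X], m < n + 1 → (∀ i, R₀ ≤ i → f m i = Ξ.eval (i : R)) ∧
            ∀ r : ℤ, 1 ≤ r → r ≤ m → Ξ.eval (lam - r) = 0 := by
          intro m
          by_cases hm : m < n + 1
          · obtain ⟨-, -, Ξ, h⟩ := hf m hm
            exact ⟨Ξ, fun _ => h⟩
          · exact ⟨0, fun h => absurd h hm⟩
        choose Ξ hΞ using hΞ
        obtain ⟨dΞ, hdΞ⟩ := exists_eval_eq_deriv d (Ξ n)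
        have hex := exists_difference_eq lam n R₀
          (fun i => -(∑ m ∈ Finset.range (n + 1), f m i * A (i + m) (i + n) + d (f n i)
            + c * i * f n i))
          (-(∑ m ∈ Finset.range (n + 1), Ξ m * (Q (n - m : ℤ)).comp (X + C (m : R))
            + dΞ + C c * X * Ξ n))
          (by
          intro i hi
          simp only [eval_neg, eval_add, eval_finsetSum, eval_mul, eval_C, eval_X, eval_comp]
          rw [hdΞ _ (deriv_natCast d i), ← (hΞ n (by omega)).1 i (by omega)]
          congr 3
          refine Finset.sum_congr rfl fun m hm => ?_
          have hm' : m < n + 1 := by simpa using hm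
          rw [(hΞ m hm').1 i (by omega), hQ _ _ (by omega)]
          congr 2
          · push_cast; rfl
          · congr 1; push_cast; ring)
          (by
          intro r h1 h2
          have hd : d (lam - (r : R)) = 0 := by rw [map_sub, hlam, deriv_intCast, sub_zero]
          simp only [eval_neg, eval_add, eval_finsetSum, eval_mul, eval_C, eval_X, eval_comp]
          rw [hdΞ _ hd, (hΞ n (by omega)).2 r h1 h2, map_zero, mul_zero, add_zero,
            add_zero, neg_eq_zero]
          refine Finset.sum_eq_zero fun m hm => ?_
          have hm' : m < n + 1 := by simpa using hm
          -- At the row lam - r either the m-th diagonal of X has a zero (r ≤ m), or the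
          -- corresponding diagonal of A, shifted by m rows, is evaluated at lam - (r - m) and has
          -- one.
          rcases le_or_gt r m with h | h
          · rw [(hΞ m hm').2 r h1 h, zero_mul]
          · have e : lam - (r : R) + (m : R) = lam - ((r - m : ℤ) : R) := by push_cast; ring
            rw [e, hQr _ _ (by omega) (by omega), mul_zero])
        obtain ⟨u, U, hu, hU, hUr⟩ := hex
        · refine ⟨u, fun h => absurd h (by omega), fun i => ?_, U, fun i hi => ?_, fun r h1 h2 => ?_⟩
          · have hi := hu i
            rw [Function.update_self, if_neg (by omega), Nat.add_sub_cancel,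
              Function.update_of_ne (by omega)]
            have e : ∑ m ∈ Finset.range (n + 1), Function.update f (n + 1) u m (i + 1)
                * A (i + 1 + m) (i + (n + 1))
                = ∑ m ∈ Finset.range (n + 1), f m (i + 1) * A (i + 1 + m) (i + 1 + n) := by
              refine Finset.sum_congr rfl fun m hm => ?_
              rw [Function.update_of_ne (by simp at hm; omega), show i + (n + 1) = i + 1 + n by ring]
            rw [e]
            push_cast at hi
            linear_combination -hi
          · rw [Function.update_self, hU i hi]
          · exact hUr r h1 (by exact_mod_cast h2)
  obtain ⟨X, hXlow, hXd⟩ : ∃ X : ℕ → ℕ → R, (∀ i j, j < i → X i j = 0) ∧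
      ∀ i n, X i (i + n) = ξ n i := by
    refine ⟨fun i j => if j < i then 0 else ξ (j - i) i, fun i j h => if_pos h, fun i n => ?_⟩
    beta_reduce
    rw [if_neg (by omega), Nat.add_sub_cancel_left]
  have hX1 : ∀ i, X i i = 1 := fun i => by
    rw [← (hξ 0).1 rfl i]
    exact hXd i 0
  -- The system for b is triangular with ones on the diagonal, as `X j j = 1`.
  obtain ⟨b, hb⟩ : ∃ b : ℕ → R, ∀ j, (∑ k ∈ Finset.range (j + 2), X 0 k * A k j) + d (X 0 j)
      = ∑ k ∈ Finset.range (j + 1), b k * X k j := by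
    refine exists_strong_seq _ ?_ ?_
    · intro n f g hfg h
      rw [h]
      refine Finset.sum_congr rfl fun k hk => ?_
      rw [hfg k (by simp at hk; omega)]
    · intro n f _
      refine ⟨(∑ k ∈ Finset.range (n + 2), X 0 k * A k n) + d (X 0 n)
        - ∑ k ∈ Finset.range n, f k * X k n, ?_⟩
      rw [Finset.sum_range_succ _ n, Function.update_self, hX1, mul_one]
      have : ∑ k ∈ Finset.range n, Function.update f n ((∑ k ∈ Finset.range (n + 2), X 0 k * A k n)
          + d (X 0 n) - ∑ k ∈ Finset.range n, f k * X k n) k * X k n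
          = ∑ k ∈ Finset.range n, f k * X k n := by
        refine Finset.sum_congr rfl fun k hk => ?_
        rw [Function.update_of_ne (by simp at hk; omega)]
      rw [this]
      ring
  have hpoly : IsPolyMat lam X := by
    choose Ξ hΞ using fun n => (hξ n).2.2
    refine ⟨0, R₀, fun n => if n < 0 then 0 else Ξ n.toNat, fun i j h => hXlow i j (by omega),
      fun i j hi => ?_, fun n r h1 h2 => ?_⟩
    · rcases lt_or_ge j i with h | h
      · beta_reduce
        rw [hXlow i j h, if_pos (by omega), eval_zero]
      · obtain ⟨n, rfl⟩ := Nat.exists_eq_add_of_le h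
        beta_reduce
        rw [hXd, if_neg (by omega), (hΞ n).1 i hi]
        congr
        omega
    · beta_reduce
      rw [if_neg (by omega), (hΞ n.toNat).2 r h1 (by omega)]
  refine ⟨X, b, hpoly, hX1, hXlow, fun i j => ?_, hb⟩
  rcases lt_or_ge j i with h | h
  · rw [hXlow i j h, hXlow (i + 1) j (by omega), Finset.sum_eq_zero]
    · simp
    · intro k hk
      rw [hXlow _ _ (by simp at hk; omega), zero_mul]
  · obtain ⟨n, rfl⟩ := Nat.exists_eq_add_of_le h
    rw [sum_diag_eq hA hXlow, hXd, hXd, (hξ n).2.1 i]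
    have e : ∑ m ∈ Finset.range n, X (i + 1) (i + 1 + m) * A (i + 1 + m) (i + n)
        = ∑ m ∈ Finset.range n, ξ m (i + 1) * A (i + 1 + m) (i + n) :=
      Finset.sum_congr rfl fun m _ => by rw [hXd]
    rw [e]
    rcases n with _ | n
    · rw [hXlow (i + 1) (i + 0) (by omega)]; simp
    · rw [if_neg (by omega), Nat.add_sub_cancel, show i + (n + 1) = i + 1 + n by ring, hXd]
      ring

variable [IsDomain R] [CharZero R]

/-- The first diagonals of the gauge transformation and of the Frobenius form are determined by
the first diagonals of the matrix. -/
theorem IsGauge.unique {d : Derivation ℂ R R} {lam c : R} {A A' X X' : ℕ → ℕ → R} {b b' : ℕ → R}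
    (hA : IsHess A) (hA' : IsHess A') (h : IsGauge d lam c A X b) (h' : IsGauge d lam c A' X' b')
    {k : ℕ} (hk : ∀ i n, n < k → A i (i + n) = A' i (i + n)) :
    (∀ n, n ≤ k → ∀ i, X i (i + n) = X' i (i + n)) ∧ ∀ j, j < k → b j = b' j := by
  have hX : ∀ n, n ≤ k → ∀ i, X i (i + n) = X' i (i + n) := by
    intro n
    induction n using Nat.strong_induction_on with
    | _ n ih =>
      intro hn
      rcases n with _ | n
      · intro i
        rw [Nat.add_zero, h.diag, h'.diag]
      obtain ⟨-, R₁, Q, -, hQ, hQr⟩ := h.polyMat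
      obtain ⟨-, R₂, Q', -, hQ', hQr'⟩ := h'.polyMat
      -- All lower diagonals agree, so the two (n + 1)-st diagonals differ by a constant in the row
      -- number, and both polynomials vanish at lam - 1.
      have key := eq_zero_of_difference_eq_zero (u := fun i => X i (i + (n + 1)) - X' i (i + (n + 1)))
        (U := Q (n + 1 : ℤ) - Q' (n + 1 : ℤ)) (i₀ := 0) (R₀ := max R₁ R₂) (a := lam - ((1 : ℤ) : R))
        ?_ ?_ ?_
      · intro i
        exact sub_eq_zero.1 (key i (Nat.zero_le i))
      · intro i _
        have e1 := h.step i (i + (n + 1))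
        have e2 := h'.step i (i + (n + 1))
        rw [sum_diag_eq hA h.lower, show i + (n + 1) = i + 1 + n by ring, ih n (by omega) (by omega)]
          at e1
        rw [sum_diag_eq hA' h'.lower, show i + (n + 1) = i + 1 + n by ring] at e2
        have e3 : ∑ m ∈ Finset.range (n + 1), X (i + 1) (i + 1 + m) * A (i + 1 + m) (i + 1 + n)
            = ∑ m ∈ Finset.range (n + 1), X' (i + 1) (i + 1 + m) * A' (i + 1 + m) (i + 1 + n) := by
          refine Finset.sum_congr rfl fun m hm => ?_
          have hm' : m < n + 1 := by simpa using hm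
          obtain ⟨p, hp⟩ := Nat.exists_eq_add_of_le (show m ≤ n by omega)
          rw [ih m hm' (by omega), hp, show i + 1 + (m + p) = i + 1 + m + p by ring,
            hk _ p (by omega)]
        rw [e3] at e1
        rw [show i + (n + 1) = i + 1 + n by ring]
        linear_combination e2 - e1
      · intro i hi
        rw [hQ i _ (le_of_max_le_left hi), hQ' i _ (le_of_max_le_right hi), eval_sub]
        congr <;> (push_cast; ring)
      · rw [eval_sub, hQr _ _ le_rfl (by omega), hQr' _ _ le_rfl (by omega), sub_zero]
  refine ⟨hX, fun j => ?_⟩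
  induction j using Nat.strong_induction_on with
  | _ j ih =>
    intro hj
    have e1 := h.row j
    have e2 := h'.row j
    have hX0 : ∀ n, n ≤ k → X 0 n = X' 0 n := fun n hn => by
      have := hX n hn 0
      rwa [Nat.zero_add] at this
    rw [Finset.sum_range_succ, Finset.sum_range_succ (fun k => b k * X k j), h.diag, hA.1] at e1
    rw [Finset.sum_range_succ, Finset.sum_range_succ (fun k => b' k * X' k j), h'.diag, hA'.1] at e2
    have e3 : ∑ m ∈ Finset.range (j + 1), X 0 m * A m j
        = ∑ m ∈ Finset.range (j + 1), X' 0 m * A' m j := by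
      refine Finset.sum_congr rfl fun m hm => ?_
      have hm' : m < j + 1 := by simpa using hm
      obtain ⟨p, rfl⟩ := Nat.exists_eq_add_of_le (show m ≤ j by omega)
      rw [hX0 m (by omega), hk _ p (by omega)]
    have e4 : ∑ m ∈ Finset.range j, b m * X m j = ∑ m ∈ Finset.range j, b' m * X' m j := by
      refine Finset.sum_congr rfl fun m hm => ?_
      have hm' : m < j := by simpa using hm
      obtain ⟨p, rfl⟩ := Nat.exists_eq_add_of_le (show m ≤ j by omega)
      rw [ih m hm' (by omega), hX p (by omega)]
    rw [e3, e4, hX0 j (by omega), hX0 (j + 1) (by omega)] at e1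
    linear_combination e2 - e1

end Gauge

/-! ### The algebra of matrices of complex size -/

section PolyMat

variable {R : Type} [CommRing R]

theorem IsPolyMat.of_rows {lam : R} {A : ℕ → ℕ → R} {N R₀ : ℕ} (hN : ∀ i j, j + N < i → A i j = 0)
    (hA : ∀ i j, R₀ ≤ i → A i j = 0) : IsPolyMat lam A :=
  ⟨N, R₀, 0, hN, fun i j h => by rw [hA i j h]; simp, fun n r _ _ => by simp⟩

theorem IsPolyMat.add {lam : R} {A B : ℕ → ℕ → R} (hA : IsPolyMat lam A) (hB : IsPolyMat lam B) :
    IsPolyMat lam (A + B) := by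
  obtain ⟨N, R₀, Q, h1, h2, h3⟩ := hA
  obtain ⟨N', R₀', Q', h1', h2', h3'⟩ := hB
  refine ⟨N + N', R₀ + R₀', Q + Q', fun i j h => ?_, fun i j h => ?_, fun n r h h' => ?_⟩
  · simp only [Pi.add_apply]
    rw [h1 i j (by omega), h1' i j (by omega), add_zero]
  · simp only [Pi.add_apply]
    rw [h2 i j (by omega), h2' i j (by omega), eval_add]
  · simp only [Pi.add_apply]
    rw [eval_add, h3 n r h h', h3' n r h h', add_zero]

/-- Additive maps that are linear over the parameter preserve the matrices of complex size. -/
theorem IsPolyMat.map {S : Type} [CommRing S] (φ : R →+ S) {lam : R} {lam' : S}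
    (hφ : ∀ x, φ (x * lam) = φ x * lam') {A : ℕ → ℕ → R} (hA : IsPolyMat lam A) :
    IsPolyMat lam' fun i j => φ (A i j) := by
  obtain ⟨N, R₀, Q, h1, h2, h3⟩ := hA
  choose Q' hQ' using fun n => exists_eval_eq_map φ (Q n)
  have hnat : ∀ (i : ℕ) x, φ (x * i) = φ x * i := fun i x => by
    rw [mul_comm, ← nsmul_eq_mul, map_nsmul, nsmul_eq_mul, mul_comm]
  have hint : ∀ (i : ℤ) x, φ (x * i) = φ x * i := fun i x => by
    rw [mul_comm, ← zsmul_eq_mul, map_zsmul, zsmul_eq_mul, mul_comm]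
  refine ⟨N, R₀, Q', fun i j h => ?_, fun i j h => ?_, fun n r h h' => ?_⟩
  · beta_reduce
    rw [h1 i j h, map_zero]
  · beta_reduce
    rw [h2 i j h, hQ' _ _ _ (hnat i)]
  · rw [hQ' n (lam - r) (lam' - r) (fun x => by rw [mul_sub, map_sub, hφ, hint, mul_sub]), h3 n r h h',
      map_zero]

theorem IsPolyMat.smul {lam : R} {A : ℕ → ℕ → R} (hA : IsPolyMat lam A) (c : R) :
    IsPolyMat lam fun i j => c * A i j :=
  hA.map (AddMonoidHom.mulLeft c) fun x => by simp [mul_assoc]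

theorem IsPolyMat.trunc {lam : R} {A : ℕ → ℕ → R} (hA : IsPolyMat lam A) (p : ℤ → Prop)
    [DecidablePred p] : IsPolyMat lam fun i j => if p ((j : ℤ) - i) then A i j else 0 := by
  obtain ⟨N, R₀, Q, h1, h2, h3⟩ := hA
  refine ⟨N, R₀, fun n => if p n then Q n else 0, fun i j h => ?_, fun i j h => ?_,
    fun n r h h' => ?_⟩
  · simp only []
    rw [h1 i j h, ite_self]
  · simp only []
    rw [h2 i j h]
    split_ifs <;> simp
  · simp only []
    split_ifs
    · exact h3 n r h h'
    · simp

/-- The matrix with constant entries on one of the diagonals below or on the main one. -/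
theorem isPolyMat_diag (lam : R) (Q : R[X]) {k : ℤ} (hk : k ≤ 0) :
    IsPolyMat lam fun i j : ℕ => if (j : ℤ) - i = k then Q.eval (i : R) else 0 := by
  refine ⟨k.natAbs, 0, fun n => if n = k then Q else 0, fun i j h => if_neg (by omega),
    fun i j _ => ?_, fun n r h h' => ?_⟩
  · beta_reduce
    split_ifs <;> simp
  · beta_reduce
    rw [if_neg (by omega), eval_zero]

end PolyMat

section Mul

variable {R : Type} [CommRing R]

theorem finsum_mul_eq_sum {A B : ℕ → ℕ → R} {M : ℕ} (hB : ∀ i j, j + M < i → B i j = 0)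
    (i k : ℕ) {n : ℕ} (hn : k + M < n) : ∑ᶠ j, A i j * B j k = ∑ j ∈ Finset.range n, A i j * B j k := by
  refine finsum_eq_sum_of_support_subset _ fun j hj => ?_
  simp only [Finset.coe_range, Set.mem_Iio]
  by_contra h
  exact hj (by simp only []; rw [hB j k (by omega), mul_zero])

theorem IsPolyMat.mul {lam : R} {A B : ℕ → ℕ → R} (hA : IsPolyMat lam A) (hB : IsPolyMat lam B) :
    IsPolyMat lam fun i k => ∑ᶠ j, A i j * B j k := by
  obtain ⟨N, R₁, Q, h1, h2, h3⟩ := hA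
  obtain ⟨M, R₂, Q', h1', h2', h3'⟩ := hB
  -- The summand N in the bound on exceptional rows ensures that every intermediate row j ≥ i - N is
  -- at least R₂. The zeros of the product at lam - r come from the first factor if r ≤ m and
  -- otherwise from the second, evaluated at lam - (r - m).
  refine ⟨N + M, R₁ + R₂ + N, fun n => ∑ m ∈ Finset.Icc (-N : ℤ) (n + M),
    Q m * (Q' (n - m)).comp (X + C (m : R)), fun i k h => ?_, fun i k h => ?_, fun n r h h' => ?_⟩
  · refine finsum_eq_zero_of_forall_eq_zero fun j => ?_
    rcases lt_or_ge (j + N) i with h | h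
    · rw [h1 i j h, zero_mul]
    · rw [h1' j k (by omega), mul_zero]
  · beta_reduce
    rw [finsum_mul_eq_sum h1' i k (n := k + M + 1) (by omega), eval_finsetSum]
    symm
    refine Finset.sum_bij_ne_zero (fun m _ _ => (i + m).toNat) ?_ ?_ ?_ ?_
    · intro m hm _
      simp only [Finset.mem_Icc, Finset.mem_range] at hm ⊢
      omega
    · intro m hm _ m' hm' _ h
      simp only [Finset.mem_Icc] at hm hm'
      omega
    · intro j hj hne
      have hj1 : i ≤ j + N := by
        by_contra h'
        exact hne (by rw [h1 i j (by omega), zero_mul])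
      refine ⟨(j : ℤ) - i, ?_, ?_, by omega⟩
      · simp only [Finset.mem_Icc, Finset.mem_range] at hj ⊢
        omega
      · rw [h2 i j (by omega), h2' j k (by omega)] at hne
        simp only [eval_mul, eval_comp, eval_add, eval_X, eval_C]
        convert hne using 4
        · push_cast; ring
        · ring
    · intro m hm _
      simp only [Finset.mem_Icc] at hm
      rw [h2 i _ (by omega), h2' _ k (by omega)]
      simp only [eval_mul, eval_comp, eval_add, eval_X, eval_C]
      have e : (((i : ℤ) + m).toNat : ℤ) = i + m := by omega
      have e' : ((((i : ℤ) + m).toNat : ℕ) : R) = i + m := by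
        rw [← Int.cast_natCast, e]; push_cast; rfl
      rw [e, e']
      congr 3
      · ring
      · ring
  · rw [eval_finsetSum]
    refine Finset.sum_eq_zero fun m _ => ?_
    simp only [eval_mul, eval_comp, eval_add, eval_X, eval_C]
    rcases le_or_gt r m with hm | hm
    · rw [h3 m r h hm, zero_mul]
    · rw [show lam - (r : R) + (m : R) = lam - ((r - m : ℤ) : R) by push_cast; ring,
        h3' _ _ (by omega) (by omega), mul_zero]

end Mul

/-! ### Specializations of the formal size -/

section Lift

variable {k : Type} [Field k] [CharZero k]

/-- Matrices of complex size are specializations of matrices that depend on a formal size. -/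
theorem IsPolyMat.exists_family {lam : k} {A : ℕ → ℕ → k} (h : IsPolyMat lam A) :
    ∃ At : ℕ → ℕ → k[X], ((∃ N : ℕ, ∀ i j, j + N < i → At i j = 0) ∧
      ∃ R : ℕ, (∃ Q : ℤ → k[X][X], ∀ i j : ℕ, R ≤ i →
        At i j = (Q ((j : ℤ) - (i : ℤ))).eval (i : k[X])) ∧
      (∀ i j μ : ℕ, R ≤ i → i < μ → μ ≤ j → (At i j).eval (μ : k) = 0)) ∧
      ∀ i j, A i j = (At i j).eval lam := by
  obtain ⟨N, R₀, Q, h1, h2, h3⟩ := h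
  -- The points lam - 1, …, lam - n are distinct in characteristic zero, so the prescribed zeros
  -- split off as linear factors.
  have hfac : ∀ n : ℕ, ∃ P : k[X], Q n = (∏ r ∈ Finset.range n,
      (X - C (lam - ((r : ℤ) + 1 : ℤ)))) * P := by
    intro n
    refine Finset.prod_dvd_of_coprime ?_ ?_
    · intro r _ r' _ hrr
      refine Polynomial.isCoprime_X_sub_C_of_isUnit_sub ?_
      refine IsUnit.mk0 _ fun h0 => hrr ?_
      have : ((r' : ℤ) : k) = ((r : ℤ) : k) := by
        push_cast at h0 ⊢
        linear_combination h0
      have := Int.cast_injective this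
      omega
    · intro r hr
      rw [Polynomial.dvd_iff_isRoot]
      exact h3 n _ (by omega) (by simp at hr; omega)
  choose P hP using hfac
  -- In the linear factors lam is replaced by the formal size t, giving factors i + r + 1 - t that
  -- vanish at t = i + 1, …, i + n; the cofactor stays independent of t.
  let F : ℤ → k[X][X] := fun n => if 0 ≤ n then ((P n.toNat).map C)
    * ∏ r ∈ Finset.range n.toNat, (X + C (C (((r : ℤ) + 1 : ℤ) : k) - X)) else (Q n).map C
  have hmap : ∀ (p : k[X]) (i : ℕ), (p.map C).eval (i : k[X]) = C (p.eval (i : k)) := by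
    intro p i
    rw [← Polynomial.C_eq_natCast, Polynomial.eval_map, Polynomial.eval₂_at_apply]
  refine ⟨fun i j => if i < R₀ then C (A i j) else (F ((j : ℤ) - i)).eval (i : k[X]),
    ⟨⟨N, fun i j h => ?_⟩, R₀, ⟨F, fun i j h => if_neg (by omega)⟩, fun i j μ h hμ hμ' => ?_⟩,
    fun i j => ?_⟩
  · beta_reduce
    split_ifs with hi
    · rw [h1 i j h, C_0]
    · simp only [F]
      rw [if_neg (by omega), hmap, ← h2 i j (by omega), h1 i j h, C_0]
  · beta_reduce
    rw [if_neg (by omega)]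
    simp only [F]
    rw [if_pos (by omega), eval_mul, eval_mul, eval_prod, eval_prod]
    refine mul_eq_zero_of_right _ (Finset.prod_eq_zero (i := μ - i - 1) ?_ ?_)
    · rw [Finset.mem_range]; omega
    · simp only [eval_add, eval_X, eval_C, eval_sub, eval_natCast]
      have : ((μ - i - 1 : ℕ) : ℤ) + 1 = μ - i := by omega
      rw [this]
      push_cast
      ring
  · beta_reduce
    split_ifs with hi
    · simp
    · simp only [F]
      split_ifs with hn
      · rw [h2 i j (by omega)]
        obtain ⟨n, hn'⟩ : ∃ n : ℕ, (j : ℤ) - i = n := ⟨((j : ℤ) - i).toNat, by omega⟩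
        rw [hn', hP n, Int.toNat_natCast, eval_mul, eval_mul, eval_mul, hmap, eval_C, mul_comm,
          eval_prod, eval_prod, eval_prod]
        congr 1
        refine Finset.prod_congr rfl fun r _ => ?_
        simp only [eval_add, eval_X, eval_C, eval_sub, eval_natCast]
        ring
      · rw [h2 i j (by omega), hmap, eval_C]

/-- The entry in row i on the n-th diagonal at size t = i + r vanishes for all large i. As a
polynomial in i it vanishes identically, in particular at i = lam - r, where the size is lam. -/
theorem isPolyMat_of_family {lam : k} {A : ℕ → ℕ → k} {At : ℕ → ℕ → k[X]} {N R₀ : ℕ}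
    {Q : ℤ → k[X][X]} (hN : ∀ i j, j + N < i → At i j = 0)
    (hQ : ∀ i j : ℕ, R₀ ≤ i → At i j = (Q ((j : ℤ) - (i : ℤ))).eval (i : k[X]))
    (hv : ∀ i j μ : ℕ, R₀ ≤ i → i < μ → μ ≤ j → (At i j).eval (μ : k) = 0)
    (hA : ∀ i j, A i j = (At i j).eval lam) : IsPolyMat lam A := by
  have hev : ∀ (n : ℤ) (i : ℕ) (a : k),
      ((Q n).map (evalRingHom a)).eval (i : k) = ((Q n).eval (i : k[X])).eval a := by
    intro n i a
    have := Polynomial.eval₂_at_apply (p := Q n) (evalRingHom a) (i : k[X])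
    rw [coe_evalRingHom, eval_natCast] at this
    rw [Polynomial.eval_map, this]
  refine ⟨N, R₀, fun n => (Q n).map (evalRingHom lam), fun i j h => ?_, fun i j h => ?_,
    fun n r h h' => ?_⟩
  · rw [hA, hN i j h, eval_zero]
  · rw [hA, hQ i j h, hev]
  · let G : k[X] := (Q n).eval₂ (compRingHom (X + C (r : k))) X
    have hG : ∀ a : k, G.eval a = ((Q n).map (evalRingHom (a + r))).eval a := by
      intro a
      have h := Polynomial.hom_eval₂ (Q n) (compRingHom (X + C (r : k))) (evalRingHom a) X
      rw [coe_evalRingHom, eval_X] at h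
      rw [Polynomial.eval_map]
      refine h.trans ?_
      congr 1
      ext
      · simp
      · simp
    have hG0 : G = 0 := by
      refine eq_of_eval_eventually (N := R₀) fun i hi => ?_
      have := hv i (i + n.toNat) (i + r.toNat) hi (by omega) (by omega)
      rw [hQ i _ hi, show ((i + n.toNat : ℕ) : ℤ) - i = n by omega] at this
      have e : (((i + r.toNat : ℕ) : ℤ) : k) = i + r := by
        rw [show ((i + r.toNat : ℕ) : ℤ) = i + r by omega]
        push_cast; rfl
      rw [Int.cast_natCast] at e
      rw [hG, eval_zero, ← this, hev, e]
    have := hG (lam - r)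
    rw [sub_add_cancel, hG0, eval_zero] at this
    exact this.symm

end Lift

/-! ### The trace of matrices of complex size -/

section Trace

variable {R : Type} [CommRing R] [IsDomain R] [CharZero R]

/-- The partial sums of the diagonal of `A` are eventually a polynomial, with the value `a`
at `lam`. -/
def HasTrace (lam : R) (A : ℕ → ℕ → R) (a : R) : Prop :=
  ∃ (P : R[X]) (N₀ : ℕ), (∀ N ≥ N₀, ∑ i ∈ Finset.range N, A i i = P.eval (N : R)) ∧ P.eval lam = a

theorem HasTrace.unique {lam : R} {A : ℕ → ℕ → R} {a b : R} (ha : HasTrace lam A a)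
    (hb : HasTrace lam A b) : a = b := by
  obtain ⟨P, N, h, rfl⟩ := ha
  obtain ⟨P', N', h', rfl⟩ := hb
  rw [eq_of_eval_eventually (p := P) (q := P') (N := max N N') fun i hi => by
    rw [← h i (le_of_max_le_left hi), ← h' i (le_of_max_le_right hi)]]

theorem HasTrace.add {lam : R} {A B : ℕ → ℕ → R} {a b : R} (ha : HasTrace lam A a)
    (hb : HasTrace lam B b) : HasTrace lam (A + B) (a + b) := by
  obtain ⟨P, N, h, rfl⟩ := ha
  obtain ⟨P', N', h', rfl⟩ := hb
  refine ⟨P + P', max N N', fun i hi => ?_, by rw [eval_add]⟩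
  rw [eval_add, ← h i (le_of_max_le_left hi), ← h' i (le_of_max_le_right hi),
    ← Finset.sum_add_distrib]
  rfl

theorem HasTrace.map (φ : R →+ R) {lam : R} (hφ : ∀ x, φ (x * lam) = φ x * lam) {A : ℕ → ℕ → R}
    {a : R} (ha : HasTrace lam A a) : HasTrace lam (fun i j => φ (A i j)) (φ a) := by
  obtain ⟨P, N, h, rfl⟩ := ha
  obtain ⟨P', hP'⟩ := exists_eval_eq_map φ P
  refine ⟨P', N, fun i hi => ?_, hP' _ _ hφ⟩
  rw [hP' i i fun x => by rw [mul_comm, ← nsmul_eq_mul, map_nsmul, nsmul_eq_mul, mul_comm],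
    ← h i hi, map_sum]

theorem IsPolyMat.exists_hasTrace [Algebra ℂ R] {lam : R} {A : ℕ → ℕ → R} (hA : IsPolyMat lam A) :
    ∃ a, HasTrace lam A a := by
  obtain ⟨N, R₀, Q, -, hQ, -⟩ := hA
  obtain ⟨U, hU⟩ := exists_antidifference ((Q 0).comp (X - 1))
  refine ⟨_, U + C (∑ i ∈ Finset.range R₀, A i i - U.eval (R₀ : R)), R₀, fun n hn => ?_, rfl⟩
  induction n, hn using Nat.le_induction with
  | base => rw [eval_add, eval_C]; ring
  | succ n hn ih =>
    have := congrArg (eval ((n : R) + 1)) hU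
    simp only [eval_sub, eval_comp, eval_X, eval_one, add_sub_cancel_right] at this
    rw [Finset.sum_range_succ, ih, hQ n n hn, sub_self, ← this]
    push_cast
    simp only [eval_add, eval_C]
    ring

/-- In the difference of the partial traces of AB and BA up to N the pairs of indices below N
cancel, and by bandedness only pairs i < N ≤ j near N remain. Their contribution is a polynomial in
N, and at N = lam each term contains an entry above the diagonal at a prescribed zero. -/
theorem HasTrace.mul_comm {lam : R} {A B : ℕ → ℕ → R} (hA : IsPolyMat lam A)
    (hB : IsPolyMat lam B) {a : R} (h : HasTrace lam (fun i k => ∑ᶠ j, A i j * B j k) a) :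
    HasTrace lam (fun i k => ∑ᶠ j, B i j * A j k) a := by
  obtain ⟨P, N₀, hP, rfl⟩ := h
  obtain ⟨M₁, R₁, Q, h1, h2, h3⟩ := hA
  obtain ⟨M₂, R₂, Q', h1', h2', h3'⟩ := hB
  set M := M₁ + M₂ + 1 with hM
  -- The boundary terms with i = N - M + s and j = N + t. At N = lam the row is lam - (M - s) with 1
  -- ≤ M - s ≤ M + t - s, which lies among the zeros of that diagonal.
  let W : R[X] := ∑ s ∈ Finset.range M, ∑ t ∈ Finset.range M,
    ((Q (M + t - s : ℤ)).comp (X - C (M : R) + C (s : R)) * (Q' (s - t - M : ℤ)).comp (X + C (t : R))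
      - (Q' (M + t - s : ℤ)).comp (X - C (M : R) + C (s : R))
        * (Q (s - t - M : ℤ)).comp (X + C (t : R)))
  refine ⟨P - W, N₀ + R₁ + R₂ + M, fun N hN => ?_, ?_⟩
  · obtain ⟨N', rfl⟩ : ∃ N', N = N' + M := ⟨N - M, by omega⟩
    rw [eval_sub, ← hP (N' + M) (by omega), eq_sub_iff_add_eq', ← eq_sub_iff_add_eq,
      ← Finset.sum_sub_distrib]
    have e : ∀ i ∈ Finset.range (N' + M), (∑ᶠ j, A i j * B j i) - (∑ᶠ j, B i j * A j i)
        = ∑ j ∈ Finset.range (N' + M), (A i j * B j i - B i j * A j i)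
          + ∑ t ∈ Finset.range M, (A i (N' + M + t) * B (N' + M + t) i
            - B i (N' + M + t) * A (N' + M + t) i) := by
      intro i hi
      have hi := Finset.mem_range.1 hi
      rw [finsum_mul_eq_sum h1' i i (n := N' + M + M) (by omega),
        finsum_mul_eq_sum h1 i i (n := N' + M + M) (by omega), ← Finset.sum_sub_distrib,
        Finset.sum_range_add]
    rw [Finset.sum_congr rfl e, Finset.sum_add_distrib]
    have e0 : ∑ i ∈ Finset.range (N' + M), ∑ j ∈ Finset.range (N' + M),
        (A i j * B j i - B i j * A j i) = 0 := by
      simp only [Finset.sum_sub_distrib]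
      rw [sub_eq_zero, Finset.sum_comm]
      exact Finset.sum_congr rfl fun _ _ => Finset.sum_congr rfl fun _ _ => _root_.mul_comm _ _
    rw [e0, zero_add, Finset.sum_range_add, Finset.sum_eq_zero, zero_add, eval_finsetSum]
    · refine Finset.sum_congr rfl fun s hs => ?_
      rw [eval_finsetSum]
      refine Finset.sum_congr rfl fun t ht => ?_
      have hs := Finset.mem_range.1 hs
      rw [h2 (N' + s) _ (by omega), h2' (N' + s) _ (by omega), h2 (N' + M + t) _ (by omega),
        h2' (N' + M + t) _ (by omega)]
      simp only [eval_sub, eval_mul, eval_comp, eval_add, eval_X, eval_C]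
      push_cast
      rw [show (N' : ℤ) + M + t - (N' + s) = M + t - s by ring,
        show (N' : ℤ) + s - (N' + M + t) = s - t - M by ring,
        show (N' : R) + M - M + s = N' + s by ring]
    · intro i hi
      have hi := Finset.mem_range.1 hi
      refine Finset.sum_eq_zero fun t _ => ?_
      rw [h1 (N' + M + t) i (by omega), h1' (N' + M + t) i (by omega)]
      simp
  · rw [eval_sub, sub_eq_self, eval_finsetSum]
    refine Finset.sum_eq_zero fun s hs => ?_
    rw [eval_finsetSum]
    refine Finset.sum_eq_zero fun t ht => ?_
    have hs := Finset.mem_range.1 hs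
    simp only [eval_sub, eval_mul, eval_comp, eval_add, eval_X, eval_C]
    rw [show lam - (M : R) + s = lam - ((M - s : ℤ) : R) by push_cast; ring,
      h3 _ _ (by omega) (by omega), h3' _ _ (by omega) (by omega)]
    simp

end Trace

/-! ### The extended algebra in terms of polynomial diagonals -/

section BarGl

theorem complexTrace_eq {lam : ℂ} {A : Matrix ℕ ℕ K} {a : K} (h : HasTrace (cst lam) A a) :
    complexTrace lam A = a := by
  have hex : ∃ P : Polynomial K, ∃ N₀ : ℕ, ∀ N ≥ N₀,
      ∑ i ∈ Finset.range N, A i i = P.eval (N : K) := by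
    obtain ⟨P, N, h, -⟩ := h
    exact ⟨P, N, h⟩
  rw [complexTrace, dif_pos hex]
  obtain ⟨N, hN⟩ := hex.choose_spec
  exact HasTrace.unique ⟨_, N, hN, rfl⟩ h

theorem mem_barGl {lam : ℂ} {A : Matrix ℕ ℕ K} :
    A ∈ (barGl lam).alg ↔ IsPolyMat (cst lam) A :=
  ⟨fun ⟨_, ⟨⟨_, hN⟩, _, ⟨_, hQ⟩, hv⟩, hA⟩ => isPolyMat_of_family hN hQ hv hA,
    fun h => h.exists_family⟩

end BarGl

/-! ### Trace identities in a ring with a derivation -/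

section TraceRing

variable {A : Type} [Ring A] (θ : A →+ A)

/-- The vector field `[x, S] + θ x`. -/
def gaugeField (S x : A) : A := x * S - S * x + θ x

variable {θ} (hθ : ∀ x y, θ (x * y) = θ x * y + x * θ y) {τ : A →+ ℂ}
  (hc : ∀ x y, τ (x * y) = τ (y * x)) (h0 : ∀ x, τ (θ x) = 0)
include hθ

/-- Gauge equivariance of the infinitesimal action, from θY = -Y (θX) Y for the inverse Y of X. -/
theorem gaugeField_conj {S S' X Y : A} (hXY : X * Y = 1) (hYX : Y * X = 1)
    (hS : X * S * Y + θ X * Y = S') (x : A) :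
    gaugeField θ S' (X * x * Y) = X * gaugeField θ S x * Y := by
  have h1 : θ 1 = 0 := by
    have := hθ 1 1
    simpa using this
  have hY : θ Y = -(Y * θ X * Y) := by
    have h := hθ X Y
    rw [hXY, h1] at h
    have : Y * (θ X * Y + X * θ Y) = 0 := by rw [← h, mul_zero]
    rw [mul_add, ← mul_assoc Y X, hYX, one_mul] at this
    rw [mul_assoc]
    exact eq_neg_of_add_eq_zero_right this
  have e1 : X * x * Y * S' = X * x * S * Y + X * x * Y * θ X * Y := by
    rw [← hS, mul_add]
    congr 1
    · rw [← mul_assoc, ← mul_assoc, mul_assoc (X * x) Y X, hYX, mul_one]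
    · rw [← mul_assoc]
  have e2 : S' * (X * x * Y) = X * S * x * Y + θ X * x * Y := by
    rw [← hS, add_mul]
    congr 1
    · rw [← mul_assoc, ← mul_assoc, mul_assoc (X * S) Y X, hYX, mul_one]
    · rw [← mul_assoc, ← mul_assoc, mul_assoc (θ X) Y X, hYX, mul_one]
  rw [gaugeField, gaugeField, e1, e2, hθ, hθ, hY]
  noncomm_ring

include hc h0

/-- The commutator part is antisymmetric by cyclicity and the part with θ because the trace of θ(xy)
is zero. This is the antisymmetry of the Kirillov–Kostant form. -/
theorem trace_gaugeField_mul (S x y : A) :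
    τ (gaugeField θ S x * y) = -τ (gaugeField θ S y * x) := by
  have h1 := h0 (x * y)
  rw [hθ, map_add, hc x] at h1
  have e1 : τ (x * S * y) = τ (S * y * x) := by rw [mul_assoc, hc]
  have e2 : τ (S * x * y) = τ (y * S * x) := by rw [hc, mul_assoc]
  simp only [gaugeField, add_mul, sub_mul, map_add, map_sub]
  rw [e1, e2]
  linear_combination h1

/-- The words in S, x, y, z cancel in the cyclic sum; the words with θ add up to the traces of
θ(xzy) and θ(xyz), which vanish. This is the algebraic content of the Jacobi identity. -/
theorem trace_gaugeField_cyclic (S x y z : A) :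
    τ ((y * gaugeField θ S x - gaugeField θ S x * y) * z)
      + τ ((z * gaugeField θ S y - gaugeField θ S y * z) * x)
      + τ ((x * gaugeField θ S z - gaugeField θ S z * x) * y) = 0 := by
  have key : ∀ x y z, τ ((y * gaugeField θ S x - gaugeField θ S x * y) * z)
      = τ (S * z * y * x) - τ (S * x * z * y) - τ (S * y * z * x) + τ (S * x * y * z)
        + τ (θ x * z * y) - τ (θ x * y * z) := by
    intro x y z
    have e1 : τ (y * x * S * z) = τ (S * z * y * x) := by
      rw [mul_assoc (y * x), hc, ← mul_assoc]
    have e2 : τ (y * S * x * z) = τ (S * x * z * y) := by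
      rw [mul_assoc, mul_assoc, hc, ← mul_assoc]
    have e3 : τ (x * S * y * z) = τ (S * y * z * x) := by
      rw [mul_assoc, mul_assoc, hc, ← mul_assoc]
    have e4 : τ (y * θ x * z) = τ (θ x * z * y) := by
      rw [mul_assoc, hc]
    simp only [gaugeField, add_mul, sub_mul, mul_add, mul_sub, map_add, map_sub, ← mul_assoc]
    rw [e1, e2, e3, e4]
    ring
  have c1 := h0 (x * z * y)
  have c2 := h0 (x * y * z)
  have r : ∀ a b c : A, τ (a * b * c) = τ (b * c * a) := fun a b c => by rw [mul_assoc, hc]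
  simp only [hθ, add_mul, map_add] at c1 c2
  rw [r x (θ z) y, ← r (θ y) x z] at c1
  rw [r x (θ y) z, ← r (θ z) x y] at c2
  rw [key, key, key]
  linear_combination c1 - c2

end TraceRing

/-! ### Products of column-finite matrices -/

section Mmul

variable {I : Type}

theorem mmul_eq_sum {A B : Matrix I I K} {i k : I} {s : Finset I} (hs : ∀ j, B j k ≠ 0 → j ∈ s) :
    mmul A B i k = ∑ j ∈ s, A i j * B j k := by
  refine finsum_eq_sum_of_support_subset _ fun j hj => hs j fun h => hj ?_
  simp only []
  rw [h, mul_zero]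

/-- Every column has finitely many nonzero entries. -/
def ColFinite (A : Matrix I I K) : Prop := ∀ j, {i | A i j ≠ 0}.Finite

theorem mmul_add {A B C : Matrix I I K} (hB : ColFinite B) (hC : ColFinite C) :
    mmul A (B + C) = mmul A B + mmul A C := by
  classical
  funext i k
  have h1 : ∀ j, B j k ≠ 0 → j ∈ (hB k).toFinset ∪ (hC k).toFinset := fun j h => by
    simp [h]
  have h2 : ∀ j, C j k ≠ 0 → j ∈ (hB k).toFinset ∪ (hC k).toFinset := fun j h => by
    simp [h]
  have h3 : ∀ j, (B + C) j k ≠ 0 → j ∈ (hB k).toFinset ∪ (hC k).toFinset := fun j h => by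
    by_contra hj
    simp only [Finset.mem_union, Set.Finite.mem_toFinset, Set.mem_ofPred_eq, not_or, not_not] at hj
    exact h (by simp [hj.1, hj.2])
  rw [mmul_eq_sum h3, Matrix.add_apply, mmul_eq_sum h1, mmul_eq_sum h2, ← Finset.sum_add_distrib]
  exact Finset.sum_congr rfl fun j _ => mul_add _ _ _

theorem add_mmul {A B C : Matrix I I K} (hC : ColFinite C) :
    mmul (A + B) C = mmul A C + mmul B C := by
  classical
  funext i k
  have h : ∀ j, C j k ≠ 0 → j ∈ (hC k).toFinset := fun j h => by simp [h]
  rw [mmul_eq_sum h, Matrix.add_apply, mmul_eq_sum h, mmul_eq_sum h, ← Finset.sum_add_distrib]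
  exact Finset.sum_congr rfl fun j _ => add_mul _ _ _

theorem mmul_assoc {A B C : Matrix I I K} (hB : ColFinite B) (hC : ColFinite C) :
    mmul (mmul A B) C = mmul A (mmul B C) := by
  classical
  funext i l
  set s := (hC l).toFinset with hs
  have h1 : ∀ k, C k l ≠ 0 → k ∈ s := fun k h => by simp [hs, h]
  set t := s.biUnion fun k => (hB k).toFinset with ht
  have h2 : ∀ k ∈ s, ∀ j, B j k ≠ 0 → j ∈ t := fun k hk j h =>
    Finset.mem_biUnion.2 ⟨k, hk, by simp [h]⟩
  have h3 : ∀ j, mmul B C j l ≠ 0 → j ∈ t := fun j h => by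
    rw [mmul_eq_sum h1] at h
    obtain ⟨k, hk, hne⟩ := Finset.exists_ne_zero_of_sum_ne_zero h
    exact h2 k hk j fun h0 => hne (by rw [h0, zero_mul])
  rw [mmul_eq_sum h1, mmul_eq_sum h3]
  have e1 : ∀ k ∈ s, mmul A B i k * C k l = ∑ j ∈ t, A i j * (B j k * C k l) := fun k hk => by
    rw [mmul_eq_sum (h2 k hk), Finset.sum_mul]
    exact Finset.sum_congr rfl fun j _ => mul_assoc _ _ _
  rw [Finset.sum_congr rfl e1, Finset.sum_comm]
  refine Finset.sum_congr rfl fun j _ => ?_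
  rw [mmul_eq_sum h1, Finset.mul_sum]

theorem mmul_one_eq (g : LoopModel I) (hg : Function.Injective g.idx) (A : Matrix I I K) :
    mmul A g.one = A := by
  classical
  funext i k
  rw [mmul_eq_sum (s := {k})]
  · simp [LoopModel.one]
  · intro j h
    by_contra hj
    refine h (if_neg fun h' => hj ?_)
    simp [hg h']

theorem one_mmul_eq (g : LoopModel I) (hg : Function.Injective g.idx) (A : Matrix I I K) :
    mmul g.one A = A := by
  classical
  funext i k
  rw [mmul, finsum_eq_single _ i]
  · simp [LoopModel.one]
  · intro j h
    rw [LoopModel.one, if_neg (fun h' => h (hg h').symm), zero_mul]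

theorem theta_mmul {A B : Matrix I I K} (hB : ColFinite B) :
    mzdz (mmul A B) = mmul (mzdz A) B + mmul A (mzdz B) := by
  classical
  funext i k
  have h : ∀ j, B j k ≠ 0 → j ∈ (hB k).toFinset := fun j h => by simp [h]
  have h' : ∀ j, (mzdz B) j k ≠ 0 → j ∈ (hB k).toFinset := fun j hj => h j fun h0 => hj (by
    simp [mzdz, h0])
  rw [Matrix.add_apply, mmul_eq_sum h, mmul_eq_sum h']
  simp only [mzdz, ← theta_eq]
  rw [mmul_eq_sum h, map_sum, ← Finset.sum_add_distrib]
  refine Finset.sum_congr rfl fun j _ => ?_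
  rw [(theta ℂ).leibniz, smul_eq_mul, smul_eq_mul]
  ring

end Mmul

/-! ### Loop algebras as rings with a derivation and a trace -/

namespace LoopModel

variable {I : Type}

/-- The properties of the loop algebras that are used in the Hamiltonian reduction. -/
class Nice (g : LoopModel I) : Prop where
  idx_injective : Function.Injective g.idx
  colFinite : ∀ A ∈ g.alg, ColFinite A
  add_mem : ∀ A ∈ g.alg, ∀ B ∈ g.alg, A + B ∈ g.alg
  smul_mem : ∀ A ∈ g.alg, ∀ c : K, (fun i j => c * A i j) ∈ g.alg
  mul_mem : ∀ A ∈ g.alg, ∀ B ∈ g.alg, mmul A B ∈ g.alg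
  theta_mem : ∀ A ∈ g.alg, mzdz A ∈ g.alg
  one_mem : g.one ∈ g.alg
  lowerShift_mem : g.lowerShift ∈ g.alg
  rows_mem : ∀ (k : ℕ) (A : Matrix I I K), (∀ i j, k ≤ g.idx i → A i j = 0) → A ∈ g.alg
  trunc_mem : ∀ A ∈ g.alg, ∀ (p : ℤ → Prop) [DecidablePred p],
    (fun i j => if p ((g.idx j : ℤ) - g.idx i) then A i j else 0) ∈ g.alg
  tr_add : ∀ A ∈ g.alg, ∀ B ∈ g.alg, g.tr (A + B) = g.tr A + g.tr B
  tr_smul : ∀ A ∈ g.alg, ∀ c : K, g.tr (fun i j => c * A i j) = c * g.tr A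
  tr_theta : ∀ A ∈ g.alg, g.tr (mzdz A) = theta ℂ (g.tr A)
  tr_mul_comm : ∀ A ∈ g.alg, ∀ B ∈ g.alg, g.tr (mmul A B) = g.tr (mmul B A)
  tr_eq_zero : ∀ A ∈ g.alg, (∀ i, A i i = 0) → g.tr A = 0
  tr_single : ∀ i a, ∀ A : Matrix I I K, A i i = a → (∀ j k, j ≠ i ∨ k ≠ i → A j k = 0) → g.tr A = a

variable (g : LoopModel I)

/-- The loop algebra as a type. -/
@[ext]
structure Alg : Type where
  mat : Matrix I I K
  mem : mat ∈ g.alg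

variable {g}

variable [hg : Nice g]

theorem neg_mem {A : Matrix I I K} (h : A ∈ g.alg) : -A ∈ g.alg := by
  have := Nice.smul_mem A h (-1)
  have e : (fun i j => (-1 : K) * A i j) = -A := by
    funext i j
    exact neg_one_mul (A i j)
  exact e ▸ this

instance : Zero g.Alg := ⟨⟨0, by
  have := Nice.smul_mem (g := g) _ Nice.one_mem 0
  have e : (fun i j => (0 : K) * g.one i j) = 0 := by
    funext i j
    exact zero_mul (g.one i j)
  exact e ▸ this⟩⟩
instance : One g.Alg := ⟨⟨g.one, Nice.one_mem⟩⟩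
instance : Add g.Alg := ⟨fun x y => ⟨x.1 + y.1, Nice.add_mem _ x.2 _ y.2⟩⟩
instance : Neg g.Alg := ⟨fun x => ⟨-x.1, neg_mem x.2⟩⟩
instance : Mul g.Alg := ⟨fun x y => ⟨mmul x.1 y.1, Nice.mul_mem _ x.2 _ y.2⟩⟩

theorem Alg.zero_mat : (0 : g.Alg).mat = 0 := rfl
theorem Alg.add_mat (x y : g.Alg) : (x + y).mat = x.mat + y.mat := rfl
theorem Alg.mul_mat (x y : g.Alg) : (x * y).mat = mmul x.mat y.mat := rfl

theorem Alg.colFinite (x : g.Alg) : ColFinite x.mat := Nice.colFinite _ x.2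

instance : Ring g.Alg where
  add_assoc x y z := Alg.ext (add_assoc x.mat y.mat z.mat)
  zero_add x := Alg.ext (zero_add x.mat)
  add_zero x := Alg.ext (add_zero x.mat)
  add_comm x y := Alg.ext (add_comm x.mat y.mat)
  neg_add_cancel x := Alg.ext (neg_add_cancel x.mat)
  left_distrib x y z := Alg.ext (mmul_add y.colFinite z.colFinite)
  right_distrib x y z := Alg.ext (add_mmul z.colFinite)
  zero_mul x := Alg.ext (by
    funext i j
    simp [Alg.mul_mat, Alg.zero_mat, mmul])
  mul_zero x := Alg.ext (by
    funext i j
    simp [Alg.mul_mat, Alg.zero_mat, mmul])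
  mul_assoc x y z := Alg.ext (mmul_assoc y.colFinite z.colFinite)
  one_mul x := Alg.ext (one_mmul_eq g Nice.idx_injective _)
  mul_one x := Alg.ext (mmul_one_eq g Nice.idx_injective _)
  nsmul := nsmulRec
  zsmul := zsmulRec

theorem Alg.sub_mat (x y : g.Alg) : (x - y).mat = x.mat - y.mat := by
  rw [sub_eq_add_neg, sub_eq_add_neg]; rfl

/-- The Euler derivation of the loop algebra. -/
def thetaAlg (g : LoopModel I) [Nice g] : g.Alg →+ g.Alg where
  toFun x := ⟨mzdz x.mat, Nice.theta_mem _ x.2⟩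
  map_zero' := Alg.ext (by
    funext i j
    show zpow 1 * dz 0 = 0
    simp)
  map_add' x y := Alg.ext (by
    funext i j
    show zpow 1 * dz (x.mat i j + y.mat i j) = zpow 1 * dz (x.mat i j) + zpow 1 * dz (y.mat i j)
    rw [map_add, mul_add])

theorem thetaAlg_mat (x : g.Alg) : (thetaAlg g x).mat = mzdz x.mat := rfl

theorem thetaAlg_apply (x : g.Alg) (i j : I) : (thetaAlg g x).mat i j = theta ℂ (x.mat i j) :=
  (theta_eq _).symm

theorem thetaAlg_mul (x y : g.Alg) :
    thetaAlg g (x * y) = thetaAlg g x * y + x * thetaAlg g y :=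
  Alg.ext (theta_mmul y.colFinite)

/-- The constant term of the trace. -/
def tau (g : LoopModel I) [Nice g] : g.Alg →+ ℂ where
  toFun x := (g.tr x.mat).coeff 0
  map_zero' := by
    rw [Nice.tr_eq_zero _ (0 : g.Alg).mem fun _ => rfl]
    rfl
  map_add' x y := by
    rw [Alg.add_mat, Nice.tr_add _ x.mem _ y.mem]
    rfl

theorem tau_apply (x : g.Alg) : tau g x = (g.tr x.mat).coeff 0 := rfl

theorem tau_mul_comm (x y : g.Alg) : tau g (x * y) = tau g (y * x) := by
  rw [tau_apply, tau_apply, Alg.mul_mat, Nice.tr_mul_comm _ x.mem _ y.mem]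
  rfl

theorem tau_theta (x : g.Alg) : tau g (thetaAlg g x) = 0 := by
  rw [tau_apply, thetaAlg_mat, Nice.tr_theta _ x.mem, theta_coeff]
  simp

theorem inner_eq_tau (x y : g.Alg) : g.inner x.mat y.mat = tau g (x * y) := by
  rw [inner, res_zpow_mul]
  rfl

/-- The vector field of the infinitesimal coadjoint action. -/
abbrev vec (S x : g.Alg) : g.Alg := gaugeField (thetaAlg g) S x

theorem tau_vec_mul (S x y : g.Alg) : tau g (vec S x * y) = -tau g (vec S y * x) :=
  trace_gaugeField_mul thetaAlg_mul tau_mul_comm tau_theta S x y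

/-- The factor z^(-1) in the inner product and in d/dz = z^(-1) θ turns residues into constant
terms. Moving A by cyclicity and θ by integration by parts gives the vector field form; the central
components of the differentials drop out. -/
theorem kirillovKostant_eq (A x y : g.Alg) (c c' : ℂ) :
    g.kirillovKostant (A.mat, 1) (x.mat, c) (y.mat, c') = -tau g (vec A x * y) := by
  have h1 : mmul x.mat y.mat - mmul y.mat x.mat = (x * y - y * x).mat := by
    rw [Alg.sub_mat]; rfl
  have h2 : mmul x.mat (mdz y.mat) = fun i j => zpow (-1) * (x * thetaAlg g y).mat i j := by
    funext i j
    obtain ⟨s, hs⟩ : ∃ s : Finset I, ∀ k, y.mat k j ≠ 0 → k ∈ s :=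
      ⟨(y.colFinite j).toFinset, fun k h => by simpa using h⟩
    rw [mmul_eq_sum (s := s) fun k hk => hs k fun h0 => hk (by simp [mdz, h0]), Alg.mul_mat, mmul_eq_sum (s := s) fun k hk => hs k fun h0 => hk (by
        rw [thetaAlg_apply, h0, map_zero]), Finset.mul_sum]
    refine Finset.sum_congr rfl fun k _ => ?_
    rw [thetaAlg_apply, theta_eq, mdz]
    have : zpow (-1) * zpow 1 = 1 := (DSReduction.zpow_add (-1) 1).trans DSReduction.zpow_zero
    linear_combination (-x.mat i k * dz (y.mat k j)) * this
  have h3 : g.cocycle x.mat y.mat = tau g (x * thetaAlg g y) := by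
    rw [cocycle, h2, Nice.tr_smul _ (x * thetaAlg g y).mem, res_zpow_mul]
    rfl
  rw [kirillovKostant, affPairing, affBracket]
  simp only []
  rw [h1, inner_eq_tau, h3, one_mul]
  have h4 := tau_theta (x * y)
  rw [thetaAlg_mul, map_add] at h4
  have e1 : tau g (x * A * y) = tau g (A * (y * x)) := by rw [mul_assoc, tau_mul_comm, mul_assoc]
  simp only [gaugeField, add_mul, sub_mul, mul_sub, map_add, map_sub]
  rw [e1, mul_assoc A]
  linear_combination h4

end LoopModel

/-- The pairing of tangent vectors and covectors of a product of copies of `ℂ((z))`. -/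
def pair {I : Type} (w q : I → K) : ℂ := (∑ᶠ j, w j * q j).coeff 0

theorem pair_eq_sum {I : Type} (w : I → K) {q : I → K} {s : Finset I} (hs : ∀ j, q j ≠ 0 → j ∈ s) :
    pair w q = ∑ j ∈ s, (w j * q j).coeff 0 := by
  rw [pair, finsum_eq_sum_of_support_subset (s := s), HahnSeries.coeff_sum]
  intro j hj
  refine hs j fun h => hj ?_
  simp only []
  rw [h, mul_zero]

/-- `q` is the differential at `b` of a function of a sequence of Laurent series. -/
def IsGrad {I : Type} (Φ : (I → K) → ℂ) (b q : I → K) : Prop :=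
  {j | q j ≠ 0}.Finite ∧ ∀ u : I → LaurentSeries ℂ[X], (∀ j, evL 0 (u j) = b j) →
    HasDerivAt (fun s : ℂ => Φ fun j => evL s (u j)) (pair (fun j => d0L (u j)) q) 0

/-! ### The momentum fiber, its orbits and differentials along it -/

namespace LoopModel

variable {I : Type} {g : LoopModel I} [hg : Nice g]

theorem Alg.mul_apply (x y : g.Alg) (i k : I) :
    (x * y).mat i k = ∑ᶠ j, x.mat i j * y.mat j k := rfl

theorem Alg.one_apply (i k : I) :
    (1 : g.Alg).mat i k = if g.idx i = g.idx k then 1 else 0 := rfl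

/-- Upper triangular elements of the loop algebra. -/
def Upper (x : g.Alg) : Prop := ∀ i j, g.idx j < g.idx i → x.mat i j = 0

/-- Strictly upper triangular elements of the loop algebra. -/
def Strict (x : g.Alg) : Prop := ∀ i j, g.idx j ≤ g.idx i → x.mat i j = 0

/-- Elements of the nilpotent loop group. -/
def Unip (x : g.Alg) : Prop := Strict (x - 1)

theorem Strict.upper {x : g.Alg} (h : Strict x) : Upper x := fun i j hij => h i j hij.le

theorem Upper.add {x y : g.Alg} (hx : Upper x) (hy : Upper y) : Upper (x + y) := fun i j h => by
  rw [Alg.add_mat, Matrix.add_apply, hx i j h, hy i j h, add_zero]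

theorem Strict.add {x y : g.Alg} (hx : Strict x) (hy : Strict y) : Strict (x + y) := fun i j h => by
  rw [Alg.add_mat, Matrix.add_apply, hx i j h, hy i j h, add_zero]

theorem Upper.mul {x y : g.Alg} (hx : Upper x) (hy : Upper y) : Upper (x * y) := fun i k h => by
  rw [Alg.mul_apply]
  refine finsum_eq_zero_of_forall_eq_zero fun j => ?_
  rcases lt_or_ge (g.idx j) (g.idx i) with h' | h'
  · rw [hx i j h', zero_mul]
  · rw [hy j k (by omega), mul_zero]

theorem Strict.mul_upper {x y : g.Alg} (hx : Strict x) (hy : Upper y) : Strict (x * y) := by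
  intro i k h
  rw [Alg.mul_apply]
  refine finsum_eq_zero_of_forall_eq_zero fun j => ?_
  rcases le_or_gt (g.idx j) (g.idx i) with h' | h'
  · rw [hx i j h', zero_mul]
  · rw [hy j k (by omega), mul_zero]

theorem Upper.mul_strict {x y : g.Alg} (hx : Upper x) (hy : Strict y) : Strict (x * y) := by
  intro i k h
  rw [Alg.mul_apply]
  refine finsum_eq_zero_of_forall_eq_zero fun j => ?_
  rcases lt_or_ge (g.idx j) (g.idx i) with h' | h'
  · rw [hx i j h', zero_mul]
  · rw [hy j k (by omega), mul_zero]

theorem Strict.theta {x : g.Alg} (hx : Strict x) : Strict (thetaAlg g x) := fun i j h => by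
  rw [thetaAlg_apply, hx i j h, map_zero]

theorem upper_one : Upper (1 : g.Alg) := fun i j h => by
  rw [Alg.one_apply, if_neg (by omega)]

theorem Unip.upper {x : g.Alg} (hx : Unip x) : Upper x := by
  have := (Strict.upper hx).add (upper_one (g := g))
  rwa [sub_add_cancel] at this

theorem unip_one : Unip (1 : g.Alg) := fun i j _ => by
  rw [sub_self, Alg.zero_mat]; rfl

theorem Unip.mul {x y : g.Alg} (hx : Unip x) (hy : Unip y) : Unip (x * y) := by
  have h : x * y - 1 = (x - 1) * y + (y - 1) := by noncomm_ring
  rw [Unip, h]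
  exact (hx.mul_upper hy.upper).add hy

theorem Strict.tau {x : g.Alg} (hx : Strict x) : tau g x = 0 := by
  rw [tau_apply, Nice.tr_eq_zero _ x.mem fun i => hx i i le_rfl]
  rfl

/-- The matrix whose only nonzero row is `w`, in the position `i`. -/
def rowAt (i : I) (w : I → K) : g.Alg :=
  ⟨open Classical in fun i' j => if i' = i then w j else 0, Nice.rows_mem (g.idx i + 1) _
    fun i' j h => if_neg fun e => by subst e; omega⟩

theorem rowAt_self (i : I) (w : I → K) (j : I) : (rowAt i w : g.Alg).mat i j = w j := if_pos rfl

theorem rowAt_ne {i i' : I} (h : i' ≠ i) (w : I → K) (j : I) :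
    (rowAt i w : g.Alg).mat i' j = 0 := if_neg h

/-- The product has a single nonzero row, and subtracting its diagonal entry leaves a matrix with
zero diagonal, hence zero trace. -/
theorem tau_rowAt_mul (i : I) (w : I → K) (x : g.Alg) :
    tau g (rowAt i w * x) = pair w fun j => x.mat j i := by
  classical
  set y : g.Alg := rowAt i w * x with hy
  set s : g.Alg := rowAt i (Pi.single i (y.mat i i)) with hs
  have hyi : y.mat i i = ∑ᶠ j, w j * x.mat j i := by
    rw [hy, Alg.mul_apply]
    simp only [rowAt_self]
  have hy' : ∀ j, j ≠ i → y.mat j j = 0 := fun j hj => by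
    rw [hy, Alg.mul_apply]
    simp only [rowAt_ne hj, zero_mul, finsum_zero]
  have h1 : g.tr s.mat = y.mat i i := by
    refine Nice.tr_single (g := g) i _ _ ?_ fun j k hjk => ?_
    · rw [hs, rowAt_self, Pi.single_eq_same]
    · by_cases hj : j = i
      · subst hj
        rw [hs, rowAt_self, Pi.single_eq_of_ne]
        simpa using hjk
      · rw [hs, rowAt_ne hj]
  have h2 : g.tr (y - s).mat = 0 := by
    refine Nice.tr_eq_zero (g := g) _ (y - s).mem fun j => ?_
    rw [Alg.sub_mat, Matrix.sub_apply]
    by_cases hj : j = i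
    · subst hj
      rw [hs, rowAt_self, Pi.single_eq_same, sub_self]
    · rw [hy' j hj, hs, rowAt_ne hj, sub_self]
  have h3 : tau g y = tau g s + tau g (y - s) := by rw [← map_add, add_sub_cancel]
  rw [h3, tau_apply, tau_apply, h1, h2, hyi, pair]
  simp

theorem pair_single [DecidableEq I] (j : I) (a : K) (q : I → K) :
    pair (Pi.single j a) q = (a * q j).coeff 0 := by
  rw [pair, finsum_eq_single _ j]
  · rw [Pi.single_eq_same]
  · intro i hi
    rw [Pi.single_eq_of_ne hi, zero_mul]

theorem coeff_zpow_mul (l : ℤ) (a : K) : (zpow l * a).coeff 0 = a.coeff (-l) := by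
  rw [zpow_mul_coeff, zero_sub]

/-- Test matrices with the single entry z^(-l) in the position (j, i) are upper triangular when j ≤
i, and they read off the l-th Laurent coefficient of the entry (i, j). -/
theorem strict_of_tau_eq_zero {x : g.Alg} (h : ∀ V : g.Alg, Upper V → tau g (V * x) = 0) :
    Strict x := by
  classical
  intro i j hij
  ext l
  have hV : Upper (rowAt j (Pi.single i (zpow (-l))) : g.Alg) := fun i' j' h' => by
    by_cases hi : i' = j
    · subst hi
      rw [rowAt_self, Pi.single_eq_of_ne]
      rintro rfl
      omega
    · rw [rowAt_ne hi]
  have := h _ hV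
  rw [tau_rowAt_mul, pair_single, coeff_zpow_mul, neg_neg] at this
  exact this

/-- Strictly upper triangular matrices with one monomial entry detect each coefficient below the
diagonal. Conversely, an upper triangular matrix times a strictly upper triangular one has zero
trace. -/
theorem mem_fiber_iff {A : Matrix I I K} :
    A ∈ g.fiber ↔ A ∈ g.alg ∧ ∀ i j, g.idx j < g.idx i → A i j = g.lowerShift i j := by
  classical
  constructor
  · rintro ⟨hA, h⟩
    refine ⟨hA, fun i j hij => ?_⟩
    ext l
    set Y : g.Alg := rowAt j (Pi.single i (zpow (-l))) with hY
    have hYs : Strict Y := fun i' j' h' => by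
      by_cases hi : i' = j
      · subst hi
        rw [hY, rowAt_self, Pi.single_eq_of_ne]
        rintro rfl
        omega
      · rw [hY, rowAt_ne hi]
    have := congrFun h ⟨Y.mat, Y.mem, hYs⟩
    simp only [momentum, affPairing, mul_zero, add_zero] at this
    have e1 : g.inner A Y.mat = tau g (Y * ⟨A, hA⟩) := by
      rw [tau_mul_comm, ← inner_eq_tau]
    have e2 : g.inner g.lowerShift Y.mat = tau g (Y * ⟨g.lowerShift, Nice.lowerShift_mem⟩) := by
      rw [tau_mul_comm, ← inner_eq_tau]
    rw [e1, e2, tau_rowAt_mul, tau_rowAt_mul, pair_single, pair_single, coeff_zpow_mul,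
      coeff_zpow_mul, neg_neg] at this
    exact this
  · rintro ⟨hA, h⟩
    refine ⟨hA, funext fun Y => ?_⟩
    set x : g.Alg := ⟨A, hA⟩ with hx
    set f : g.Alg := ⟨g.lowerShift, Nice.lowerShift_mem⟩ with hf
    set y : g.Alg := ⟨Y, Y.2.1⟩ with hy
    have hys : Strict y := Y.2.2
    have hxf : Upper (x - f) := fun i j hij => by
      rw [Alg.sub_mat, Matrix.sub_apply]
      exact sub_eq_zero.2 (h i j hij)
    simp only [momentum, affPairing, mul_zero, add_zero]
    have := (hxf.mul_strict hys).tau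
    rw [sub_mul, map_sub, sub_eq_zero, ← inner_eq_tau, ← inner_eq_tau] at this
    exact this

/-- A point of the fiber as an element of the loop algebra. -/
def toAlg (A : g.fiber) : g.Alg := ⟨A, A.2.1⟩

theorem toAlg_mat (A : g.fiber) : (toAlg A).mat = A := rfl

theorem exists_fiber {A : g.fiber} {B : g.Alg} (h : Upper (B - toAlg A)) :
    ∃ B' : g.fiber, toAlg B' = B := by
  refine ⟨⟨B.mat, mem_fiber_iff.2 ⟨B.mem, fun i j hij => ?_⟩⟩, rfl⟩
  have h1 := h i j hij
  rw [Alg.sub_mat, Matrix.sub_apply, sub_eq_zero] at h1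
  rw [h1]
  exact (mem_fiber_iff.1 A.2).2 i j hij

/-- The gauge action of the nilpotent loop group. -/
def IsGaugeEq (A B X Y : g.Alg) : Prop :=
  Unip X ∧ Unip Y ∧ X * Y = 1 ∧ Y * X = 1 ∧ X * A * Y + thetaAlg g X * Y = B

theorem sameOrbit_iff {A B : g.fiber} :
    g.SameOrbit A B ↔ ∃ X Y : g.Alg, IsGaugeEq (toAlg A) (toAlg B) X Y := by
  have hmem : ∀ X ∈ g.unip, X ∈ g.alg := fun X hX => by
    have := Nice.add_mem _ hX.1 _ (Nice.one_mem (g := g))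
    rwa [sub_add_cancel] at this
  have hsub : ∀ x : g.Alg, x.mat - g.one = (x - 1).mat := fun x => by
    rw [Alg.sub_mat]; rfl
  have hco : ∀ X Y : g.Alg, coadjoint X.mat Y.mat ((A : Matrix I I K), 1)
      = ((X * toAlg A * Y + thetaAlg g X * Y).mat, 1) := fun X Y => by
    rw [coadjoint, Alg.add_mat]
    simp only [one_smul]
    rfl
  constructor
  · rintro ⟨X, hX, Y, hY, h1, h2, h3⟩
    set x : g.Alg := ⟨X, hmem X hX⟩ with hx
    set y : g.Alg := ⟨Y, hmem Y hY⟩ with hy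
    refine ⟨x, y, ?_, ?_, Alg.ext h1, Alg.ext h2, Alg.ext ?_⟩
    · have h := hX.2
      intro i j hij
      rw [← hsub]
      exact h i j hij
    · have h := hY.2
      intro i j hij
      rw [← hsub]
      exact h i j hij
    · have := (hco x y).symm.trans h3
      exact congrArg Prod.fst this
  · rintro ⟨X, Y, hX, hY, h1, h2, h3⟩
    refine ⟨X.mat, ⟨?_, ?_⟩, Y.mat, ⟨?_, ?_⟩, congrArg Alg.mat h1, congrArg Alg.mat h2, ?_⟩
    · rw [hsub]; exact (X - 1).mem
    · rw [hsub]; exact hX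
    · rw [hsub]; exact (Y - 1).mem
    · rw [hsub]; exact hY
    · rw [hco, h3]; rfl

theorem theta_inv {X Y : g.Alg} (hXY : X * Y = 1) (hYX : Y * X = 1) :
    thetaAlg g Y = -(Y * thetaAlg g X * Y) := by
  have h1 : thetaAlg g (1 : g.Alg) = 0 := by
    have := thetaAlg_mul (1 : g.Alg) 1
    simpa using this
  have h := thetaAlg_mul X Y
  rw [hXY, h1] at h
  have : Y * (thetaAlg g X * Y + X * thetaAlg g Y) = 0 := by rw [← h, mul_zero]
  rw [mul_add, ← mul_assoc Y X, hYX, one_mul] at this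
  rw [mul_assoc]
  exact eq_neg_of_add_eq_zero_right this

theorem IsGaugeEq.symm {A B X Y : g.Alg} (h : IsGaugeEq A B X Y) : IsGaugeEq B A Y X := by
  obtain ⟨hX, hY, h1, h2, rfl⟩ := h
  refine ⟨hY, hX, h2, h1, ?_⟩
  rw [theta_inv h1 h2]
  have e1 : Y * (X * A * Y + thetaAlg g X * Y) * X
      = (Y * X) * A * (Y * X) + Y * thetaAlg g X * (Y * X) := by noncomm_ring
  have e2 : -(Y * thetaAlg g X * Y) * X = -(Y * thetaAlg g X * (Y * X)) := by noncomm_ring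
  rw [e1, e2, h2]
  simp

theorem IsGaugeEq.trans {A B C X Y X' Y' : g.Alg} (h : IsGaugeEq A B X Y)
    (h' : IsGaugeEq B C X' Y') : IsGaugeEq A C (X' * X) (Y * Y') := by
  obtain ⟨hX, hY, h1, h2, rfl⟩ := h
  obtain ⟨hX', hY', h1', h2', rfl⟩ := h'
  refine ⟨hX'.mul hX, hY.mul hY', ?_, ?_, ?_⟩
  · rw [mul_assoc, ← mul_assoc X, h1, one_mul, h1']
  · rw [mul_assoc, ← mul_assoc Y', h2', one_mul, h2]
  · have : thetaAlg g (X' * X) * (Y * Y')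
        = thetaAlg g X' * (X * Y) * Y' + X' * (thetaAlg g X * Y) * Y' := by
      rw [thetaAlg_mul]; noncomm_ring
    rw [this, h1]
    noncomm_ring

theorem isGaugeEq_refl (A : g.Alg) : IsGaugeEq A A 1 1 := by
  refine ⟨unip_one, unip_one, one_mul _, one_mul _, ?_⟩
  have h1 : thetaAlg g (1 : g.Alg) = 0 := by
    have := thetaAlg_mul (1 : g.Alg) 1
    simpa using this
  rw [h1]
  simp

theorem sameOrbit_equivalence : Equivalence g.SameOrbit where
  refl A := sameOrbit_iff.2 ⟨1, 1, isGaugeEq_refl _⟩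
  symm h := by
    obtain ⟨X, Y, h⟩ := sameOrbit_iff.1 h
    exact sameOrbit_iff.2 ⟨Y, X, h.symm⟩
  trans h h' := by
    obtain ⟨X, Y, h⟩ := sameOrbit_iff.1 h
    obtain ⟨X', Y', h'⟩ := sameOrbit_iff.1 h'
    exact sameOrbit_iff.2 ⟨_, _, h.trans h'⟩

theorem proj_eq_iff {A B : g.fiber} :
    g.proj A = g.proj B ↔ ∃ X Y : g.Alg, IsGaugeEq (toAlg A) (toAlg B) X Y := by
  rw [← sameOrbit_iff]
  refine ⟨fun h => ?_, fun h => Quot.sound h⟩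
  exact sameOrbit_equivalence.eqvGen_iff.1 (Quot.eqvGen_exact h)

/-- `x` represents the differential along the fiber of an invariant function. -/
def IsFiberDiff (F : g.Reduced → ℂ) (A : g.fiber) (x : g.Alg) : Prop :=
  ∀ V : g.Alg, Upper V → ∀ φ : ℂ → g.fiber,
    (∀ s, (φ s : Matrix I I K) = (A : Matrix I I K) + s • V.mat) →
      HasDerivAt (fun s => F (g.proj (φ s))) (tau g (V * x)) 0

/-- Multiples by complex numbers. -/
def csmul (s : ℂ) (V : g.Alg) : g.Alg := ⟨fun i j => cst s * V.mat i j, Nice.smul_mem _ V.mem _⟩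

theorem csmul_mat (s : ℂ) (V : g.Alg) : (csmul s V).mat = s • V.mat := by
  funext i j
  exact (smul_eq_cst_mul s (V.mat i j)).symm

theorem mul_csmul_mul (s : ℂ) (X V Y : g.Alg) : X * csmul s V * Y = csmul s (X * V * Y) := by
  refine Alg.ext ?_
  funext i j
  show (X * csmul s V * Y).mat i j = cst s * (X * V * Y).mat i j
  have h : ∀ (i k : I), (X * csmul s V).mat i k = cst s * (X * V).mat i k := fun i k => by
    obtain ⟨t, ht⟩ : ∃ t : Finset I, ∀ j, V.mat j k ≠ 0 → j ∈ t :=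
      ⟨(V.colFinite k).toFinset, fun j h => by simpa using h⟩
    rw [Alg.mul_mat, Alg.mul_mat, mmul_eq_sum ht, mmul_eq_sum (s := t), Finset.mul_sum]
    · refine Finset.sum_congr rfl fun j _ => ?_
      show X.mat i j * (cst s * V.mat j k) = cst s * (X.mat i j * V.mat j k)
      ring
    · intro j hj
      refine ht j fun h0 => hj ?_
      show cst s * V.mat j k = 0
      rw [h0, mul_zero]
  obtain ⟨t, ht⟩ : ∃ t : Finset I, ∀ k, Y.mat k j ≠ 0 → k ∈ t :=
    ⟨(Y.colFinite j).toFinset, fun j h => by simpa using h⟩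
  rw [Alg.mul_mat (X * csmul s V), Alg.mul_mat (X * V), mmul_eq_sum ht, mmul_eq_sum ht,
    Finset.mul_sum]
  refine Finset.sum_congr rfl fun k _ => ?_
  rw [h, mul_assoc]

theorem Upper.csmul {V : g.Alg} (hV : Upper V) (s : ℂ) : Upper (csmul s V) := fun i j h => by
  show cst s * V.mat i j = 0
  rw [hV i j h, mul_zero]

theorem exists_line (A : g.fiber) {V : g.Alg} (hV : Upper V) :
    ∃ φ : ℂ → g.fiber, ∀ s, toAlg (φ s) = toAlg A + LoopModel.csmul s V := by
  choose φ hφ using fun s => exists_fiber (A := A) (B := toAlg A + LoopModel.csmul s V) (by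
    rw [add_sub_cancel_left]
    exact hV.csmul s)
  exact ⟨φ, hφ⟩

theorem line_mat {A B : g.fiber} {V : g.Alg} {s : ℂ} :
    (B : Matrix I I K) = (A : Matrix I I K) + s • V.mat ↔ toAlg B = toAlg A + LoopModel.csmul s V := by
  rw [← csmul_mat]
  exact ⟨fun h => Alg.ext h, fun h => congrArg Alg.mat h⟩

/-- The tangent space of the fiber consists of the upper triangular matrices, whose annihilator
under the trace form is the strictly upper triangular ones. -/
theorem IsFiberDiff.strict_sub {F : g.Reduced → ℂ} {A : g.fiber} {x y : g.Alg}
    (hx : IsFiberDiff F A x) (hy : IsFiberDiff F A y) : Strict (x - y) := by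
  refine strict_of_tau_eq_zero fun V hV => ?_
  obtain ⟨φ, hφ⟩ := exists_line A hV
  have := (hx V hV φ fun s => line_mat.2 (hφ s)).unique (hy V hV φ fun s => line_mat.2 (hφ s))
  rw [mul_sub, map_sub, this, sub_self]

/-- The gauge action is affine, so it carries the line A + sV to the line B + s XVY, on which the
invariant function takes the same values. -/
theorem IsFiberDiff.conj {F : g.Reduced → ℂ} {A B : g.fiber} {x X Y : g.Alg}
    (h : IsGaugeEq (toAlg A) (toAlg B) X Y) (hx : IsFiberDiff F B x) :
    IsFiberDiff F A (Y * x * X) := by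
  intro V hV φ hφ
  have hX := h.1
  have hY := h.2.1
  have hW : Upper (X * V * Y) := (hX.upper.mul hV).mul hY.upper
  obtain ⟨ψ, hψ⟩ := exists_line B hW
  have e : ∀ s, g.proj (φ s) = g.proj (ψ s) := fun s => by
    refine proj_eq_iff.2 ⟨X, Y, hX, hY, h.2.2.1, h.2.2.2.1, ?_⟩
    rw [line_mat.1 (hφ s), hψ s, ← h.2.2.2.2, ← mul_csmul_mul]
    noncomm_ring
  simp only [e]
  have h1 := hx _ hW ψ fun s => line_mat.2 (hψ s)
  have h2 : tau g (X * V * Y * x) = tau g (V * (Y * x * X)) := by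
    rw [mul_assoc, mul_assoc, tau_mul_comm, ← mul_assoc, ← mul_assoc]
    congr 1
    noncomm_ring
  rwa [h2] at h1

/-- The orbit directions are tangent to the fiber: commuting a strictly upper triangular matrix with
a Hessenberg one produces nothing below the diagonal. -/
theorem vec_upper_of_strict (A : g.fiber) {n : g.Alg} (hn : Strict n) : Upper (vec (toAlg A) n) := by
  have hA := (mem_fiber_iff.1 A.2).2
  have h1 : Upper (n * toAlg A) := fun i k h => by
    rw [Alg.mul_apply]
    refine finsum_eq_zero_of_forall_eq_zero fun j => ?_
    rcases le_or_gt (g.idx j) (g.idx i) with h' | h'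
    · rw [hn i j h', zero_mul]
    · rw [toAlg_mat, hA j k (by omega), lowerShift, if_neg (by omega), mul_zero]
  have h2 : Upper (toAlg A * n) := fun i k h => by
    rw [Alg.mul_apply]
    refine finsum_eq_zero_of_forall_eq_zero fun j => ?_
    rcases le_or_gt (g.idx k) (g.idx j) with h' | h'
    · rw [hn j k h', mul_zero]
    · rw [toAlg_mat, hA i j (by omega), lowerShift, if_neg (by omega), zero_mul]
  intro i j h
  rw [vec, gaugeField, Alg.add_mat, Alg.sub_mat, Matrix.add_apply, Matrix.sub_apply, h1 i j h,
    h2 i j h, hn.theta.upper i j h]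
  simp

/-- The Kirillov--Kostant bracket of invariant functions does not depend on the choice of the
representatives of the differentials along the fiber. -/
theorem tau_vec_eq {A : g.fiber} {x x' y y' : g.Alg} (hx : Strict (x' - x)) (hy : Strict (y' - y))
    (hvx : Upper (vec (toAlg A) x)) (hvy : Upper (vec (toAlg A) y)) :
    tau g (vec (toAlg A) x' * y') = tau g (vec (toAlg A) x * y) := by
  set S := toAlg A
  have hadd : ∀ a b, vec S (a + b) = vec S a + vec S b := fun a b => by
    simp only [vec, gaugeField, map_add]
    noncomm_ring
  have e1 : x' = x + (x' - x) := by abel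
  have e2 : y' = y + (y' - y) := by abel
  rw [e1, e2, hadd, add_mul, mul_add, mul_add, map_add, map_add, map_add,
    (hvx.mul_strict hy).tau, ((vec_upper_of_strict A hx).mul_strict hy).tau, tau_vec_mul S (x' - x) y,
    (hvy.mul_strict hx).tau]
  simp

end LoopModel

/-! ### Hamiltonian reduction along a slice -/

namespace LoopModel

variable {I : Type}

/-- A slice of the action of the nilpotent loop group on the fiber. -/
structure SliceData (g : LoopModel I) [Nice g] where
  base : I
  idx_base : g.idx base = 0
  S : (I → K) → g.fiber
  β : g.Reduced ≃ (I → K)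
  β_proj : ∀ b, β (g.proj (S b)) = b
  -- A line through a point of the slice, projected back to the slice, is a polynomial family of
  -- Laurent series, and its velocity differs from V by an orbit direction.
  curve : ∀ (b : I → K) (V : g.Alg), Upper V → ∃ u : I → LaurentSeries ℂ[X],
    (∀ (s : ℂ) (B : g.fiber), toAlg B = toAlg (S b) + csmul s V →
      ∀ j, β (g.proj B) j = evL s (u j)) ∧
    ∃ n : g.Alg, Strict n ∧ V + vec (toAlg (S b)) n = rowAt base fun j => d0L (u j)
  -- Every finitely supported covector is the base column of some matrix whose vector field is
  -- tangent to the slice.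
  ham : ∀ b q : I → K, {j | q j ≠ 0}.Finite → ∃ (x : g.Alg) (w : I → K),
    (∀ i, x.mat i base = q i) ∧ vec (toAlg (S b)) x = rowAt base w

variable {g : LoopModel I} [hg : Nice g] (D : SliceData g)

theorem SliceData.upper_row (w : I → K) : Upper (rowAt D.base w : g.Alg) := fun i j h => by
  refine rowAt_ne ?_ w j
  rintro rfl
  rw [D.idx_base] at h
  omega

/-- `x` and `w` are Hamiltonian data for a function with the differential `q` at the point `b`
of the slice. -/
def SliceData.Ham (b q : I → K) (x : g.Alg) (w : I → K) : Prop :=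
  (∀ i, x.mat i D.base = q i) ∧ vec (toAlg (D.S b)) x = rowAt D.base w

variable {D}

theorem SliceData.Ham.tau {b q r w w' : I → K} {x y : g.Alg} (hx : D.Ham b q x w)
    (hy : D.Ham b r y w') : LoopModel.tau g (vec (toAlg (D.S b)) x * y) = pair w r := by
  rw [hx.2, tau_rowAt_mul]
  simp only [hy.1]

theorem csmul_zero (V : g.Alg) : csmul 0 V = 0 := by
  refine Alg.ext ?_
  funext i j
  show cst 0 * V.mat i j = 0
  simp [cst]

/-- The direction V is the velocity along the slice minus an orbit direction. The first pairs with x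
through its base column, which is the differential of F. The second pairs to zero, because by
antisymmetry it is the trace of the row of w times a strictly upper triangular matrix. -/
theorem SliceData.isFiberDiff {F : g.Reduced → ℂ} {b q w : I → K} {x : g.Alg}
    (hF : IsGrad (F ∘ D.β.symm) b q) (hx : D.Ham b q x w) : IsFiberDiff F (D.S b) x := by
  intro V hV φ hφ
  obtain ⟨u, hu, n, hn, hun⟩ := D.curve b V hV
  have h0 : ∀ j, evL 0 (u j) = b j := fun j => by
    rw [← hu 0 (D.S b) (by rw [csmul_zero, add_zero]) j, D.β_proj]
  have h1 := hF.2 u h0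
  have e1 : (fun s : ℂ => (F ∘ D.β.symm) fun j => evL s (u j)) = fun s => F (g.proj (φ s)) := by
    funext s
    have : (fun j => evL s (u j)) = D.β (g.proj (φ s)) := by
      funext j
      exact (hu s (φ s) (line_mat.1 (hφ s)) j).symm
    rw [this, Function.comp_apply, Equiv.symm_apply_apply]
  rw [e1] at h1
  convert h1 using 1
  have e2 : V = rowAt D.base (fun j => d0L (u j)) - vec (toAlg (D.S b)) n := by
    rw [← hun, add_sub_cancel_right]
  rw [e2, sub_mul, map_sub, tau_rowAt_mul, tau_vec_mul, hx.2,
    ((D.upper_row w).mul_strict hn).tau]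
  simp only [hx.1]
  simp

/-- The slice is reached from any point of the fiber. -/
theorem SliceData.exists_isGaugeEq (A : g.fiber) :
    ∃ X Y : g.Alg, IsGaugeEq (toAlg A) (toAlg (D.S (D.β (g.proj A)))) X Y := by
  refine proj_eq_iff.1 (D.β.injective ?_)
  rw [D.β_proj]

/-- Conjugation carries the Hamiltonian data from the slice to any point of the orbit. The resulting
representative has an upper triangular vector field, as `tau_vec_eq` requires. -/
theorem SliceData.exists_canonical {F : g.Reduced → ℂ} {A : g.fiber} {q w : I → K} {x X Y : g.Alg}
    (hF : IsGrad (F ∘ D.β.symm) (D.β (g.proj A)) q) (hx : D.Ham (D.β (g.proj A)) q x w)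
    (h : IsGaugeEq (toAlg A) (toAlg (D.S (D.β (g.proj A)))) X Y) :
    IsFiberDiff F A (Y * x * X) ∧ Upper (vec (toAlg A) (Y * x * X)) ∧
      vec (toAlg A) (Y * x * X) = Y * rowAt D.base w * X := by
  have h2 : vec (toAlg A) (Y * x * X) = Y * rowAt D.base w * X := by
    rw [← hx.2]
    exact gaugeField_conj thetaAlg_mul h.2.2.2.1 h.2.2.1 h.symm.2.2.2.2 x
  refine ⟨(SliceData.isFiberDiff hF hx).conj h, ?_, h2⟩
  rw [h2]
  exact (h.2.1.upper.mul (D.upper_row w)).mul h.1.upper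

/-- Arbitrary representatives may be replaced by the conjugates of the Hamiltonian data on the
slice, and then the conjugating elements cancel under the trace. -/
theorem SliceData.tau_vec_isFiberDiff {F G : g.Reduced → ℂ} {A : g.fiber} {x y : g.Alg}
    (hx : IsFiberDiff F A x) (hy : IsFiberDiff G A y) {q r w : I → K} {x₀ : g.Alg}
    (hF : IsGrad (F ∘ D.β.symm) (D.β (g.proj A)) q)
    (hG : IsGrad (G ∘ D.β.symm) (D.β (g.proj A)) r) (hx₀ : D.Ham (D.β (g.proj A)) q x₀ w) :
    LoopModel.tau g (vec (toAlg A) x * y) = pair w r := by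
  obtain ⟨y₀, w', hy₀⟩ := D.ham (D.β (g.proj A)) r hG.1
  obtain ⟨X, Y, h⟩ := D.exists_isGaugeEq A
  obtain ⟨h1, h2, h3⟩ := D.exists_canonical hF hx₀ h
  obtain ⟨h1', h2', h3'⟩ := D.exists_canonical hG hy₀ h
  rw [tau_vec_eq (hx.strict_sub h1) (hy.strict_sub h1') h2 h2', h3, ← SliceData.Ham.tau hx₀ hy₀,
    hx₀.2]
  have e : Y * rowAt D.base w * X * (Y * y₀ * X) = Y * (rowAt D.base w * ((X * Y) * y₀ * X)) := by
    noncomm_ring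
  rw [e, h.2.2.1, one_mul, tau_mul_comm]
  congr 1
  rw [← mul_assoc, mul_assoc _ X Y, h.2.2.1, mul_one]

theorem isFiberDiff_of_isDifferentialAt {F : g.Reduced → ℂ} {Ft : Matrix I I K × ℂ → ℂ}
    (h : g.IsContinuation F Ft) {A : g.fiber} {x : Matrix I I K × ℂ}
    (hx : g.IsDifferentialAt Ft ((A : Matrix I I K), 1) x) : IsFiberDiff F A ⟨x.1, hx.1⟩ := by
  intro V hV φ hφ
  have h1 := hx.2 (V.mat, 0) V.mem
  have e1 : (fun s : ℂ => Ft (((A : Matrix I I K), 1) + s • (V.mat, (0 : ℂ))))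
      = fun s => F (g.proj (φ s)) := by
    funext s
    rw [← h.2, hφ s]
    congr 1
    refine Prod.ext rfl ?_
    show (1 : ℂ) + s * 0 = 1
    ring
  rw [e1] at h1
  convert h1 using 1
  rw [affPairing, zero_mul, add_zero]
  exact (inner_eq_tau V ⟨x.1, hx.1⟩).symm

/-- The part of a matrix on some of the diagonals. -/
def trunc (p : ℤ → Prop) [DecidablePred p] (A : g.Alg) : g.Alg :=
  ⟨fun i j => if p ((g.idx j : ℤ) - g.idx i) then A.mat i j else 0, Nice.trunc_mem _ A.mem p⟩

theorem trunc_apply (p : ℤ → Prop) [DecidablePred p] (A : g.Alg) (i j : I) :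
    (trunc p A).mat i j = if p ((g.idx j : ℤ) - g.idx i) then A.mat i j else 0 := rfl

/-- Overwriting the entries below the diagonal by those of f is an affine retraction of the loop
algebra onto the fiber. -/
theorem exists_retract (A : g.Alg) : ∃ B : g.fiber,
    ∀ i j, (B : Matrix I I K) i j = if g.idx i ≤ g.idx j then A.mat i j else g.lowerShift i j := by
  let f : g.Alg := ⟨g.lowerShift, Nice.lowerShift_mem⟩
  let B : g.Alg := trunc (fun n => 0 ≤ n) A + trunc (fun n => n < 0) f
  have hB : ∀ i j, B.mat i j = if g.idx i ≤ g.idx j then A.mat i j else g.lowerShift i j := by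
    intro i j
    show (trunc (fun n => 0 ≤ n) A).mat i j + (trunc (fun n => n < 0) f).mat i j = _
    rw [trunc_apply, trunc_apply]
    by_cases h : g.idx i ≤ g.idx j
    · rw [if_pos h, if_pos (by omega), if_neg (by omega), add_zero]
    · rw [if_neg h, if_neg (by omega), if_pos (by omega), zero_add]
  exact ⟨⟨B.mat, mem_fiber_iff.2 ⟨B.mem, fun i j h => by rw [hB, if_neg (by omega)]⟩⟩, hB⟩

/-- Only entries in opposite positions pair, so the adjoint of the projection to nonnegative
diagonals is the projection to nonpositive ones. -/
theorem tau_trunc (V x : g.Alg) :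
    LoopModel.tau g (trunc (fun n => 0 ≤ n) V * x) = LoopModel.tau g (V * trunc (fun n => n ≤ 0) x) := by
  set V' := trunc (fun n => 0 ≤ n) V with hV'
  set x' := trunc (fun n => n ≤ 0) x with hx'
  have h1 : LoopModel.tau g ((V - V') * x') = 0 := by
    rw [tau_apply, Nice.tr_eq_zero _ (Alg.mem _)]
    · rfl
    intro i
    rw [Alg.mul_apply]
    refine finsum_eq_zero_of_forall_eq_zero fun j => ?_
    rcases le_or_gt (g.idx i) (g.idx j) with h | h
    · rw [Alg.sub_mat, Matrix.sub_apply, hV', trunc_apply, if_pos (by omega), sub_self, zero_mul]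
    · rw [hx', trunc_apply, if_neg (by omega), mul_zero]
  have h2 : LoopModel.tau g (V' * (x - x')) = 0 := by
    refine Strict.tau (Upper.mul_strict (fun i j h => ?_) fun i j h => ?_)
    · rw [hV', trunc_apply, if_neg (by omega)]
    · rw [Alg.sub_mat, Matrix.sub_apply, hx', trunc_apply, if_pos (by omega), sub_self]
  rw [sub_mul, map_sub] at h1
  rw [mul_sub, map_sub] at h2
  linear_combination h2 - h1

/-- Composition with the affine retraction continues the function, and the differential is the
projection to nonpositive diagonals of the one along the fiber at the retracted point. -/
theorem SliceData.exists_continuation (D : SliceData g) {F : g.Reduced → ℂ}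
    (hF : ∀ b, ∃ q, IsGrad (F ∘ D.β.symm) b q) : ∃ Ft, g.IsContinuation F Ft := by
  classical
  choose B hB using fun A : g.Alg => exists_retract A
  have hfix : ∀ A : g.fiber, B (toAlg A) = A := fun A => by
    refine Subtype.ext ?_
    funext i j
    rw [hB]
    split_ifs with h
    · rfl
    · exact ((mem_fiber_iff.1 A.2).2 i j (by omega)).symm
  -- The value 0 outside the loop algebra is arbitrary: differentiability is tested only inside it.
  refine ⟨fun ξ => if h : ξ.1 ∈ g.alg then F (g.proj (B ⟨ξ.1, h⟩)) else 0, ?_, fun A => ?_⟩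
  · intro ξ hξ
    set A := B ⟨ξ.1, hξ⟩ with hA
    obtain ⟨q, hq⟩ := hF (D.β (g.proj A))
    obtain ⟨x, w, hx⟩ := D.ham (D.β (g.proj A)) q hq.1
    obtain ⟨X, Y, h⟩ := D.exists_isGaugeEq A
    have hd := (D.exists_canonical hq hx h).1
    set y := Y * x * X with hy
    refine ⟨((trunc (fun n => n ≤ 0) y).mat, 0), Alg.mem _, fun η hη => ?_⟩
    set V : g.Alg := ⟨η.1, hη⟩ with hV
    have hVu : Upper (trunc (fun n => 0 ≤ n) V) := fun i j h => by
      rw [trunc_apply, if_neg (by omega)]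
    set C : ℂ → g.Alg := fun s => ⟨ξ.1, hξ⟩ + csmul s V with hC
    have hCm : ∀ s, (C s).mat = (ξ + s • η).1 := fun s => by
      rw [hC]
      show ξ.1 + (csmul s V).mat = ξ.1 + s • η.1
      rw [csmul_mat]
    have h1 := hd (trunc (fun n => 0 ≤ n) V) hVu (fun s => B (C s)) fun s => by
      funext i j
      rw [hB, hCm, Matrix.add_apply, hA, hB, Matrix.smul_apply, trunc_apply]
      by_cases hij : g.idx i ≤ g.idx j
      · rw [if_pos hij, if_pos hij, if_pos (by omega)]
        rfl
      · rw [if_neg hij, if_neg hij, if_neg (by omega), smul_zero, add_zero]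
    have e1 : (fun s : ℂ => if h : (ξ + s • η).1 ∈ g.alg then F (g.proj (B ⟨(ξ + s • η).1, h⟩)) else 0)
        = fun s => F (g.proj (B (C s))) := by
      funext s
      have hm : (ξ + s • η).1 ∈ g.alg := by rw [← hCm]; exact (C s).mem
      rw [dif_pos hm]
      congr 3
      exact Alg.ext (hCm s).symm
    rw [e1]
    convert h1 using 1
    rw [affPairing, mul_zero, add_zero, tau_trunc]
    exact inner_eq_tau V _
  · have hm : (A : Matrix I I K) ∈ g.alg := A.2.1
    show (if h : (A : Matrix I I K) ∈ g.alg then F (g.proj (B ⟨A, h⟩)) else 0) = _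
    rw [dif_pos hm]
    exact congrArg (fun x => F (g.proj x)) (hfix A)

/-- Continuations exist through the slice, and all of them give the bracket of the slice because
only their differentials along the fiber matter. The second conclusion records the formula for
arbitrary differentials along the fiber, which permits a change of slice. -/
theorem SliceData.isHamiltonianReduction (D : SliceData g) (P : PoissonStructure g.Reduced)
    (hmem : ∀ F : g.Reduced → ℂ, F ∈ P.functions ↔ g.IsRegularOnFiber fun A => F (g.proj A))
    (hgrad : ∀ F ∈ P.functions, ∀ b, ∃ q, IsGrad (F ∘ D.β.symm) b q)
    (hbr : ∀ (F G : P.functions) (b q r w : I → K) (x : g.Alg),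
      IsGrad ((F : g.Reduced → ℂ) ∘ D.β.symm) b q → IsGrad ((G : g.Reduced → ℂ) ∘ D.β.symm) b r →
      D.Ham b q x w → (P.bracket F G : g.Reduced → ℂ) (D.β.symm b) = -pair w r) :
    g.IsHamiltonianReduction P ∧ ∀ (F G : P.functions) (A : g.fiber) (x y : g.Alg),
      IsFiberDiff (F : g.Reduced → ℂ) A x → IsFiberDiff (G : g.Reduced → ℂ) A y →
      (P.bracket F G : g.Reduced → ℂ) (g.proj A) = -LoopModel.tau g (vec (toAlg A) x * y) := by
  have key : ∀ (F G : P.functions) (A : g.fiber) (x y : g.Alg),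
      IsFiberDiff (F : g.Reduced → ℂ) A x → IsFiberDiff (G : g.Reduced → ℂ) A y →
      (P.bracket F G : g.Reduced → ℂ) (g.proj A) = -LoopModel.tau g (vec (toAlg A) x * y) := by
    intro F G A x y hx hy
    obtain ⟨q, hq⟩ := hgrad F F.2 (D.β (g.proj A))
    obtain ⟨r, hr⟩ := hgrad G G.2 (D.β (g.proj A))
    obtain ⟨x₀, w, hx₀⟩ := D.ham (D.β (g.proj A)) q hq.1
    rw [D.tau_vec_isFiberDiff hx hy hq hr hx₀, ← hbr F G _ q r w x₀ hq hr hx₀,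
      Equiv.symm_apply_apply]
  refine ⟨⟨hmem, fun F hF => D.exists_continuation (hgrad F hF), ?_⟩, key⟩
  intro F G Ft Gt hFt hGt A x y hx hy
  rw [key F G A _ _ (isFiberDiff_of_isDifferentialAt hFt hx)
    (isFiberDiff_of_isDifferentialAt hGt hy)]
  exact (kirillovKostant_eq (toAlg A) ⟨x.1, hx.1⟩ ⟨y.1, hy.1⟩ x.2 y.2).symm

end LoopModel

/-! ### The two models as loop algebras with trace -/

theorem mzdz_eq {I : Type} (A : Matrix I I K) : mzdz A = fun i j => theta ℂ (A i j) := by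
  funext i j
  exact (theta_eq _).symm

theorem theta_mul_cst (x : K) (c : ℂ) : theta ℂ (x * cst c) = theta ℂ x * cst c := by
  rw [(theta ℂ).leibniz, theta_cst, smul_zero, zero_add, smul_eq_mul, mul_comm]

theorem complexTrace_spec {lam : ℂ} {A : Matrix ℕ ℕ K} (h : A ∈ (barGl lam).alg) :
    HasTrace (cst lam) A ((barGl lam).tr A) := by
  obtain ⟨a, ha⟩ := (mem_barGl.1 h).exists_hasTrace
  rwa [show (barGl lam).tr A = a from complexTrace_eq ha]

instance (lam : ℂ) : (barGl lam).Nice where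
  idx_injective _ _ h := h
  colFinite A hA j := by
    obtain ⟨N, -, -, hN, -⟩ := mem_barGl.1 hA
    refine (Set.finite_Iic (j + N)).subset fun i hi => ?_
    by_contra h
    exact hi (hN i j (by simpa using h))
  add_mem A hA B hB := mem_barGl.2 ((mem_barGl.1 hA).add (mem_barGl.1 hB))
  smul_mem A hA c := mem_barGl.2 ((mem_barGl.1 hA).smul c)
  mul_mem A hA B hB := mem_barGl.2 ((mem_barGl.1 hA).mul (mem_barGl.1 hB))
  theta_mem A hA := by
    rw [mzdz_eq]
    exact mem_barGl.2 ((mem_barGl.1 hA).map ((theta ℂ : K →+ K)) fun x => theta_mul_cst x lam)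
  one_mem := by
    rw [mem_barGl]
    refine (congrArg (IsPolyMat (cst lam)) ?_).mpr (isPolyMat_diag (cst lam) (1 : K[X]) (k := 0) le_rfl)
    funext i j
    show (if i = j then (1 : K) else 0) = _
    rw [eval_one]
    exact if_congr (by omega) rfl rfl
  lowerShift_mem := by
    rw [mem_barGl]
    refine (congrArg (IsPolyMat (cst lam)) ?_).mpr (isPolyMat_diag (cst lam) (1 : K[X]) (k := -1) (by omega))
    funext i j
    show (if i = j + 1 then (1 : K) else 0) = _
    rw [eval_one]
    exact if_congr (by omega) rfl rfl
  rows_mem k A h := mem_barGl.2 (IsPolyMat.of_rows (N := k) (R₀ := k)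
    (fun i j hij => h i j (by show k ≤ i; omega)) fun i j hi => h i j hi)
  trunc_mem A hA p _ := mem_barGl.2 ((mem_barGl.1 hA).trunc p)
  tr_add A hA B hB := complexTrace_eq ((complexTrace_spec hA).add (complexTrace_spec hB))
  tr_smul A hA c := complexTrace_eq ((complexTrace_spec hA).map (AddMonoidHom.mulLeft c)
    fun x => by simp [mul_assoc])
  tr_theta A hA := by
    rw [mzdz_eq]
    exact complexTrace_eq ((complexTrace_spec hA).map (theta ℂ : K →+ K)
      fun x => theta_mul_cst x lam)
  tr_mul_comm A hA B hB := by
    have h := complexTrace_spec (mem_barGl.2 ((mem_barGl.1 hB).mul (mem_barGl.1 hA)))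
    exact complexTrace_eq (HasTrace.mul_comm (mem_barGl.1 hB) (mem_barGl.1 hA) h)
  tr_eq_zero A _ h := complexTrace_eq ⟨0, 0, fun N _ => by
    rw [eval_zero]
    exact Finset.sum_eq_zero fun i _ => h i, eval_zero⟩
  tr_single i a A h h' := by
    refine complexTrace_eq ⟨C a, i + 1, fun N hN => ?_, eval_C⟩
    rw [eval_C, Finset.sum_eq_single i, h]
    · intro j _ hj
      exact h' j j (Or.inl hj)
    · intro hi
      exact absurd (Finset.mem_range.2 (by omega)) hi

theorem mmul_fin {n : ℕ} (A B : Matrix (Fin n) (Fin n) K) : mmul A B = A * B := by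
  funext i k
  rw [mmul, finsum_eq_sum_of_fintype, Matrix.mul_apply]

instance (n : ℕ) : (glMat n).Nice where
  idx_injective _ _ h := Fin.ext h
  colFinite _ _ _ := Set.toFinite _
  add_mem _ _ _ _ := trivial
  smul_mem _ _ _ := trivial
  mul_mem _ _ _ _ := trivial
  theta_mem _ _ := trivial
  one_mem := trivial
  lowerShift_mem := trivial
  rows_mem _ _ _ := trivial
  trunc_mem _ _ _ _ := trivial
  tr_add A _ B _ := Matrix.trace_add A B
  tr_smul A _ c := (Finset.mul_sum Finset.univ (fun i => A i i) c).symm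
  tr_theta A _ := by
    rw [mzdz_eq]
    exact (map_sum (theta ℂ) (fun i => A i i) Finset.univ).symm
  tr_mul_comm A _ B _ := by
    rw [mmul_fin, mmul_fin]
    exact Matrix.trace_mul_comm A B
  tr_eq_zero A _ h := Finset.sum_eq_zero (s := Finset.univ) (f := fun i => A i i) fun i _ => h i
  tr_single i a A h h' := by
    show ∑ j, A j j = a
    rw [Finset.sum_eq_single i, h]
    · intro j _ hj
      exact h' j j (Or.inl hj)
    · intro hi
      exact absurd (Finset.mem_univ i) hi

/-! ### Inverses of unitriangular matrices -/

section Inverse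

variable {R : Type} [CommRing R]

/-- Upper unitriangular matrices of complex size have a left inverse. -/
theorem IsPolyMat.exists_left_inv {lam : R} {X : ℕ → ℕ → R} (hX : IsPolyMat lam X)
    (hd : ∀ i, X i i = 1) (hl : ∀ i j, j < i → X i j = 0) :
    ∃ Y : ℕ → ℕ → R, IsPolyMat lam Y ∧ (∀ i, Y i i = 1) ∧ (∀ i j, j < i → Y i j = 0) ∧
      ∀ i k, ∑ᶠ j, Y i j * X j k = if i = k then 1 else 0 := by
  obtain ⟨-, R₀, Q, -, hQ, hQr⟩ := hX
  -- The diagonals of the left inverse are given recursively by products of earlier ones with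
  -- diagonals of X, so polynomiality and the zeros at lam - r pass on as in `IsPolyMat.mul`,
  -- without any summation.
  let P : ℕ → (ℕ → ℕ → R) → Prop := fun n η =>
    (∀ i, η n i = if n = 0 then 1 else -∑ m ∈ Finset.range n, η m i * X (i + m) (i + n)) ∧
    ∃ H : R[X], (∀ i, R₀ ≤ i → η n i = H.eval (i : R)) ∧
      ∀ r : ℤ, 1 ≤ r → r ≤ n → H.eval (lam - r) = 0
  obtain ⟨η, hη⟩ : ∃ η : ℕ → ℕ → R, ∀ n, P n η := by
    refine exists_strong_seq P ?_ ?_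
    · rintro n f g hfg ⟨h1, H, h2, h3⟩
      refine ⟨fun i => ?_, H, fun i hi => by rw [← hfg n le_rfl, h2 i hi], h3⟩
      rw [← hfg n le_rfl, h1]
      congr 2
      refine Finset.sum_congr rfl fun m hm => ?_
      rw [hfg m (by simp at hm; omega)]
    · intro n f hf
      rcases n with _ | n
      · refine ⟨fun _ => 1, fun i => by simp, 1, fun i _ => by simp, fun r h1 h2 => ?_⟩
        push_cast at h2
        omega
      · have hH : ∀ m, ∃ H : R[X], m < n + 1 → (∀ i, R₀ ≤ i → f m i = H.eval (i : R)) ∧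
            ∀ r : ℤ, 1 ≤ r → r ≤ m → H.eval (lam - r) = 0 := by
          intro m
          by_cases hm : m < n + 1
          · obtain ⟨-, H, h⟩ := hf m hm
            exact ⟨H, fun _ => h⟩
          · exact ⟨0, fun h => absurd h hm⟩
        choose H hH using hH
        refine ⟨fun i => -∑ m ∈ Finset.range (n + 1), f m i * X (i + m) (i + (n + 1)), fun i => ?_,
          -∑ m ∈ Finset.range (n + 1), H m * (Q (n + 1 - m : ℤ)).comp (Polynomial.X + C (m : R)),
          fun i hi => ?_, fun r h1 h2 => ?_⟩
        · rw [Function.update_self, if_neg (by omega)]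
          congr 1
          refine Finset.sum_congr rfl fun m hm => ?_
          rw [Function.update_of_ne (by simp at hm; omega)]
        · rw [Function.update_self, eval_neg, eval_finsetSum]
          congr 1
          refine Finset.sum_congr rfl fun m hm => ?_
          have hm' : m < n + 1 := by simpa using hm
          rw [eval_mul, eval_comp, eval_add, eval_X, eval_C, (hH m hm').1 i hi, hQ _ _ (by omega)]
          congr 2
          · push_cast; rfl
          · congr 1; push_cast; ring
        · rw [eval_neg, eval_finsetSum, neg_eq_zero]
          refine Finset.sum_eq_zero fun m hm => ?_
          have hm' : m < n + 1 := by simpa using hm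
          rw [eval_mul, eval_comp, eval_add, eval_X, eval_C]
          rcases le_or_gt r m with h | h
          · rw [(hH m hm').2 r h1 h, zero_mul]
          · have e : lam - (r : R) + (m : R) = lam - ((r - m : ℤ) : R) := by push_cast; ring
            rw [e, hQr _ _ (by omega) (by push_cast at h2; omega), mul_zero]
  obtain ⟨Y, hYl, hYd⟩ : ∃ Y : ℕ → ℕ → R, (∀ i j, j < i → Y i j = 0) ∧
      ∀ i n, Y i (i + n) = η n i := by
    refine ⟨fun i j => if j < i then 0 else η (j - i) i, fun i j h => if_pos h, fun i n => ?_⟩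
    beta_reduce
    rw [if_neg (by omega), Nat.add_sub_cancel_left]
  have hY1 : ∀ i, Y i i = 1 := fun i => by
    have := hYd i 0
    rw [(hη 0).1, if_pos rfl] at this
    exact this
  refine ⟨Y, ?_, hY1, hYl, fun i k => ?_⟩
  · choose H hH using fun n => (hη n).2
    refine ⟨0, R₀, fun n => if n < 0 then 0 else H n.toNat, fun i j h => hYl i j (by omega),
      fun i j hi => ?_, fun n r h1 h2 => ?_⟩
    · beta_reduce
      rcases lt_or_ge j i with h | h
      · rw [hYl i j h, if_pos (by omega), eval_zero]
      · obtain ⟨n, rfl⟩ := Nat.exists_eq_add_of_le h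
        rw [hYd, if_neg (by omega), (hH n).1 i hi]
        congr
        omega
    · beta_reduce
      rw [if_neg (by omega), (hH n.toNat).2 r h1 (by omega)]
  · rw [finsum_mul_eq_sum (M := 0) (fun i j h => hl i j (by omega)) i k (n := k + 1) (by omega)]
    rcases lt_or_ge k i with h | h
    · rw [if_neg (by omega)]
      refine Finset.sum_eq_zero fun j hj => ?_
      rw [hYl i j (by simp at hj; omega), zero_mul]
    · obtain ⟨n, rfl⟩ := Nat.exists_eq_add_of_le h
      rw [Nat.add_assoc, Finset.sum_range_add, Finset.sum_eq_zero, zero_add,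
        Finset.sum_range_succ, hd, mul_one, hYd, (hη n).1 i]
      · rcases n with _ | n
        · simp
        · rw [if_neg (by omega), if_neg (by omega)]
          simp only [hYd]
          ring
      · intro j hj
        rw [hYl i j (by simpa using hj), zero_mul]

end Inverse

section BarGlInverse

open LoopModel

theorem unip_barGl_iff {lam : ℂ} {X : (barGl lam).Alg} :
    Unip X ↔ (∀ i, X.mat i i = 1) ∧ ∀ i j, j < i → X.mat i j = 0 := by
  have h1 : ∀ i j, (X - 1).mat i j = X.mat i j - if i = j then 1 else 0 := fun i j => by
    rw [Alg.sub_mat, Matrix.sub_apply, Alg.one_apply]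
    rfl
  constructor
  · intro h
    refine ⟨fun i => ?_, fun i j hij => ?_⟩
    · have := h i i le_rfl
      rw [h1, if_pos rfl, sub_eq_zero] at this
      exact this
    · have := h i j hij.le
      rw [h1, if_neg (by omega), sub_zero] at this
      exact this
  · rintro ⟨hd, hl⟩ i j hij
    rw [h1]
    rcases Nat.eq_or_lt_of_le (show j ≤ i from hij) with h | h
    · rw [if_pos h.symm, h, hd, sub_self]
    · rw [if_neg (by omega), hl i j h, sub_zero]

/-- A left inverse has a left inverse itself, which must be X, so it is two-sided. -/
theorem exists_inv_barGl {lam : ℂ} {X : (barGl lam).Alg} (hX : Unip X) :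
    ∃ Y : (barGl lam).Alg, Unip Y ∧ X * Y = 1 ∧ Y * X = 1 := by
  have hleft : ∀ X : (barGl lam).Alg, Unip X → ∃ Y : (barGl lam).Alg, Unip Y ∧ Y * X = 1 := by
    intro X hX
    obtain ⟨hd, hl⟩ := unip_barGl_iff.1 hX
    obtain ⟨Y, h1, h2, h3, h4⟩ := (mem_barGl.1 X.mem).exists_left_inv hd hl
    refine ⟨⟨Y, mem_barGl.2 h1⟩, unip_barGl_iff.2 ⟨h2, h3⟩, Alg.ext ?_⟩
    funext i k
    exact h4 i k
  obtain ⟨Y, hY, hYX⟩ := hleft X hX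
  obtain ⟨Z, hZ, hZY⟩ := hleft Y hY
  have : Z = X := by rw [← mul_one Z, ← hYX, ← mul_assoc, hZY, one_mul]
  exact ⟨Y, hY, by rw [← this]; exact hZY, hYX⟩

end BarGlInverse

/-! ### Shifted Frobenius matrices -/

section SliceMat

variable {R : Type} [CommRing R]

/-- The sum of the Frobenius matrix with first row `b` and of the diagonal matrix with
entries `-c i`. -/
def sliceMat (c : R) (b : ℕ → R) (i j : ℕ) : R :=
  (if i = 0 then b j else 0) + (if i = j + 1 then 1 else 0) - if i = j then c * i else 0

theorem sliceMat_zero (c : R) (b : ℕ → R) (j : ℕ) : sliceMat c b 0 j = b j := by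
  rw [sliceMat, if_pos rfl, if_neg (by omega)]
  split_ifs <;> simp

theorem sliceMat_succ (c : R) (b : ℕ → R) (i j : ℕ) : sliceMat c b (i + 1) j
    = (if j = i then 1 else 0) - if j = i + 1 then c * ((i : R) + 1) else 0 := by
  rw [sliceMat, if_neg (by omega), zero_add]
  congr 1
  · exact if_congr (by omega) rfl rfl
  · push_cast
    exact if_congr (by omega) rfl rfl

theorem isHess_sliceMat (c : R) (b : ℕ → R) : IsHess (sliceMat c b) := by
  refine ⟨fun i => ?_, fun i j h => ?_⟩
  · rw [sliceMat_succ, if_pos rfl, if_neg (by omega), sub_zero]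
  · obtain ⟨i, rfl⟩ : ∃ k, i = k + 1 := ⟨i - 1, by omega⟩
    rw [sliceMat_succ, if_neg (by omega), if_neg (by omega), sub_zero]

theorem isPolyMat_sliceMat (lam c : R) (b : ℕ → R) : IsPolyMat lam (sliceMat c b) := by
  have h1 : IsPolyMat lam fun i j : ℕ => if i = 0 then b j else 0 :=
    IsPolyMat.of_rows (N := 0) (R₀ := 1) (fun i j h => if_neg (by omega))
      fun i j h => if_neg (by omega)
  have h := (h1.add (isPolyMat_diag lam 1 (k := -1) (by omega))).add
    (isPolyMat_diag lam (-(C c * X)) (k := 0) le_rfl)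
  refine (congrArg (IsPolyMat lam) ?_).mpr h
  funext i j
  simp only [Pi.add_apply, eval_one, eval_neg, eval_mul, eval_C, eval_X]
  rw [sliceMat, sub_eq_add_neg]
  congr 1
  · congr 1
    exact if_congr (by omega) rfl rfl
  · rcases eq_or_ne i j with h | h
    · rw [if_pos h, if_pos (by omega)]
    · rw [if_neg h, if_neg (by omega), neg_zero]

theorem finsum_mul_hess {A : ℕ → ℕ → R} (hA : IsHess A) (x : ℕ → ℕ → R) (i j : ℕ) :
    ∑ᶠ k, x i k * A k j = ∑ k ∈ Finset.range (j + 2), x i k * A k j :=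
  finsum_mul_eq_sum (M := 1) (fun i j h => hA.2 i j (by omega)) i j (by omega)

theorem finsum_mul_upper {A : ℕ → ℕ → R} (hA : ∀ i j, j < i → A i j = 0) (b : ℕ → R) (j : ℕ) :
    ∑ᶠ k, b k * A k j = ∑ k ∈ Finset.range (j + 1), b k * A k j :=
  finsum_mul_eq_sum (A := fun _ => b) (M := 0) (fun i j h => hA i j (by omega)) 0 j (by omega)

theorem finsum_sliceMat_mul_succ (c : R) (b : ℕ → R) (x : ℕ → ℕ → R) (i j : ℕ) :
    ∑ᶠ k, sliceMat c b (i + 1) k * x k j = x i j - c * ((i : R) + 1) * x (i + 1) j := by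
  rw [finsum_eq_sum_of_support_subset (s := {i, i + 1})]
  · rw [Finset.sum_pair (by omega), sliceMat_succ, sliceMat_succ, if_pos rfl, if_pos rfl,
      if_neg (by omega), if_neg (by omega)]
    ring
  · intro k hk
    by_contra h
    simp only [Finset.coe_insert, Finset.coe_singleton, Set.mem_insert_iff, Set.mem_singleton_iff,
      not_or] at h
    refine hk ?_
    simp only []
    rw [sliceMat_succ, if_neg h.1, if_neg h.2, sub_zero, zero_mul]

theorem finsum_mul_sliceMat (c : R) (b : ℕ → R) (x : ℕ → ℕ → R) (i j : ℕ) :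
    ∑ᶠ k, x i k * sliceMat c b k j = x i 0 * b j + x i (j + 1) - c * j * x i j := by
  rw [finsum_mul_hess (isHess_sliceMat c b), Finset.sum_range_succ', sliceMat_zero]
  have e : ∀ k ∈ Finset.range (j + 1), x i (k + 1) * sliceMat c b (k + 1) j
      = (if k = j then x i (j + 1) else 0) - if k + 1 = j then c * j * x i j else 0 := by
    intro k _
    rw [sliceMat_succ]
    rcases eq_or_ne j k with h | h
    · subst h
      rw [if_pos rfl, if_neg (by omega), if_pos rfl, if_neg (by omega)]
      ring
    · rw [if_neg h, if_neg h.symm]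
      rcases eq_or_ne j (k + 1) with h' | h'
      · subst h'
        rw [if_pos rfl, if_pos rfl]
        push_cast
        ring
      · rw [if_neg h', if_neg h'.symm]
        ring
  rw [Finset.sum_congr rfl e, Finset.sum_sub_distrib, Finset.sum_ite_eq' (Finset.range (j + 1)) j,
    if_pos (by simp)]
  rcases j with _ | j
  · simp [add_comm]
  · have e' : ∀ k ∈ Finset.range (j + 1 + 1), (if k + 1 = j + 1 then c * ((j + 1 : ℕ) : R)
        * x i (j + 1) else 0) = if k = j then c * ((j + 1 : ℕ) : R) * x i (j + 1) else 0 :=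
      fun k _ => if_congr (by omega) rfl rfl
    rw [Finset.sum_congr rfl e', Finset.sum_ite_eq' (Finset.range (j + 1 + 1)) j,
      if_pos (by simp)]
    ring

variable [Algebra ℂ R] {d : Derivation ℂ R R} {lam c : R}

theorem isGauge_one {b : ℕ → R} :
    IsGauge d lam c (sliceMat c b) (fun i j => if i = j then 1 else 0) b := by
  have hX : ∀ i j : ℕ, (if i = j then (1 : R) else 0)
      = (fun i j : ℕ => if i = j then (1 : R) else 0) i j := fun _ _ => rfl
  have hd : ∀ i j : ℕ, d (if i = j then (1 : R) else 0) = 0 := fun i j => by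
    split_ifs <;> simp
  refine ⟨?_, fun i => if_pos rfl, fun i j h => if_neg (by omega), fun i j => ?_, fun j => ?_⟩
  · refine (congrArg (IsPolyMat lam) ?_).mpr (isPolyMat_diag lam 1 (k := 0) le_rfl)
    funext i j
    rw [eval_one]
    exact if_congr (by omega) rfl rfl
  · rw [← finsum_mul_hess (isHess_sliceMat c b) (fun i j => if i = j then (1 : R) else 0) (i + 1) j,
      finsum_eq_single _ (i + 1), hd, sliceMat_succ, if_pos rfl]
    · rcases eq_or_ne j i with h | h
      · subst h
        simp
      · rcases eq_or_ne j (i + 1) with h' | h'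
        · subst h'
          simp
        · rw [if_neg h, if_neg h', if_neg h.symm, if_neg h'.symm]
          ring
    · intro k hk
      rw [if_neg hk.symm, zero_mul]
  · rw [← finsum_mul_hess (isHess_sliceMat c b) (fun i j => if i = j then (1 : R) else 0) 0 j,
      finsum_eq_single _ 0, hd, sliceMat_zero, if_pos rfl, Finset.sum_eq_single j, if_pos rfl]
    · ring
    · intro k _ hk
      rw [if_neg hk, mul_zero]
    · intro h
      exact absurd (Finset.self_mem_range_succ j) h
    · intro k hk
      rw [if_neg hk.symm, zero_mul]

/-- Ring homomorphisms that commute with the derivations preserve gauge transformations. -/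
theorem IsGauge.map {S : Type} [CommRing S] [Algebra ℂ S] {d' : Derivation ℂ S S} (φ : R →+* S)
    (hφ : ∀ x, φ (d x) = d' (φ x)) {A X : ℕ → ℕ → R} {b : ℕ → R} (h : IsGauge d lam c A X b) :
    IsGauge d' (φ lam) (φ c) (fun i j => φ (A i j)) (fun i j => φ (X i j)) fun j => φ (b j) := by
  refine ⟨h.polyMat.map (φ : R →+ S) fun x => map_mul φ _ _, fun i => ?_, fun i j hij => ?_,
    fun i j => ?_, fun j => ?_⟩
  · rw [h.diag, map_one]
  · rw [h.lower i j hij, map_zero]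
  · rw [h.step i j]
    simp only [map_add, map_sum, map_mul, hφ, map_natCast, map_one]
  · have := congrArg φ (h.row j)
    simpa only [map_add, map_sum, map_mul, hφ] using this

end SliceMat

/-! ### The reduced space as a slice -/

namespace LoopModel

variable {lam : ℂ}

/-- A matrix of complex size as an element of the loop algebra. -/
def algOf {A : ℕ → ℕ → K} (h : IsPolyMat (cst lam) A) : (barGl lam).Alg := ⟨A, mem_barGl.2 h⟩

theorem isHess_iff {A : Matrix ℕ ℕ K} (hA : A ∈ (barGl lam).alg) :
    IsHess A ↔ A ∈ (barGl lam).fiber := by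
  rw [mem_fiber_iff]
  constructor
  · intro h
    refine ⟨hA, fun i j hij => ?_⟩
    show A i j = if i = j + 1 then 1 else 0
    rcases eq_or_ne i (j + 1) with h' | h'
    · rw [if_pos h', h', h.1]
    · rw [if_neg h']
      exact h.2 i j (by have : j < i := hij; omega)
  · rintro ⟨-, h⟩
    refine ⟨fun i => ?_, fun i j hij => ?_⟩
    · rw [h _ _ (Nat.lt_succ_self i)]
      exact if_pos rfl
    · rw [h i j (show j < i by omega)]
      exact if_neg (show ¬i = j + 1 by omega)

/-- The slice of the fiber that consists of the matrices `sliceMat c b`. -/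
def barSlice (lam : ℂ) (c : K) (b : ℕ → K) : (barGl lam).fiber :=
  ⟨sliceMat c b, (isHess_iff (mem_barGl.2 (isPolyMat_sliceMat _ c b))).1 (isHess_sliceMat c b)⟩

theorem barSlice_apply (c : K) (b : ℕ → K) (i j : ℕ) :
    (toAlg (barSlice lam c b)).mat i j = sliceMat c b i j := rfl

theorem vec_barSlice_succ (c : K) (b : ℕ → K) (x : (barGl lam).Alg) (i j : ℕ) :
    (vec (toAlg (barSlice lam c b)) x).mat (i + 1) j = x.mat (i + 1) 0 * b j
      + x.mat (i + 1) (j + 1) - c * j * x.mat (i + 1) j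
      - (x.mat i j - c * ((i : K) + 1) * x.mat (i + 1) j) + theta ℂ (x.mat (i + 1) j) := by
  rw [vec, gaugeField, Alg.add_mat, Alg.sub_mat, Matrix.add_apply, Matrix.sub_apply,
    Alg.mul_apply, Alg.mul_apply, thetaAlg_apply]
  simp only [barSlice_apply]
  rw [finsum_mul_sliceMat c b x.mat (i + 1) j, finsum_sliceMat_mul_succ c b x.mat i j]

theorem vec_barSlice_zero (c : K) (b : ℕ → K) (x : (barGl lam).Alg) (j : ℕ) :
    (vec (toAlg (barSlice lam c b)) x).mat 0 j = x.mat 0 0 * b j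
      + x.mat 0 (j + 1) - c * j * x.mat 0 j - (∑ᶠ k, b k * x.mat k j) + theta ℂ (x.mat 0 j) := by
  rw [vec, gaugeField, Alg.add_mat, Alg.sub_mat, Matrix.add_apply, Matrix.sub_apply,
    Alg.mul_apply, Alg.mul_apply, thetaAlg_apply]
  simp only [barSlice_apply]
  rw [finsum_mul_sliceMat c b x.mat 0 j]
  simp only [sliceMat_zero]

theorem gauge_entry_succ (c : K) (A : (barGl lam).fiber) (b : ℕ → K) (X : (barGl lam).Alg)
    (i j : ℕ) : (X * toAlg A + thetaAlg (barGl lam) X - toAlg (barSlice lam c b) * X).mat (i + 1) j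
      = (∑ k ∈ Finset.range (j + 2), X.mat (i + 1) k * (A : Matrix ℕ ℕ K) k j)
        + theta ℂ (X.mat (i + 1) j) + c * ((i : K) + 1) * X.mat (i + 1) j - X.mat i j := by
  rw [Alg.sub_mat, Alg.add_mat, Matrix.sub_apply, Matrix.add_apply, Alg.mul_apply, Alg.mul_apply,
    thetaAlg_apply]
  simp only [barSlice_apply, toAlg_mat]
  rw [finsum_sliceMat_mul_succ c b X.mat i j, finsum_mul_hess ((isHess_iff A.2.1).2 A.2) X.mat]
  ring

theorem gauge_entry_zero (c : K) (A : (barGl lam).fiber) (b : ℕ → K) {X : (barGl lam).Alg}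
    (hX : ∀ i j, j < i → X.mat i j = 0) (j : ℕ) :
    (X * toAlg A + thetaAlg (barGl lam) X - toAlg (barSlice lam c b) * X).mat 0 j
      = (∑ k ∈ Finset.range (j + 2), X.mat 0 k * (A : Matrix ℕ ℕ K) k j)
        + theta ℂ (X.mat 0 j) - ∑ k ∈ Finset.range (j + 1), b k * X.mat k j := by
  rw [Alg.sub_mat, Alg.add_mat, Matrix.sub_apply, Matrix.add_apply, Alg.mul_apply, Alg.mul_apply,
    thetaAlg_apply]
  simp only [barSlice_apply, toAlg_mat, sliceMat_zero]
  rw [finsum_mul_hess ((isHess_iff A.2.1).2 A.2) X.mat, finsum_mul_upper hX]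

/-- The equation XA + θX = SX, read entry by entry: its row i + 1 is solved for row i of X because S
has ones below the diagonal, and its row 0 determines b. -/
theorem isGauge_iff (c : K) (A : (barGl lam).fiber) (b : ℕ → K) {X : (barGl lam).Alg}
    (hX : Unip X) :
    X * toAlg A + thetaAlg (barGl lam) X = toAlg (barSlice lam c b) * X ↔
      IsGauge (theta ℂ) (cst lam) c (A : Matrix ℕ ℕ K) X.mat b := by
  obtain ⟨h1, h2⟩ := unip_barGl_iff.1 hX
  rw [← sub_eq_zero]
  constructor
  · intro h
    refine ⟨mem_barGl.1 X.mem, h1, h2, fun i j => ?_, fun j => ?_⟩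
    · have := gauge_entry_succ c A b X i j
      rw [h, Alg.zero_mat, Matrix.zero_apply] at this
      exact (sub_eq_zero.1 this.symm).symm
    · have := gauge_entry_zero c A b h2 j
      rw [h, Alg.zero_mat, Matrix.zero_apply] at this
      exact sub_eq_zero.1 this.symm
  · intro h
    refine Alg.ext ?_
    funext i j
    rw [Alg.zero_mat, Matrix.zero_apply]
    rcases i with _ | i
    · rw [gauge_entry_zero c A b h2, h.row, sub_self]
    · rw [gauge_entry_succ, ← h.step, sub_self]

theorem isGaugeEq_iff {I : Type} {g : LoopModel I} [Nice g] {A B X Y : g.Alg} (hX : Unip X) (hY : Unip Y)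
    (h1 : X * Y = 1) (h2 : Y * X = 1) :
    IsGaugeEq A B X Y ↔ X * A + thetaAlg g X = B * X := by
  constructor
  · rintro ⟨-, -, -, -, rfl⟩
    have e : (X * A * Y + thetaAlg g X * Y) * X = X * A * (Y * X) + thetaAlg g X * (Y * X) := by
      noncomm_ring
    rw [e, h2, mul_one, mul_one]
  · intro h
    refine ⟨hX, hY, h1, h2, ?_⟩
    rw [← add_mul, h, mul_assoc, h1, mul_one]

theorem exists_proj_barSlice (c : K) (A : (barGl lam).fiber) {X : ℕ → ℕ → K} {b : ℕ → K}
    (h : IsGauge (theta ℂ) (cst lam) c (A : Matrix ℕ ℕ K) X b) :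
    (barGl lam).proj A = (barGl lam).proj (barSlice lam c b) := by
  let x : (barGl lam).Alg := algOf h.polyMat
  have hx : Unip x := unip_barGl_iff.2 ⟨h.diag, h.lower⟩
  obtain ⟨y, hy, h1, h2⟩ := exists_inv_barGl hx
  exact proj_eq_iff.2 ⟨x, y, (isGaugeEq_iff hx hy h1 h2).2 ((isGauge_iff c A b hx).2 h)⟩

theorem exists_isGauge_fiber (c : K) (A : (barGl lam).fiber) :
    ∃ X b, IsGauge (theta ℂ) (cst lam) c (A : Matrix ℕ ℕ K) X b :=
  exists_isGauge (theta ℂ) (theta_cst lam) c ((isHess_iff A.2.1).2 A.2) (mem_barGl.1 A.2.1)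

/-- A gauge transformation between two points of the slice and the identity are both normalizations
of the same matrix, so uniqueness makes the points equal. Surjectivity is the existence of the
normal form. -/
theorem barSlice_bijective (lam : ℂ) (c : K) :
    Function.Bijective fun b => (barGl lam).proj (barSlice lam c b) := by
  constructor
  · intro b b' h
    obtain ⟨X, Y, h⟩ := proj_eq_iff.1 h
    have h' := (isGauge_iff c (barSlice lam c b) b' h.1).1
      ((isGaugeEq_iff h.1 h.2.1 h.2.2.1 h.2.2.2.1).1 h)
    funext j
    exact (IsGauge.unique (isHess_sliceMat c b) (isHess_sliceMat c b) isGauge_one h'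
      (k := j + 1) fun i n _ => rfl).2 j (by omega)
  · intro x
    obtain ⟨A, rfl⟩ : ∃ A, (barGl lam).proj A = x := Quot.exists_rep x
    obtain ⟨X, b, h⟩ := exists_isGauge_fiber c A
    exact ⟨b, (exists_proj_barSlice c A h).symm⟩

/-- The identification of the reduced space with the slice. -/
def barEquiv (lam : ℂ) (c : K) : (barGl lam).Reduced ≃ (ℕ → K) :=
  (Equiv.ofBijective _ (barSlice_bijective lam c)).symm

theorem barEquiv_symm (c : K) (b : ℕ → K) :
    (barEquiv lam c).symm b = (barGl lam).proj (barSlice lam c b) := rfl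

theorem barEquiv_proj (c : K) (A : (barGl lam).fiber) {X : ℕ → ℕ → K} {b : ℕ → K}
    (h : IsGauge (theta ℂ) (cst lam) c (A : Matrix ℕ ℕ K) X b) :
    barEquiv lam c ((barGl lam).proj A) = b := by
  rw [exists_proj_barSlice c A h, ← barEquiv_symm, Equiv.apply_symm_apply]

/-- The normal form of the whole line S(b) + tV is computed at once over Laurent series with
coefficients in ℂ[X]. Specializing t gives the curve, and the linear terms in t of the gauge
equations give the relation between velocity, V and the orbit direction n, the derivative of the
gauge transformation. -/
theorem barSlice_curve {c : K} (b : ℕ → K) {V : (barGl lam).Alg}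
    (hV : Upper V) : ∃ u : ℕ → LaurentSeries ℂ[X],
    (∀ (s : ℂ) (B : (barGl lam).fiber), toAlg B = toAlg (barSlice lam c b) + csmul s V →
      ∀ j, barEquiv lam c ((barGl lam).proj B) j = evL s (u j)) ∧
    ∃ n : (barGl lam).Alg, Strict n ∧
      V + vec (toAlg (barSlice lam c b)) n = rowAt 0 fun j => d0L (u j) := by
  let A : ℕ → ℕ → LaurentSeries ℂ[X] := fun i j =>
    constL ℂ[X] (sliceMat c b i j) + parL * constL ℂ[X] (V.mat i j)
  have hVl : ∀ i j, j < i → V.mat i j = 0 := hV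
  have hA : IsHess A := by
    refine ⟨fun i => ?_, fun i j h => ?_⟩
    · simp only [A]
      rw [(isHess_sliceMat c b).1, hVl _ _ (Nat.lt_succ_self i), map_one, map_zero, mul_zero, add_zero]
    · simp only [A]
      rw [(isHess_sliceMat c b).2 i j h, hVl i j (by omega), map_zero, mul_zero, add_zero]
  have hAp : IsPolyMat (constL ℂ[X] (cst lam)) A := by
    have h1 := (isPolyMat_sliceMat (cst lam) c b).map (lam' := constL ℂ[X] (cst lam))
      (constL ℂ[X] : K →+ LaurentSeries ℂ[X]) fun x => map_mul (constL ℂ[X]) _ _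
    have h2 := (mem_barGl.1 V.mem).map (lam' := constL ℂ[X] (cst lam))
      (constL ℂ[X] : K →+ LaurentSeries ℂ[X]) fun x => map_mul (constL ℂ[X]) _ _
    exact h1.add (h2.smul parL)
  have hl : theta ℂ[X] (constL ℂ[X] (cst lam)) = 0 := by
    rw [cst_eq, AlgHom.commutes]
    exact (theta ℂ[X]).map_algebraMap lam
  obtain ⟨X, u, hX⟩ := exists_isGauge (theta ℂ[X]) hl (constL ℂ[X] c) hA hAp
  have hev : ∀ s, IsGauge (theta ℂ) (cst lam) c (fun i j => sliceMat c b i j + cst s * V.mat i j)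
      (fun i j => evL s (X i j)) fun j => evL s (u j) := by
    intro s
    have := hX.map (evL s : LaurentSeries ℂ[X] →+* K) (d' := theta ℂ) fun x => evL_theta s x
    simpa [A] using this
  refine ⟨u, fun s B hB j => ?_, ?_⟩
  · refine congrFun (barEquiv_proj c B (X := fun i j => evL s (X i j))
      (b := fun j => evL s (u j)) ?_) j
    have e : (B : Matrix ℕ ℕ K) = fun i j => sliceMat c b i j + cst s * V.mat i j :=
      congrArg Alg.mat hB
    rw [e]
    exact hev s
  · have h0 : ∀ i j, evL 0 (X i j) = if i = j then 1 else 0 := by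
      have h1 := hev 0
      have e : (fun i j => sliceMat c b i j + cst 0 * V.mat i j) = sliceMat c b := by
        funext i j
        simp [cst]
      rw [e] at h1
      intro i j
      rcases lt_or_ge j i with h | h
      · rw [hX.lower i j h, map_zero, if_neg (by omega)]
      · obtain ⟨n, rfl⟩ := Nat.exists_eq_add_of_le h
        exact (IsGauge.unique (isHess_sliceMat c b) (isHess_sliceMat c b) h1 isGauge_one
          (k := n) fun i n _ => rfl).1 n le_rfl i
    have hdA : ∀ i j, d0L (A i j) = V.mat i j := fun i j => by
      simp [A, d0L_mul]
    have hA0 : ∀ i j, evL 0 (A i j) = sliceMat c b i j := fun i j => by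
      simp [A, cst]
    have hu0 : ∀ j, evL 0 (u j) = b j := by
      have h1 := hev 0
      have e : (fun i j => sliceMat c b i j + cst 0 * V.mat i j) = sliceMat c b := by
        funext i j
        simp [cst]
      rw [e] at h1
      intro j
      exact (IsGauge.unique (isHess_sliceMat c b) (isHess_sliceMat c b) h1 isGauge_one
          (k := j + 1) fun i n _ => rfl).2 j (by omega)
    have hnp : IsPolyMat (cst lam) fun i j => d0L (X i j) :=
      hX.polyMat.map (d0L : LaurentSeries ℂ[X] →+ K) fun x => by
        show d0L (x * constL ℂ[X] (cst lam)) = d0L x * cst lam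
        rw [d0L_mul, d0L_constL, evL_constL, mul_zero, add_zero]
    have hnl : ∀ i j, j ≤ i → d0L (X i j) = 0 := by
      intro i j hij
      rcases Nat.eq_or_lt_of_le hij with h | h
      · rw [h, hX.diag, ← map_one (constL ℂ[X]), d0L_constL]
      · rw [hX.lower i j h, map_zero]
    have hsum : ∀ i j, d0L (∑ k ∈ Finset.range (j + 2), X i k * A k j)
        = (d0L (X i 0) * b j + d0L (X i (j + 1)) - c * j * d0L (X i j)) + V.mat i j := by
      intro i j
      have e1 : d0L (∑ k ∈ Finset.range (j + 2), X i k * A k j)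
          = (∑ k ∈ Finset.range (j + 2), d0L (X i k) * sliceMat c b k j)
            + ∑ k ∈ Finset.range (j + 2), (if i = k then 1 else 0) * V.mat k j := by
        rw [map_sum, ← Finset.sum_add_distrib]
        refine Finset.sum_congr rfl fun k _ => ?_
        rw [d0L_mul, hdA, hA0, h0]
      rw [e1, ← finsum_mul_hess (isHess_sliceMat c b) (fun i j => d0L (X i j)) i j,
        finsum_mul_sliceMat c b (fun i j => d0L (X i j)) i j]
      congr 1
      rcases lt_or_ge i (j + 2) with h | h
      · rw [Finset.sum_eq_single i]
        · simp
        · intro k _ hk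
          rw [if_neg hk.symm, zero_mul]
        · intro h'
          exact absurd (Finset.mem_range.2 h) h'
      · rw [hVl i j (by omega)]
        refine Finset.sum_eq_zero fun k hk => ?_
        rw [if_neg (by simp at hk; omega), zero_mul]
    refine ⟨algOf hnp, hnl, Alg.ext ?_⟩
    funext i j
    rw [Alg.add_mat, Matrix.add_apply]
    rcases i with _ | i
    · rw [rowAt_self, vec_barSlice_zero]
      show V.mat 0 j + (d0L (X 0 0) * b j + d0L (X 0 (j + 1)) - c * j * d0L (X 0 j)
        - (∑ᶠ k, b k * d0L (X k j)) + theta ℂ (d0L (X 0 j))) = d0L (u j)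
      have h1 := congrArg d0L (hX.row j)
      rw [map_add, hsum, d0L_theta, map_sum] at h1
      have e : ∑ k ∈ Finset.range (j + 1), d0L (u k * X k j)
          = d0L (u j) + ∑ᶠ k, b k * d0L (X k j) := by
        rw [finsum_mul_upper (A := fun i j => d0L (X i j)) (fun i j h => hnl i j h.le)]
        have e1 : ∀ k ∈ Finset.range (j + 1), d0L (u k * X k j)
            = (if k = j then d0L (u j) else 0) + b k * d0L (X k j) := by
          intro k _
          rw [d0L_mul, h0, hu0]
          rcases eq_or_ne k j with h | h
          · subst h; simp
          · simp [h]
        rw [Finset.sum_congr rfl e1, Finset.sum_add_distrib, Finset.sum_ite_eq' _ j,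
          if_pos (Finset.self_mem_range_succ j)]
      rw [e] at h1
      linear_combination h1
    · rw [rowAt_ne (Nat.succ_ne_zero i), vec_barSlice_succ]
      show V.mat (i + 1) j + (d0L (X (i + 1) 0) * b j + d0L (X (i + 1) (j + 1))
        - c * j * d0L (X (i + 1) j) - (d0L (X i j) - c * ((i : K) + 1) * d0L (X (i + 1) j))
        + theta ℂ (d0L (X (i + 1) j))) = 0
      have h1 := congrArg d0L (hX.step i j)
      have e2 : d0L (constL ℂ[X] c * ((i : LaurentSeries ℂ[X]) + 1) * X (i + 1) j)
          = c * ((i : K) + 1) * d0L (X (i + 1) j) := by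
        have : constL ℂ[X] c * ((i : LaurentSeries ℂ[X]) + 1) = constL ℂ[X] (c * ((i : K) + 1)) := by
          simp
        rw [this, d0L_mul, d0L_constL, evL_constL, zero_mul, zero_add]
      rw [map_add, map_add, hsum, d0L_theta, e2] at h1
      linear_combination -h1

end LoopModel

/-! ### Hamiltonian data on the slices with constants 0 and 1 -/

theorem IsPolyMat.diag_mul {R : Type} [CommRing R] {lam : R} {A : ℕ → ℕ → R}
    (hA : IsPolyMat lam A) (f : ℤ → R) : IsPolyMat lam fun i j => f ((j : ℤ) - i) * A i j := by
  obtain ⟨N, R₀, Q, h1, h2, h3⟩ := hA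
  refine ⟨N, R₀, fun n => C (f n) * Q n, fun i j h => ?_, fun i j h => ?_, fun n r h h' => ?_⟩
  · beta_reduce
    rw [h1 i j h, mul_zero]
  · beta_reduce
    rw [h2 i j h, eval_mul, eval_C]
  · beta_reduce
    rw [eval_mul, h3 n r h h', mul_zero]

namespace LoopModel

variable {lam : ℂ}

theorem vec_of_isHam {b q w : ℕ → K} {x : ℕ → ℕ → K}
    (h : IsHam (theta ℂ) (cst lam) b q x w) :
    vec (toAlg (barSlice lam 0 b)) (algOf h.polyMat) = rowAt 0 w := by
  refine Alg.ext ?_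
  funext i j
  rcases i with _ | i
  · rw [rowAt_self, vec_barSlice_zero]
    show x 0 0 * b j + x 0 (j + 1) - 0 * j * x 0 j - (∑ᶠ k, b k * x k j) + theta ℂ (x 0 j) = w j
    rw [h.row, h.col]
    ring
  · rw [rowAt_ne (Nat.succ_ne_zero i), vec_barSlice_succ]
    show x (i + 1) 0 * b j + x (i + 1) (j + 1) - 0 * j * x (i + 1) j
      - (x i j - 0 * ((i : K) + 1) * x (i + 1) j) + theta ℂ (x (i + 1) j) = 0
    rw [h.step i j, h.col]
    ring

theorem zpow_mul_zpow_mul (n m : ℤ) (x : K) : zpow n * (zpow m * x) = zpow (n + m) * x := by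
  rw [← mul_assoc, DSReduction.zpow_add]

/-- Hamiltonian data for `d/dz` yield such data for `z d/dz` after a rescaling. -/
theorem vec_of_isHam_dz {b q w : ℕ → K} {x : ℕ → ℕ → K} (h : IsHam dzD (cst lam) b q x w) :
    vec (toAlg (barSlice lam 1 fun j : ℕ => zpow (j + 1) * b j))
      (algOf (h.polyMat.diag_mul zpow)) = rowAt 0 fun j : ℕ => zpow (j + 1) * w j := by
  -- The term n z^n y is what conjugation by the diagonal matrix of powers of z adds; it cancels
  -- against the diagonal entries -i of the slice with c = 1, leaving the equations for d/dz.
  have hth : ∀ (n : ℤ) (y : K), theta ℂ (zpow n * y) = n * (zpow n * y) + zpow (n + 1) * dz y := by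
    intro n y
    rw [(theta ℂ).leibniz, theta_zpow, smul_eq_mul, smul_eq_mul, theta_eq, ← mul_assoc (zpow n),
      DSReduction.zpow_add]
    ring
  refine Alg.ext ?_
  funext i j
  rcases i with _ | i
  · rw [rowAt_self, vec_barSlice_zero]
    show zpow (((0 : ℕ) : ℤ) - (0 : ℕ)) * x 0 0 * (zpow (j + 1) * b j)
      + zpow (((j + 1 : ℕ) : ℤ) - (0 : ℕ)) * x 0 (j + 1) - 1 * j * (zpow ((j : ℤ) - (0 : ℕ)) * x 0 j)
      - (∑ᶠ k : ℕ, zpow (k + 1) * b k * (zpow ((j : ℤ) - k) * x k j))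
      + theta ℂ (zpow ((j : ℤ) - (0 : ℕ)) * x 0 j) = zpow (j + 1) * w j
    have e : ∑ᶠ k : ℕ, zpow (k + 1) * b k * (zpow ((j : ℤ) - k) * x k j)
        = zpow (j + 1) * ∑ᶠ k, b k * x k j := by
      rw [mul_finsum]
      refine finsum_congr fun k => ?_
      have : zpow ((j : ℤ) + 1) = zpow ((k : ℤ) + 1) * zpow ((j : ℤ) - k) := by
        rw [DSReduction.zpow_add]; congr 1; ring
      rw [this]
      ring
    rw [e, h.row, hth, h.col, dzD_apply]
    simp only [Nat.cast_zero, sub_zero, zpow_zero, one_mul]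
    push_cast
    ring
  · rw [rowAt_ne (Nat.succ_ne_zero i), vec_barSlice_succ]
    show zpow (((0 : ℕ) : ℤ) - (i + 1 : ℕ)) * x (i + 1) 0 * (zpow (j + 1) * b j)
      + zpow (((j + 1 : ℕ) : ℤ) - (i + 1 : ℕ)) * x (i + 1) (j + 1)
      - 1 * j * (zpow ((j : ℤ) - (i + 1 : ℕ)) * x (i + 1) j)
      - (zpow ((j : ℤ) - i) * x i j
        - 1 * ((i : K) + 1) * (zpow ((j : ℤ) - (i + 1 : ℕ)) * x (i + 1) j))
      + theta ℂ (zpow ((j : ℤ) - (i + 1 : ℕ)) * x (i + 1) j) = 0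
    have e1 : zpow (((0 : ℕ) : ℤ) - (i + 1 : ℕ)) * x (i + 1) 0 * (zpow (j + 1) * b j)
        = zpow ((j : ℤ) - i) * (q (i + 1) * b j) := by
      have : zpow ((j : ℤ) - i) = zpow (((0 : ℕ) : ℤ) - (i + 1 : ℕ)) * zpow (j + 1) := by
        rw [DSReduction.zpow_add]; congr 1; push_cast; ring
      rw [this, h.col]
      ring
    have e2 : (((j + 1 : ℕ) : ℤ) - (i + 1 : ℕ)) = (j : ℤ) - i := by push_cast; ring
    rw [e1, e2, hth, h.step i j, dzD_apply]
    have e3 : (j : ℤ) - (i + 1 : ℕ) + 1 = (j : ℤ) - i := by push_cast; ring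
    rw [e3]
    push_cast
    ring

theorem exists_bound {q : ℕ → K} (hq : {j | q j ≠ 0}.Finite) : ∃ k : ℕ, ∀ i, k ≤ i → q i = 0 := by
  obtain ⟨k, hk⟩ := hq.bddAbove
  refine ⟨k + 1, fun i hi => ?_⟩
  by_contra h
  have := hk h
  omega

/-- The slice of Frobenius matrices. -/
def frobSlice (lam : ℂ) : SliceData (barGl lam) where
  base := 0
  idx_base := rfl
  S := barSlice lam 0
  β := barEquiv lam 0
  β_proj b := by rw [← barEquiv_symm, Equiv.apply_symm_apply]
  curve b V hV := barSlice_curve b hV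
  ham b q hq := by
    obtain ⟨k, hk⟩ := exists_bound hq
    obtain ⟨x, w, h⟩ := exists_isHam (theta_cst lam) b hk
    exact ⟨algOf h.polyMat, w, h.col, vec_of_isHam h⟩

/-- The slice of Frobenius matrices shifted by the diagonal matrix with entries `-i`. -/
def symbolSlice (lam : ℂ) : SliceData (barGl lam) where
  base := 0
  idx_base := rfl
  S := barSlice lam 1
  β := barEquiv lam 1
  β_proj b := by rw [← barEquiv_symm, Equiv.apply_symm_apply]
  curve b V hV := barSlice_curve b hV
  ham b q hq := by
    obtain ⟨k, hk⟩ := exists_bound hq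
    -- The point and the covector are first scaled by inverse powers of z, since `vec_of_isHam_dz`
    -- and the weights of the matrix scale them back.
    obtain ⟨x, w, h⟩ := exists_isHam (d := dzD) (lam := cst lam) (by simp [dzD, theta_cst])
      (fun j : ℕ => zpow (-(j + 1 : ℤ)) * b j) (q := fun i : ℕ => zpow i * q i) (k := k)
      fun i hi => by rw [hk i hi, mul_zero]
    refine ⟨algOf (h.polyMat.diag_mul zpow), fun j : ℕ => zpow (j + 1) * w j, fun i => ?_, ?_⟩
    · show zpow (((0 : ℕ) : ℤ) - i) * x i 0 = q i
      rw [h.col, zpow_mul_zpow_mul]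
      simp
    · have := vec_of_isHam_dz h
      simp only [zpow_mul_zpow_mul, add_neg_cancel, zpow_zero, one_mul] at this
      exact this

end LoopModel

/-! ### Coefficients of products and the chain rule for polynomials -/

section Pairing

variable {A : Type} [CommRing A]

theorem coeff_mul_zero_eq_sum (x y : LaurentSeries A) {T : Finset ℤ}
    (hT : ∀ l, x.coeff l * y.coeff (-l) ≠ 0 → l ∈ T) :
    (x * y).coeff 0 = ∑ l ∈ T, x.coeff l * y.coeff (-l) := by
  rw [HahnSeries.coeff_mul]
  refine Finset.sum_bij_ne_zero (fun ij _ _ => ij.1) ?_ ?_ ?_ ?_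
  · rintro ⟨i, j⟩ h h'
    simp only [Finset.mem_antidiagonal] at h
    refine hT i ?_
    rwa [show -i = j by omega]
  · rintro ⟨i, j⟩ h _ ⟨i', j'⟩ h' _ he
    simp only [Finset.mem_antidiagonal] at h h'
    simp only at he
    simp only [Prod.mk.injEq]
    omega
  · intro l _ hl
    refine ⟨(l, -l), ?_, hl, rfl⟩
    simp only [Finset.mem_antidiagonal, HahnSeries.mem_support]
    exact ⟨left_ne_zero_of_mul hl, right_ne_zero_of_mul hl, by omega⟩
  · rintro ⟨i, j⟩ h _
    simp only [Finset.mem_antidiagonal] at h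
    simp only []
    rw [show -i = j by omega]

theorem exists_coeff_bound (x : LaurentSeries A) : ∃ m : ℕ, ∀ l : ℤ, l < -m → x.coeff l = 0 := by
  by_cases hx : x = 0
  · exact ⟨0, fun l _ => by rw [hx]; rfl⟩
  · refine ⟨x.order.natAbs, fun l hl => HahnSeries.coeff_eq_zero_of_lt_order (by omega)⟩

theorem exists_coeff_bounds (u : ℕ → LaurentSeries A) (k : ℕ) :
    ∃ m : ℕ, ∀ i < k, ∀ l : ℤ, l < -m → (u i).coeff l = 0 := by
  choose m hm using fun i => exists_coeff_bound (u i)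
  refine ⟨∑ i ∈ Finset.range k, m i, fun i hi l hl => hm i l ?_⟩
  have : m i ≤ ∑ i ∈ Finset.range k, m i :=
    Finset.single_le_sum (fun _ _ => Nat.zero_le _) (Finset.mem_range.2 hi)
  omega

end Pairing

/-- The chain rule with infinitely many variables: one finite set of variables, independent of the
substitution, carries all nonzero partial derivatives. -/
theorem exists_derivative_aeval {σ : Type} (p : MvPolynomial σ ℂ) : ∃ T : Finset σ,
    (∀ v ∉ T, MvPolynomial.pderiv v p = 0) ∧ ∀ a : σ → ℂ[X],
      derivative (MvPolynomial.aeval a p)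
        = ∑ v ∈ T, MvPolynomial.aeval a (MvPolynomial.pderiv v p) * derivative (a v) := by
  classical
  have hext : ∀ (p : MvPolynomial σ ℂ) (T T' : Finset σ), T ⊆ T' →
      (∀ v ∉ T, MvPolynomial.pderiv v p = 0) → ∀ a : σ → ℂ[X],
      ∑ v ∈ T, MvPolynomial.aeval a (MvPolynomial.pderiv v p) * derivative (a v)
        = ∑ v ∈ T', MvPolynomial.aeval a (MvPolynomial.pderiv v p) * derivative (a v) := by
    intro p T T' h h' a
    refine Finset.sum_subset h fun v _ hv => ?_
    rw [h' v hv, map_zero, zero_mul]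
  induction p using MvPolynomial.induction_on with
  | C c =>
    refine ⟨∅, fun v _ => MvPolynomial.pderiv_C, fun a => ?_⟩
    rw [Finset.sum_empty, MvPolynomial.aeval_C, Polynomial.algebraMap_eq, derivative_C]
  | add p q hp hq =>
    obtain ⟨T, h1, h2⟩ := hp
    obtain ⟨T', h1', h2'⟩ := hq
    refine ⟨T ∪ T', fun v hv => ?_, fun a => ?_⟩
    · rw [Finset.mem_union, not_or] at hv
      rw [map_add, h1 v hv.1, h1' v hv.2, add_zero]
    · rw [map_add, derivative_add, h2, h2', hext p _ (T ∪ T') Finset.subset_union_left h1,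
        hext q _ (T ∪ T') Finset.subset_union_right h1', ← Finset.sum_add_distrib]
      refine Finset.sum_congr rfl fun v _ => ?_
      rw [map_add, map_add, add_mul]
  | mul_X p i hp =>
    obtain ⟨T, h1, h2⟩ := hp
    have hpd : ∀ v, MvPolynomial.pderiv v (p * MvPolynomial.X i)
        = MvPolynomial.pderiv v p * MvPolynomial.X i + if v = i then p else 0 := by
      intro v
      rw [MvPolynomial.pderiv_mul, MvPolynomial.pderiv_X]
      congr 1
      rcases eq_or_ne v i with h | h
      · subst h
        rw [Pi.single_eq_same, if_pos rfl, mul_one]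
      · rw [Pi.single_eq_of_ne h.symm, if_neg h, mul_zero]
    refine ⟨insert i T, fun v hv => ?_, fun a => ?_⟩
    · rw [Finset.mem_insert, not_or] at hv
      rw [hpd, h1 v hv.2, if_neg hv.1, zero_mul, add_zero]
    · rw [map_mul, MvPolynomial.aeval_X, derivative_mul, h2, hext p _ (insert i T)
        (Finset.subset_insert i T) h1]
      simp only [hpd, map_add, map_mul, MvPolynomial.aeval_X, add_mul, Finset.sum_add_distrib]
      congr 1
      · rw [Finset.sum_mul]
        refine Finset.sum_congr rfl fun v _ => ?_
        ring
      · rw [Finset.sum_eq_single i]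
        · rw [if_pos rfl]
        · intro v _ hv
          rw [if_neg hv, map_zero, zero_mul]
        · intro h
          exact absurd (Finset.mem_insert_self i T) h

theorem pderiv_pderiv_comm {σ : Type} (v w : σ) (p : MvPolynomial σ ℂ) :
    MvPolynomial.pderiv v (MvPolynomial.pderiv w p)
      = MvPolynomial.pderiv w (MvPolynomial.pderiv v p) := by
  classical
  have hX : ∀ v w i : σ, MvPolynomial.pderiv v (MvPolynomial.pderiv w
      (MvPolynomial.X i : MvPolynomial σ ℂ)) = 0 := by
    intro v w i
    rw [MvPolynomial.pderiv_X]
    rcases eq_or_ne w i with h | h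
    · subst h
      rw [Pi.single_eq_same, MvPolynomial.pderiv_one]
    · rw [Pi.single_eq_of_ne h.symm, map_zero]
  induction p using MvPolynomial.induction_on with
  | C c => simp
  | add p q hp hq => simp only [map_add, hp, hq]
  | mul_X p i hp =>
    simp only [MvPolynomial.pderiv_mul, map_add, hp, hX]
    ring

theorem aeval_comp_eval {σ A : Type} [CommRing A] [Algebra ℂ A] (φ : A →ₐ[ℂ] ℂ) (a : σ → A)
    (p : MvPolynomial σ ℂ) :
    φ (MvPolynomial.aeval a p) = MvPolynomial.eval (fun v => φ (a v)) p := by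
  rw [← MvPolynomial.coe_aeval_eq_eval, ← AlgHom.comp_apply, MvPolynomial.comp_aeval]
  rfl

/-! ### Regular functions and their differentials -/

section Regular

/-- The coefficients of the first members of a sequence of Laurent series. -/
def coeffs {A : Type} [CommRing A] (k : ℕ) (u : ℕ → LaurentSeries A) (v : Fin k × ℤ) : A :=
  (u v.1).coeff v.2

/-- `F` is the regular function that is given, for poles of order at most `m`, by the
polynomial `P m`. -/
def RegWith (k : ℕ) (P : ℕ → MvPolynomial (Fin k × ℤ) ℂ) (F : (ℕ → K) → ℂ) : Prop :=
  ∀ m u, (∀ i < k, PoleLE m (u i)) → F u = MvPolynomial.eval (coeffs k u) (P m)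

theorem isRegularSeq_iff {F : (ℕ → K) → ℂ} : IsRegularSeq F ↔ ∃ k P, RegWith k P F := by
  constructor
  · rintro ⟨k, h⟩
    choose P hP using h
    exact ⟨k, P, fun m u hu => hP m u hu⟩
  · rintro ⟨k, P, h⟩
    exact ⟨k, fun m => ⟨P m, fun u hu => h m u hu⟩⟩

variable {k : ℕ} {P : ℕ → MvPolynomial (Fin k × ℤ) ℂ} {F : (ℕ → K) → ℂ}

/-- The poles of the first members of a sequence are of order at most `m`. -/
def PolesLE {A : Type} [CommRing A] (k m : ℕ) (u : ℕ → LaurentSeries A) : Prop :=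
  ∀ i < k, ∀ l : ℤ, l < -m → (u i).coeff l = 0

theorem PolesLE.mono {A : Type} [CommRing A] {k m m' : ℕ} {u : ℕ → LaurentSeries A}
    (h : PolesLE k m u) (hm : m ≤ m') : PolesLE k m' u := fun i hi l hl => h i hi l (by omega)

theorem RegWith.mapL_eq (hF : RegWith k P F) {A : Type} [CommRing A] [Algebra ℂ A] {m : ℕ}
    {u : ℕ → LaurentSeries A} (hu : PolesLE k m u) (φ : A →ₐ[ℂ] ℂ) :
    F (fun j => mapL φ (u j)) = φ (MvPolynomial.aeval (coeffs k u) (P m)) := by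
  rw [hF m, aeval_comp_eval]
  · simp only [coeffs]
    rfl
  · intro i hi l hl
    rw [mapL_coeff, hu i hi l hl, map_zero]

/-- Along a family with coefficients in ℂ[X] and bounded poles a regular function is a polynomial in
s, so its derivative is algebraic. -/
theorem RegWith.hasDerivAt (hF : RegWith k P F) {m : ℕ} {T : Finset (Fin k × ℤ)}
    (hT : ∀ a : Fin k × ℤ → ℂ[X], derivative (MvPolynomial.aeval a (P m))
      = ∑ v ∈ T, MvPolynomial.aeval a (MvPolynomial.pderiv v (P m)) * derivative (a v))
    {u : ℕ → LaurentSeries ℂ[X]} (hu : PolesLE k m u) :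
    HasDerivAt (fun s : ℂ => F fun j => evL s (u j))
      (∑ v ∈ T, MvPolynomial.eval (coeffs k fun j => evL 0 (u j)) (MvPolynomial.pderiv v (P m))
        * (d0L (u v.1)).coeff v.2) 0 := by
  have e1 : (fun s : ℂ => F fun j => evL s (u j))
      = fun s => (MvPolynomial.aeval (coeffs k u) (P m)).eval s := by
    funext s
    refine (hF.mapL_eq hu (aeval s)).trans ?_
    rw [Polynomial.coe_aeval_eq_eval]
  rw [e1]
  refine (Polynomial.hasDerivAt (MvPolynomial.aeval (coeffs k u) (P m)) 0).congr_deriv ?_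
  rw [hT, eval_finsetSum]
  refine Finset.sum_congr rfl fun v _ => ?_
  rw [eval_mul, ← Polynomial.coe_aeval_eq_eval, aeval_comp_eval, d0L_coeff]
  have : (fun v => (aeval (0 : ℂ)) (coeffs k u v)) = coeffs k fun j => evL 0 (u j) := by
    funext v
    simp only [coeffs, evL_coeff, Polynomial.coe_aeval_eq_eval]
  rw [this]
  simp [coeffs, Polynomial.coe_aeval_eq_eval, ← Polynomial.coeff_zero_eq_eval_zero,
    Polynomial.coeff_derivative]

/-- A line of sequences. -/
def lineL {I : Type} (b δ : I → K) (j : I) : LaurentSeries ℂ[X] :=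
  constL ℂ[X] (b j) + parL * constL ℂ[X] (δ j)

theorem evL_lineL {I : Type} (b δ : I → K) (s : ℂ) (j : I) :
    evL s (lineL b δ j) = b j + cst s * δ j := by simp [lineL]

theorem evL_zero_lineL {I : Type} (b δ : I → K) (j : I) : evL 0 (lineL b δ j) = b j := by
  rw [evL_lineL]
  simp [cst]

theorem d0L_lineL {I : Type} (b δ : I → K) (j : I) : d0L (lineL b δ j) = δ j := by
  simp [lineL, d0L_mul]

theorem lineL_coeff {I : Type} (b δ : I → K) (j : I) (l : ℤ) :
    (lineL b δ j).coeff l = C ((b j).coeff l) + X * C ((δ j).coeff l) := by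
  rw [lineL, HahnSeries.coeff_add, parL, HahnSeries.C_mul_eq_smul, HahnSeries.coeff_smul]
  rfl

theorem polesLE_lineL {b δ : ℕ → K} {m : ℕ} (hb : PolesLE k m b) (hδ : PolesLE k m δ) :
    PolesLE k m (lineL b δ) := by
  intro i hi l hl
  rw [lineL_coeff, hb i hi l hl, hδ i hi l hl]
  simp

theorem IsGrad.unique {I : Type} {Φ : (I → K) → ℂ} {b q q' : I → K} (h : IsGrad Φ b q)
    (h' : IsGrad Φ b q') : q = q' := by
  classical
  funext j
  ext l
  have h1 := h.2 (lineL b (Pi.single j (zpow (-l)))) (evL_zero_lineL b _)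
  have h2 := h'.2 (lineL b (Pi.single j (zpow (-l)))) (evL_zero_lineL b _)
  have := h1.unique h2
  simp only [d0L_lineL] at this
  rwa [LoopModel.pair_single, LoopModel.pair_single, LoopModel.coeff_zpow_mul,
    LoopModel.coeff_zpow_mul, neg_neg] at this

/-- The polynomials for different pole bounds need not be equal; they agree only where poles have
order at most m. So their partial derivatives are compared only in the directions z^l with l ≥ -m,
which stay in that region. -/
theorem RegWith.eval_pderiv_eq (hF : RegWith k P F) {b : ℕ → K} {m M : ℕ} (hb : PolesLE k m b)
    (hM : m ≤ M) (v : Fin k × ℤ) (hv : -(m : ℤ) ≤ v.2) :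
    MvPolynomial.eval (coeffs k b) (MvPolynomial.pderiv v (P M))
      = MvPolynomial.eval (coeffs k b) (MvPolynomial.pderiv v (P m)) := by
  classical
  set δ : ℕ → K := Pi.single (v.1 : ℕ) (zpow v.2) with hδ
  have hδm : PolesLE k m δ := by
    intro i _ l hl
    rcases eq_or_ne i v.1 with h | h
    · rw [hδ, h, Pi.single_eq_same, zpow, HahnSeries.coeff_single_of_ne (by omega)]
    · rw [hδ, Pi.single_eq_of_ne h]
      rfl
  have key : ∀ m' : ℕ, m ≤ m' → HasDerivAt (fun s : ℂ => F fun j => evL s (lineL b δ j))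
      (MvPolynomial.eval (coeffs k b) (MvPolynomial.pderiv v (P m'))) 0 := by
    intro m' hm'
    obtain ⟨T, h1, h2⟩ := exists_derivative_aeval (P m')
    convert hF.hasDerivAt h2 (polesLE_lineL (hb.mono hm') (hδm.mono hm')) using 1
    have e : (fun j => evL 0 (lineL b δ j)) = b := funext (evL_zero_lineL b δ)
    rw [e]
    have hne : ∀ w : Fin k × ℤ, w ≠ v → (d0L (lineL b δ w.1)).coeff w.2 = 0 := by
      intro w hw
      rw [d0L_lineL, hδ]
      rcases eq_or_ne (w.1 : ℕ) v.1 with h | h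
      · rw [h, Pi.single_eq_same, zpow, HahnSeries.coeff_single_of_ne]
        intro h'
        exact hw (Prod.ext (Fin.ext h) h')
      · rw [Pi.single_eq_of_ne h]
        rfl
    rw [Finset.sum_eq_single v]
    · rw [d0L_lineL, hδ, Pi.single_eq_same, zpow, HahnSeries.coeff_single_same, mul_one]
    · intro w _ hw
      rw [hne w hw, mul_zero]
    · intro hv
      rw [h1 v hv, map_zero, zero_mul]
  exact (key M hM).unique (key m le_rfl)

theorem pair_eq_sum_range {w q : ℕ → K} {k : ℕ} (hq : ∀ j, k ≤ j → q j = 0) :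
    pair w q = ∑ j ∈ Finset.range k, (w j * q j).coeff 0 :=
  pair_eq_sum w fun j hj => Finset.mem_range.2 (by
    by_contra h
    exact hj (hq j (by omega)))

theorem finite_of_bound {q : ℕ → K} {k : ℕ} (hq : ∀ j, k ≤ j → q j = 0) : {j | q j ≠ 0}.Finite :=
  (Set.finite_Iio k).subset fun j hj => by
    by_contra h
    exact hj (hq j (by simpa using h))

/-- Families of sequences have families of differentials. -/
theorem RegWith.exists_grad (hF : RegWith k P F) {A : Type} [CommRing A] [Algebra ℂ A]
    (u : ℕ → LaurentSeries A) : ∃ q : ℕ → LaurentSeries A, (∀ j, k ≤ j → q j = 0) ∧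
      ∀ φ : A →ₐ[ℂ] ℂ, IsGrad F (fun j => mapL φ (u j)) fun j => mapL φ (q j) := by
  classical
  obtain ⟨m, hm⟩ := exists_coeff_bounds u k
  -- The pairing takes constant terms, so the coefficient of z^n in the differential is the partial
  -- derivative with respect to the coefficient of z^(-n). For n > m that variable lies beyond the
  -- pole bound m, and the polynomial for the bound n is used.
  let f : Fin k → ℤ → A := fun j n => MvPolynomial.aeval (coeffs k u)
    (MvPolynomial.pderiv (j, -n) (P (max m n.toNat)))
  -- For negative n only the polynomial `P m` occurs, and it has finitely many variables.
  have hf : ∀ j, BddBelow (Function.support (f j)) := by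
    intro j
    obtain ⟨T, h1, -⟩ := exists_derivative_aeval (P m)
    obtain ⟨L, hL⟩ := (T.image Prod.snd).bddAbove
    refine ⟨min 0 (-L), fun n hn => ?_⟩
    by_contra h
    rw [not_le, lt_min_iff] at h
    refine hn ?_
    simp only [f]
    rw [show max m n.toNat = m by omega, h1, map_zero]
    intro hT
    have := hL (Finset.mem_coe.2 (Finset.mem_image_of_mem Prod.snd hT))
    simp only at this
    omega
  let q : ℕ → LaurentSeries A := fun j => if h : j < k then
    HahnSeries.ofSuppBddBelow (f ⟨j, h⟩) (hf ⟨j, h⟩) else 0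
  have hq : ∀ (j : Fin k) n, (q j).coeff n = f j n := fun j n => by
    simp only [q]
    rw [dif_pos j.2]
    rfl
  have hq0 : ∀ j, k ≤ j → q j = 0 := fun j hj => dif_neg (by omega)
  refine ⟨q, hq0, fun φ => ⟨finite_of_bound (k := k) fun j hj => by rw [hq0 j hj, map_zero],
    fun w hw => ?_⟩⟩
  obtain ⟨M', hM'⟩ := exists_coeff_bounds w k
  set M := max m M' with hM
  obtain ⟨T, h1, h2⟩ := exists_derivative_aeval (P M)
  convert hF.hasDerivAt h2 (PolesLE.mono hM' (le_max_right m M')) using 1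
  set b : ℕ → K := fun j => evL 0 (w j) with hb
  have hbu : b = fun j => mapL φ (u j) := funext hw
  have hbm : PolesLE k m b := fun i hi l hl => by
    rw [hbu]
    simp only [mapL_coeff]
    rw [hm i hi l hl, map_zero]
  have hφ : ∀ (j : Fin k) l, -(M : ℤ) ≤ l → (mapL φ (q j)).coeff (-l)
      = MvPolynomial.eval (coeffs k b) (MvPolynomial.pderiv (j, l) (P M)) := by
    intro j l hl
    rw [mapL_coeff, hq]
    simp only [f]
    rw [aeval_comp_eval, neg_neg, hF.eval_pderiv_eq (hbm.mono (le_max_left m (-l).toNat))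
      (show max m (-l).toNat ≤ M by omega) (j, l) (by simp only; omega), hbu]
    simp only [coeffs]
    rfl
  rw [pair_eq_sum_range (k := k) fun j hj => by rw [hq0 j hj, map_zero], Finset.sum_range]
  have hd : ∀ (j : Fin k) l, l < -(M : ℤ) → (d0L (w j)).coeff l = 0 := fun j l hl => by
    rw [d0L_coeff, hM' j j.2 l (by omega)]
    simp
  have e1 : ∀ j : Fin k, (d0L (w j) * mapL φ (q j)).coeff 0 = ∑ l ∈ T.image Prod.snd,
      (d0L (w j)).coeff l * MvPolynomial.eval (coeffs k b) (MvPolynomial.pderiv (j, l) (P M)) := by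
    intro j
    have hz : ∀ l, (d0L (w j)).coeff l * (mapL φ (q j)).coeff (-l) = (d0L (w j)).coeff l
        * MvPolynomial.eval (coeffs k b) (MvPolynomial.pderiv (j, l) (P M)) := by
      intro l
      rcases lt_or_ge l (-(M : ℤ)) with h | h
      · rw [hd j l h, zero_mul, zero_mul]
      · rw [hφ j l h]
    rw [coeff_mul_zero_eq_sum _ _ (T := T.image Prod.snd)]
    · exact Finset.sum_congr rfl fun l _ => hz l
    · intro l hl
      rw [hz] at hl
      by_contra hT
      refine hl ?_
      rw [h1 (j, l) fun h => hT (Finset.mem_image_of_mem Prod.snd h), map_zero, mul_zero]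
  rw [Finset.sum_congr rfl fun j _ => e1 j, ← Finset.sum_product']
  symm
  refine (Finset.sum_subset (fun v hv => ?_) fun v _ hv => ?_).trans
    (Finset.sum_congr rfl fun v _ => mul_comm _ _)
  · exact Finset.mem_product.2 ⟨Finset.mem_univ _, Finset.mem_image_of_mem Prod.snd hv⟩
  · rw [h1 v hv, map_zero, zero_mul]

theorem RegWith.exists_isGrad (hF : RegWith k P F) (b : ℕ → K) :
    ∃ q, (∀ j, k ≤ j → q j = 0) ∧ IsGrad F b q := by
  obtain ⟨q, h1, h2⟩ := hF.exists_grad (A := ℂ) b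
  refine ⟨q, h1, ?_⟩
  have := h2 (AlgHom.id ℂ ℂ)
  have e : ∀ x : K, mapL (AlgHom.id ℂ ℂ) x = x := fun x => by ext; simp
  simpa only [e] using this

/-- The derivative of the differential along a curve, in terms of second derivatives. -/
theorem RegWith.pair_d0L (hF : RegWith k P F) (m : ℕ) : ∃ T : Finset (Fin k × ℤ),
    ∀ (u q : ℕ → LaurentSeries ℂ[X]) (ε : ℕ → K), PolesLE k m u → PolesLE k m ε →
      (∀ j, k ≤ j → q j = 0) →
      (∀ s, IsGrad F (fun j => evL s (u j)) fun j => evL s (q j)) →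
      pair ε (fun j => d0L (q j)) = ∑ v ∈ T, ∑ v' ∈ T,
        MvPolynomial.eval (coeffs k fun j => evL 0 (u j))
          (MvPolynomial.pderiv v' (MvPolynomial.pderiv v (P m)))
          * (d0L (u v'.1)).coeff v'.2 * (ε v.1).coeff v.2 := by
  classical
  obtain ⟨T₀, h1, h2⟩ := exists_derivative_aeval (P m)
  choose T' h1' h2' using fun v => exists_derivative_aeval (MvPolynomial.pderiv v (P m))
  refine ⟨T₀ ∪ T₀.biUnion T', fun u q ε hu hε hq hg => ?_⟩
  set T := T₀ ∪ T₀.biUnion T' with hT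
  have hT2 : ∀ v w, w ∉ T → MvPolynomial.pderiv w (MvPolynomial.pderiv v (P m)) = 0 := by
    intro v w hw
    rw [hT, Finset.mem_union, not_or, Finset.mem_biUnion] at hw
    by_cases hv : v ∈ T₀
    · exact h1' v w fun h => hw.2 ⟨v, hv, h⟩
    · rw [h1 v hv, map_zero]
  -- Both polynomials give the derivative of F in the direction ε at the point s of the curve, once
  -- through the differential and once through the partial derivatives. Being equal for every s,
  -- they have the same derivative at 0.
  let p₁ : ℂ[X] := ∑ j ∈ Finset.range k, (constL ℂ[X] (ε j) * q j).coeff 0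
  let p₂ : ℂ[X] := ∑ v ∈ T, MvPolynomial.aeval (coeffs k u) (MvPolynomial.pderiv v (P m))
    * C ((ε v.1).coeff v.2)
  have hp : p₁ = p₂ := by
    refine Polynomial.funext fun s => ?_
    have hps : PolesLE k m fun j => evL s (u j) := fun i hi l hl => by
      rw [evL_coeff, hu i hi l hl, eval_zero]
    have d1 := (hg s).2 (lineL (fun j => evL s (u j)) ε) (evL_zero_lineL _ _)
    have d2 := hF.hasDerivAt h2 (polesLE_lineL hps hε)
    have := d1.unique d2
    simp only [d0L_lineL, evL_zero_lineL] at this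
    have e1 : p₁.eval s = pair ε fun j => evL s (q j) := by
      rw [pair_eq_sum_range (k := k) fun j hj => by rw [hq j hj, map_zero]]
      simp only [p₁]
      rw [eval_finsetSum]
      refine Finset.sum_congr rfl fun j _ => ?_
      rw [← evL_coeff, map_mul, evL_constL]
    have e2 : p₂.eval s = ∑ v ∈ T₀, MvPolynomial.eval (coeffs k fun j => evL s (u j))
        (MvPolynomial.pderiv v (P m)) * (ε v.1).coeff v.2 := by
      simp only [p₂]
      rw [eval_finsetSum]
      symm
      refine (Finset.sum_subset Finset.subset_union_left fun v _ hv => ?_).trans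
        (Finset.sum_congr rfl fun v _ => ?_)
      · rw [h1 v hv, map_zero, zero_mul]
      · rw [eval_mul, eval_C, ← Polynomial.coe_aeval_eq_eval, aeval_comp_eval]
        simp only [coeffs, Polynomial.coe_aeval_eq_eval]
        rfl
    rw [e1, e2, this]
  have hd := congrArg (fun p => (derivative p).eval 0) hp
  simp only [p₁, p₂, derivative_sum, eval_finsetSum] at hd
  have e0 : ∀ x : LaurentSeries ℂ[X], ∀ n, eval 0 (derivative (x.coeff n)) = (d0L x).coeff n :=
    fun x n => by
      rw [d0L_coeff, ← Polynomial.coeff_zero_eq_eval_zero, Polynomial.coeff_derivative]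
      simp
  rw [pair_eq_sum_range (k := k) fun j hj => by rw [hq j hj, map_zero]]
  have e1 : ∀ j ∈ Finset.range k, eval 0 (derivative ((constL ℂ[X] (ε j) * q j).coeff 0))
      = (ε j * d0L (q j)).coeff 0 := fun j _ => by
    rw [e0, d0L_mul, d0L_constL, evL_constL, zero_mul, zero_add]
  rw [Finset.sum_congr rfl e1] at hd
  rw [hd]
  refine Finset.sum_congr rfl fun v hv => ?_
  rw [derivative_mul, derivative_C, mul_zero, add_zero, eval_mul, eval_C, h2' v, eval_finsetSum,
    ← Finset.sum_mul]
  congr 1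
  have hz : ∀ w ∉ T' v, eval 0 (MvPolynomial.aeval (coeffs k u) (MvPolynomial.pderiv w
      (MvPolynomial.pderiv v (P m))) * derivative (coeffs k u w)) = 0 := fun w hw => by
    rw [h1' v w hw, map_zero, zero_mul, eval_zero]
  have hz' : ∀ w ∉ T, eval 0 (MvPolynomial.aeval (coeffs k u) (MvPolynomial.pderiv w
      (MvPolynomial.pderiv v (P m))) * derivative (coeffs k u w)) = 0 := fun w hw => by
    rw [hT2 v w hw, map_zero, zero_mul, eval_zero]
  rw [Finset.sum_subset (Finset.subset_union_left (s₂ := T)) fun w _ hw => hz w hw,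
    ← Finset.sum_subset (Finset.subset_union_right (s₁ := T' v)) fun w _ hw => hz' w hw]
  refine Finset.sum_congr rfl fun w _ => ?_
  rw [eval_mul, coeffs, e0, ← Polynomial.coe_aeval_eq_eval, aeval_comp_eval]
  simp only [coeffs, Polynomial.coe_aeval_eq_eval]
  rfl

/-- The symmetry of second derivatives. -/
theorem RegWith.hessian_symm (hF : RegWith k P F) {u u' q q' : ℕ → LaurentSeries ℂ[X]}
    (h0 : ∀ j, evL 0 (u j) = evL 0 (u' j)) (hq : ∀ j, k ≤ j → q j = 0)
    (hq' : ∀ j, k ≤ j → q' j = 0)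
    (hg : ∀ s, IsGrad F (fun j => evL s (u j)) fun j => evL s (q j))
    (hg' : ∀ s, IsGrad F (fun j => evL s (u' j)) fun j => evL s (q' j)) :
    pair (fun j => d0L (u' j)) (fun j => d0L (q j))
      = pair (fun j => d0L (u j)) fun j => d0L (q' j) := by
  obtain ⟨m, hm⟩ := exists_coeff_bounds u k
  obtain ⟨m', hm'⟩ := exists_coeff_bounds u' k
  set M := max m m'
  have hu : PolesLE k M u := PolesLE.mono hm (le_max_left m m')
  have hu' : PolesLE k M u' := PolesLE.mono hm' (le_max_right m m')
  have hd : ∀ {u : ℕ → LaurentSeries ℂ[X]}, PolesLE k M u → PolesLE k M fun j => d0L (u j) :=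
    fun hu i hi l hl => by
      rw [d0L_coeff, hu i hi l hl]
      simp
  obtain ⟨T, hT⟩ := hF.pair_d0L M
  rw [hT u q _ hu (hd hu') hq hg, hT u' q' _ hu' (hd hu) hq' hg', Finset.sum_comm]
  refine Finset.sum_congr rfl fun v _ => Finset.sum_congr rfl fun v' _ => ?_
  have e : (fun j => evL 0 (u j)) = fun j => evL 0 (u' j) := funext h0
  rw [e, pderiv_pderiv_comm]
  ring

end Regular

/-! ### Linearity of the pairing and of differentials -/

section Pair

variable {I : Type}

theorem pair_add {w q r : I → K} (hq : {j | q j ≠ 0}.Finite) (hr : {j | r j ≠ 0}.Finite) :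
    pair w (fun j => q j + r j) = pair w q + pair w r := by
  classical
  rw [pair_eq_sum w (q := q) (s := hq.toFinset ∪ hr.toFinset) fun j h => by simp [h],
    pair_eq_sum w (q := r) (s := hq.toFinset ∪ hr.toFinset) fun j h => by simp [h],
    pair_eq_sum w (s := hq.toFinset ∪ hr.toFinset), ← Finset.sum_add_distrib]
  · refine Finset.sum_congr rfl fun j _ => ?_
    rw [mul_add]
    rfl
  · intro j h
    by_contra hj
    simp only [Finset.mem_union, Set.Finite.mem_toFinset, Set.mem_ofPred_eq, not_or, not_not] at hj
    exact h (by rw [hj.1, hj.2, add_zero])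

theorem finite_add {q r : I → K} (hq : {j | q j ≠ 0}.Finite) (hr : {j | r j ≠ 0}.Finite) :
    {j | q j + r j ≠ 0}.Finite :=
  (hq.union hr).subset fun j h => by
    by_contra hj
    simp only [Set.mem_union, Set.mem_ofPred_eq, not_or, not_not] at hj
    exact h (by rw [hj.1, hj.2, add_zero])

theorem pair_smul (c : ℂ) (w : I → K) {q : I → K} (hq : {j | q j ≠ 0}.Finite) :
    pair w (fun j => c • q j) = c * pair w q := by
  classical
  rw [pair_eq_sum w (q := q) (s := hq.toFinset) fun j h => by simp [h],
    pair_eq_sum w (s := hq.toFinset) fun j h => by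
      by_contra hj
      simp only [Set.Finite.mem_toFinset, Set.mem_ofPred_eq, not_not] at hj
      exact h (by rw [hj, smul_zero]), Finset.mul_sum]
  refine Finset.sum_congr rfl fun j _ => ?_
  rw [smul_eq_cst_mul, ← mul_assoc, mul_comm (w j), mul_assoc, ← smul_eq_cst_mul]
  rfl

theorem finite_smul (c : ℂ) {q : I → K} (hq : {j | q j ≠ 0}.Finite) : {j | c • q j ≠ 0}.Finite :=
  hq.subset fun j h => by
    by_contra hj
    simp only [Set.mem_ofPred_eq, not_not] at hj
    exact h (by rw [hj, smul_zero])

variable {F G : (I → K) → ℂ} {b q r : I → K}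

theorem IsGrad.add (hF : IsGrad F b q) (hG : IsGrad G b r) :
    IsGrad (F + G) b fun j => q j + r j := by
  refine ⟨finite_add hF.1 hG.1, fun u hu => ?_⟩
  rw [pair_add hF.1 hG.1]
  exact (hF.2 u hu).add (hG.2 u hu)

theorem IsGrad.smul (hF : IsGrad F b q) (c : ℂ) : IsGrad (c • F) b fun j => c • q j := by
  refine ⟨finite_smul c hF.1, fun u hu => ?_⟩
  rw [pair_smul c _ hF.1]
  exact (hF.2 u hu).const_mul c

theorem IsGrad.mul (hF : IsGrad F b q) (hG : IsGrad G b r) :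
    IsGrad (F * G) b fun j => F b • r j + G b • q j := by
  refine ⟨finite_add (finite_smul _ hG.1) (finite_smul _ hF.1), fun u hu => ?_⟩
  rw [pair_add (finite_smul _ hG.1) (finite_smul _ hF.1), pair_smul _ _ hG.1, pair_smul _ _ hF.1]
  have hb : (fun j => evL 0 (u j)) = b := funext hu
  refine ((hF.2 u hu).mul (hG.2 u hu)).congr_deriv ?_
  rw [hb]
  ring

end Pair

/-! ### The algebra of regular functions -/

section RegularAlgebra

variable {F G : (ℕ → K) → ℂ}

theorem RegWith.mono {k k' : ℕ} {P : ℕ → MvPolynomial (Fin k × ℤ) ℂ} (hF : RegWith k P F)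
    (h : k ≤ k') : RegWith k' (fun m => MvPolynomial.rename
      (fun v : Fin k × ℤ => ((Fin.castLE h v.1, v.2) : Fin k' × ℤ)) (P m)) F := by
  intro m u hu
  rw [hF m u fun i hi => hu i (by omega), MvPolynomial.eval_rename]
  rfl

theorem IsRegularSeq.exists_common (hF : IsRegularSeq F) (hG : IsRegularSeq G) :
    ∃ k P P', RegWith k P F ∧ RegWith k P' G := by
  obtain ⟨k, P, hP⟩ := isRegularSeq_iff.1 hF
  obtain ⟨k', P', hP'⟩ := isRegularSeq_iff.1 hG
  exact ⟨max k k', _, _, hP.mono (le_max_left k k'), hP'.mono (le_max_right k k')⟩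

theorem IsRegularSeq.add (hF : IsRegularSeq F) (hG : IsRegularSeq G) : IsRegularSeq (F + G) := by
  obtain ⟨k, P, P', h, h'⟩ := hF.exists_common hG
  refine isRegularSeq_iff.2 ⟨k, fun m => P m + P' m, fun m u hu => ?_⟩
  rw [Pi.add_apply, h m u hu, h' m u hu, map_add]

theorem IsRegularSeq.mul (hF : IsRegularSeq F) (hG : IsRegularSeq G) : IsRegularSeq (F * G) := by
  obtain ⟨k, P, P', h, h'⟩ := hF.exists_common hG
  refine isRegularSeq_iff.2 ⟨k, fun m => P m * P' m, fun m u hu => ?_⟩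
  rw [Pi.mul_apply, h m u hu, h' m u hu, map_mul]

theorem isRegularSeq_const (c : ℂ) : IsRegularSeq fun _ => c :=
  isRegularSeq_iff.2 ⟨0, fun _ => MvPolynomial.C c, fun m u _ => by rw [MvPolynomial.eval_C]⟩

/-- The algebra of regular functions. -/
def regularSeq : Subalgebra ℂ ((ℕ → K) → ℂ) where
  carrier := {F | IsRegularSeq F}
  mul_mem' := IsRegularSeq.mul
  add_mem' := IsRegularSeq.add
  algebraMap_mem' c := isRegularSeq_const c

theorem IsRegularSeq.exists_isGrad (hF : IsRegularSeq F) (b : ℕ → K) : ∃ q, IsGrad F b q := by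
  obtain ⟨k, P, h⟩ := isRegularSeq_iff.1 hF
  obtain ⟨q, -, hq⟩ := h.exists_isGrad b
  exact ⟨q, hq⟩

theorem RegWith.bound {k : ℕ} {P : ℕ → MvPolynomial (Fin k × ℤ) ℂ} (hF : RegWith k P F)
    {b q : ℕ → K} (hq : IsGrad F b q) : ∀ j, k ≤ j → q j = 0 := by
  obtain ⟨q', h, hq'⟩ := hF.exists_isGrad b
  rw [hq.unique hq']
  exact h

theorem RegWith.isGrad_congr {k : ℕ} {P : ℕ → MvPolynomial (Fin k × ℤ) ℂ} (hF : RegWith k P F)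
    {b b' q : ℕ → K} (hb : ∀ j < k, b j = b' j) (hq : IsGrad F b q) : IsGrad F b' q := by
  have hq0 := hF.bound hq
  refine ⟨hq.1, fun u hu => ?_⟩
  have h := hq.2 (fun j => if j < k then u j else constL ℂ[X] (b j)) fun j => by
    split_ifs with hj
    · rw [hu, hb j hj]
    · rw [evL_constL]
  have e1 : ∀ s, (F fun j => evL s (if j < k then u j else constL ℂ[X] (b j)))
      = F fun j => evL s (u j) := by
    intro s
    obtain ⟨m, hm⟩ := exists_coeff_bounds (fun j => evL s (u j)) k
    rw [hF m _ hm, hF m]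
    · refine congrArg (fun a => MvPolynomial.eval a (P m)) (funext fun v => ?_)
      simp only [coeffs]
      rw [if_pos v.1.2]
    · intro i hi l hl
      rw [if_pos hi]
      exact hm i hi l hl
  simp only [e1] at h
  rw [pair_eq_sum_range hq0] at h ⊢
  refine h.congr_deriv (Finset.sum_congr rfl fun j hj => ?_)
  rw [if_pos (Finset.mem_range.1 hj)]

end RegularAlgebra

/-! ### Naturality of Hamiltonian data -/

section HamMap

variable {R S : Type} [CommRing R] [Algebra ℂ R] [CommRing S] [Algebra ℂ S]

theorem IsPolyMat.finite_col {lam : R} {A : ℕ → ℕ → R} (hA : IsPolyMat lam A) (b : ℕ → R) (j : ℕ) :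
    (Function.support fun k => b k * A k j).Finite := by
  obtain ⟨N, -, -, h, -⟩ := hA
  refine (Set.finite_Iic (j + N)).subset fun i hi => ?_
  by_contra hij
  exact hi (by simp only []; rw [h i j (by simpa using hij), mul_zero])

theorem IsHam.map {d : Derivation ℂ R R} {d' : Derivation ℂ S S} {lam : R} {b q w : ℕ → R}
    {x : ℕ → ℕ → R} (h : IsHam d lam b q x w) (φ : R →+* S) (hφ : ∀ x, φ (d x) = d' (φ x)) :
    IsHam d' (φ lam) (fun j => φ (b j)) (fun j => φ (q j)) (fun i j => φ (x i j))
      fun j => φ (w j) := by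
  refine ⟨h.polyMat.map (φ : R →+ S) fun x => map_mul φ _ _, fun i => by rw [h.col],
    fun i j => ?_, fun j => ?_⟩
  · rw [h.step i j, map_add, map_add, hφ, map_mul]
  · rw [h.row j, map_sub, map_add, map_add, hφ, map_mul]
    congr 1
    refine ((φ : R →+ S).map_finsum (h.polyMat.finite_col b j)).trans (finsum_congr fun k => ?_)
    exact map_mul φ _ _

end HamMap

/-! ### The reduced bracket in Frobenius coordinates -/

section Bracket

open LoopModel

variable {lam : ℂ}

theorem ham_of_isHam {b q w : ℕ → K} {x : ℕ → ℕ → K} (h : IsHam (theta ℂ) (cst lam) b q x w) :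
    (frobSlice lam).Ham b q (algOf h.polyMat) w := ⟨h.col, vec_of_isHam h⟩

theorem Ham.step {b q w : ℕ → K} {x : (barGl lam).Alg} (h : (frobSlice lam).Ham b q x w)
    (i j : ℕ) : x.mat i j = x.mat (i + 1) (j + 1) + theta ℂ (x.mat (i + 1) j) + q (i + 1) * b j := by
  have h2 := congrArg (fun a => a.mat (i + 1) j) h.2
  have h3 : (vec (toAlg (barSlice lam 0 b)) x).mat (i + 1) j = 0 :=
    h2.trans (rowAt_ne (Nat.succ_ne_zero i) w j)
  rw [vec_barSlice_succ] at h3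
  have h1 : x.mat (i + 1) 0 = q (i + 1) := h.1 (i + 1)
  rw [← h1]
  linear_combination -h3

/-- The step equation computes each column from the previous one, so the range of possibly nonzero
rows grows by at most one per column. -/
theorem Ham.col_eq_zero {b q w : ℕ → K} {x : (barGl lam).Alg} (h : (frobSlice lam).Ham b q x w)
    {k : ℕ} (hq : ∀ i, k ≤ i → q i = 0) (j i : ℕ) (hi : k + j ≤ i) : x.mat i j = 0 := by
  induction j generalizing i with
  | zero => exact (h.1 i).trans (hq i (by omega))
  | succ j ih =>
    obtain ⟨i, rfl⟩ : ∃ i', i = i' + 1 := ⟨i - 1, by omega⟩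
    have := Ham.step h i j
    rw [ih i (by omega), ih (i + 1) (by omega), hq (i + 1) (by omega), map_zero, zero_mul] at this
    simpa using this.symm

/-- The difference of two solutions has zero first column, hence vanishes on and below the diagonal
by the step equation. Above it, each diagonal in turn is constant along the rows and has a zero at
lam - 1. -/
theorem Ham.unique {b q w w' : ℕ → K} {x x' : (barGl lam).Alg} (h : (frobSlice lam).Ham b q x w)
    (h' : (frobSlice lam).Ham b q x' w') : x = x' := by
  set D : ℕ → ℕ → K := fun i j => x.mat i j - x'.mat i j with hD
  have hstep : ∀ i j, D i j = D (i + 1) (j + 1) + theta ℂ (D (i + 1) j) := fun i j => by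
    simp only [hD]
    rw [Ham.step h i j, Ham.step h' i j, map_sub]
    ring
  have hlow : ∀ j i, j ≤ i → D i j = 0 := by
    intro j
    induction j with
    | zero => exact fun i _ => sub_eq_zero.2 ((h.1 i).trans (h'.1 i).symm)
    | succ j ih =>
      intro i hi
      obtain ⟨i, rfl⟩ : ∃ i', i = i' + 1 := ⟨i - 1, by omega⟩
      have := hstep i j
      rw [ih i (by omega), ih (i + 1) (by omega), map_zero, add_zero] at this
      exact this.symm
  obtain ⟨-, R₁, Q₁, -, h1, h2⟩ := mem_barGl.1 x.mem
  obtain ⟨-, R₂, Q₂, -, h1', h2'⟩ := mem_barGl.1 x'.mem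
  have hup : ∀ n i, D i (i + n) = 0 := by
    intro n
    induction n with
    | zero => exact fun i => hlow _ _ le_rfl
    | succ n ih =>
      intro i
      refine eq_zero_of_difference_eq_zero (u := fun i => D i (i + (n + 1)))
        (U := Q₁ (n + 1 : ℤ) - Q₂ (n + 1 : ℤ)) (i₀ := 0) (R₀ := max R₁ R₂)
        (a := cst lam - ((1 : ℤ) : K)) (fun i _ => ?_) (fun i hi => ?_) ?_ i (Nat.zero_le i)
      · have := hstep i (i + (n + 1))
        rw [show D (i + 1) (i + (n + 1)) = 0 by rw [show i + (n + 1) = i + 1 + n by ring]; exact ih _,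
          map_zero, add_zero, show i + (n + 1) + 1 = i + 1 + (n + 1) by ring] at this
        exact this.symm
      · simp only [hD]
        rw [h1 i _ (le_of_max_le_left hi), h1' i _ (le_of_max_le_right hi), eval_sub]
        congr <;> (push_cast; ring)
      · rw [eval_sub, h2 _ _ le_rfl (by omega), h2' _ _ le_rfl (by omega), sub_zero]
  refine Alg.ext ?_
  funext i j
  refine sub_eq_zero.1 ?_
  rcases le_or_gt j i with hij | hij
  · exact hlow j i hij
  · obtain ⟨n, rfl⟩ := Nat.exists_eq_add_of_le hij.le
    exact hup n i

theorem Ham.row_unique {b q w w' : ℕ → K} {x x' : (barGl lam).Alg}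
    (h : (frobSlice lam).Ham b q x w) (h' : (frobSlice lam).Ham b q x' w') : w = w' := by
  funext j
  have h2 := congrArg (fun a => a.mat 0 j) h.2
  have h2' := congrArg (fun a => a.mat 0 j) h'.2
  rw [← Ham.unique h h', h2] at h2'
  exact ((rowAt_self 0 w j).symm.trans h2').trans (rowAt_self 0 w' j)

open Classical in
/-- The differential of a function of a sequence of Laurent series. -/
def grad (F : (ℕ → K) → ℂ) (b : ℕ → K) : ℕ → K :=
  if h : ∃ q, IsGrad F b q then h.choose else 0

theorem isGrad_grad {F : (ℕ → K) → ℂ} (hF : IsRegularSeq F) (b : ℕ → K) : IsGrad F b (grad F b) := by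
  rw [grad, dif_pos (hF.exists_isGrad b)]
  exact (hF.exists_isGrad b).choose_spec

open Classical in
/-- The Hamiltonian vector field of a function with the differential `q` at `b`. -/
def hamField (lam : ℂ) (b q : ℕ → K) : ℕ → K :=
  if h : ∃ w x, (frobSlice lam).Ham b q x w then h.choose else 0

theorem hamField_eq {b q w : ℕ → K} {x : (barGl lam).Alg} (h : (frobSlice lam).Ham b q x w) :
    hamField lam b q = w := by
  have hex : ∃ w x, (frobSlice lam).Ham b q x w := ⟨w, x, h⟩
  rw [hamField, dif_pos hex]
  obtain ⟨x', hx'⟩ := hex.choose_spec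
  exact Ham.row_unique hx' h

/-- The reduced bracket in the coordinates given by the Frobenius matrices. -/
def seqBracket (lam : ℂ) (F G : (ℕ → K) → ℂ) (b : ℕ → K) : ℂ :=
  -pair (hamField lam b (grad F b)) (grad G b)

theorem seqBracket_eq {F G : (ℕ → K) → ℂ} (hF : IsRegularSeq F) (hG : IsRegularSeq G)
    {b q r w : ℕ → K} {x : (barGl lam).Alg} (hq : IsGrad F b q) (hr : IsGrad G b r)
    (h : (frobSlice lam).Ham b q x w) : seqBracket lam F G b = -pair w r := by
  rw [seqBracket, (isGrad_grad hF b).unique hq, (isGrad_grad hG b).unique hr, hamField_eq h]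

theorem exists_ham {b q : ℕ → K} (hq : {j | q j ≠ 0}.Finite) :
    ∃ x w, (frobSlice lam).Ham b q x w := (frobSlice lam).ham b q hq

theorem pair_eq_tau {b w r : ℕ → K} {z : (barGl lam).Alg} (hz : ∀ i, z.mat i 0 = r i)
    {x : (barGl lam).Alg} (hx : vec (toAlg (barSlice lam 0 b)) x = rowAt 0 w) :
    pair w r = tau (barGl lam) (vec (toAlg (barSlice lam 0 b)) x * z) := by
  rw [hx, tau_rowAt_mul]
  exact congrArg (pair w) (funext fun i => (hz i).symm)

theorem seqBracket_anticomm {F G : (ℕ → K) → ℂ} (hF : IsRegularSeq F) (hG : IsRegularSeq G)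
    (b : ℕ → K) : seqBracket lam F G b = -seqBracket lam G F b := by
  obtain ⟨x, w, hx⟩ := exists_ham (lam := lam) (b := b) (isGrad_grad hF b).1
  obtain ⟨y, w', hy⟩ := exists_ham (lam := lam) (b := b) (isGrad_grad hG b).1
  rw [seqBracket_eq hF hG (isGrad_grad hF b) (isGrad_grad hG b) hx,
    seqBracket_eq hG hF (isGrad_grad hG b) (isGrad_grad hF b) hy, pair_eq_tau hy.1 hx.2,
    pair_eq_tau hx.1 hy.2, tau_vec_mul]

theorem seqBracket_add_right {F G G' : (ℕ → K) → ℂ} (hF : IsRegularSeq F) (hG : IsRegularSeq G)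
    (hG' : IsRegularSeq G') (b : ℕ → K) :
    seqBracket lam F (G + G') b = seqBracket lam F G b + seqBracket lam F G' b := by
  have h1 := isGrad_grad hG b
  have h2 := isGrad_grad hG' b
  obtain ⟨x, w, hx⟩ := exists_ham (lam := lam) (b := b) (isGrad_grad hF b).1
  rw [seqBracket_eq hF hG (isGrad_grad hF b) h1 hx, seqBracket_eq hF hG' (isGrad_grad hF b) h2 hx,
    seqBracket_eq hF (hG.add hG') (isGrad_grad hF b) (h1.add h2) hx, pair_add h1.1 h2.1]
  ring

theorem seqBracket_smul_right {F G : (ℕ → K) → ℂ} (hF : IsRegularSeq F) (hG : IsRegularSeq G)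
    (c : ℂ) (hc : IsRegularSeq (c • G)) (b : ℕ → K) :
    seqBracket lam F (c • G) b = c * seqBracket lam F G b := by
  have h1 := isGrad_grad hG b
  obtain ⟨x, w, hx⟩ := exists_ham (lam := lam) (b := b) (isGrad_grad hF b).1
  rw [seqBracket_eq hF hG (isGrad_grad hF b) h1 hx,
    seqBracket_eq hF hc (isGrad_grad hF b) (h1.smul c) hx, pair_smul c _ h1.1]
  ring

theorem seqBracket_mul_right {F G H : (ℕ → K) → ℂ} (hF : IsRegularSeq F) (hG : IsRegularSeq G)
    (hH : IsRegularSeq H) (b : ℕ → K) :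
    seqBracket lam F (G * H) b = seqBracket lam F G b * H b + G b * seqBracket lam F H b := by
  have h1 := isGrad_grad hG b
  have h2 := isGrad_grad hH b
  obtain ⟨x, w, hx⟩ := exists_ham (lam := lam) (b := b) (isGrad_grad hF b).1
  rw [seqBracket_eq hF hG (isGrad_grad hF b) h1 hx, seqBracket_eq hF hH (isGrad_grad hF b) h2 hx,
    seqBracket_eq hF (hG.mul hH) (isGrad_grad hF b) (h1.mul h2) hx,
    pair_add (finite_smul _ h2.1) (finite_smul _ h1.1), pair_smul _ _ h2.1, pair_smul _ _ h1.1]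
  ring

theorem mul_rowAt_apply (y : (barGl lam).Alg) (w : ℕ → K) (i j : ℕ) :
    (y * rowAt 0 w).mat i j = y.mat i 0 * w j := by
  rw [Alg.mul_apply, finsum_eq_single _ 0]
  · rw [rowAt_self]
  · intro k hk
    rw [rowAt_ne hk, mul_zero]

theorem rowAt_mul_zero (y : (barGl lam).Alg) (w : ℕ → K) (j : ℕ) :
    (rowAt 0 w * y).mat 0 j = ∑ᶠ k, w k * y.mat k j := by
  rw [Alg.mul_apply]
  simp only [rowAt_self]

theorem rowAt_mul_succ (y : (barGl lam).Alg) (w : ℕ → K) (i j : ℕ) :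
    (rowAt 0 w * y).mat (i + 1) j = 0 := by
  rw [Alg.mul_apply]
  simp only [rowAt_ne (Nat.succ_ne_zero i), zero_mul, finsum_zero]

theorem barSlice_sub (b b' : ℕ → K) : toAlg (barSlice lam 0 b) - toAlg (barSlice lam 0 b')
    = rowAt 0 fun j => b j - b' j := by
  refine Alg.ext ?_
  funext i j
  rw [Alg.sub_mat, Matrix.sub_apply, barSlice_apply, barSlice_apply]
  rcases i with _ | i
  · rw [sliceMat_zero, sliceMat_zero, rowAt_self]
  · rw [sliceMat_succ, sliceMat_succ, sub_self, rowAt_ne (Nat.succ_ne_zero i)]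

/-- The bracket depends on finitely many coordinates of the point. -/
theorem pair_ham_congr {b b' q r w w' : ℕ → K} {x x' : (barGl lam).Alg} {k : ℕ}
    (hb : ∀ j < 2 * k, b j = b' j) (hq : ∀ j, k ≤ j → q j = 0) (hr : ∀ j, k ≤ j → r j = 0)
    (hx : (frobSlice lam).Ham b q x w) (hx' : (frobSlice lam).Ham b' q x' w') :
    pair w r = pair w' r := by
  obtain ⟨y, wy, hy⟩ := exists_ham (lam := lam) (b := b) (finite_of_bound hr)
  have hS := barSlice_sub (lam := lam) b b'
  set E : (barGl lam).Alg := rowAt 0 fun j => b j - b' j with hE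
  set S := toAlg (barSlice lam 0 b) with hSdef
  set S' := toAlg (barSlice lam 0 b') with hS'def
  have hv : vec S' y = vec S y - (y * E - E * y) := by
    rw [← hS]
    simp only [vec, gaugeField]
    noncomm_ring
  -- E has nonzero entries only in columns j ≥ 2k of its row. In the first column of z z' the row j
  -- involves only z_{jl} with l < k, and these vanish for j ≥ k + l. Hence the correction terms
  -- from changing the point have zero trace.
  have hcol : ∀ (z z' : (barGl lam).Alg) (p : ℕ → K), (∀ j i, k + j ≤ i → z.mat i j = 0) →
      (∀ i, z'.mat i 0 = p i) → (∀ i, k ≤ i → p i = 0) → tau (barGl lam) (E * (z * z')) = 0 := by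
    intro z z' p hz hz' hp
    rw [hE, tau_rowAt_mul, pair]
    rw [finsum_eq_zero_of_forall_eq_zero]
    · rfl
    intro j
    rcases lt_or_ge j (2 * k) with h | h
    · rw [hb j h, sub_self, zero_mul]
    · refine mul_eq_zero_of_right _ ?_
      rw [Alg.mul_apply]
      refine finsum_eq_zero_of_forall_eq_zero fun l => ?_
      rw [hz']
      rcases lt_or_ge l k with h' | h'
      · rw [hz l j (by omega), zero_mul]
      · rw [hp l h', mul_zero]
  have h1 := hcol x' y r (Ham.col_eq_zero hx' hq) hy.1 hr
  have h2 := hcol y x' q (Ham.col_eq_zero hy hr) hx'.1 hq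
  rw [pair_eq_tau hy.1 hx.2, pair_eq_tau hy.1 hx'.2, tau_vec_mul, tau_vec_mul S', hv, sub_mul,
    map_sub]
  have e1 : tau (barGl lam) (vec S y * x) = tau (barGl lam) (vec S y * x') := by
    rw [← pair_eq_tau hx.1 hy.2, ← pair_eq_tau hx'.1 hy.2]
  have e2 : tau (barGl lam) ((y * E - E * y) * x') = 0 := by
    have : tau (barGl lam) (y * E * x') = tau (barGl lam) (E * (x' * y)) := by
      rw [mul_assoc, tau_mul_comm, mul_assoc]
    rw [sub_mul, map_sub, this, h1, mul_assoc, h2, sub_zero]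
  rw [e1, e2, sub_zero]

theorem theta_constL {A : Type} [CommRing A] [Algebra ℂ A] (c : ℂ) :
    theta A (constL A (cst c)) = 0 := by
  rw [cst_eq, AlgHom.commutes]
  exact (theta A).map_algebraMap c

theorem coeff_pair_mapL {A : Type} [CommRing A] [Algebra ℂ A] (φ : A →ₐ[ℂ] ℂ)
    (w r : ℕ → LaurentSeries A) {k : ℕ} (hr : ∀ j, k ≤ j → r j = 0) :
    pair (fun j => mapL φ (w j)) (fun j => mapL φ (r j))
      = φ (∑ j ∈ Finset.range k, (w j * r j).coeff 0) := by
  rw [pair_eq_sum_range (k := k) fun j hj => by rw [hr j hj, map_zero], map_sum]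
  refine Finset.sum_congr rfl fun j _ => ?_
  rw [← map_mul, mapL_coeff]

/-- The Laurent coefficients of order at least -m are independent variables, so that one computation
covers all sequences with poles bounded by m. -/
theorem exists_generic (N m : ℕ) : ∃ U : ℕ → LaurentSeries (MvPolynomial (Fin N × ℤ) ℂ),
    ∀ u : ℕ → K, PolesLE N m u → ∀ j,
      mapL (MvPolynomial.aeval (coeffs N u)) (U j) = if j < N then u j else 0 := by
  let f : Fin N → ℤ → MvPolynomial (Fin N × ℤ) ℂ := fun j l =>
    if l < -(m : ℤ) then 0 else MvPolynomial.X (j, l)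
  have hf : ∀ j, BddBelow (Function.support (f j)) := fun j => ⟨-(m : ℤ), fun l hl => by
    by_contra h
    exact hl (if_pos (not_le.1 h))⟩
  refine ⟨fun j => if h : j < N then HahnSeries.ofSuppBddBelow (f ⟨j, h⟩) (hf ⟨j, h⟩) else 0,
    fun u hu j => ?_⟩
  by_cases hj : j < N
  · simp only []
    rw [dif_pos hj, if_pos hj]
    ext l
    rw [mapL_coeff]
    show MvPolynomial.aeval (coeffs N u) (f ⟨j, hj⟩ l) = _
    simp only [f]
    split_ifs with h
    · rw [map_zero, hu j hj l h]
    · rw [MvPolynomial.aeval_X]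
      rfl
  · simp only []
    rw [dif_neg hj, if_neg hj, map_zero]

/-- The differentials and the Hamiltonian data exist at the generic sequence, with polynomials as
Laurent coefficients, and specialize to every point. Cutting the sequence after 2k members is
allowed by `pair_ham_congr`. -/
theorem isRegularSeq_seqBracket {F G : (ℕ → K) → ℂ} (hF : IsRegularSeq F) (hG : IsRegularSeq G) :
    IsRegularSeq (seqBracket lam F G) := by
  obtain ⟨k, P, P', hP, hP'⟩ := hF.exists_common hG
  refine ⟨2 * k, fun m => ?_⟩
  obtain ⟨U, hU⟩ := exists_generic (2 * k) m
  obtain ⟨q, hq0, hq⟩ := hP.exists_grad U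
  obtain ⟨r, hr0, hr⟩ := hP'.exists_grad U
  obtain ⟨x, w, hx⟩ := exists_isHam (theta_constL (A := MvPolynomial (Fin (2 * k) × ℤ) ℂ) lam) U hq0
  refine ⟨-∑ j ∈ Finset.range k, (w j * r j).coeff 0, fun u hu => ?_⟩
  set φ : MvPolynomial (Fin (2 * k) × ℤ) ℂ →ₐ[ℂ] ℂ := MvPolynomial.aeval (coeffs (2 * k) u) with hφ
  have hUu : ∀ j < 2 * k, mapL φ (U j) = u j := fun j hj => by
    rw [hU u hu, if_pos hj]
  have h1 := hx.map (φ := (mapL φ : _ →+* K)) (d' := theta ℂ) fun x => mapL_theta φ x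
  have h2 : IsHam (theta ℂ) (cst lam) (fun j => mapL φ (U j)) (fun j => mapL φ (q j))
      (fun i j => mapL φ (x i j)) fun j => mapL φ (w j) := by
    have e : mapL φ (constL (MvPolynomial (Fin (2 * k) × ℤ) ℂ) (cst lam)) = cst lam :=
      mapL_constL φ (cst lam)
    rw [← e]
    exact h1
  have hq' := hP.isGrad_congr (b' := u) (fun j hj => hUu j (by omega)) (hq φ)
  have hr' := hP'.isGrad_congr (b' := u) (fun j hj => hUu j (by omega)) (hr φ)
  obtain ⟨y, v, hy⟩ := exists_ham (lam := lam) (b := u) hq'.1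
  rw [seqBracket_eq hF hG hq' hr' hy,
    pair_ham_congr (k := k) (fun j hj => (hUu j hj).symm) (hP.bound hq') (hP'.bound hr') hy
      (ham_of_isHam h2), coeff_pair_mapL φ w r hr0, map_neg]
  rfl

/-- The bracket depends polynomially on the parameter. -/
theorem exists_seqBracket_eq_eval {F G : (ℕ → K) → ℂ} (hF : IsRegularSeq F) (hG : IsRegularSeq G)
    (b : ℕ → K) : ∃ p : ℂ[X], ∀ lam, seqBracket lam F G b = p.eval lam := by
  obtain ⟨k, P, P', hP, hP'⟩ := hF.exists_common hG
  obtain ⟨q, hq0, hq⟩ := hP.exists_isGrad b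
  obtain ⟨r, hr0, hr⟩ := hP'.exists_isGrad b
  -- The size is taken to be the formal parameter, a constant for θ; evaluating the resulting
  -- Hamiltonian data gives those for every lam.
  obtain ⟨x, w, hx⟩ := exists_isHam theta_parL (fun j => constL ℂ[X] (b j))
    (q := fun j => constL ℂ[X] (q j)) (k := k) fun j hj => by rw [hq0 j hj, map_zero]
  refine ⟨-∑ j ∈ Finset.range k, (w j * constL ℂ[X] (r j)).coeff 0, fun lam => ?_⟩
  have h1 := hx.map (φ := (evL lam : _ →+* K)) (d' := theta ℂ) fun x => evL_theta lam x
  simp only [RingHom.coe_coe, evL_parL, evL_constL] at h1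
  have h2 := coeff_pair_mapL (aeval lam) w (fun j => constL ℂ[X] (r j)) (k := k)
    fun j hj => by rw [hr0 j hj, map_zero]
  simp only [mapL_constL] at h2
  rw [seqBracket_eq hF hG hq hr (ham_of_isHam h1), eval_neg, ← Polynomial.coe_aeval_eq_eval, ← h2]
  rfl

/-- The second derivatives of a regular function at a point, as a bilinear form. -/
theorem IsRegularSeq.exists_hessian {F : (ℕ → K) → ℂ} (hF : IsRegularSeq F) (b : ℕ → K) :
    ∃ (q : (ℕ → K) → ℕ → LaurentSeries ℂ[X]), (∃ k, ∀ δ j, k ≤ j → q δ j = 0) ∧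
      (∀ δ s, IsGrad F (fun j => evL s (lineL b δ j)) fun j => evL s (q δ j)) ∧
      ∀ δ ε, pair ε (fun j => d0L (q δ j)) = pair δ fun j => d0L (q ε j) := by
  obtain ⟨k, P, hP⟩ := isRegularSeq_iff.1 hF
  choose q hq0 hq using fun δ => hP.exists_grad (lineL b δ)
  refine ⟨q, ⟨k, hq0⟩, fun δ s => hq δ (aeval s), fun δ ε => ?_⟩
  have := hP.hessian_symm (u := lineL b δ) (u' := lineL b ε)
    (fun j => by rw [evL_zero_lineL, evL_zero_lineL]) (hq0 δ) (hq0 ε)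
    (fun s => hq δ (aeval s)) fun s => hq ε (aeval s)
  simpa only [d0L_lineL] using this

/-- The function {G, H} is differentiated along the Hamiltonian direction of F. Differentiating
vec_S(y) = (row of w_G) along the line, where S moves with velocity vec_S(x), gives the row of the
derivative of w_G as vec_S(y') + [y, vec_S(x)]. By antisymmetry the first term becomes a second
derivative term, the commutator becomes the trace. -/
theorem seqBracket_seqBracket {F G H : (ℕ → K) → ℂ} (hF : IsRegularSeq F) (hG : IsRegularSeq G)
    (hH : IsRegularSeq H) {b qF qG qH wF wG wH : ℕ → K} {x y z : (barGl lam).Alg}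
    (hqF : IsGrad F b qF) (hqG : IsGrad G b qG) (hqH : IsGrad H b qH)
    (hx : (frobSlice lam).Ham b qF x wF) (hy : (frobSlice lam).Ham b qG y wG)
    (hz : (frobSlice lam).Ham b qH z wH) {g h : ℕ → LaurentSeries ℂ[X]} {k : ℕ}
    (hg0 : ∀ j, k ≤ j → g j = 0) (hh0 : ∀ j, k ≤ j → h j = 0)
    (hg : ∀ s, IsGrad G (fun j => evL s (lineL b wF j)) fun j => evL s (g j))
    (hh : ∀ s, IsGrad H (fun j => evL s (lineL b wF j)) fun j => evL s (h j)) :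
    seqBracket lam F (seqBracket lam G H) b
      = -pair wH (fun j => d0L (g j)) + pair wG (fun j => d0L (h j))
        + tau (barGl lam) ((y * vec (toAlg (barSlice lam 0 b)) x
          - vec (toAlg (barSlice lam 0 b)) x * y) * z) := by
  have hK := isRegularSeq_seqBracket (lam := lam) hG hH
  obtain ⟨κ, hκ⟩ := hK.exists_isGrad b
  rw [seqBracket_eq hF hK hqF hκ hx]
  have hd := hκ.2 (lineL b wF) (evL_zero_lineL b wF)
  simp only [d0L_lineL] at hd
  obtain ⟨yh, wh, hyh⟩ := exists_isHam (theta_constL (A := ℂ[X]) lam) (lineL b wF) hg0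
  have hev : ∀ s, IsHam (theta ℂ) (cst lam) (fun j => evL s (lineL b wF j)) (fun j => evL s (g j))
      (fun i j => evL s (yh i j)) fun j => evL s (wh j) := by
    intro s
    have h1 := hyh.map (φ := (evL s : _ →+* K)) (d' := theta ℂ) fun x => evL_theta s x
    simpa only [RingHom.coe_coe, evL_constL] using h1
  have hcurve : (fun s => seqBracket lam G H fun j => evL s (lineL b wF j))
      = fun s => (-∑ j ∈ Finset.range k, (wh j * h j).coeff 0).eval s := by
    funext s
    rw [seqBracket_eq hG hH (hg s) (hh s) (ham_of_isHam (hev s)), eval_neg,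
      ← Polynomial.coe_aeval_eq_eval, ← coeff_pair_mapL (aeval s) wh h hh0]
    rfl
  rw [hcurve] at hd
  have hd' := hd.unique (Polynomial.hasDerivAt _ 0)
  have hb0 : (fun j => evL 0 (lineL b wF j)) = b := funext (evL_zero_lineL b wF)
  have hg1 : (fun j => evL 0 (g j)) = qG := by
    have := hg 0
    rw [hb0] at this
    exact this.unique hqG
  have hh1 : (fun j => evL 0 (h j)) = qH := by
    have := hh 0
    rw [hb0] at this
    exact this.unique hqH
  have hH0 := hev 0
  rw [hb0, hg1] at hH0
  have hyu := Ham.unique (ham_of_isHam hH0) hy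
  have hwu := Ham.row_unique (ham_of_isHam hH0) hy
  have hy0 : ∀ i j, evL 0 (yh i j) = y.mat i j := fun i j =>
    congrArg (fun a : (barGl lam).Alg => a.mat i j) hyu
  have e0 : ∀ x : LaurentSeries ℂ[X], ∀ n, eval 0 (derivative (x.coeff n)) = (d0L x).coeff n :=
    fun x n => by
      rw [d0L_coeff, ← Polynomial.coeff_zero_eq_eval_zero, Polynomial.coeff_derivative]
      simp
  have hd2 : pair wF κ = -(pair (fun j => d0L (wh j)) qH + pair wG fun j => d0L (h j)) := by
    rw [hd', derivative_neg, eval_neg, derivative_sum, eval_finsetSum,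
      pair_eq_sum_range (q := qH) (k := k) fun j hj => by
        rw [← hh1]
        simp only []
        rw [hh0 j hj, map_zero],
      pair_eq_sum_range (k := k) fun j hj => by rw [hh0 j hj, map_zero], ← Finset.sum_add_distrib]
    congr 1
    refine Finset.sum_congr rfl fun j _ => ?_
    rw [e0, d0L_mul, ← hh1, ← hwu]
    rfl
  have hyd : IsPolyMat (cst lam) fun i j => d0L (yh i j) :=
    hyh.polyMat.map (d0L : LaurentSeries ℂ[X] →+ K) fun x => by
      show d0L (x * constL ℂ[X] (cst lam)) = d0L x * cst lam
      rw [d0L_mul, d0L_constL, evL_constL, mul_zero, add_zero]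
  set S := toAlg (barSlice lam 0 b) with hS
  -- The linearized Hamiltonian equations; `vec S x` enters because it is the row `wF` along which
  -- the point moves.
  have hvec : (rowAt 0 fun j => d0L (wh j) : (barGl lam).Alg)
      = vec S (algOf hyd) + (y * vec S x - vec S x * y) := by
    have hxS : vec S x = rowAt 0 wF := hx.2
    rw [hxS]
    refine Alg.ext ?_
    funext i j
    rw [Alg.add_mat, Alg.sub_mat, Matrix.add_apply, Matrix.sub_apply, mul_rowAt_apply]
    have hcol : y.mat i 0 = evL 0 (g i) := by
      rw [← hy0, hyh.col]
    rcases i with _ | i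
    · rw [rowAt_self, rowAt_mul_zero, vec_barSlice_zero, hyh.row]
      show _ = d0L (yh 0 0) * b j + d0L (yh 0 (j + 1)) - 0 * j * d0L (yh 0 j)
        - (∑ᶠ k, b k * d0L (yh k j)) + theta ℂ (d0L (yh 0 j)) + _
      have hfs : d0L (∑ᶠ k, lineL b wF k * yh k j)
          = (∑ᶠ k, b k * d0L (yh k j)) + ∑ᶠ k, wF k * y.mat k j := by
        refine ((d0L : LaurentSeries ℂ[X] →+ K).map_finsum
          (hyh.polyMat.finite_col (lineL b wF) j)).trans ?_
        have hm := mem_barGl.1 y.mem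
        rw [← finsum_add_distrib (hyd.finite_col b j) (hm.finite_col wF j)]
        refine finsum_congr fun k => ?_
        show d0L (lineL b wF k * yh k j) = _
        rw [d0L_mul, d0L_lineL, evL_zero_lineL, hy0]
        ring
      rw [map_sub, hfs, map_add, map_add, d0L_theta, d0L_mul, d0L_lineL, evL_zero_lineL, hcol,
        hyh.col]
      ring
    · rw [rowAt_ne (Nat.succ_ne_zero i), rowAt_mul_succ, vec_barSlice_succ]
      show 0 = d0L (yh (i + 1) 0) * b j + d0L (yh (i + 1) (j + 1)) - 0 * j * d0L (yh (i + 1) j)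
        - (d0L (yh i j) - 0 * ((i : K) + 1) * d0L (yh (i + 1) j)) + theta ℂ (d0L (yh (i + 1) j)) + _
      have h1 := congrArg d0L (hyh.step i j)
      rw [map_add, map_add, d0L_theta, d0L_mul, d0L_lineL, evL_zero_lineL] at h1
      rw [hyh.col, hcol]
      linear_combination h1
  have e1 : pair (fun j => d0L (wh j)) qH = -pair wH (fun j => d0L (g j))
      + tau (barGl lam) ((y * vec S x - vec S x * y) * z) := by
    have h1 : pair (fun j => d0L (wh j)) qH
        = tau (barGl lam) ((rowAt 0 fun j => d0L (wh j)) * z) := by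
      rw [tau_rowAt_mul]
      exact congrArg (pair _) (funext fun i => (hz.1 i).symm)
    rw [h1, hvec, add_mul, map_add, tau_vec_mul]
    congr 2
    rw [show vec S z = rowAt 0 wH from hz.2, tau_rowAt_mul]
    refine congrArg (pair wH) (funext fun i => ?_)
    show d0L (yh i 0) = d0L (g i)
    rw [hyh.col]
  rw [hd2, e1]
  ring

/-- The six second derivative terms cancel in pairs by symmetry of the Hessians, and the three
traces cancel by `trace_gaugeField_cyclic`. -/
theorem seqBracket_jacobi {F G H : (ℕ → K) → ℂ} (hF : IsRegularSeq F) (hG : IsRegularSeq G)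
    (hH : IsRegularSeq H) (b : ℕ → K) :
    seqBracket lam F (seqBracket lam G H) b + seqBracket lam G (seqBracket lam H F) b
      + seqBracket lam H (seqBracket lam F G) b = 0 := by
  obtain ⟨f, ⟨k₁, hf0⟩, hf, hf'⟩ := hF.exists_hessian b
  obtain ⟨g, ⟨k₂, hg0⟩, hg, hg'⟩ := hG.exists_hessian b
  obtain ⟨h, ⟨k₃, hh0⟩, hh, hh'⟩ := hH.exists_hessian b
  set k := k₁ + k₂ + k₃
  have hqF := isGrad_grad hF b
  have hqG := isGrad_grad hG b
  have hqH := isGrad_grad hH b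
  obtain ⟨x, u, hx⟩ := exists_ham (lam := lam) (b := b) hqF.1
  obtain ⟨y, v, hy⟩ := exists_ham (lam := lam) (b := b) hqG.1
  obtain ⟨z, w, hz⟩ := exists_ham (lam := lam) (b := b) hqH.1
  rw [seqBracket_seqBracket hF hG hH hqF hqG hqH hx hy hz (k := k)
      (fun j hj => hg0 _ j (by omega)) (fun j hj => hh0 _ j (by omega)) (hg u) (hh u),
    seqBracket_seqBracket hG hH hF hqG hqH hqF hy hz hx (k := k)
      (fun j hj => hh0 _ j (by omega)) (fun j hj => hf0 _ j (by omega)) (hh v) (hf v),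
    seqBracket_seqBracket hH hF hG hqH hqF hqG hz hx hy (k := k)
      (fun j hj => hf0 _ j (by omega)) (fun j hj => hg0 _ j (by omega)) (hf w) (hg w),
    hg' u w, hh' u v, hf' v w]
  have := trace_gaugeField_cyclic (thetaAlg_mul (g := barGl lam)) tau_mul_comm tau_theta
    (toAlg (barSlice lam 0 b)) x y z
  linear_combination this

/-- The Poisson structure of the reduced space in the coordinates given by the Frobenius
matrices. -/
def seqPoisson (lam : ℂ) : PoissonStructure (ℕ → K) where
  functions := regularSeq
  bracket := LinearMap.mk₂ ℂ
    (fun F G => ⟨seqBracket lam F G, isRegularSeq_seqBracket F.2 G.2⟩)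
    (fun F F' G => Subtype.ext (funext fun b => by
      show seqBracket lam (F + F' : (ℕ → K) → ℂ) G b = seqBracket lam F G b + seqBracket lam F' G b
      rw [seqBracket_anticomm (IsRegularSeq.add F.2 F'.2) G.2, seqBracket_add_right G.2 F.2 F'.2,
        seqBracket_anticomm F.2 G.2, seqBracket_anticomm F'.2 G.2]
      ring))
    (fun c F G => Subtype.ext (funext fun b => by
      have hc : IsRegularSeq (c • (F : (ℕ → K) → ℂ)) := (c • F).2
      show seqBracket lam (c • (F : (ℕ → K) → ℂ)) G b = c * seqBracket lam F G b
      rw [seqBracket_anticomm hc G.2, seqBracket_smul_right G.2 F.2 c hc,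
        seqBracket_anticomm F.2 G.2]
      ring))
    (fun F G G' => Subtype.ext (funext fun b => seqBracket_add_right F.2 G.2 G'.2 b))
    (fun c F G => Subtype.ext (funext fun b => seqBracket_smul_right F.2 G.2 c (c • G).2 b))
  bracket_self F := Subtype.ext (funext fun b => by
    show seqBracket lam F F b = 0
    have := seqBracket_anticomm (lam := lam) F.2 F.2 b
    linear_combination (1 / 2 : ℂ) * this)
  jacobi F G H := Subtype.ext (funext fun b => seqBracket_jacobi F.2 G.2 H.2 b)
  leibniz F G H := Subtype.ext (funext fun b => seqBracket_mul_right F.2 G.2 H.2 b)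

end Bracket

/-! ### Regular functions on the fiber -/

/-- Polynomials of bounded degree with prescribed roots are combinations, with complex polynomials
as coefficients, of their values at finitely many natural numbers. -/
theorem exists_interpolation (lam : ℂ) (R d : ℕ) : ∃ R' : ℕ, R ≤ R' ∧ ∀ n : ℕ, ∃ l : ℕ → ℂ[X],
    (∀ p < d + 1, ∀ r : ℤ, 1 ≤ r → r ≤ n → (l p).eval (lam - r) = 0) ∧
    ∀ q : K[X], q.natDegree ≤ d → (∀ r : ℤ, 1 ≤ r → r ≤ n → q.eval (cst lam - r) = 0) →
      q = ∑ p ∈ Finset.range (d + 1), C (q.eval ((R' + p : ℕ) : K)) * (l p).map (algebraMap ℂ K) := by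
  -- With row numbers beyond the absolute value of lam, the interpolation nodes R' + p never
  -- coincide with the zeros lam - r.
  obtain ⟨M, hM⟩ := exists_nat_gt ‖lam‖
  refine ⟨max R M, le_max_left R M, fun n => ?_⟩
  set R' := max R M with hR'
  -- The first d + 1 nodes are row numbers, the remaining n are lam - 1, …, lam - n. The latter
  -- contribute nothing to the interpolation formula, since the values there are zero.
  let v : ℕ → ℂ := fun t => if t < d + 1 then ((R' + t : ℕ) : ℂ) else lam - ((t - d : ℕ) : ℂ)
  have hne : ∀ a b : ℕ, ((R' + a : ℕ) : ℂ) ≠ lam - (b : ℂ) := by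
    intro a b h
    have h1 : lam = ((R' + a + b : ℕ) : ℂ) := by
      push_cast at h ⊢
      linear_combination -h
    rw [h1, Complex.norm_natCast] at hM
    have h2 : R' + a + b < M := by exact_mod_cast hM
    have := le_max_right R M
    omega
  have hv : Set.InjOn v (Finset.range (d + 1 + n)) := by
    intro s hs t ht h
    simp only [v] at h
    split_ifs at h with h1 h2 h2
    · have : R' + s = R' + t := by exact_mod_cast h
      omega
    · exact absurd h (hne _ _)
    · exact absurd h.symm (hne _ _)
    · have : s - d = t - d := by
        have : ((s - d : ℕ) : ℂ) = ((t - d : ℕ) : ℂ) := by linear_combination -h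
        exact_mod_cast this
      omega
  have hroot : ∀ r : ℤ, 1 ≤ r → r ≤ n → ∃ t ∈ Finset.range (d + 1 + n), d + 1 ≤ t ∧
      v t = lam - r := by
    intro r h1 h2
    refine ⟨d + r.toNat, Finset.mem_range.2 (by omega), by omega, ?_⟩
    simp only [v]
    rw [if_neg (by omega), Nat.add_sub_cancel_left]
    congr 1
    have : ((r.toNat : ℤ) : ℂ) = (r : ℂ) := by rw [Int.toNat_of_nonneg (by omega)]
    exact_mod_cast this
  refine ⟨fun p => Lagrange.basis (Finset.range (d + 1 + n)) v p, fun p hp r h1 h2 => ?_,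
    fun q hq hr => ?_⟩
  · obtain ⟨t, ht, htd, hvt⟩ := hroot r h1 h2
    rw [← hvt]
    exact Lagrange.eval_basis_of_ne (by omega) ht
  have hinj : Function.Injective (algebraMap ℂ K) := (algebraMap ℂ K).injective
  have hcard : ∀ {m : ℕ}, m < d + 1 + n → (m : WithBot ℕ) < (Finset.range (d + 1 + n)).card := by
    intro m hm
    rw [Finset.card_range]
    exact_mod_cast hm
  refine Polynomial.eq_of_degrees_lt_of_eval_index_eq (s := Finset.range (d + 1 + n))
    (v := fun t => algebraMap ℂ K (v t)) (hinj.comp_injOn hv)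
    (lt_of_le_of_lt (degree_le_of_natDegree_le hq) (hcard (by omega)))
    (lt_of_le_of_lt (b := ((d + n : ℕ) : WithBot ℕ)) ?_ (hcard (by omega))) fun t ht => ?_
  · refine (degree_sum_le _ _).trans (Finset.sup_le fun p hp => ?_)
    rw [← smul_eq_C_mul]
    refine (degree_smul_le _ _).trans (degree_map_le.trans ?_)
    rw [Lagrange.degree_basis hv (by simp at hp ⊢; omega), Finset.card_range]
    exact_mod_cast (by omega : d + 1 + n - 1 ≤ d + n)
  · rw [eval_finsetSum]
    simp only [eval_mul, eval_C, eval_map_algebraMap, aeval_algebraMap_apply]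
    have hvK : ∀ p, p < d + 1 → algebraMap ℂ K (v p) = ((R' + p : ℕ) : K) := fun p hp => by
      simp only [v]
      rw [if_pos hp, map_natCast]
    rcases lt_or_ge t (d + 1) with h | h
    · rw [Finset.sum_eq_single t, coe_aeval_eq_eval, Lagrange.eval_basis_self hv ht, map_one, mul_one,
        hvK t h]
      · intro p _ hpt
        rw [coe_aeval_eq_eval, Lagrange.eval_basis_of_ne hpt ht, map_zero, mul_zero]
      · intro h'
        exact absurd (Finset.mem_range.2 h) h'
    · rw [Finset.sum_eq_zero]
      · have := hr ((t - d : ℕ) : ℤ) (by omega) (by simp at ht; omega)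
        simp only [v]
        rw [if_neg (by omega), map_sub, map_natCast, ← cst_eq, ← this]
        simp
      · intro p hp
        rw [coe_aeval_eq_eval, Lagrange.eval_basis_of_ne (by simp at hp; omega) ht, map_zero, mul_zero]

theorem RegWith.congr {k : ℕ} {P : ℕ → MvPolynomial (Fin k × ℤ) ℂ} {F : (ℕ → K) → ℂ}
    (hF : RegWith k P F) {b b' : ℕ → K} (h : ∀ j < k, b j = b' j) : F b = F b' := by
  obtain ⟨m, hm⟩ := exists_coeff_bounds b k
  rw [hF m b hm, hF m b' fun i hi => by rw [← h i hi]; exact hm i hi]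
  refine congrArg (fun a => MvPolynomial.eval a (P m)) (funext fun v => ?_)
  simp only [coeffs]
  rw [h _ v.1.2]

theorem eval_eq_eval_aeval {σ τ : Type} {P : MvPolynomial σ ℂ} {a : τ → ℂ} {b : σ → ℂ}
    {f : σ → MvPolynomial τ ℂ} (h : ∀ v, b v = MvPolynomial.eval a (f v)) :
    MvPolynomial.eval b P = MvPolynomial.eval a (MvPolynomial.aeval f P) := by
  obtain rfl : b = _ := funext h
  exact (aeval_comp_eval (MvPolynomial.aeval a) f P).symm

/-- The generic Laurent series with poles of order at most `m`. -/
def genericL {ι : Type} (m : ℕ) (i : ι) : LaurentSeries (MvPolynomial (ι × ℤ) ℂ) :=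
  HahnSeries.ofSuppBddBelow (fun l => if l < -(m : ℤ) then 0 else MvPolynomial.X (i, l))
    ⟨-(m : ℤ), fun l hl => by
      by_contra h
      exact hl (if_pos (not_le.1 h))⟩

theorem mapL_genericL {ι : Type} {m : ℕ} (u : ι → K) {i : ι} (hu : PoleLE m (u i)) :
    mapL (MvPolynomial.aeval fun v : ι × ℤ => (u v.1).coeff v.2) (genericL m i) = u i := by
  ext l
  rw [mapL_coeff]
  show MvPolynomial.aeval _ (if l < -(m : ℤ) then 0 else MvPolynomial.X (i, l)) = _
  split_ifs with h
  · rw [map_zero, hu l h]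
  · rw [MvPolynomial.aeval_X]

namespace LoopModel

variable {lam : ℂ}

theorem mem_band {k i j : ℕ} : (i, j) ∈ (barGl lam).Band k ↔ i ≤ j ∧ j < i + k := Iff.rfl

theorem eval_map_constL {A : Type} [CommRing A] [Algebra ℂ A] (φ : A →ₐ[ℂ] ℂ)
    (p : ℂ[X]) (x : LaurentSeries A) :
    mapL φ ((p.map (algebraMap ℂ (LaurentSeries A))).eval x)
      = (p.map (algebraMap ℂ K)).eval (mapL φ x) := by
  rw [eval_map_algebraMap, eval_map_algebraMap, ← Polynomial.aeval_algHom_apply]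

/-- A matrix with parameters whose specializations are the elements of a tame family, as far as
the first `k` upper diagonals are concerned. -/
theorem exists_generic_matrix (lam : ℂ) (k R d m : ℕ) :
    ∃ A : ℕ → ℕ → LaurentSeries (MvPolynomial ((barGl lam).Band k × ℤ) ℂ), IsHess A ∧
      IsPolyMat (constL _ (cst lam)) A ∧ ∀ B : (barGl lam).fiber,
        (∀ n < k, ∃ q : Polynomial K, q.natDegree ≤ d ∧
          ∀ i ≥ R, (B : Matrix ℕ ℕ K) i (i + n) = q.eval (i : K)) →
        (∀ p ∈ (barGl lam).Band k, PoleLE m ((B : Matrix ℕ ℕ K) p.1 p.2)) →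
        ∀ i n, n < k → mapL (MvPolynomial.aeval fun v : (barGl lam).Band k × ℤ =>
          ((B : Matrix ℕ ℕ K) v.1.1.1 v.1.1.2).coeff v.2) (A i (i + n))
            = (B : Matrix ℕ ℕ K) i (i + n) := by
  classical
  obtain ⟨R', hR, h⟩ := exists_interpolation lam R d
  choose l hl hq using h
  set 𝓛 := LaurentSeries (MvPolynomial ((barGl lam).Band k × ℤ) ℂ)
  let U : ℕ → ℕ → 𝓛 := fun i j =>
    if h : (i, j) ∈ (barGl lam).Band k then genericL m (⟨(i, j), h⟩ : (barGl lam).Band k) else 0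
  let Q : ℕ → 𝓛[X] := fun n => ∑ p ∈ Finset.range (d + 1),
    C (U (R' + p) (R' + p + n)) * (l n p).map (algebraMap ℂ 𝓛)
  -- Rows before R' have free indeterminate entries; from R' on the entries interpolate the d + 1
  -- indeterminates in rows R', …, R' + d. Diagonals from k on are set to zero, as they do not
  -- matter.
  let A : ℕ → ℕ → 𝓛 := fun i j => if i = j + 1 then 1 else if j < i then 0 else
    if k ≤ j - i then 0 else if i < R' then U i j else (Q (j - i)).eval (i : 𝓛)
  have hA : ∀ i n, n < k → A i (i + n) = if i < R' then U i (i + n) else (Q n).eval (i : 𝓛) := by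
    intro i n hn
    simp only [A]
    rw [if_neg (by omega), if_neg (by omega), Nat.add_sub_cancel_left, if_neg (by omega)]
  refine ⟨A, ⟨fun i => if_pos rfl, fun i j h => ?_⟩, ⟨1, R', fun n => if n = -1 then 1 else
    if n < 0 then 0 else if (k : ℤ) ≤ n then 0 else Q n.toNat, fun i j h => ?_, fun i j h => ?_,
    fun n r h1 h2 => ?_⟩, fun B hB hp i n hn => ?_⟩
  · simp only [A]
    rw [if_neg (by omega), if_pos (by omega)]
  · simp only [A]
    rw [if_neg (by omega), if_pos (by omega)]
  · simp only [A]
    split_ifs <;> first | omega | simp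
  · beta_reduce
    rw [if_neg (by omega), if_neg (by omega)]
    split_ifs with h
    · exact eval_zero
    · simp only [Q]
      rw [eval_finsetSum]
      refine Finset.sum_eq_zero fun p hp => ?_
      have e : constL (MvPolynomial ((barGl lam).Band k × ℤ) ℂ) (cst lam) - (r : 𝓛)
          = algebraMap ℂ 𝓛 (lam - r) := by
        rw [cst_eq, AlgHom.commutes, map_sub, map_intCast]
      rw [eval_mul, e, eval_map_algebraMap, aeval_algebraMap_apply, coe_aeval_eq_eval,
        hl n.toNat p (Finset.mem_range.1 hp) r h1 (by omega), map_zero, mul_zero]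
  · set φ : MvPolynomial ((barGl lam).Band k × ℤ) ℂ →ₐ[ℂ] ℂ :=
      MvPolynomial.aeval fun v => ((B : Matrix ℕ ℕ K) v.1.1.1 v.1.1.2).coeff v.2 with hφ
    have hU : ∀ i, mapL φ (U i (i + n)) = (B : Matrix ℕ ℕ K) i (i + n) := by
      intro i
      have hb : (i, i + n) ∈ (barGl lam).Band k := mem_band.2 ⟨by omega, by omega⟩
      simp only [U]
      rw [dif_pos hb]
      exact mapL_genericL (fun v : (barGl lam).Band k => (B : Matrix ℕ ℕ K) v.1.1 v.1.2) (hp _ hb)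
    rw [hA i n hn]
    split_ifs with hi
    · exact hU i
    · obtain ⟨q, hqd, hqB⟩ := hB n hn
      -- The polynomial given by the tame family agrees in all large rows with the one from
      -- `IsPolyMat`, so it is the same polynomial and has the prescribed zeros.
      have hroot : ∀ r : ℤ, 1 ≤ r → r ≤ n → q.eval (cst lam - r) = 0 := by
        obtain ⟨-, R₀, Q₀, -, h1, h2⟩ := mem_barGl.1 B.2.1
        have : q = Q₀ n := eq_of_eval_eventually (N := max R R₀) fun i hi => by
          rw [← hqB i (le_of_max_le_left hi), h1 i _ (le_of_max_le_right hi)]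
          congr
          push_cast
          ring
        rw [this]
        exact h2 n
      rw [hqB i (by omega)]
      conv_rhs => rw [hq n q hqd hroot]
      simp only [Q]
      rw [eval_finsetSum, eval_finsetSum, map_sum]
      refine Finset.sum_congr rfl fun p _ => ?_
      rw [eval_mul, eval_mul, eval_C, eval_C, map_mul, eval_map_constL, map_natCast, hU,
        hqB _ (by omega)]

/-- In one direction the function is restricted to the slice, a tame family with polynomial entries.
In the other the normal form of the generic matrix of a tame family is computed once; by
`IsGauge.unique` its specialization has the right first k members, whatever the remaining diagonals
are. -/
theorem isRegularOnFiber_iff (c : K) (hc : PoleLE 0 c) (F : (barGl lam).Reduced → ℂ) :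
    (barGl lam).IsRegularOnFiber (fun A => F ((barGl lam).proj A)) ↔
      IsRegularSeq (F ∘ (barEquiv lam c).symm) := by
  classical
  constructor
  · rintro ⟨k, h⟩
    refine ⟨k, fun m => ?_⟩
    -- For slice matrices only row 0 is exceptional, and the main diagonal -c i has degree one in
    -- the row.
    obtain ⟨P, hP⟩ := h {A | ∀ n < k, ∃ q : Polynomial K, q.natDegree ≤ 1 ∧
      ∀ i ≥ 1, A i (i + n) = q.eval (i : K)} ⟨1, 1, rfl⟩ m
    refine ⟨MvPolynomial.aeval (fun v : (barGl lam).Band k × ℤ =>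
      if h : v.1.1.1 = 0 then MvPolynomial.X (⟨v.1.1.2, by
        have := (mem_band.1 v.1.2).2
        rw [h, zero_add] at this
        exact this⟩, v.2) else
      MvPolynomial.C ((sliceMat c 0 v.1.1.1 v.1.1.2).coeff v.2)) P, fun u hu => ?_⟩
    rw [Function.comp_apply, barEquiv_symm]
    refine (hP (barSlice lam c u) ?_ ?_).trans ?_
    rotate_left 2
    · refine eval_eq_eval_aeval fun v => ?_
      obtain ⟨⟨⟨i, j⟩, hij⟩, l⟩ := v
      show (sliceMat c u i j).coeff l = _
      rcases i with _ | i
      · rw [dif_pos rfl, MvPolynomial.eval_X, sliceMat_zero]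
      · rw [dif_neg (Nat.succ_ne_zero i), MvPolynomial.eval_C, sliceMat_succ, sliceMat_succ]
    · intro n _
      refine ⟨if n = 0 then -(C c * X) else 0, ?_, fun i hi => ?_⟩
      · split_ifs
        · rw [natDegree_neg]
          exact (natDegree_C_mul_le _ _).trans natDegree_X_le
        · simp
      · obtain ⟨i, rfl⟩ : ∃ j, i = j + 1 := ⟨i - 1, by omega⟩
        show sliceMat c u (i + 1) (i + 1 + n) = _
        rw [sliceMat_succ, if_neg (by omega)]
        split_ifs with h1 h2 h2 <;> first | omega | simp
    · rintro ⟨i, j⟩ hij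
      have hij' := mem_band.1 hij
      show PoleLE m (sliceMat c u i j)
      rcases i with _ | i
      · rw [sliceMat_zero]
        exact hu j (by omega)
      · rw [sliceMat_succ, if_neg (by omega)]
        intro l hl
        split_ifs with h
        · have : c * ((i : K) + 1) = ((i + 1 : ℕ) : ℂ) • c := by
            rw [smul_eq_cst_mul, cst_eq, map_natCast]
            push_cast
            ring
          rw [this, zero_sub, HahnSeries.coeff_neg, HahnSeries.coeff_smul, hc l (by omega), smul_zero,
            neg_zero]
        · simp
  · intro hF
    obtain ⟨k, P, hP⟩ := isRegularSeq_iff.1 hF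
    refine ⟨k, ?_⟩
    rintro S ⟨R, d, rfl⟩ m
    obtain ⟨A, hA, hAp, hAB⟩ := exists_generic_matrix lam k R d m
    obtain ⟨X, b, hX⟩ := exists_isGauge (theta _) (theta_constL lam) (constL _ c) hA hAp
    obtain ⟨M, hM⟩ := exists_coeff_bounds b k
    refine ⟨MvPolynomial.aeval (coeffs k b) (P M), fun B hB hp => ?_⟩
    have hBA := hAB B hB hp
    set φ : MvPolynomial ((barGl lam).Band k × ℤ) ℂ →ₐ[ℂ] ℂ :=
      MvPolynomial.aeval fun v => ((B : Matrix ℕ ℕ K) v.1.1.1 v.1.1.2).coeff v.2 with hφ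
    obtain ⟨X', b', hX'⟩ := exists_isGauge_fiber c B
    have h1 := hX.map (mapL φ : _ →+* K) (d' := theta ℂ) fun x => mapL_theta φ x
    simp only [RingHom.coe_coe, mapL_constL] at h1
    have hA' : IsHess fun i j => mapL φ (A i j) :=
      ⟨fun i => (congrArg _ (hA.1 i)).trans (map_one _),
        fun i j h => (congrArg _ (hA.2 i j h)).trans (map_zero _)⟩
    have h2 := (IsGauge.unique hA' ((isHess_iff B.2.1).2 B.2) h1 hX' (k := k) fun i n hn =>
      hBA i n hn).2
    have h3 : F ((barGl lam).proj B) = (F ∘ (barEquiv lam c).symm) b' := by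
      rw [Function.comp_apply, ← barEquiv_proj c B hX', Equiv.symm_apply_apply]
    refine h3.trans ?_
    rw [← hP.congr h2, hP.mapL_eq hM φ]
    rfl

end LoopModel

/-! ### Restriction of Poisson structures to retracts -/

namespace PoissonStructure

variable {M M' : Type}

theorem bracket_swap (P : PoissonStructure M) (F G : P.functions) :
    P.bracket F G = -P.bracket G F := by
  have h := P.bracket_self (F + G)
  rw [map_add, map_add P.bracket, LinearMap.add_apply, LinearMap.add_apply, P.bracket_self,
    P.bracket_self, zero_add, add_zero, add_comm] at h
  exact eq_neg_of_add_eq_zero_left h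

/-- The image of `ι` is a Poisson submanifold, onto which the functions can be retracted
by `r`. -/
structure IsRetract (P : PoissonStructure M') (ι : M → M') (r : M' → M) : Prop where
  left_inv : ∀ x, r (ι x) = x
  mem : ∀ F ∈ P.functions, F ∘ ι ∘ r ∈ P.functions
  bracket : ∀ F G : P.functions, (G : M' → ℂ) ∘ ι = 0 → (P.bracket F G : M' → ℂ) ∘ ι = 0

variable {P : PoissonStructure M'} {ι : M → M'} {r : M' → M}

theorem IsRetract.bracket_congr_right (h : P.IsRetract ι r) (F : P.functions) {G G' : P.functions}
    (hG : (G : M' → ℂ) ∘ ι = (G' : M' → ℂ) ∘ ι) :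
    (P.bracket F G : M' → ℂ) ∘ ι = (P.bracket F G' : M' → ℂ) ∘ ι := by
  have h1 := h.bracket F (G - G') (funext fun x => sub_eq_zero.2 (congrFun hG x))
  rw [map_sub] at h1
  exact funext fun x => sub_eq_zero.1 (congrFun h1 x)

theorem IsRetract.bracket_congr (h : P.IsRetract ι r) {F F' G G' : P.functions}
    (hF : (F : M' → ℂ) ∘ ι = (F' : M' → ℂ) ∘ ι) (hG : (G : M' → ℂ) ∘ ι = (G' : M' → ℂ) ∘ ι) :
    (P.bracket F G : M' → ℂ) ∘ ι = (P.bracket F' G' : M' → ℂ) ∘ ι := by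
  rw [h.bracket_congr_right F hG, P.bracket_swap F, P.bracket_swap F']
  funext x
  exact congrArg Neg.neg (congrFun (h.bracket_congr_right G' hF) x)

theorem isRetract_equiv (P : PoissonStructure M') (e : M ≃ M') : P.IsRetract e e.symm where
  left_inv := e.symm_apply_apply
  mem F hF := by rwa [Equiv.self_comp_symm]
  bracket F G hG := by
    have : G = 0 := Subtype.ext (funext fun x => by
      have := congrFun hG (e.symm x)
      rwa [Function.comp_apply, Equiv.apply_symm_apply] at this)
    rw [this, map_zero]
    rfl

/-- The functions on a Poisson submanifold onto which the functions can be retracted. -/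
def restrictFunctions (P : PoissonStructure M') (r : M' → M) : Subalgebra ℂ (M → ℂ) where
  carrier := {F | F ∘ r ∈ P.functions}
  mul_mem' h h' := P.functions.mul_mem h h'
  add_mem' h h' := P.functions.add_mem h h'
  algebraMap_mem' c := P.functions.algebraMap_mem c

/-- The Poisson structure of a submanifold onto which the functions can be retracted. -/
def restrict (P : PoissonStructure M') {ι : M → M'} {r : M' → M} (h : P.IsRetract ι r) :
    PoissonStructure M where
  functions := P.restrictFunctions r
  bracket := LinearMap.mk₂ ℂ
    (fun F G => ⟨(P.bracket ⟨(F : M → ℂ) ∘ r, F.2⟩ ⟨(G : M → ℂ) ∘ r, G.2⟩ : M' → ℂ) ∘ ι,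
      h.mem _ (P.bracket _ _).2⟩)
    (fun F F' G => Subtype.ext (congrArg (fun a : P.functions => (a : M' → ℂ) ∘ ι)
      (LinearMap.map_add₂ P.bracket (⟨(F : M → ℂ) ∘ r, F.2⟩ : P.functions) ⟨(F' : M → ℂ) ∘ r, F'.2⟩
        ⟨(G : M → ℂ) ∘ r, G.2⟩)))
    (fun c F G => Subtype.ext (congrArg (fun a : P.functions => (a : M' → ℂ) ∘ ι)
      (LinearMap.map_smul₂ P.bracket c (⟨(F : M → ℂ) ∘ r, F.2⟩ : P.functions)
        ⟨(G : M → ℂ) ∘ r, G.2⟩)))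
    (fun F G G' => Subtype.ext (congrArg (fun a : P.functions => (a : M' → ℂ) ∘ ι)
      (map_add (P.bracket (⟨(F : M → ℂ) ∘ r, F.2⟩ : P.functions)) ⟨(G : M → ℂ) ∘ r, G.2⟩
        ⟨(G' : M → ℂ) ∘ r, G'.2⟩)))
    (fun c F G => Subtype.ext (congrArg (fun a : P.functions => (a : M' → ℂ) ∘ ι)
      (map_smul (P.bracket (⟨(F : M → ℂ) ∘ r, F.2⟩ : P.functions)) c ⟨(G : M → ℂ) ∘ r, G.2⟩)))
  bracket_self F := Subtype.ext (congrArg (fun a : P.functions => (a : M' → ℂ) ∘ ι)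
    (P.bracket_self ⟨(F : M → ℂ) ∘ r, F.2⟩))
  jacobi F G H := by
    -- The inner bracket is restricted and then extended back through the retraction. This alters it
    -- by a function vanishing on the image of `ι`, which does not affect the outer bracket there.
    have key : ∀ (F : P.functions) (K : P.functions),
        (P.bracket F ⟨((K : M' → ℂ) ∘ ι) ∘ r, h.mem _ K.2⟩ : M' → ℂ) ∘ ι
          = (P.bracket F K : M' → ℂ) ∘ ι := fun F K =>
      h.bracket_congr_right F (funext fun x => by
        simp only [Function.comp_apply, h.left_inv])
    have := congrArg (fun a : P.functions => (a : M' → ℂ) ∘ ι) (P.jacobi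
      ⟨(F : M → ℂ) ∘ r, F.2⟩ ⟨(G : M → ℂ) ∘ r, G.2⟩ ⟨(H : M → ℂ) ∘ r, H.2⟩)
    refine Subtype.ext (Eq.trans ?_ this)
    exact congrArg₂ (· + ·) (congrArg₂ (· + ·) (key _ _) (key _ _)) (key _ _)
  leibniz F G H := by
    refine Subtype.ext ((congrArg (fun a : P.functions => (a : M' → ℂ) ∘ ι) (P.leibniz
      ⟨(F : M → ℂ) ∘ r, F.2⟩ ⟨(G : M → ℂ) ∘ r, G.2⟩ ⟨(H : M → ℂ) ∘ r, H.2⟩)).trans ?_)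
    funext x
    show _ * (H : M → ℂ) (r (ι x)) + (G : M → ℂ) (r (ι x)) * _ = _
    rw [h.left_inv]
    rfl

theorem isPoissonEmbedding_restrict (h : P.IsRetract ι r) :
    IsPoissonEmbedding (P.restrict h) P ι where
  injective := Function.LeftInverse.injective h.left_inv
  pullback_mem F hF := h.mem F hF
  pullback_surjective F hF := ⟨F ∘ r, hF, funext fun x => by
    simp only [Function.comp_apply, h.left_inv]⟩
  map_bracket F G F' G' hF hG := by
    refine h.bracket_congr (funext fun x => ?_) (funext fun x => ?_)
    · show (F' : M → ℂ) (r (ι x)) = _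
      rw [h.left_inv, hF]
    · show (G' : M → ℂ) (r (ι x)) = _
      rw [h.left_inv, hG]

/-- Transport of a Poisson structure along a bijection. -/
def transport (P : PoissonStructure M') (e : M ≃ M') : PoissonStructure M :=
  P.restrict (P.isRetract_equiv e)

/-- The isomorphism onto the transported structure. -/
def transportIso (P : PoissonStructure M') (e : M ≃ M') : PoissonIso (P.transport e) P where
  toEquiv := e
  mem_iff F := by
    show (F ∘ e) ∘ e.symm ∈ P.functions ↔ _
    rw [Function.comp_assoc, Equiv.self_comp_symm, Function.comp_id]
  map_bracket := (isPoissonEmbedding_restrict (P.isRetract_equiv e)).map_bracket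

end PoissonStructure

/-! ### The Poisson structure of the reduced space -/

namespace LoopModel

variable {lam : ℂ}

/-- The Poisson structure of the reduced space. -/
def barPoisson (lam : ℂ) : PoissonStructure (barGl lam).Reduced :=
  (seqPoisson lam).transport (barEquiv lam 0)

theorem mem_barPoisson {F : (barGl lam).Reduced → ℂ} :
    F ∈ (barPoisson lam).functions ↔ IsRegularSeq (F ∘ (barEquiv lam 0).symm) := Iff.rfl

theorem barPoisson_bracket (F G : (barPoisson lam).functions) (x : (barGl lam).Reduced) :
    ((barPoisson lam).bracket F G : (barGl lam).Reduced → ℂ) x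
      = seqBracket lam ((F : (barGl lam).Reduced → ℂ) ∘ (barEquiv lam 0).symm)
        ((G : (barGl lam).Reduced → ℂ) ∘ (barEquiv lam 0).symm) (barEquiv lam 0 x) := rfl

theorem poleLE_zero (m : ℕ) : PoleLE m 0 := fun _ _ => HahnSeries.coeff_zero

theorem poleLE_one (m : ℕ) : PoleLE m 1 := fun l hl => by
  rw [HahnSeries.coeff_one, if_neg (by omega)]

/-- Regularity in the coordinates of either slice is regularity on the fiber, so the slices with
different c define the same functions. -/
theorem mem_barPoisson_iff (c : K) (hc : PoleLE 0 c) {F : (barGl lam).Reduced → ℂ} :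
    F ∈ (barPoisson lam).functions ↔ IsRegularSeq (F ∘ (barEquiv lam c).symm) := by
  rw [mem_barPoisson, ← isRegularOnFiber_iff 0 (poleLE_zero 0), isRegularOnFiber_iff c hc]

theorem isHamiltonianReduction_barPoisson (lam : ℂ) :
    (barGl lam).IsHamiltonianReduction (barPoisson lam) ∧
    ∀ (F G : (barPoisson lam).functions) (A : (barGl lam).fiber) (x y : (barGl lam).Alg),
      IsFiberDiff (F : (barGl lam).Reduced → ℂ) A x →
      IsFiberDiff (G : (barGl lam).Reduced → ℂ) A y →
      ((barPoisson lam).bracket F G : (barGl lam).Reduced → ℂ) ((barGl lam).proj A)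
        = -tau (barGl lam) (vec (toAlg A) x * y) := by
  refine (frobSlice lam).isHamiltonianReduction (barPoisson lam) (fun F => ?_) (fun F hF b => ?_)
    fun F G b q r w x hq hr hx => ?_
  · exact (isRegularOnFiber_iff 0 (poleLE_zero 0) F).symm
  · exact IsRegularSeq.exists_isGrad hF b
  · rw [barPoisson_bracket]
    show seqBracket lam _ _ (barEquiv lam 0 ((barEquiv lam 0).symm b)) = _
    rw [Equiv.apply_symm_apply]
    exact seqBracket_eq F.2 G.2 hq hr hx

theorem frobenius_eq_barSlice (b : ℕ → K) :
    (barGl lam).frobenius b = (barSlice lam 0 b : Matrix ℕ ℕ K) := by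
  funext i j
  show (if i = 0 then b j else if i = j + 1 then 1 else 0) = sliceMat 0 b i j
  rw [sliceMat]
  rcases i with _ | i
  · simp
  · rw [if_neg (Nat.succ_ne_zero i), if_neg (Nat.succ_ne_zero i)]
    simp

theorem hasFrobeniusForm_barEquiv (x : (barGl lam).Reduced) :
    (barGl lam).HasFrobeniusForm x (barEquiv lam 0 x) := by
  have h := frobenius_eq_barSlice (lam := lam) (barEquiv lam 0 x)
  refine ⟨h ▸ (barSlice lam 0 (barEquiv lam 0 x)).2, ?_⟩
  have e : (⟨(barGl lam).frobenius (barEquiv lam 0 x), h ▸ (barSlice lam 0 (barEquiv lam 0 x)).2⟩ :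
      (barGl lam).fiber) = barSlice lam 0 (barEquiv lam 0 x) := Subtype.ext h
  rw [e, ← barEquiv_symm, Equiv.symm_apply_apply]

end LoopModel

/-! ### The Gelfand–Dickey bracket in terms of Hamiltonian matrices -/

section Symbols

theorem symMul_eq_gsymMul (μ : ℂ) (a b : ℤ → K) : symMul μ a b = gsymMul dzD (cst μ) a b := by
  funext n
  refine finsum_congr fun p => ?_
  have h1 : cst μ + (p.1 : K) = algebraMap ℂ K (μ + p.1) := by
    rw [map_add, map_intCast, cst_eq]
  have h2 : (dz : K → K) = dzD := funext fun x => (dzD_apply x).symm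
  rw [h1, gbinom_algebraMap, h2]
  exact smul_eq_cst_mul _ _

theorem dzD_cst (c : ℂ) : dzD (cst c) = 0 := by simp [dzD, theta_cst]

theorem doSym_neg (q : ℕ →₀ K) {n : ℤ} (hn : n < 0) : doSym q n = 0 := if_neg (by omega)

theorem exists_ordLE_doSym (q : ℕ →₀ K) : ∃ k : ℕ, OrdLE k (doSym q) := by
  obtain ⟨k, hk⟩ := q.support.bddAbove
  refine ⟨k, fun n hn => ?_⟩
  rw [doSym, if_pos (by omega)]
  by_contra h
  have := hk (Finset.mem_coe.2 (Finsupp.mem_support_iff.2 h))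
  omega

variable {lam : ℂ}

theorem covSym_eq (q : ℕ →₀ K) :
    covSym lam q = gsymMul dzD (-cst lam) (monoSym 0 1) (doSym q) := by
  rw [covSym, symMul_eq_gsymMul, show cst (-lam) = -cst lam from map_neg _ _]
  rfl

theorem symMul_covSym {a : ℤ → K} {N : ℤ} (ha : OrdLE N a) (q : ℕ →₀ K) :
    symMul lam a (covSym lam q) = gsymMul dzD 0 a (doSym q) := by
  obtain ⟨k, hk⟩ := exists_ordLE_doSym q
  have h1 : OrdLE (0 + k) (gsymMul dzD (-cst lam) (monoSym 0 1) (doSym q)) :=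
    (ordLE_monoSym (R := K) 0 1).gsymMul hk
  have h := gsymMul_assoc (d := dzD) (μ := cst lam) (ν := -cst lam)
    (by rw [map_neg, dzD_cst, neg_zero]) ha (ordLE_monoSym (R := K) 0 1) hk
  rw [symMul_eq_gsymMul, covSym_eq, ← h, add_neg_cancel, gsymMul_monoSym_right ha]
  simp only [sub_zero]

theorem rightCoeff_eq_zero {Q : ℤ → K} {k : ℕ} (hQ : OrdLE k Q) {i : ℕ} (hi : k < i) :
    rightCoeff dzD Q i = 0 :=
  ((ordLE_monoSym (-(i : ℤ) - 1) (1 : K)).gsymMul hQ) _ (by omega)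

/-- A term a_p D^p of the left factor with p ≥ 0 contributes nothing to the coefficient of D^(-1),
while a term with p = -1 - j contributes a_p times a right coefficient. The factor z accounts for a
pairing by constant terms in place of residues. -/
theorem symTrace_symMul_covSym {a : ℤ → K} {N : ℤ} (ha : OrdLE N a) (q : ℕ →₀ K) :
    symTrace (symMul lam a (covSym lam q))
      = pair (fun j : ℕ => a (-1 - j)) fun j => zpow 1 * rightCoeff dzD (doSym q) j := by
  obtain ⟨k, hk⟩ := exists_ordLE_doSym q
  rw [symMul_covSym ha, symTrace, pair_eq_sum_range (k := k + 1) fun j hj => by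
    rw [rightCoeff_eq_zero hk hj, mul_zero], gsymMul_eq_sum_mono ha hk
    (s := Finset.Icc (-1 - k) (max N (-1)))
    fun p h h' => Finset.mem_Icc.2 ⟨h, h'.trans (le_max_left _ _)⟩, res, HahnSeries.coeff_sum]
  refine (Finset.sum_of_injOn (fun j : ℕ => (-1 - j : ℤ)) (fun i _ j _ h => ?_) (fun j hj => ?_)
    (fun p hp h => ?_) fun j _ => ?_).symm
  · have h : (-1 - i : ℤ) = -1 - j := h
    omega
  · have := Finset.mem_range.1 hj
    refine Finset.mem_coe.2 (Finset.mem_Icc.2 ⟨?_, le_trans (b := -1) ?_ (le_max_right _ _)⟩) <;>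
    · show (_ : ℤ) ≤ _
      beta_reduce
      omega
  · have h0 : 0 ≤ p := by
      by_contra hn
      have := (Finset.mem_Icc.1 hp).1
      exact h ⟨(-1 - p).toNat, Finset.mem_coe.2 (Finset.mem_range.2 (by omega)), by
        show (-1 - ((-1 - p).toNat : ℤ)) = p
        omega⟩
    rw [gsymMul_apply_eq_zero (b := doSym q) (n := -1) (a := monoSym p 1)
      (fun n hn => if_neg (by omega)) (K := 0) (fun n hn => doSym_neg q hn) (by omega), mul_zero,
      HahnSeries.coeff_zero]
  · have e : rightCoeff dzD (doSym q) j = gsymMul dzD 0 (monoSym (-1 - j : ℤ) 1) (doSym q) (-1) := by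
      rw [rightCoeff, show (-(j : ℤ) - 1) = -1 - j by ring]
    rw [← mul_assoc, mul_comm _ (zpow 1), mul_assoc, LoopModel.coeff_zpow_mul, e]

theorem lowerSym_neg (u : ℕ → K) (j : ℕ) : lowerSym u (-1 - j) = u j := by
  rw [lowerSym, if_pos (by omega)]
  congr 1
  omega

theorem ordLE_lowerSym (u : ℕ → K) : OrdLE (-1) (lowerSym u) := fun n hn => if_neg (by omega)

theorem sym_eq_frobSym (L : PsiDS lam) : L.sym = frobSym fun j => -L.coeff j := by
  funext n
  rw [PsiDS.sym, frobSym, lowerSym, neg_neg]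

/-- The Hamiltonian map of the quadratic Gelfand--Dickey bracket in terms of matrices. -/
theorem hamiltonian_eq (L : PsiDS lam) (q : ℕ →₀ K) :
    L.hamiltonian q = -hamSym dzD (cst lam) (fun j => -L.coeff j) (doSym q) := by
  obtain ⟨k, hk⟩ := exists_ordLE_doSym q
  have hL : OrdLE (0 : ℤ) L.sym := by
    rw [sym_eq_frobSym]
    exact ordLE_frobSym
  have hS : symPlus (symMul (-lam) (covSym lam q) L.sym)
      = hamPlus dzD (cst lam) (fun j => -L.coeff j) (doSym q) := by
    rw [symMul_eq_gsymMul, covSym_eq, sym_eq_frobSym, show cst (-lam) = -cst lam from map_neg _ _]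
    rfl
  have hSo := ordLE_hamPlus (d := dzD) (lam := cst lam) (b := fun j => -L.coeff j) hk
  have h := gsymMul_assoc (d := dzD) (μ := 0) (ν := cst lam) (dzD_cst lam) hL
    (ordLE_monoSym (R := K) 0 1) hSo
  rw [PsiDS.hamiltonian, hS, symMul_covSym hL, symMul_eq_gsymMul, symMul_eq_gsymMul, hamSym, neg_sub,
    show cst 0 = 0 from map_zero _, ← sym_eq_frobSym]
  rw [← h, zero_add, gsymMul_monoSym_right hL]
  simp only [sub_zero]
  rfl

theorem ordLE_hamiltonian (L : PsiDS lam) (q : ℕ →₀ K) : ∃ N, OrdLE N (L.hamiltonian q) := by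
  obtain ⟨k, hk⟩ := exists_ordLE_doSym q
  have hL : OrdLE (0 : ℤ) (frobSym fun j => -L.coeff j) := ordLE_frobSym
  refine ⟨0 + k + 0, ?_⟩
  rw [hamiltonian_eq, hamSym, neg_sub]
  refine ((hL.gsymMul hk).gplus.gsymMul hL).sub ?_
  exact (hL.gsymMul (ordLE_lam_hamPlus hk)).mono (by omega)

end Symbols

theorem IsRegularSeq.scale {F : (ℕ → K) → ℂ} (hF : IsRegularSeq F) (a : ℕ → K) :
    IsRegularSeq fun u => F fun j => a j * u j := by
  obtain ⟨k, P, hP⟩ := isRegularSeq_iff.1 hF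
  refine ⟨k, fun m => ?_⟩
  obtain ⟨U, hU⟩ := exists_generic k m
  obtain ⟨M, hM⟩ := exists_coeff_bounds (fun j => constL _ (a j) * U j) k
  refine ⟨MvPolynomial.aeval (coeffs k fun j => constL _ (a j) * U j) (P M), fun u hu => ?_⟩
  have h := hP.mapL_eq hM (MvPolynomial.aeval (coeffs k u))
  refine Eq.trans (hP.congr fun j hj => ?_) h
  rw [map_mul, mapL_constL, hU u hu, if_pos hj]

theorem IsGrad.scale {I : Type} {Φ : (I → K) → ℂ} {b q a a' : I → K} (h : IsGrad Φ b q)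
    (ha : ∀ j, a j * a' j = 1) :
    IsGrad (fun u => Φ fun j => a j * u j) (fun j => a' j * b j) fun j => a j * q j := by
  refine ⟨h.1.subset fun j hj h0 => hj (by beta_reduce; rw [h0, mul_zero]), fun u hu => ?_⟩
  have h1 := h.2 (fun j => constL _ (a j) * u j) fun j => by
    rw [map_mul, evL_constL, hu, ← mul_assoc, ha, one_mul]
  simp only [map_mul, evL_constL, d0L_mul, d0L_constL, zero_mul, zero_add] at h1
  refine h1.congr_deriv ?_
  rw [pair, pair]
  congr 1
  exact finsum_congr fun j => by ring

/-! ### Symbols as points of the reduced space -/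

namespace LoopModel

theorem SliceData.Ham.neg {I : Type} {g : LoopModel I} [Nice g] {D : SliceData g} {b q w : I → K}
    {x : g.Alg} (h : D.Ham b q x w) : D.Ham b (fun i => -q i) (-x) fun j => -w j := by
  refine ⟨fun i => congrArg Neg.neg (h.1 i), ?_⟩
  have e : vec (toAlg (D.S b)) (-x) = -vec (toAlg (D.S b)) x := by
    rw [vec, vec, gaugeField, gaugeField, map_neg]
    noncomm_ring
  rw [e, h.2]
  refine Alg.ext ?_
  funext i j
  show -(rowAt D.base w : g.Alg).mat i j = _
  by_cases hi : i = D.base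
  · rw [hi, rowAt_self, rowAt_self]
  · rw [rowAt_ne hi, rowAt_ne hi, neg_zero]

variable {lam : ℂ}

theorem zpow_neg_mul_zpow (n : ℤ) : -zpow (-n) * -zpow n = 1 := by
  have h : zpow (-n) * zpow n = 1 := by
    rw [DSReduction.zpow_add, neg_add_cancel, DSReduction.zpow_zero]
  linear_combination h

/-- The identification of the symbols with the reduced space. -/
def symbolEquiv (lam : ℂ) : PsiDS lam ≃ (barGl lam).Reduced where
  -- The sign comes from L = D^lam - ∑ b_j D^(lam-1-j), the powers of z from the passage between
  -- d/dz and z d/dz.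
  toFun L := (barEquiv lam 1).symm fun j : ℕ => -zpow (j + 1) * L.coeff j
  invFun x := ⟨fun j : ℕ => -zpow (-(j + 1)) * barEquiv lam 1 x j⟩
  left_inv L := by
    refine PsiDS.ext (funext fun j => ?_)
    show -zpow (-(j + 1)) * barEquiv lam 1 ((barEquiv lam 1).symm _) j = _
    rw [Equiv.apply_symm_apply, ← mul_assoc, zpow_neg_mul_zpow, one_mul]
  right_inv x := by
    rw [Equiv.symm_apply_eq]
    funext j
    rw [← mul_assoc, mul_comm (-zpow _), zpow_neg_mul_zpow, one_mul]

/-- The Gelfand--Dickey structure. -/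
def symbolPoisson (lam : ℂ) : PoissonStructure (PsiDS lam) :=
  (barPoisson lam).transport (symbolEquiv lam)

theorem mem_symbolPoisson {F : PsiDS lam → ℂ} :
    F ∈ (symbolPoisson lam).functions ↔ IsRegularSeq fun u => F ⟨u⟩ := by
  have h : F ∈ (symbolPoisson lam).functions ↔ IsRegularSeq fun β : ℕ → K =>
      F ⟨fun j : ℕ => -zpow (-(j + 1)) * β j⟩ := by
    refine (mem_barPoisson_iff (lam := lam) 1 (poleLE_one 0)
      (F := F ∘ (symbolEquiv lam).symm)).trans (iff_of_eq (congrArg _ (funext fun β => ?_)))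
    show F ⟨fun j : ℕ => -zpow (-(j + 1)) * barEquiv lam 1 ((barEquiv lam 1).symm β) j⟩ = _
    rw [Equiv.apply_symm_apply]
  rw [h]
  constructor
  · intro h'
    have h2 := h'.scale fun j : ℕ => -zpow (j + 1)
    simpa only [← mul_assoc, zpow_neg_mul_zpow, one_mul] using h2
  · exact fun h' => h'.scale fun j : ℕ => -zpow (-(j + 1))

theorem eq_of_pair_eq {I : Type} {q q' : I → K} (h : ∀ δ, pair δ q = pair δ q') : q = q' := by
  classical
  funext j
  ext l
  have := h (Pi.single j (zpow (-l)))
  rwa [pair_single, pair_single, coeff_zpow_mul, coeff_zpow_mul, neg_neg] at this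

/-- Both notions describe the same directional derivatives, and the pairing separates covectors; the
covector of D^(-lam) q is z times its right coefficients. -/
theorem IsGrad.isDifferentialAt_iff {F : PsiDS lam → ℂ} {L : PsiDS lam} {r : ℕ → K}
    (hr : IsGrad (fun u => F ⟨u⟩) L.coeff r) (q : ℕ →₀ K) :
    PsiDS.IsDifferentialAt F L q ↔ r = fun j => zpow 1 * rightCoeff dzD (doSym q) j := by
  have hd : ∀ δ : ℕ → K, HasDerivAt (fun s : ℂ => F ⟨L.coeff + s • δ⟩) (pair δ r) 0 := by
    intro δ
    have h1 := hr.2 (lineL L.coeff δ) (evL_zero_lineL _ _)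
    simp only [evL_lineL, d0L_lineL] at h1
    refine (congrArg (fun f => HasDerivAt f (pair δ r) 0) (funext fun s => ?_)).mp h1
    refine congrArg (fun u => F ⟨u⟩) (funext fun j => ?_)
    rw [← smul_eq_cst_mul]
    rfl
  have hp : ∀ δ : ℕ → K, symTrace (symMul lam (lowerSym δ) (covSym lam q))
      = pair δ fun j => zpow 1 * rightCoeff dzD (doSym q) j := by
    intro δ
    rw [symTrace_symMul_covSym (ordLE_lowerSym δ)]
    simp only [lowerSym_neg]
  constructor
  · intro h
    refine eq_of_pair_eq fun δ => ?_
    rw [← hp]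
    exact (hd δ).unique (h δ)
  · intro h δ
    rw [hp, ← h]
    exact hd δ

theorem isGrad_of_isDifferentialAt {F : PsiDS lam → ℂ} (hF : IsRegularSeq fun u => F ⟨u⟩)
    {L : PsiDS lam} {q : ℕ →₀ K} (h : PsiDS.IsDifferentialAt F L q) :
    IsGrad (fun u => F ⟨u⟩) L.coeff fun j => zpow 1 * rightCoeff dzD (doSym q) j := by
  obtain ⟨r, hr⟩ := hF.exists_isGrad L.coeff
  rwa [(IsGrad.isDifferentialAt_iff hr q).1 h] at hr

theorem exists_doSym_rightCoeff (p : ℕ → K) (k : ℕ) (hp : ∀ j, k ≤ j → p j = 0) :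
    ∃ q : ℕ →₀ K, rightCoeff dzD (doSym q) = p := by
  refine ⟨Finsupp.onFinset (Finset.range (k + 1)) (fun i => ofRightCoeff dzD p k i) fun i hi => ?_,
    ?_⟩
  · by_contra h
    exact hi (ordLE_ofRightCoeff p k _ (by simp at h; omega))
  · have e : doSym (Finsupp.onFinset (Finset.range (k + 1)) (fun i => ofRightCoeff dzD p k i)
        fun i hi => by
          by_contra h
          exact hi (ordLE_ofRightCoeff p k _ (by simp at h; omega))) = ofRightCoeff dzD p k := by
      funext n
      rw [doSym]
      split_ifs with h
      · rw [Finsupp.onFinset_apply, Int.toNat_of_nonneg h]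
      · rw [ofRightCoeff_neg p k (by omega)]
    rw [e]
    funext i
    rw [rightCoeff_ofRightCoeff]
    split_ifs with h
    · rfl
    · rw [hp i (by omega)]

/-- Hamiltonian data for the slice that corresponds to the symbols. -/
theorem exists_symbolSlice_ham (L : PsiDS lam) (q : ℕ →₀ K) : ∃ x : (barGl lam).Alg,
    (symbolSlice lam).Ham (fun j : ℕ => -zpow (j + 1) * L.coeff j)
      (fun j : ℕ => -zpow (-(j + 1)) * (zpow 1 * rightCoeff dzD (doSym q) j)) x
      fun j : ℕ => zpow (j + 1) * L.hamiltonian q (-1 - j) := by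
  obtain ⟨k, hk⟩ := exists_ordLE_doSym q
  have h := isHam_hamMat (dzD_cst lam) (b := fun j => -L.coeff j) hk
  have hx : (symbolSlice lam).Ham (fun j : ℕ => zpow (j + 1) * -L.coeff j)
      (fun i : ℕ => zpow (-i) * rightCoeff dzD (doSym q) i) (algOf (h.polyMat.diag_mul zpow)) _ :=
    ⟨fun i => ?_, vec_of_isHam_dz h⟩
  · refine ⟨-algOf (h.polyMat.diag_mul zpow), ?_⟩
    · have h2 := hx.neg
      have e1 : (fun j : ℕ => zpow (j + 1) * -L.coeff j) = fun j : ℕ => -zpow (j + 1) * L.coeff j :=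
        funext fun j => by ring
      have e2 : (fun i : ℕ => -(zpow (-i) * rightCoeff dzD (doSym q) i))
          = fun j : ℕ => -zpow (-(j + 1)) * (zpow 1 * rightCoeff dzD (doSym q) j) :=
        funext fun j => by
          have h0 : zpow (-(j + 1 : ℤ)) * zpow 1 = zpow (-j) := by
            rw [DSReduction.zpow_add]
            congr 1
            ring
          linear_combination rightCoeff dzD (doSym q) j * h0
      have e3 : (fun j : ℕ => zpow (j + 1) * L.hamiltonian q (-1 - j)) = fun j : ℕ => -(zpow (j + 1)
          * hamSym dzD (cst lam) (fun j => -L.coeff j) (doSym q) (-1 - j)) := funext fun j => by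
        rw [hamiltonian_eq, Pi.neg_apply]
        ring
      rw [← e1, ← e2, e3]
      exact h2
  · show zpow (((0 : ℕ) : ℤ) - i) * hamMat dzD (cst lam) _ (doSym q) i 0 = _
    rw [hamMat_col (dzD_cst lam) hk, Nat.cast_zero, zero_sub]

/-- The structure is defined through the slice with c = 0, but its bracket is known for all
differentials along the fiber, and Hamiltonian data on the slice with c = 1 supply such
differentials. -/
theorem barPoisson_bracket_of_ham (F G : (barPoisson lam).functions) {β q r w w' : ℕ → K}
    {x y : (barGl lam).Alg} (hq : IsGrad ((F : (barGl lam).Reduced → ℂ) ∘ (barEquiv lam 1).symm) β q)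
    (hr : IsGrad ((G : (barGl lam).Reduced → ℂ) ∘ (barEquiv lam 1).symm) β r)
    (hx : (symbolSlice lam).Ham β q x w) (hy : (symbolSlice lam).Ham β r y w') :
    ((barPoisson lam).bracket F G : (barGl lam).Reduced → ℂ) ((barEquiv lam 1).symm β)
      = -pair w r := by
  rw [← SliceData.Ham.tau hx hy]
  exact (isHamiltonianReduction_barPoisson lam).2 F G ((symbolSlice lam).S β) x y
    (SliceData.isFiberDiff (D := symbolSlice lam) hq hx)
    (SliceData.isFiberDiff (D := symbolSlice lam) hr hy)

/-- The Hamiltonian data on the slice with c = 1 have the vector field of the Gelfand–Dickey bracket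
up to the factors z^(j+1). These cancel in the pairing against the factors -z^(-(j+1)) of the
covector, and the signs combine. -/
theorem isGelfandDickey_symbolPoisson (lam : ℂ) : IsGelfandDickey lam (symbolPoisson lam) where
  mem_iff F := mem_symbolPoisson
  exists_differential F hF L := by
    obtain ⟨r, hr⟩ := (mem_symbolPoisson.1 hF).exists_isGrad L.coeff
    obtain ⟨k, hk⟩ := exists_bound hr.1
    obtain ⟨q, hq⟩ := exists_doSym_rightCoeff (fun j => zpow (-1) * r j) k fun j hj => by
      rw [hk j hj, mul_zero]
    refine ⟨q, (IsGrad.isDifferentialAt_iff hr q).2 (funext fun j => ?_)⟩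
    rw [hq, zpow_mul_zpow_mul, add_neg_cancel, DSReduction.zpow_zero, one_mul]
  bracket_eq F G L q r hq hr := by
    have hF := mem_symbolPoisson.1 F.2
    have hG := mem_symbolPoisson.1 G.2
    have ha : ∀ j : ℕ, -zpow (-(j + 1)) * -zpow (j + 1) = 1 := fun j => zpow_neg_mul_zpow _
    obtain ⟨x, hx⟩ := exists_symbolSlice_ham L q
    obtain ⟨y, hy⟩ := exists_symbolSlice_ham L r
    set β : ℕ → K := fun j : ℕ => -zpow (j + 1) * L.coeff j with hβ
    have hgrad : ∀ {H : PsiDS lam → ℂ} {q : ℕ →₀ K}, IsRegularSeq (fun u => H ⟨u⟩) →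
        PsiDS.IsDifferentialAt H L q → IsGrad ((H ∘ (symbolEquiv lam).symm) ∘ (barEquiv lam 1).symm)
          β fun j : ℕ => -zpow (-(j + 1)) * (zpow 1 * rightCoeff dzD (doSym q) j) := by
      intro H q hH hq
      have h := (isGrad_of_isDifferentialAt hH hq).scale ha
      refine (congrArg (fun f => IsGrad f β _) (funext fun u => ?_)).mp h
      show _ = H ⟨fun j : ℕ => -zpow (-(j + 1)) * barEquiv lam 1 ((barEquiv lam 1).symm u) j⟩
      rw [Equiv.apply_symm_apply]
    refine (barPoisson_bracket_of_ham ⟨(F : PsiDS lam → ℂ) ∘ (symbolEquiv lam).symm, F.2⟩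
      ⟨(G : PsiDS lam → ℂ) ∘ (symbolEquiv lam).symm, G.2⟩ (hgrad hF hq) (hgrad hG hr) hx hy).trans ?_
    obtain ⟨N, hN⟩ := ordLE_hamiltonian L q
    rw [symTrace_symMul_covSym hN]
    rw [pair, pair, ← HahnSeries.coeff_neg, ← finsum_neg_distrib]
    congr 1
    refine finsum_congr fun j => ?_
    linear_combination (L.hamiltonian q (-1 - j) * (zpow 1 * rightCoeff dzD (doSym r) j)) * ha j

end LoopModel

/-! ### The classical reduction at integral size -/

/-- Above the block of the first `n` rows, a matrix of size `n` with nearly constant diagonals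
vanishes. -/
theorem IsPolyMat.eq_zero_of_step {R : Type} [CommRing R] [Algebra ℂ R] [IsDomain R] [CharZero R]
    {d : Derivation ℂ R R} {n : ℕ} (hn : 1 ≤ n) {Y : ℕ → ℕ → R} (hY : IsPolyMat (n : R) Y)
    (hd : ∀ i, d (Y i i) = 0)
    (hs : ∀ i j, n ≤ j → Y i j = Y (i + 1) (j + 1) + d (Y (i + 1) j)) :
    ∀ i j, i < n → n ≤ j → Y i j = 0 := by
  obtain ⟨-, R₀, Q, -, h1, h2⟩ := hY
  -- From row n - 1 on every diagonal above the main one is constant along the rows, once the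
  -- previous diagonal is known to have zero derivative. The prescribed zero at lam - 1 = n - 1 then
  -- kills it.
  have hlow : ∀ m i, n ≤ i + 1 → d (Y i (i + m)) = 0 ∧ (1 ≤ m → Y i (i + m) = 0) := by
    intro m
    induction m with
    | zero => exact fun i _ => ⟨hd i, fun h => absurd h (by omega)⟩
    | succ m ih =>
      intro i hi
      have h : Y i (i + (m + 1)) = 0 := by
        refine eq_zero_of_difference_eq_zero (u := fun i => Y i (i + (m + 1))) (i₀ := n - 1)
          (U := Q (m + 1 : ℤ)) (R₀ := R₀) (a := (n : R) - ((1 : ℤ) : R)) (fun i hi => ?_)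
          (fun i hi => ?_) (h2 _ _ le_rfl (by omega)) i (by omega)
        · have := hs i (i + (m + 1)) (by omega)
          rw [show i + (m + 1) = i + 1 + m by ring, (ih (i + 1) (by omega)).1, add_zero] at this
          rw [show i + (m + 1) = i + 1 + m by ring, this, add_assoc (i + 1)]
        · rw [h1 i _ hi]
          congr
          push_cast
          ring
      exact ⟨by rw [h, map_zero], fun _ => h⟩
  intro i j hi hj
  -- Induction on the distance k from row n - 1 carries the vanishing up to the first rows.
  obtain ⟨k, hk⟩ := Nat.exists_eq_add_of_le (show i ≤ n - 1 by omega)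
  induction k generalizing i j with
  | zero =>
    obtain ⟨m, rfl⟩ := Nat.exists_eq_add_of_le (show i ≤ j by omega)
    exact (hlow m i (by omega)).2 (by omega)
  | succ k ih =>
    rw [hs i j hj, ih (i + 1) (j + 1) (by omega) (by omega) (by omega),
      ih (i + 1) j (by omega) hj (by omega), map_zero, add_zero]

namespace LoopModel

variable {n : ℕ}

/-- The block of the first `n` rows and columns. -/
def block (n : ℕ) {lam : ℂ} (M : (barGl lam).Alg) : (glMat n).Alg :=
  ⟨fun i j => M.mat i j, Set.mem_univ _⟩

section Block

variable {lam : ℂ}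

theorem block_apply (M : (barGl lam).Alg) (i j : Fin n) : (block n M).mat i j = M.mat i j := rfl

/-- Cutting out the block is multiplicative as soon as no intermediate index k ≥ n contributes; a
right factor that is upper triangular or a left factor with zero upper right block ensures this. -/
theorem block_mul {M N : (barGl lam).Alg}
    (h : ∀ i k j, i < n → j < n → n ≤ k → M.mat i k * N.mat k j = 0) :
    block n (M * N) = block n M * block n N := by
  refine Alg.ext ?_
  funext i j
  rw [block_apply, Alg.mul_apply, Alg.mul_apply]
  refine (finsum_eq_sum_of_support_subset (s := Finset.range n) _ fun k hk => ?_).trans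
    ((Fin.sum_univ_eq_sum_range (fun k => M.mat i k * N.mat k j) n).symm.trans
      (finsum_eq_sum_of_fintype _).symm)
  by_contra hkn
  exact hk (h i k j i.2 j.2 (by simpa using hkn))

theorem block_mul_upper {M N : (barGl lam).Alg} (hN : Upper N) :
    block n (M * N) = block n M * block n N :=
  block_mul fun i k j _ hj hk => by rw [hN k j (show j < k by omega), mul_zero]

theorem block_mul_block {M N : (barGl lam).Alg} (hM : ∀ i j, i < n → n ≤ j → M.mat i j = 0) :
    block n (M * N) = block n M * block n N :=
  block_mul fun i k j hi _ hk => by rw [hM i k hi hk, zero_mul]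

theorem block_one : block n (1 : (barGl lam).Alg) = 1 := rfl

theorem block_add (M N : (barGl lam).Alg) : block n (M + N) = block n M + block n N := rfl

theorem block_sub (M N : (barGl lam).Alg) : block n (M - N) = block n M - block n N := rfl

theorem block_theta (M : (barGl lam).Alg) :
    block n (thetaAlg _ M) = thetaAlg _ (block n M) := by
  refine Alg.ext ?_
  funext i j
  rw [block_apply, thetaAlg_apply, thetaAlg_apply]
  rfl

theorem Strict.block {M : (barGl lam).Alg} (hM : Strict M) : Strict (block n M) :=
  fun i j h => hM i j h

theorem Unip.block {M : (barGl lam).Alg} (hM : Unip M) : Unip (LoopModel.block n M) :=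
  fun i j h => hM i j h

/-- The extension of an `n × n` matrix by ones just below the diagonal. -/
def extMat (A : Matrix (Fin n) (Fin n) K) : ℕ → ℕ → K := fun i j =>
  if h : i < n ∧ j < n then A ⟨i, h.1⟩ ⟨j, h.2⟩ else if i = j + 1 then 1 else 0

theorem extMat_of_lt (A : Matrix (Fin n) (Fin n) K) (i j : Fin n) : extMat A i j = A i j :=
  dif_pos ⟨i.2, j.2⟩

theorem extMat_of_le {A : Matrix (Fin n) (Fin n) K} {i j : ℕ} (h : n ≤ i ∨ n ≤ j) :
    extMat A i j = if i = j + 1 then 1 else 0 := dif_neg (by omega)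

theorem isPolyMat_extMat (c : K) (A : Matrix (Fin n) (Fin n) K) : IsPolyMat c (extMat A) := by
  refine ⟨n + 1, n, fun k => if k = -1 then 1 else 0, fun i j h => ?_, fun i j h => ?_,
    fun k r h h' => ?_⟩
  · rw [extMat_of_le (by omega), if_neg (by omega)]
  · rw [extMat_of_le (Or.inl h)]
    beta_reduce
    split_ifs <;> first | omega | simp
  · beta_reduce
    rw [if_neg (by omega), eval_zero]

theorem isHess_extMat (A : (glMat n).fiber) : IsHess (extMat (A : Matrix (Fin n) (Fin n) K)) := by
  have h : ∀ i j, j < i → extMat (A : Matrix (Fin n) (Fin n) K) i j = if i = j + 1 then 1 else 0 := by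
    intro i j hij
    rw [extMat]
    split_ifs with h h' h'
    · exact ((mem_fiber_iff.1 A.2).2 ⟨i, h.1⟩ ⟨j, h.2⟩ hij).trans (if_pos h')
    · exact ((mem_fiber_iff.1 A.2).2 ⟨i, h.1⟩ ⟨j, h.2⟩ hij).trans (if_neg h')
    · rfl
    · rfl
  exact ⟨fun i => (h _ _ (Nat.lt_succ_self i)).trans (if_pos rfl),
    fun i j hij => (h _ _ (by omega)).trans (if_neg (by omega))⟩

/-- The extension of an element of the fiber of `n × n` matrices. -/
def extFiber (n : ℕ) (A : (glMat n).fiber) : (barGl (n : ℂ)).fiber :=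
  ⟨extMat (A : Matrix (Fin n) (Fin n) K),
    (isHess_iff (mem_barGl.2 (isPolyMat_extMat _ _))).1 (isHess_extMat A)⟩

theorem block_extFiber (A : (glMat n).fiber) : block n (toAlg (extFiber n A)) = toAlg A := by
  refine Alg.ext ?_
  funext i j
  exact extMat_of_lt _ i j

end Block

theorem frobenius_mem_fiber (b : Fin n → K) : (glMat n).frobenius b ∈ (glMat n).fiber := by
  refine mem_fiber_iff.2 ⟨Set.mem_univ _, fun i j h => ?_⟩
  have h' : (j : ℕ) < i := h
  show (if (i : ℕ) = 0 then b j else if (i : ℕ) = j + 1 then 1 else 0)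
    = if (i : ℕ) = j + 1 then 1 else 0
  rw [if_neg (by omega)]

/-- The slice of Frobenius matrices. -/
def matSlice (b : Fin n → K) : (glMat n).fiber := ⟨(glMat n).frobenius b, frobenius_mem_fiber b⟩

theorem extendZero_val (b : Fin n → K) (j : Fin n) : extendZero b j = b j := dif_pos j.2

theorem extendZero_of_le {b : Fin n → K} {j : ℕ} (h : n ≤ j) : extendZero b j = 0 :=
  dif_neg (by omega)

theorem extFiber_matSlice (b : Fin n → K) :
    extFiber n (matSlice b) = barSlice (n : ℂ) 0 (extendZero b) := by
  refine Subtype.ext ?_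
  funext i j
  show extMat ((glMat n).frobenius b) i j = sliceMat 0 (extendZero b) i j
  have hf : ∀ (i j : Fin n), (glMat n).frobenius b i j
    = if (i : ℕ) = 0 then b j else if (i : ℕ) = j + 1 then 1 else 0 := fun _ _ => rfl
  rcases i with _ | i
  · rw [sliceMat_zero, extMat]
    by_cases h : 0 < n ∧ j < n
    · rw [dif_pos h, hf, if_pos rfl]
      exact (extendZero_val b ⟨j, h.2⟩).symm
    · rw [dif_neg h, if_neg (by omega), extendZero_of_le (by omega)]
  · rw [sliceMat_succ, extMat]
    have e : (if i + 1 = j + 1 then (1 : K) else 0) = if j = i then 1 else 0 :=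
      if_congr (by omega) rfl rfl
    rw [zero_mul, ite_self, sub_zero, ← e]
    split_ifs with h h' h'
    · rw [hf, if_neg (Nat.succ_ne_zero i), if_pos h']
    · rw [hf, if_neg (Nat.succ_ne_zero i), if_neg h']
    · rfl
    · rfl

theorem sliceMat_extendZero_eq_zero (b : Fin n → K) {i j : ℕ} (hi : i < n) (hj : n ≤ j) :
    sliceMat 0 (extendZero b) i j = 0 := by
  rcases i with _ | i
  · rw [sliceMat_zero, extendZero_of_le hj]
  · rw [sliceMat_succ, if_neg (by omega), zero_mul, ite_self, sub_zero]

theorem block_barSlice (b : Fin n → K) :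
    block n (toAlg (barSlice (n : ℂ) 0 (extendZero b))) = toAlg (matSlice b) := by
  rw [← extFiber_matSlice, block_extFiber]

theorem block_vec (b : Fin n → K) {M : (barGl (n : ℂ)).Alg}
    (hM : ∀ i j, i < n → n ≤ j → M.mat i j = 0) :
    block n (vec (toAlg (barSlice (n : ℂ) 0 (extendZero b))) M)
      = vec (toAlg (matSlice b)) (block n M) := by
  rw [vec, vec, gaugeField, gaugeField, block_add, block_sub, block_mul_block hM,
    block_mul_block fun i j hi hj => sliceMat_extendZero_eq_zero b hi hj, block_theta,
    block_barSlice]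

theorem cst_natCast : cst (n : ℂ) = (n : K) := by rw [cst_eq, map_natCast]

/-- The extended matrix has a single one in each column j ≥ n, so the gauge equations there are
those of `IsPolyMat.eq_zero_of_step` and the upper right block of X is zero. Hence b stops at n, and
the block of X is a gauge transformation of n × n matrices. -/
theorem exists_gauge_matSlice (hn : 1 ≤ n) (A : (glMat n).fiber) : ∃ b : Fin n → K,
    (glMat n).proj A = (glMat n).proj (matSlice b) ∧
    barEquiv (n : ℂ) 0 ((barGl (n : ℂ)).proj (extFiber n A)) = extendZero b := by
  obtain ⟨X, b, h⟩ := exists_isGauge_fiber 0 (extFiber n A)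
  have hE : ∀ k j, n ≤ j → (extFiber n A : Matrix ℕ ℕ K) k j = if k = j + 1 then 1 else 0 :=
    fun k j hj => extMat_of_le (Or.inr hj)
  have hsum : ∀ i j, n ≤ j → ∑ k ∈ Finset.range (j + 2), X i k * (extFiber n A : Matrix ℕ ℕ K) k j
      = X i (j + 1) := by
    intro i j hj
    rw [Finset.sum_eq_single (j + 1), hE _ _ hj, if_pos rfl, mul_one]
    · intro k _ hk
      rw [hE _ _ hj, if_neg hk, mul_zero]
    · intro h'
      exact absurd (Finset.mem_range.2 (by omega)) h'
  have hp := h.polyMat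
  rw [cst_natCast] at hp
  have hX : ∀ i j, i < n → n ≤ j → X i j = 0 := hp.eq_zero_of_step (d := theta ℂ) hn
    (fun i => by rw [h.diag, Derivation.map_one_eq_zero])
    fun i j hj => by rw [h.step i j, hsum _ _ hj, zero_mul, zero_mul, add_zero]
  have hb : ∀ j, n ≤ j → b j = 0 := by
    intro j
    induction j using Nat.strong_induction_on with
    | _ j ih =>
      intro hj
      have h1 := h.row j
      rw [hsum _ _ hj, hX 0 _ hn (by omega), hX 0 _ hn hj, map_zero, add_zero,
        Finset.sum_range_succ, h.diag, mul_one, Finset.sum_eq_zero, zero_add] at h1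
      · exact h1.symm
      · intro k hk
        rcases lt_or_ge k n with hkn | hkn
        · rw [hX k j hkn hj, mul_zero]
        · rw [ih k (by simpa using hk) hkn, zero_mul]
  obtain ⟨b, rfl⟩ : ∃ c : Fin n → K, b = extendZero c := ⟨fun j => b j, funext fun j => by
    rcases lt_or_ge j n with hj | hj
    · exact (extendZero_val (fun j : Fin n => b j) ⟨j, hj⟩).symm
    · rw [hb j hj, extendZero_of_le hj]⟩
  refine ⟨b, ?_, barEquiv_proj 0 _ h⟩
  let x : (barGl (n : ℂ)).Alg := algOf h.polyMat
  have hx : Unip x := unip_barGl_iff.2 ⟨h.diag, h.lower⟩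
  obtain ⟨y, hy, h1, h2⟩ := exists_inv_barGl hx
  have h3 := congrArg (block n) ((isGauge_iff 0 _ _ hx).2 h)
  rw [block_add, block_mul_block hX, block_theta, block_mul_upper hx.upper, block_barSlice,
    block_extFiber] at h3
  refine proj_eq_iff.2 ⟨block n x, block n y, (isGaugeEq_iff hx.block hy.block ?_ ?_).2 h3⟩
  · rw [← block_mul_upper hy.upper, h1, block_one]
  · rw [← block_mul_upper hx.upper, h2, block_one]

/-- A unitriangular matrix between two Frobenius matrices is the identity: its last row is a row of
the identity, and the gauge equation computes each row from the next one. -/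
theorem matSlice_injective (hn : 1 ≤ n) :
    Function.Injective fun b : Fin n → K => (glMat n).proj (matSlice b) := by
  intro b b' h
  obtain ⟨X, Y, h⟩ := proj_eq_iff.1 h
  have hX := h.1
  have he := (isGaugeEq_iff h.1 h.2.1 h.2.2.1 h.2.2.2.1).1 h
  have hU : ∀ i j : Fin n, j ≤ i → X.mat i j = if i = j then 1 else 0 := by
    intro i j hij
    have := hX i j hij
    rw [Alg.sub_mat, Matrix.sub_apply, sub_eq_zero, Alg.one_apply] at this
    rw [this]
    exact if_congr Fin.ext_iff.symm rfl rfl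
  have hS : ∀ (c : Fin n → K) (i j : Fin n), (i : ℕ) ≠ 0 →
      (toAlg (matSlice c)).mat i j = if (i : ℕ) = j + 1 then 1 else 0 := fun c i j hi => if_neg hi
  have hone : ∀ (k : ℕ) (i j : Fin n), n ≤ i + k + 1 → X.mat i j = if i = j then 1 else 0 := by
    intro k
    induction k with
    | zero => exact fun i j hi => hU i j (Fin.le_def.2 (by omega))
    | succ k ih =>
      intro i j hi
      rcases lt_or_ge ((i : ℕ) + 1) n with hin | hin
      · set i' : Fin n := ⟨i + 1, hin⟩ with hi'
        have hi0 : (i' : ℕ) ≠ 0 := Nat.succ_ne_zero i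
        have h1 := congrArg (fun a => a.mat i' j) he
        simp only [Alg.add_mat, Matrix.add_apply] at h1
        have hrow : ∀ j, X.mat i' j = if i' = j then 1 else 0 := fun j =>
          ih i' j (by show n ≤ i + 1 + k + 1; omega)
        rw [Alg.mul_apply, Alg.mul_apply, thetaAlg_apply, finsum_eq_single _ i',
          finsum_eq_single _ i, hrow i', if_pos rfl, hS _ _ _ hi0, hS _ _ _ hi0, hrow j] at h1
        · have hth : theta ℂ (if i' = j then (1 : K) else 0) = 0 := by split_ifs <;> simp
          rw [hth, add_zero, one_mul, if_pos (show (i' : ℕ) = i + 1 from rfl), one_mul] at h1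
          rw [← h1]
          refine if_congr ?_ rfl rfl
          rw [Fin.ext_iff]
          show i + 1 = (j : ℕ) + 1 ↔ _
          omega
        · intro k hk
          rw [hS _ _ _ hi0, if_neg (fun h => hk (Fin.ext (Nat.succ_injective h.symm))), zero_mul]
        · intro k hk
          rw [hrow, if_neg hk.symm, zero_mul]
      · exact ih i j (by omega)
  have hX1 : X = 1 := Alg.ext (by
    funext i j
    rw [hone n i j (by omega), Alg.one_apply]
    exact if_congr Fin.ext_iff rfl rfl)
  have hth1 : thetaAlg (glMat n) 1 = 0 := by
    have := thetaAlg_mul (g := glMat n) 1 1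
    rw [mul_one, one_mul, mul_one] at this
    exact left_eq_add.1 this
  rw [hX1, one_mul, mul_one, hth1, add_zero] at he
  funext j
  have h0 := congrArg (fun a => a.mat ⟨0, hn⟩ j) he
  have e : ∀ c : Fin n → K, (toAlg (matSlice c)).mat ⟨0, hn⟩ j = c j := fun c => by
    show (if ((⟨0, hn⟩ : Fin n) : ℕ) = 0 then c j
      else if ((⟨0, hn⟩ : Fin n) : ℕ) = (j : ℕ) + 1 then 1 else 0) = c j
    exact if_pos rfl
  rwa [e, e] at h0

/-- The identification of the reduced space of `n × n` matrices with the slice. -/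
def matEquiv (hn : 1 ≤ n) : (glMat n).Reduced ≃ (Fin n → K) :=
  (Equiv.ofBijective _ ⟨matSlice_injective hn, fun x => by
    obtain ⟨A, rfl⟩ : ∃ A, (glMat n).proj A = x := Quot.exists_rep x
    obtain ⟨b, hb, -⟩ := exists_gauge_matSlice hn A
    exact ⟨b, hb.symm⟩⟩).symm

theorem matEquiv_symm (hn : 1 ≤ n) (b : Fin n → K) :
    (matEquiv hn).symm b = (glMat n).proj (matSlice b) := rfl

theorem barEquiv_extFiber (hn : 1 ≤ n) (A : (glMat n).fiber) :
    barEquiv (n : ℂ) 0 ((barGl (n : ℂ)).proj (extFiber n A))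
      = extendZero (matEquiv hn ((glMat n).proj A)) := by
  obtain ⟨b, hb, h⟩ := exists_gauge_matSlice hn A
  rw [h, hb, ← matEquiv_symm hn, Equiv.apply_symm_apply]

theorem hasFrobeniusForm_matEquiv (hn : 1 ≤ n) (x : (glMat n).Reduced) :
    (glMat n).HasFrobeniusForm x (matEquiv hn x) :=
  ⟨frobenius_mem_fiber _, ((matEquiv hn).symm_apply_apply x).symm⟩

/-- The slice of Frobenius matrices. -/
def matSliceData (hn : 1 ≤ n) : SliceData (glMat n) where
  base := ⟨0, hn⟩
  idx_base := rfl
  S := matSlice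
  β := matEquiv hn
  β_proj b := by rw [← matEquiv_symm hn, Equiv.apply_symm_apply]
  -- V is padded by zeros and the curve for size n is used. The orbit direction found there has zero
  -- upper right block, so the relation survives the restriction to the block.
  curve b V hV := by
    have hVp : IsPolyMat (cst (n : ℂ)) fun i j : ℕ =>
        if h : i < n ∧ j < n then V.mat ⟨i, h.1⟩ ⟨j, h.2⟩ else 0 :=
      IsPolyMat.of_rows (N := n) (R₀ := n) (fun i j h => dif_neg (by omega))
        fun i j h => dif_neg (by omega)
    have hVu : Upper (algOf hVp) := fun i j hij => by
      show (if h : i < n ∧ j < n then V.mat ⟨i, h.1⟩ ⟨j, h.2⟩ else 0) = 0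
      split_ifs with h
      · exact hV _ _ hij
      · rfl
    obtain ⟨u, hu, m, hm, hmu⟩ := barSlice_curve (extendZero b) hVu
    refine ⟨fun j => u j, fun s B hB j => ?_, block n m, hm.block, ?_⟩
    · rw [← hu s (extFiber n B), barEquiv_extFiber hn, extendZero_val]
      rw [← extFiber_matSlice]
      refine Alg.ext ?_
      funext i j
      show extMat (B : Matrix (Fin n) (Fin n) K) i j = extMat ((glMat n).frobenius b) i j
        + cst s * (if h : i < n ∧ j < n then V.mat ⟨i, h.1⟩ ⟨j, h.2⟩ else 0)
      rw [extMat, extMat]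
      split_ifs with h
      · exact congrArg (fun a => a.mat ⟨i, h.1⟩ ⟨j, h.2⟩) hB
      · rw [mul_zero, add_zero]
      · rw [mul_zero, add_zero]
    · have hm0 : ∀ i j, i < n → n ≤ j → m.mat i j = 0 := by
        have hp := mem_barGl.1 m.mem
        rw [cst_natCast] at hp
        refine hp.eq_zero_of_step (d := theta ℂ) hn (fun i => by rw [hm i i le_rfl, map_zero])
          fun i j hj => ?_
        have h1 := congrArg (fun a => a.mat (i + 1) j) hmu
        simp only [Alg.add_mat, Matrix.add_apply] at h1
        rw [rowAt_ne (Nat.succ_ne_zero i), vec_barSlice_succ, hm (i + 1) 0 (Nat.zero_le _)] at h1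
        have h2 : (algOf hVp).mat (i + 1) j = 0 := dif_neg (by omega)
        rw [h2] at h1
        linear_combination -h1
      rw [← block_vec b hm0]
      have hV' : block n (algOf hVp) = V := by
        refine Alg.ext ?_
        funext i j
        exact dif_pos ⟨i.2, j.2⟩
      rw [← hV', ← block_add, hmu]
      refine Alg.ext ?_
      funext i j
      rw [block_apply]
      by_cases hi : i = ⟨0, hn⟩
      · rw [hi, rowAt_self, rowAt_self]
      · rw [rowAt_ne hi, rowAt_ne fun h => hi (Fin.ext h)]
  ham b q _ := by
    obtain ⟨x, w, h, hx, -⟩ := exists_isHam_natCast (d := theta ℂ) hn (b := extendZero b)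
      (fun j hj => extendZero_of_le hj) (q := extendZero q) (k := n) fun j hj => extendZero_of_le hj
    rw [← cst_natCast] at h
    refine ⟨block n (algOf h.polyMat), fun j => w j, fun i => ?_, ?_⟩
    · exact (h.col i).trans (extendZero_val q i)
    · rw [← block_vec b hx, vec_of_isHam h]
      refine Alg.ext ?_
      funext i j
      rw [block_apply]
      by_cases hi : i = ⟨0, hn⟩
      · rw [hi, rowAt_self, rowAt_self]
      · rw [rowAt_ne hi, rowAt_ne fun h => hi (Fin.ext h)]

end LoopModel

/-! ### The classical reduced space as a Poisson submanifold -/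

section Restrict

variable {n : ℕ}

theorem pair_val {w q : ℕ → K} (h : ∀ j, n ≤ j → w j = 0 ∨ q j = 0) :
    pair w q = pair (fun j : Fin n => w j) fun j => q j := by
  rw [pair, pair]
  congr 1
  refine (finsum_eq_sum_of_support_subset (s := Finset.range n) _ fun k hk => ?_).trans
    ((Fin.sum_univ_eq_sum_range (fun k => w k * q k) n).symm.trans
      (finsum_eq_sum_of_fintype _).symm)
  by_contra hkn
  rcases h k (by simpa using hkn) with h | h
  · exact hk (by beta_reduce; rw [h, zero_mul])
  · exact hk (by beta_reduce; rw [h, mul_zero])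

theorem IsGrad.extend {Ψ : (Fin n → K) → ℂ} {b q : Fin n → K} (h : IsGrad Ψ b q) :
    IsGrad (fun u : ℕ → K => Ψ fun j : Fin n => u j) (extendZero b) (extendZero q) := by
  refine ⟨finite_of_bound (k := n) fun j hj => LoopModel.extendZero_of_le hj, fun u hu => ?_⟩
  rw [pair_val fun j hj => Or.inr (LoopModel.extendZero_of_le hj)]
  simp only [LoopModel.extendZero_val]
  exact h.2 (fun j => u j) fun j => by rw [hu, LoopModel.extendZero_val]

theorem IsGrad.val {Ψ : (Fin n → K) → ℂ} {b : Fin n → K} {q : ℕ → K}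
    (h : IsGrad (fun u : ℕ → K => Ψ fun j : Fin n => u j) (extendZero b) q) : IsGrad Ψ b fun j => q j := by
  refine ⟨Set.toFinite _, fun u hu => ?_⟩
  have h1 := h.2 (fun j => if hj : j < n then u ⟨j, hj⟩ else 0) fun j => by
    rw [extendZero]
    split_ifs with hj
    · exact hu _
    · exact map_zero _
  rw [pair_val fun j hj => Or.inl (by rw [dif_neg (Nat.not_lt.2 hj), map_zero])] at h1
  simp only [Fin.is_lt, dif_pos, Fin.eta] at h1
  exact h1

end Restrict

namespace LoopModel

variable {n : ℕ} (hn : 1 ≤ n)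

/-- The embedding of the classical reduced space. -/
def matEmbedding (x : (glMat n).Reduced) : (barGl (n : ℂ)).Reduced :=
  (barEquiv (n : ℂ) 0).symm (extendZero (matEquiv hn x))

/-- The retraction onto the classical reduced space. -/
def matRetraction (y : (barGl (n : ℂ)).Reduced) : (glMat n).Reduced :=
  (matEquiv hn).symm fun j => barEquiv (n : ℂ) 0 y j

/-- At a point of the subspace the Hamiltonian vector field of any function is tangent to it, and
only the first n members of the covectors enter. The block of the Hamiltonian matrix provides the
classical data. -/
theorem seqBracket_extendZero {F G : (ℕ → K) → ℂ} (hF : IsRegularSeq F) (hG : IsRegularSeq G)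
    {b : Fin n → K} {q r : ℕ → K} (hq : IsGrad F (extendZero b) q)
    (hr : IsGrad G (extendZero b) r) : ∃ (x : (glMat n).Alg) (w : Fin n → K),
      (matSliceData hn).Ham b (fun j => q j) x w ∧
      seqBracket (n : ℂ) F G (extendZero b) = -pair w fun j => r j := by
  obtain ⟨k, hk⟩ := exists_bound hq.1
  obtain ⟨x, w, h, hx, hw⟩ := exists_isHam_natCast (d := theta ℂ) hn (b := extendZero b)
    (fun j hj => extendZero_of_le hj) (q := q) (k := k) hk
  rw [← cst_natCast] at h
  refine ⟨block n (algOf h.polyMat), fun j => w j, ⟨fun i => h.col i, ?_⟩, ?_⟩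
  · refine (block_vec b hx).symm.trans ?_
    rw [vec_of_isHam h]
    refine Alg.ext ?_
    funext i j
    rw [block_apply]
    by_cases hi : i = ⟨0, hn⟩
    · rw [hi, rowAt_self]
      exact (rowAt_self (⟨0, hn⟩ : Fin n) (fun j : Fin n => w j) j).symm
    · rw [rowAt_ne fun h => hi (Fin.ext h)]
      exact (rowAt_ne hi (fun j : Fin n => w j) j).symm
  · rw [seqBracket_eq hF hG hq hr (ham_of_isHam h), pair_val fun j hj => Or.inl (hw j hj)]

theorem isRetract_mat :
    (barPoisson (n : ℂ)).IsRetract (matEmbedding hn) (matRetraction hn) where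
  left_inv x := by
    rw [matEmbedding, matRetraction, Equiv.apply_symm_apply]
    simp only [extendZero_val]
    exact (matEquiv hn).symm_apply_apply x
  mem F hF := by
    -- Restriction followed by extension amounts to multiplying the members from n on by zero.
    have h := IsRegularSeq.scale hF fun j => if j < n then 1 else 0
    refine (congrArg IsRegularSeq (funext fun u => ?_)).mp h
    simp only [Function.comp_apply, matEmbedding, matRetraction, Equiv.apply_symm_apply]
    congr 2
    funext j
    rw [extendZero]
    split_ifs with hj
    · exact one_mul _
    · exact zero_mul _
  bracket F G hG := by
    classical
    funext x
    have h0 : ∀ b : Fin n → K,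
        ((G : (barGl (n : ℂ)).Reduced → ℂ) ∘ (barEquiv (n : ℂ) 0).symm) (extendZero b) = 0 := by
      intro b
      have := congrFun hG ((matEquiv hn).symm b)
      rwa [Function.comp_apply, matEmbedding, Equiv.apply_symm_apply] at this
    have hF' : IsRegularSeq ((F : (barGl (n : ℂ)).Reduced → ℂ) ∘ (barEquiv (n : ℂ) 0).symm) := F.2
    have hG' : IsRegularSeq ((G : (barGl (n : ℂ)).Reduced → ℂ) ∘ (barEquiv (n : ℂ) 0).symm) := G.2
    set b := matEquiv hn x with hb
    obtain ⟨q, hq⟩ := hF'.exists_isGrad (extendZero b)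
    obtain ⟨r, hr⟩ := hG'.exists_isGrad (extendZero b)
    obtain ⟨y, w, -, h⟩ := seqBracket_extendZero hn hF' hG' hq hr
    rw [Function.comp_apply, barPoisson_bracket, matEmbedding, Equiv.apply_symm_apply, h]
    -- The line in the direction of the Hamiltonian vector field of F stays in the subspace, where G
    -- is zero, so the derivative of G along it vanishes.
    have hw := hr.2 (lineL (extendZero b) (extendZero w)) (evL_zero_lineL _ _)
    have e : (fun s : ℂ => ((G : (barGl (n : ℂ)).Reduced → ℂ) ∘ (barEquiv (n : ℂ) 0).symm)
        fun j => evL s (lineL (extendZero b) (extendZero w) j)) = fun _ => 0 := by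
      funext s
      rw [← h0 fun j => b j + cst s * w j]
      congr 1
      funext j
      rw [evL_lineL, extendZero, extendZero, extendZero]
      split_ifs <;> simp
    rw [e] at hw
    simp only [d0L_lineL] at hw
    have h1 := hw.unique (hasDerivAt_const 0 0)
    rw [pair_val fun j hj => Or.inl (extendZero_of_le hj)] at h1
    simp only [extendZero_val] at h1
    rw [h1, neg_zero]
    rfl

/-- The classical reduced Poisson structure. -/
def matPoisson : PoissonStructure (glMat n).Reduced :=
  (barPoisson (n : ℂ)).restrict (isRetract_mat hn)

theorem mem_matPoisson {F : (glMat n).Reduced → ℂ} : F ∈ (matPoisson hn).functions ↔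
    IsRegularSeq fun u : ℕ → K => F ((matEquiv hn).symm fun j : Fin n => u j) := by
  refine iff_of_eq (congrArg IsRegularSeq (funext fun u => ?_))
  simp only [Function.comp_apply, matRetraction, Equiv.apply_symm_apply]

/-- In one direction the function is evaluated on Frobenius matrices. In the other it is pulled back
through the retraction, where regularity on the fiber is known, and restricted to extended matrices.
-/
theorem isRegularOnFiber_glMat_iff (F : (glMat n).Reduced → ℂ) :
    (glMat n).IsRegularOnFiber (fun A => F ((glMat n).proj A)) ↔
      IsRegularSeq fun u : ℕ → K => F ((matEquiv hn).symm fun j : Fin n => u j) := by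
  classical
  constructor
  · rintro ⟨k, h⟩
    refine ⟨n, fun m => ?_⟩
    obtain ⟨P, hP⟩ := h Set.univ rfl m
    have hA : ∀ (u : ℕ → K) (i j : Fin n), i ≤ j → (glMat n).frobenius (fun j : Fin n => u j) i j
        = if (i : ℕ) = 0 then u j else 0 := by
      intro u i j hij
      show (if (i : ℕ) = 0 then u j else if (i : ℕ) = j + 1 then 1 else 0) = _
      rw [if_neg (c := (i : ℕ) = j + 1) (by have := Fin.le_def.1 hij; omega)]
    refine ⟨MvPolynomial.aeval (fun v : (glMat n).Band k × ℤ =>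
      if (v.1.1.1 : ℕ) = 0 then MvPolynomial.X (v.1.1.2, v.2) else 0) P, fun u hu => ?_⟩
    refine (hP (matSlice fun j => u j) trivial ?_).trans (eval_eq_eval_aeval fun v => ?_)
    · rintro ⟨i, j⟩ hij
      show PoleLE m ((glMat n).frobenius (fun j : Fin n => u j) i j)
      rw [hA u i j hij.1]
      split_ifs
      · exact hu j j.2
      · exact poleLE_zero m
    · have h1 : (matSlice fun j : Fin n => u j : Matrix (Fin n) (Fin n) K) v.1.1.1 v.1.1.2 = _ :=
        hA u v.1.1.1 v.1.1.2 v.1.2.1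
      rw [h1]
      split_ifs
      · rw [MvPolynomial.eval_X]
      · rw [HahnSeries.coeff_zero, map_zero]
  · intro hF
    have h : (barGl (n : ℂ)).IsRegularOnFiber fun A => F (matRetraction hn ((barGl (n : ℂ)).proj A)) :=
      (isRegularOnFiber_iff 0 (poleLE_zero 0) (fun x => F (matRetraction hn x))).2
        ((mem_matPoisson hn).2 hF)
    obtain ⟨k, h⟩ := h
    refine ⟨n, fun S _ m => ?_⟩
    -- Beyond its first n rows an extended matrix is zero on and above the diagonal, so n
    -- exceptional rows and degree 0 suffice.
    obtain ⟨P, hP⟩ := h {A | ∀ l < k, ∃ q : Polynomial K, q.natDegree ≤ 0 ∧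
      ∀ i ≥ n, A i (i + l) = q.eval (i : K)} ⟨n, 0, rfl⟩ m
    refine ⟨MvPolynomial.aeval (fun v : (barGl (n : ℂ)).Band k × ℤ =>
      if h : v.1.1.1 < n ∧ v.1.1.2 < n then MvPolynomial.X
        (⟨(⟨v.1.1.1, h.1⟩, ⟨v.1.1.2, h.2⟩), v.1.2.1, lt_of_lt_of_le h.2 (Nat.le_add_left _ _)⟩, v.2)
      else 0) P, fun A _ hp => ?_⟩
    have hr : F ((glMat n).proj A)
        = F (matRetraction hn ((barGl (n : ℂ)).proj (extFiber n A))) := by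
      rw [matRetraction, barEquiv_extFiber hn]
      simp only [extendZero_val]
      rw [Equiv.symm_apply_apply]
    have hE : ∀ i j, i ≤ j → (extFiber n A : Matrix ℕ ℕ K) i j
        = if h : i < n ∧ j < n then (A : Matrix (Fin n) (Fin n) K) ⟨i, h.1⟩ ⟨j, h.2⟩ else 0 := by
      intro i j hij
      show extMat _ i j = _
      rw [extMat, if_neg (by omega)]
    refine hr.trans ((hP (extFiber n A) ?_ ?_).trans (eval_eq_eval_aeval fun v => ?_))
    · refine fun l _ => ⟨0, by simp, fun i hi => ?_⟩
      rw [hE _ _ (by omega), dif_neg (by omega), eval_zero]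
    · rintro ⟨i, j⟩ hij
      show PoleLE m ((extFiber n A : Matrix ℕ ℕ K) i j)
      rw [hE i j hij.1]
      split_ifs with h
      · exact hp (⟨i, h.1⟩, ⟨j, h.2⟩) ⟨hij.1, lt_of_lt_of_le h.2 (Nat.le_add_left _ _)⟩
      · exact poleLE_zero m
    · have h1 : (extFiber n A : Matrix ℕ ℕ K) v.1.1.1 v.1.1.2 = _ := hE _ _ v.1.2.1
      refine (congrArg (fun x : K => x.coeff v.2) h1).trans ?_
      split_ifs with h
      · rw [MvPolynomial.eval_X]
      · rw [HahnSeries.coeff_zero, map_zero]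

theorem isHamiltonianReduction_matPoisson :
    (glMat n).IsHamiltonianReduction (matPoisson hn) := by
  refine ((matSliceData hn).isHamiltonianReduction (matPoisson hn) (fun F => ?_) (fun F hF b => ?_)
    fun F G b q r w x hq hr hx => ?_).1
  · rw [mem_matPoisson, isRegularOnFiber_glMat_iff hn]
  · obtain ⟨q, hq⟩ := ((mem_matPoisson hn).1 hF).exists_isGrad (extendZero b)
    exact ⟨_, IsGrad.val hq⟩
  · have hF := (mem_matPoisson hn).1 F.2
    have hG := (mem_matPoisson hn).1 G.2
    obtain ⟨x', w', hx', h⟩ := seqBracket_extendZero hn hF hG hq.extend hr.extend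
    simp only [extendZero_val] at hx' h
    obtain ⟨y, v, hy⟩ := (matSliceData hn).ham b r hr.1
    -- The given Hamiltonian data and those cut from size n are not compared directly. Antisymmetry
    -- against data for the second covector shows that both fields pair with it equally.
    have e : pair w r = pair w' r := by
      rw [← SliceData.Ham.tau hx hy, ← SliceData.Ham.tau hx' hy, tau_vec_mul _ x y,
        tau_vec_mul _ x' y, SliceData.Ham.tau hy hx, SliceData.Ham.tau hy hx']
    have hb : barEquiv (n : ℂ) 0 (matEmbedding hn ((matEquiv hn).symm b)) = extendZero b := by
      rw [matEmbedding, Equiv.apply_symm_apply, Equiv.apply_symm_apply]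
    have hr : ∀ F : (glMat n).Reduced → ℂ, (F ∘ matRetraction hn) ∘ (barEquiv (n : ℂ) 0).symm
        = fun u : ℕ → K => F ((matEquiv hn).symm fun j : Fin n => u j) := fun F => by
      funext u
      simp only [Function.comp_apply, matRetraction, Equiv.apply_symm_apply]
    rw [e, ← h, ← hb, ← hr, ← hr]
    rfl

end LoopModel

/-- The inverse of an isomorphism of Poisson manifolds. -/
def PoissonIso.symm {M M' : Type} {P : PoissonStructure M} {P' : PoissonStructure M'}
    (e : PoissonIso P P') : PoissonIso P' P where
  toEquiv := e.toEquiv.symm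
  mem_iff F := by
    rw [← e.mem_iff, Function.comp_assoc, Equiv.symm_comp_self, Function.comp_id]
  map_bracket F G F' G' hF hG := by
    rw [e.map_bracket F' G' F G, Function.comp_assoc, Equiv.self_comp_symm, Function.comp_id]
    · rw [hF, Function.comp_assoc, Equiv.symm_comp_self, Function.comp_id]
    · rw [hG, Function.comp_assoc, Equiv.symm_comp_self, Function.comp_id]

end

end DSReduction
-- The main theorem
open DSReduction in
theorem theorem3p8 :
    ∃ (P : ∀ lam : ℂ, PoissonStructure (barGl lam).Reduced)
      (Q : ∀ lam : ℂ, PoissonStructure (PsiDS lam))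
      (β : ∀ lam : ℂ, (barGl lam).Reduced ≃ (ℕ → K)),
      -- the reduced space is isomorphic to the Gelfand--Dickey Poisson manifold
      (∀ lam : ℂ, (barGl lam).IsHamiltonianReduction (P lam) ∧ IsGelfandDickey lam (Q lam) ∧
        Nonempty (PoissonIso (P lam) (Q lam))) ∧
      -- Frobenius matrices identify all the reduced spaces with one and the same space
      (∀ (lam : ℂ) (x : (barGl lam).Reduced), (barGl lam).HasFrobeniusForm x (β lam x)) ∧
      (∀ (lam : ℂ) (F : (ℕ → K) → ℂ), F ∘ β lam ∈ (P lam).functions ↔ IsRegularSeq F) ∧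
      -- on that space the brackets depend polynomially on the parameter
      (∀ F G : (ℕ → K) → ℂ, IsRegularSeq F → IsRegularSeq G → ∀ b : ℕ → K, ∃ p : Polynomial ℂ,
        ∀ (lam : ℂ) (F' G' : (P lam).functions),
          (F' : (barGl lam).Reduced → ℂ) = F ∘ β lam →
          (G' : (barGl lam).Reduced → ℂ) = G ∘ β lam →
          ((P lam).bracket F' G' : (barGl lam).Reduced → ℂ) ((β lam).symm b) = p.eval lam) ∧
      -- for integral values the classical reduction is a Poisson submanifold
      (∀ n : ℕ, 1 ≤ n → ∃ (Pn : PoissonStructure (glMat n).Reduced)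
        (βn : (glMat n).Reduced ≃ (Fin n → K)),
        (glMat n).IsHamiltonianReduction Pn ∧
        (∀ x : (glMat n).Reduced, (glMat n).HasFrobeniusForm x (βn x)) ∧
        IsPoissonEmbedding Pn (P n) (fun x => (β n).symm (extendZero (βn x)))) := by
  refine ⟨LoopModel.barPoisson, LoopModel.symbolPoisson, fun lam => LoopModel.barEquiv lam 0,
    fun lam => ⟨(LoopModel.isHamiltonianReduction_barPoisson lam).1, LoopModel.isGelfandDickey_symbolPoisson lam,
      ⟨((LoopModel.barPoisson lam).transportIso (LoopModel.symbolEquiv lam)).symm⟩⟩,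
    fun lam => LoopModel.hasFrobeniusForm_barEquiv, fun lam F => ?_, fun F G hF hG b => ?_, fun n hn =>
      ⟨LoopModel.matPoisson hn, LoopModel.matEquiv hn, LoopModel.isHamiltonianReduction_matPoisson hn,
        LoopModel.hasFrobeniusForm_matEquiv hn, PoissonStructure.isPoissonEmbedding_restrict (LoopModel.isRetract_mat hn)⟩⟩
  · rw [LoopModel.mem_barPoisson, Function.comp_assoc, Equiv.self_comp_symm, Function.comp_id]
  · obtain ⟨p, hp⟩ := exists_seqBracket_eq_eval hF hG b
    refine ⟨p, fun lam F' G' hF' hG' => ?_⟩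
    rw [LoopModel.barPoisson_bracket, hF', hG', Function.comp_assoc, Function.comp_assoc,
      Equiv.self_comp_symm, Function.comp_id, Function.comp_id, Equiv.apply_symm_apply, hp]
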